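/- Let $\Gamma=(I,\Omega)$ be a finite quiver (loops and multiple arrows allowed). For $\mathbf v\in\mathbb Z_{\ge0}^I$ let $A_{\mathbf v}(q)$ be its Kac polynomial: the polynomial whose value at every prime power $q$ is the number of isomorphism classes of absolutely indecomposable representations of $\Gamma$ of dimension $\mathbf v$ over $\mathbb F_q$. Partitions include the empty one. For partitions put $\langle\lambda,\mu\rangle=\sum_{i,j}\min(i,j)\,m_i(\lambda)m_j(\mu)$, where $m_j(\lambda)$ is the multiplicity of the part $j$ in $\lambda$. Let $\mathbf x_i=(x_{i,1},x_{i,2},\dots)$, $i\in I$, be sets of infinitely many independent variables, and let $$\mathbb H(\mathbf x;q)=(q-1)\,\mathrm{Log}\Bigl(\sum_{\pi=(\pi^i)_{i\in I}}\frac{\prod_{i\to j\in\Omega}q^{\langle\pi^i,\pi^j\rangle}}{\prod_{i\in I}q^{\langle\pi^i,\pi^i\rangle}\prod_k\prod_{j=1}^{m_k(\pi^i)}(1-q^{-j})}\prod_{i\in I}\tilde H_{\pi^i}(\mathbf x_i;q)\Bigr),$$ the sum being over all $I$-tuples of partitions. Here $\mathrm{Log}\,F=\sum_{d\ge1}\frac{\mu(d)}{d}\psi_d(\log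 F)$ is the plethystic logarithm, $\mu$ being the Möbius function and $\psi_d$ the operation raising $q$ and all variables to the power $d$. Moreover $\tilde H_\lambda(x;q)=\sum_\mu q^{n(\lambda)}K_{\mu\lambda}(q^{-1})s_\mu(x)$ is the transformed Hall–Littlewood function, with $n(\lambda)=\sum_i(i-1)\lambda_i$ and with the Kostka–Foulkes polynomials $K_{\mu\lambda}(t)$ defined by $s_\mu=\sum_\lambda K_{\mu\lambda}(t)P_\lambda(x;t)$, where $s_\mu$ are the Schur functions and $P_\lambda$ the Hall–Littlewood functions. For $\boldsymbol\mu=(\mu^i)_{i\in I}$ let $\mathbb H^s_{\boldsymbol\mu}(q)=\langle\mathbb H,s_{\boldsymbol\mu}\rangle\in\mathbb Q(q)$ be the coefficient of $s_{\boldsymbol\mu}=\prod_i s_{\mu^i}(\mathbf x_i)$ in the (unique) expansion of $\mathbb H$ in these products of Schur functions. For $\mathbf v\in\mathbb Z_{\ge0}^I$ put $\delta(\mathbf v)=\sum_i v_i$ and $\gamma(\mathbf v)=\sum_i v_i^2-2\sum_{i\to j\in\Omega}v_iv_j$. The refined DT-invariants $\mathrm{DT}_{\mathbf v}(q)\in\mathbb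 Q(q)$ of the double quiver $\overline\Gamma$ are defined by $$\sum_{\mathbf v\ne0}\mathrm{DT}_{\mathbf v}(q)(-1)^{\delta(\mathbf v)}T^{\mathbf v}=(q-1)\,\mathrm{Log}\sum_{\mathbf v\in\mathbb Z_{\ge0}^I}\frac{(-1)^{\delta(\mathbf v)}q^{-\frac12(\gamma(\mathbf v)+\delta(\mathbf v))}}{\prod_{i\in I}(1-q^{-1})\cdots(1-q^{-v_i})}T^{\mathbf v},$$ and $\mathrm{DT}_0(q)=0$. Then for every $\mathbf v\in\mathbb Z_{\ge0}^I$: (i) $A_{\mathbf v}(q)=\mathbb H^s_{\mathbf v^1}(q)$, where $\mathbf v^1=((v_i))_{i\in I}$ consists of one-row partitions; and (ii) $\mathrm{DT}_{\mathbf v}(q)=\mathbb H^s_{1^{\mathbf v}}(q)$, where $1^{\mathbf v}=((1^{v_i}))_{i\in I}$ consists of one-column partitions. -/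

import Mathlib

open Finset Polynomial

noncomputable section

namespace KacDT

/-! ## Partitions -/

/-- The parts of a partition in weakly decreasing order. -/
def rowList {n : ℕ} (p : n.Partition) : List ℕ := p.parts.sort (· ≥ ·)

/-- The `i`-th part (counted from `0`) of a partition, which is `0` beyond the length. -/
def row {n : ℕ} (p : n.Partition) (i : ℕ) : ℕ := (rowList p).getD i 0

/-- The Young diagram of a partition. -/
def diagram {n : ℕ} (p : n.Partition) : YoungDiagram :=
  YoungDiagram.ofRowLens (rowList p) (Multiset.pairwise_sort p.parts (· ≥ ·)).sortedGE

/-- `n(λ) = ∑ (i - 1) λ_i` (here with `i` counted from `0`). -/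
def nStat {n : ℕ} (p : n.Partition) : ℕ := ∑ i ∈ range n, i * row p i

/-- The pairing `⟨λ, μ⟩ = ∑_{i,j} min(i,j) m_i(λ) m_j(μ)`. -/
def pairing {a b : ℕ} (p : a.Partition) (r : b.Partition) : ℕ :=
  ∑ i ∈ Icc 1 a, ∑ j ∈ Icc 1 b, min i j * p.parts.count i * r.parts.count j

/-- The one-row partition `(n)`; it is the empty partition when `n = 0`. -/
def oneRow (n : ℕ) : n.Partition := Nat.Partition.indiscrete n

/-- The one-column partition `(1^n)`; it is the empty partition when `n = 0`. -/
def oneColumn (n : ℕ) : n.Partition :=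
  Nat.Partition.ofSums n (Multiset.replicate n 1) (by simp)

/-! ## Schur functions -/

/-- The coefficient of the monomial `x^m` in the Schur function `s_p`: the number of
semistandard Young tableaux of shape `p` and weight `m`. -/
def kostkaNumber {n : ℕ} (p : n.Partition) (m : ℕ →₀ ℕ) : ℕ :=
  Nat.card {T : SemistandardYoungTableau (diagram p) //
    ∀ k, #{c ∈ (diagram p).cells | T c.1 c.2 = k} = m k}

/-- The field `ℚ(q)`. -/
abbrev Qq : Type := RatFunc ℚ

/-- The indeterminate `q`. -/
abbrev q : Qq := RatFunc.X

/-- The Schur function `s_p(x_0, x_1, …)` in infinitely many variables, over `ℚ(q)`. -/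
def schur {n : ℕ} (p : n.Partition) : MvPowerSeries ℕ Qq := fun m => (kostkaNumber p m : Qq)

/-! ## Hall-Littlewood functions -/

section HallLittlewood

variable {k : Type*} [Field k]

/-- The field of rational functions in `x_0, …, x_{N-1}` over `k`. -/
abbrev RatVars (k : Type*) [Field k] (N : ℕ) : Type _ := FractionRing (MvPolynomial (Fin N) k)

/-- The variable `x_i`, in the field of rational functions. -/
def xvar (k : Type*) [Field k] {N : ℕ} (i : Fin N) : RatVars k N :=
  algebraMap (MvPolynomial (Fin N) k) (RatVars k N) (MvPolynomial.X i)

/-- The Schur polynomial `s_p(x_0, …, x_{N-1})`. -/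
def schurPoly (k : Type*) [Field k] (N : ℕ) {n : ℕ} (p : n.Partition) : RatVars k N :=
  ∑ m ∈ finsuppAntidiag (univ : Finset (Fin N)) n,
    (kostkaNumber p (m.embDomain Fin.valEmbedding) : RatVars k N) * ∏ i, xvar k i ^ m i

/-- `v_m(t) = ∏_{j=1}^m (1 - t^j) / (1 - t)`. -/
def vFactor (t : k) (m : ℕ) : k := ∏ j ∈ Icc 1 m, (1 - t ^ j) / (1 - t)

/-- `v_p(t) = ∏_{i ≥ 0} v_{m_i}(t)` for `p = (p_0, …, p_{n-1})` padded by zeros to length `n`,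
`m_i` being the number of entries equal to `i`. -/
def vPart (t : k) {n : ℕ} (p : n.Partition) : k :=
  ∏ i ∈ range (n + 1), vFactor t #{j ∈ range n | row p j = i}

/-- The Hall-Littlewood polynomial of a partition `p` of `n` in `n` variables,
`P_p(x; t) = v_p(t)⁻¹ ∑_{w ∈ S_n} w (x^p ∏_{i < j} (x_i - t x_j) / (x_i - x_j))`. -/
def hallLittlewoodP (t : k) {n : ℕ} (p : n.Partition) : RatVars k n :=
  (vPart t p)⁻¹ • ∑ w : Equiv.Perm (Fin n),
    (∏ i, xvar k (w i) ^ row p i) *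
      ∏ i, ∏ j ∈ Ioi i, (xvar k (w i) - t • xvar k (w j)) / (xvar k (w i) - xvar k (w j))

/-- The property that defines the Kostka-Foulkes polynomials: `s_p = ∑_r K_{p r}(t) P_r(x; t)`.
(For partitions of `n`, `n` variables suffice.) -/
def IsKostkaFoulkes (t : k) {n : ℕ} (K : n.Partition → n.Partition → k) : Prop :=
  ∀ p : n.Partition, schurPoly k n p = ∑ r, K p r • hallLittlewoodP t r

/-- The Kostka-Foulkes polynomial `K_{p r}(t)`, as an element of `k`. -/
def kostkaFoulkes (t : k) {n : ℕ} : n.Partition → n.Partition → k :=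
  Classical.epsilon (IsKostkaFoulkes t (n := n))

end HallLittlewood

/-- The transformed Hall-Littlewood function
`H̃_p(x; q) = ∑_r K̃_{r p}(q) s_r(x)` with `K̃_{r p}(q) = q^{n(p)} K_{r p}(q⁻¹)`. -/
def hallLittlewoodH {n : ℕ} (p : n.Partition) : MvPowerSeries ℕ Qq :=
  ∑ r : n.Partition, (q ^ nStat p * kostkaFoulkes (q⁻¹ : Qq) r p) • schur r

/-! ## The plethystic logarithm -/

section Log

variable {σ : Type*}

/-- The Adams operation `f(q) ↦ f(q^d)` on `ℚ(q)`, for `d ≥ 1`. -/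
def adams (d : ℕ) (f : Qq) : Qq := f.eval (algebraMap ℚ Qq) (q ^ d)

/-- The logarithm `∑_{n ≥ 1} (-1)^(n-1) (F - 1)^n / n` of a power series with constant term `1`.
In the coefficient of `x^m` only the terms with `n ≤ |m|` matter. -/
def logSeries (F : MvPowerSeries σ Qq) : MvPowerSeries σ Qq := fun m =>
  ∑ n ∈ Icc 1 m.degree, (-1) ^ (n - 1) / (n : Qq) * MvPowerSeries.coeff m ((F - 1) ^ n)

open Classical in
/-- The plethystic logarithm `Log F = ∑_{d ≥ 1} (μ(d) / d) ψ_d (log F)` of a power series with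
constant term `1`, where `ψ_d` raises `q` and all the variables to the power `d`.
The coefficient of `x^m` in `ψ_d G` is `ψ_d` of the coefficient of `x^(m/d)` in `G` if `d`
divides `m`, and is `0` otherwise. -/
def plethLog (F : MvPowerSeries σ Qq) : MvPowerSeries σ Qq := fun m =>
  ∑ d ∈ Icc 1 m.degree,
    if ∀ s, d ∣ m s then
      ((ArithmeticFunction.moebius d : ℤ) : Qq) / (d : Qq) *
        adams d (MvPowerSeries.coeff (m.mapRange (· / d) (Nat.zero_div d)) (logSeries F))
    else 0

end Log

/-! ## Several sets of variables

The variable `x_{i,j}` is indexed by `(i, j) : I × ℕ`. -/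

section SchurExpansion

variable {I : Type*} [Fintype I] [DecidableEq I]

/-- The degree of a monomial in each of the sets of variables `x_i`. -/
def multidegree (m : I × ℕ →₀ ℕ) : I → ℕ := fun i => (m.curry i).degree

/-- `f = ∑_μ c_μ s_μ`, the sum being over all multipartitions `μ = (μ^i)_{i ∈ I}` and
`s_μ = ∏_i s_{μ^i}(x_i)`. (`s_μ` is homogeneous of multidegree `(|μ^i|)_i`, so that only finitely
many `μ` contribute to a given monomial.) -/
def IsSchurExpansion (f : MvPowerSeries (I × ℕ) Qq)
    (c : (v : I → ℕ) → ((i : I) → (v i).Partition) → Qq) : Prop :=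
  ∀ m : I × ℕ →₀ ℕ, MvPowerSeries.coeff m f =
    ∑ μ : ((i : I) → (multidegree m i).Partition),
      c (multidegree m) μ * ∏ i, MvPowerSeries.coeff (m.curry i) (schur (μ i))

/-- The Hall pairing `⟨f, s_μ⟩`, for which the `s_μ` are orthonormal: the coefficient of `s_μ`
in the Schur expansion of `f`. -/
def hallSchur (f : MvPowerSeries (I × ℕ) Qq) {v : I → ℕ} (μ : (i : I) → (v i).Partition) : Qq :=
  Classical.epsilon (IsSchurExpansion f) v μ

end SchurExpansion

/-! ## Quivers and their representations -/

/-- A quiver with vertex set `I` and arrow set `Ω`; loops and multiple arrows are allowed. -/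
structure FinQuiver (I Ω : Type*) where
  /-- the source of an arrow -/
  src : Ω → I
  /-- the target of an arrow -/
  tgt : Ω → I

namespace FinQuiver

variable {I Ω : Type*}

/-- The double quiver: every arrow is supplemented by a reversed one. -/
def double (Γ : FinQuiver I Ω) : FinQuiver I (Ω ⊕ Ω) where
  src := Sum.elim Γ.src Γ.tgt
  tgt := Sum.elim Γ.tgt Γ.src

/-- Representations of dimension `v` over `k`: matrices `k^{v_i} → k^{v_j}` for arrows `i → j`. -/
abbrev Rep (Γ : FinQuiver I Ω) (v : I → ℕ) (k : Type*) : Type _ :=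
  (a : Ω) → Matrix (Fin (v (Γ.tgt a))) (Fin (v (Γ.src a))) k

variable {Γ : FinQuiver I Ω} {v : I → ℕ}

/-- Isomorphism of representations of the same dimension. -/
def RepIso {k : Type*} [Field k] (φ ψ : Γ.Rep v k) : Prop :=
  ∃ g : (i : I) → GL (Fin (v i)) k, ∀ a,
    ψ a = (g (Γ.tgt a)).val * φ a * (g (Γ.src a))⁻¹.val

variable (Γ v) in
/-- Isomorphism is an equivalence relation. -/
def repSetoid (k : Type*) [Field k] : Setoid (Γ.Rep v k) where
  r := RepIso
  iseqv :=
    { refl := fun φ => ⟨fun _ => 1, fun a => by simp⟩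
      symm := by
        rintro φ ψ ⟨g, hg⟩
        refine ⟨fun i => (g i)⁻¹, fun a => ?_⟩
        simp only [hg a, inv_inv, ← Matrix.mul_assoc, Units.inv_mul, Matrix.one_mul]
        rw [Matrix.mul_assoc, Units.inv_mul, Matrix.mul_one]
      trans := by
        rintro φ ψ χ ⟨g, hg⟩ ⟨h, hh⟩
        refine ⟨fun i => h i * g i, fun a => ?_⟩
        simp only [hh a, hg a, mul_inv_rev, Units.val_mul, Matrix.mul_assoc] }

/-- A graded subspace `(U_i)_i` is a subrepresentation. -/
def IsStable {k : Type*} [Field k] (φ : Γ.Rep v k)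
    (U : (i : I) → Submodule k (Fin (v i) → k)) : Prop :=
  ∀ a, ∀ x ∈ U (Γ.src a), (φ a).mulVec x ∈ U (Γ.tgt a)

/-- A representation is indecomposable if it is nonzero and is not the direct sum of two nonzero
subrepresentations. -/
def IsIndecomposable {k : Type*} [Field k] (φ : Γ.Rep v k) : Prop :=
  v ≠ 0 ∧ ∀ U W : (i : I) → Submodule k (Fin (v i) → k), IsStable φ U → IsStable φ W →
    (∀ i, IsCompl (U i) (W i)) → (∀ i, U i = ⊥) ∨ (∀ i, W i = ⊥)

/-- A representation is absolutely indecomposable if it is indecomposable over the algebraic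
closure. -/
def IsAbsIndecomposable {k : Type*} [Field k] (φ : Γ.Rep v k) : Prop :=
  IsIndecomposable (Γ := Γ) (v := v) (k := AlgebraicClosure k)
    fun a => (φ a).map (algebraMap k (AlgebraicClosure k))

variable (Γ v) in
/-- The number of isomorphism classes of absolutely indecomposable representations of `Γ` of
dimension `v` over `k`. -/
def numAbsIndecomposable (k : Type*) [Field k] : ℕ :=
  Set.ncard {C : Quotient (Γ.repSetoid v k) | ∃ φ : Γ.Rep v k,
    IsAbsIndecomposable φ ∧ Quotient.mk (Γ.repSetoid v k) φ = C}

variable (Γ v) in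
/-- `A` is the Kac polynomial `A_v`: its value at `q` is the number of isomorphism classes of
absolutely indecomposable representations of dimension `v` over the field with `q` elements, for
every prime power `q`. -/
def IsKacPolynomial (A : ℚ[X]) : Prop :=
  ∀ (F : Type) [Field F] [Finite F],
    A.eval (Nat.card F : ℚ) = (Γ.numAbsIndecomposable v F : ℚ)

/-! ## The generating function and the refined DT-invariants -/

variable [Fintype I] [Fintype Ω]

/-- `∏_{i → j} q^⟨π^i, π^j⟩ / ∏_i (q^⟨π^i, π^i⟩ ∏_k ∏_{j=1}^{m_k(π^i)} (1 - q^{-j}))`. -/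
def huaTerm (Γ : FinQuiver I Ω) {v : I → ℕ} (π : (i : I) → (v i).Partition) : Qq :=
  (∏ a : Ω, q ^ pairing (π (Γ.src a)) (π (Γ.tgt a))) /
    ∏ i : I, (q ^ pairing (π i) (π i) *
      ∏ k ∈ Icc 1 (v i), ∏ j ∈ Icc 1 ((π i).parts.count k), (1 - (q⁻¹) ^ j))

/-- The quadratic form `γ(v) = ∑_i v_i² - ∑_{i → j} v_i v_j`, over the arrows of `Γ`. -/
def gammaForm (Γ : FinQuiver I Ω) (v : I → ℕ) : ℤ :=
  ∑ i, (v i : ℤ) ^ 2 - ∑ a : Ω, (v (Γ.src a) : ℤ) * v (Γ.tgt a)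

/-- For a double quiver `γ(v) + δ(v)` is even, where `δ(v) = ∑_i v_i`. -/
theorem two_dvd_gammaForm_double (Γ : FinQuiver I Ω) (v : I → ℕ) :
    2 ∣ Γ.double.gammaForm v + ∑ i, (v i : ℤ) := by
  have h1 : ∑ a : Ω ⊕ Ω, (v (Γ.double.src a) : ℤ) * v (Γ.double.tgt a)
      = 2 * ∑ a : Ω, (v (Γ.src a) : ℤ) * v (Γ.tgt a) := by
    rw [Fintype.sum_sum_type, two_mul]
    congr 1
    exact Finset.sum_congr rfl fun a _ => mul_comm _ _
  have h2 : (2 : ℤ) ∣ ∑ i, ((v i : ℤ) ^ 2 + v i) :=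
    Finset.dvd_sum fun i _ => by
      have h := Int.even_mul_succ_self (v i : ℤ)
      rw [show (v i : ℤ) ^ 2 + v i = v i * (v i + 1) by ring]
      exact h.two_dvd
  rw [Finset.sum_add_distrib] at h2
  rw [gammaForm, h1]
  omega

/-- The series `∑_v (-1)^δ(v) q^{-(γ(v) + δ(v))/2} / ∏_i ((1 - q⁻¹) ⋯ (1 - q^{-v_i})) T^v` of a
quiver for which `γ(v) + δ(v)` is always even. -/
def dtSeries (Γ : FinQuiver I Ω) : MvPowerSeries I Qq := fun v =>
  (-1) ^ (∑ i, v i) * q ^ (-((Γ.gammaForm v + ∑ i, (v i : ℤ)) / 2)) /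
    ∏ i, ∏ j ∈ Icc 1 (v i), (1 - (q⁻¹) ^ j)

/-- The refined DT-invariant `DT_v(q)` of the double quiver of `Γ`, defined by
`∑_v DT_v(q) (-1)^δ(v) T^v = (q - 1) Log (dtSeries)`. -/
def dtInvariant (Γ : FinQuiver I Ω) (v : I → ℕ) : Qq :=
  (-1) ^ (∑ i, v i) *
    MvPowerSeries.coeff (Finsupp.equivFunOnFinite.symm v)
      ((q - 1) • plethLog Γ.double.dtSeries)

variable [DecidableEq I]

/-- The series `∑_π huaTerm(π) ∏_i H̃_{π^i}(x_i; q)` over all multipartitions `π`. (`H̃_{π^i}` is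
homogeneous of degree `|π^i|`, so that only the `π` with `|π^i|` equal to the degree in `x_i`
contribute to a given monomial.) -/
def omegaSeries (Γ : FinQuiver I Ω) : MvPowerSeries (I × ℕ) Qq := fun m =>
  ∑ π : ((i : I) → (multidegree m i).Partition),
    Γ.huaTerm π * ∏ i, MvPowerSeries.coeff (m.curry i) (hallLittlewoodH (π i))

/-- The generating function `ℍ = (q - 1) Log (∑_π huaTerm(π) ∏_i H̃_{π^i}(x_i; q))`. -/
def genFun (Γ : FinQuiver I Ω) : MvPowerSeries (I × ℕ) Qq :=
  (q - 1) • plethLog Γ.omegaSeries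

/-- The Schur coefficient `ℍ^s_μ(q) = ⟨ℍ, s_μ⟩`. -/
def schurCoeff (Γ : FinQuiver I Ω) {v : I → ℕ} (μ : (i : I) → (v i).Partition) : Qq :=
  hallSchur Γ.genFun μ

end FinQuiver

end KacDT

end

/-! Let Ω be the series inside the logarithm. Both parts rest on one principle: one-row Schur
coefficients commute with Log, and so do one-column coefficients up to sign. Indeed, putting `k`
variables of each set equal to `T_i` and the others equal to zero commutes with Log and sends `s_μ`
to `∏ s_{μ^i}(1^k) · T^v`. For `k = 1` only one-row shapes survive (`plethLog_oneRow`). Since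
`s_λ(1^k)` is a polynomial in `k` (`tabTotal_eq_sum_choose`), the compatibility with Log is a
polynomial identity in `k`. It therefore holds at `k = -1`, where `s_λ` takes the value `(-1)^|λ|`
on single columns and `0` on other shapes (`signedCount_eq_ite`, `plethLog_oneColumn`).

It remains to find the row and column coefficients of Ω itself, that is, `K_{(n),λ}(t) = t^{n(λ)}`
and `K_{(1^n),λ} = δ`. The latter says that `P_{(1^n)}` is the product of the variables. The former
is the expansion of `h_n` in Hall-Littlewood polynomials (`completeH_eq_sum_symSum`), which comes
from the interpolation identity `subsetPoly_eq_one`. In the column coefficient a single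
multipartition survives and gives the DT series, which proves (ii). In the row coefficient the
powers of `q` cancel, so (i) becomes Hua's formula: the Kac polynomial is the coefficient of `(q -
1) Log` of the series of sums of Hua terms.

Hua's formula compares two counts of isomorphism classes over a finite field. On one side,
Burnside's lemma gives a sum over tuples of invertible matrices. The summand and the centralizers
depend only on the types of the matrices as `K[X]`-modules, and a type attaches a partition to each
monic irreducible polynomial other than `X`. The generating series is thus an Euler product over
irreducible polynomials. Its logarithmic derivative, together with Möbius inversion of the number of
irreducible polynomials, is `euler_repSeries`. On the other side, Krull-Schmidt over the algebraic
closure and descent by Lang's theorem turn classes over the finite field into Frobenius-invariant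
multisets of indecomposable classes. Counting these by orbits gives a recursion of the same shape
(`euler_repSeries_ind`), whose unknowns are the numbers of absolutely indecomposable classes. The
recursions for all powers of one prime have a unique solution (`coeff_eq_of_adamsSum_euler`), hence
the two families agree (`numAbsIndecomposable_eq_kacSeries`).

The numbers so obtained are values at prime powers of one rational function. Being integers at all
primes, they force it to be a polynomial (`exists_eq_mul_of_integral`), so the existence of the Kac
polynomial is part of the conclusion. -/

noncomputable section

set_option linter.unusedSectionVars false

namespace KacDT

/-! ## Logarithms of power series over `ℚ`-algebras -/

section GenLog

variable {σ τ R S : Type*} [CommRing R] [Algebra ℚ R] [CommRing S] [Algebra ℚ S]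

/-- The logarithm of a power series with constant term `1` over a `ℚ`-algebra. -/
def genLog (F : MvPowerSeries σ R) : MvPowerSeries σ R := fun m =>
  ∑ n ∈ Icc 1 m.degree, algebraMap ℚ R ((-1) ^ (n - 1) / n) * MvPowerSeries.coeff m ((F - 1) ^ n)

open Classical in
/-- The plethystic logarithm of a power series over a `ℚ`-algebra with operations `ψ d`. -/
def genPlethLog (ψ : ℕ → R → R) (F : MvPowerSeries σ R) : MvPowerSeries σ R := fun m =>
  ∑ d ∈ Icc 1 m.degree,
    if ∀ s, d ∣ m s then
      algebraMap ℚ R ((ArithmeticFunction.moebius d : ℤ) / d) *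
        ψ d (MvPowerSeries.coeff (m.mapRange (· / d) (Nat.zero_div d)) (genLog F))
    else 0

lemma coeff_genLog (F : MvPowerSeries σ R) (m : σ →₀ ℕ) :
    MvPowerSeries.coeff m (genLog F) = ∑ n ∈ Icc 1 m.degree,
      algebraMap ℚ R ((-1) ^ (n - 1) / n) * MvPowerSeries.coeff m ((F - 1) ^ n) := rfl

open Classical in
lemma coeff_genPlethLog (ψ : ℕ → R → R) (F : MvPowerSeries σ R) (m : σ →₀ ℕ) :
    MvPowerSeries.coeff m (genPlethLog ψ F) = ∑ d ∈ Icc 1 m.degree,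
      if ∀ s, d ∣ m s then
        algebraMap ℚ R ((ArithmeticFunction.moebius d : ℤ) / d) *
          ψ d (MvPowerSeries.coeff (m.mapRange (· / d) (Nat.zero_div d)) (genLog F))
      else 0 := rfl

lemma logSeries_eq_genLog (F : MvPowerSeries σ Qq) : logSeries F = genLog F := by
  funext m
  simp [logSeries, genLog]

/-- The logarithm is needed over several coefficient rings besides `Qq`: over `Qq[X]` to interpolate
in the number of variables, over `EvalPt → ℚ` for values at integers, and over `evalAlg`, which
links the last to `Qq`. All of them are instances of `genPlethLog`. -/
lemma plethLog_eq_genPlethLog (F : MvPowerSeries σ Qq) :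
    plethLog F = genPlethLog adams F := by
  funext m
  simp [plethLog, genPlethLog, logSeries_eq_genLog]

lemma map_genLog (h : R →+* S) (F : MvPowerSeries σ R) :
    genLog (MvPowerSeries.map h F) = MvPowerSeries.map h (genLog F) := by
  ext m
  have hh : ∀ x : ℚ, h (algebraMap ℚ R x) = algebraMap ℚ S x := fun x =>
    RingHom.congr_fun (Subsingleton.elim (h.comp (algebraMap ℚ R)) (algebraMap ℚ S)) x
  have : MvPowerSeries.map h F - 1 = MvPowerSeries.map h (F - 1) := by simp
  simp only [MvPowerSeries.coeff_map, coeff_genLog, map_sum, map_mul, hh, this, ← map_pow]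

/-- Each coefficient is a finite rational combination of Adams operations applied to coefficients of
powers of `F`, so a ring homomorphism that intertwines the operations passes through. Only `d ≥ 1`
occurs in the sum. -/
lemma map_genPlethLog (h : R →+* S) (ψ : ℕ → R → R) (ψ' : ℕ → S → S)
    (hψ : ∀ d x, d ≠ 0 → h (ψ d x) = ψ' d (h x)) (F : MvPowerSeries σ R) :
    genPlethLog ψ' (MvPowerSeries.map h F) = MvPowerSeries.map h (genPlethLog ψ F) := by
  classical
  ext m
  have hh : ∀ x : ℚ, h (algebraMap ℚ R x) = algebraMap ℚ S x := fun x =>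
    RingHom.congr_fun (Subsingleton.elim (h.comp (algebraMap ℚ R)) (algebraMap ℚ S)) x
  simp only [MvPowerSeries.coeff_map, coeff_genPlethLog, map_sum, map_genLog]
  refine sum_congr rfl fun d hd => ?_
  have : d ≠ 0 := by have := (mem_Icc.1 hd).1; omega
  split_ifs
  · rw [map_mul, hh, hψ _ _ this]
  · simp

lemma degree_embDomain (e : τ ↪ σ) (m : τ →₀ ℕ) : (m.embDomain e).degree = m.degree := by
  rw [Finsupp.embDomain_eq_mapDomain, Finsupp.degree_mapDomain]

/-- Setting the variables outside the range of `e` to zero reads off the coefficients at embedded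
exponents. Embedding preserves the degree, so the truncated sums have the same length. -/
lemma killCompl_genLog (e : τ ↪ σ) (F : MvPowerSeries σ R) :
    genLog (MvPowerSeries.killCompl e F) = MvPowerSeries.killCompl e (genLog F) := by
  ext m
  have : MvPowerSeries.killCompl e F - 1 = MvPowerSeries.killCompl e (F - 1) := by simp
  simp only [MvPowerSeries.coeff_killCompl, coeff_genLog, this, ← map_pow, degree_embDomain]

lemma killCompl_genPlethLog (e : τ ↪ σ) (ψ : ℕ → R → R)
    (F : MvPowerSeries σ R) :
    genPlethLog ψ (MvPowerSeries.killCompl e F)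
      = MvPowerSeries.killCompl e (genPlethLog ψ F) := by
  classical
  ext m
  simp only [MvPowerSeries.coeff_killCompl, coeff_genPlethLog, killCompl_genLog, degree_embDomain]
  refine sum_congr rfl fun d hd => ?_
  have h1 : (∀ s, d ∣ m.embDomain e s) ↔ ∀ s, d ∣ m s := by
    refine ⟨fun h s => by simpa using h (e s), fun h s => ?_⟩
    by_cases hs : s ∈ Set.range e
    · obtain ⟨a, rfl⟩ := hs
      simpa using h a
    · rw [Finsupp.embDomain_of_notMem_range _ _ _ hs]
      exact dvd_zero d
  have h2 : (m.embDomain e).mapRange (· / d) (Nat.zero_div d)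
      = (m.mapRange (· / d) (Nat.zero_div d)).embDomain e := by
    ext s
    by_cases hs : s ∈ Set.range e
    · obtain ⟨a, rfl⟩ := hs
      simp
    · simp [Finsupp.embDomain_of_notMem_range _ _ _ hs]
  simp only [h1, h2]

/-! ### Logarithms under identification of variables. -/

section Rename

variable (f : σ → τ) [Filter.TendstoCofinite f]

lemma rename_genLog (F : MvPowerSeries σ R) :
    genLog (MvPowerSeries.rename f F) = MvPowerSeries.rename f (genLog F) := by
  ext m
  have h1 : MvPowerSeries.rename f F - 1 = MvPowerSeries.rename f (F - 1) := by simp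
  simp only [coeff_genLog, h1, ← map_pow, MvPowerSeries.coeff_rename, mul_sum]
  rw [sum_comm]
  refine sum_congr rfl fun x hx => ?_
  have : x.degree = m.degree := by
    simp only [Set.Finite.mem_toFinset, Set.mem_preimage, Set.mem_singleton_iff] at hx
    rw [← hx, Finsupp.degree_mapDomain]
  rw [this]

lemma mapRange_div_eq_iff {d : ℕ} (hd : d ≠ 0) {m : σ →₀ ℕ} (h : ∀ s, d ∣ m s) (y : σ →₀ ℕ) :
    m.mapRange (· / d) (Nat.zero_div d) = y ↔ m = d • y := by
  constructor
  · rintro rfl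
    ext s
    simp [Nat.mul_div_cancel' (h s)]
  · rintro rfl
    ext s
    simp [Nat.mul_div_cancel_left _ (Nat.pos_of_ne_zero hd)]

/-- A coefficient of a renamed series is a sum over a fibre of exponents, which is why the
operations have to be additive here. -/
lemma rename_genPlethLog (ψ : ℕ → R →+ R) (F : MvPowerSeries σ R) :
    genPlethLog (fun d => ψ d) (MvPowerSeries.rename f F)
      = MvPowerSeries.rename f (genPlethLog (fun d => ψ d) F) := by
  classical
  ext m
  rw [MvPowerSeries.coeff_rename]
  simp only [coeff_genPlethLog, rename_genLog, MvPowerSeries.coeff_rename]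
  symm
  have hdeg : ∀ x ∈ (Filter.TendstoCofinite.finite_preimage_singleton
      (Finsupp.mapDomain (M := ℕ) f) m).toFinset, x.degree = m.degree := fun x hx => by
    simp only [Set.Finite.mem_toFinset, Set.mem_preimage, Set.mem_singleton_iff] at hx
    rw [← hx, Finsupp.degree_mapDomain]
  rw [sum_congr rfl fun (x : σ →₀ ℕ) hx => by rw [hdeg x hx]]
  rw [sum_comm]
  refine sum_congr rfl fun (d : ℕ) hd => Eq.symm ?_
  have hd0 : d ≠ 0 := by have := (mem_Icc.1 hd).1; omega
  have hsmul : ∀ y : σ →₀ ℕ, Finsupp.mapDomain f (d • y) = d • Finsupp.mapDomain f y := fun y =>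
    map_nsmul (Finsupp.mapDomain.addMonoidHom f) d y
  split_ifs with hm
  · rw [map_sum, mul_sum, ← sum_filter]
    -- Multiplication by `d` identifies the fibre over `m / d` with the exponents divisible by `d`
    -- in the fibre over `m`.
    refine sum_bij' (fun y _ => d • y) (fun x _ => x.mapRange (· / d) (Nat.zero_div d)) ?_ ?_ ?_ ?_ ?_
    · intro y hy
      simp only [Set.Finite.mem_toFinset, Set.mem_preimage, Set.mem_singleton_iff] at hy
      simp only [mem_filter, Set.Finite.mem_toFinset, Set.mem_preimage, Set.mem_singleton_iff, hsmul]
      exact ⟨((mapRange_div_eq_iff hd0 hm _).1 hy.symm).symm, fun s => by simp⟩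
    · intro x hx
      simp only [mem_filter, Set.Finite.mem_toFinset, Set.mem_preimage,
        Set.mem_singleton_iff] at hx
      simp only [Set.Finite.mem_toFinset, Set.mem_preimage, Set.mem_singleton_iff]
      obtain ⟨hx, hx'⟩ := hx
      symm
      rw [mapRange_div_eq_iff hd0 hm, ← hsmul, ← (mapRange_div_eq_iff hd0 hx' _).1 rfl, hx]
    · intro y hy
      exact (mapRange_div_eq_iff hd0 (fun s => by simp) _).2 rfl
    · intro x hx
      simp only [mem_filter] at hx
      exact ((mapRange_div_eq_iff hd0 hx.2 _).1 rfl).symm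
    · intro y hy
      rw [(mapRange_div_eq_iff hd0 (fun s => by simp) y).2 rfl]
  · symm
    refine sum_eq_zero fun x hx => if_neg fun h => hm fun s => ?_
    simp only [Set.Finite.mem_toFinset, Set.mem_preimage, Set.mem_singleton_iff] at hx
    rw [← hx, (mapRange_div_eq_iff hd0 h _).1 rfl, hsmul]
    simp

end Rename

/-! ## The Euler operator -/

/-- The Euler operator, which multiplies the coefficient of `x^m` by the degree of `m`. -/
def euler (F : MvPowerSeries σ R) : MvPowerSeries σ R := fun m =>
  (m.degree : R) * MvPowerSeries.coeff m F

lemma coeff_euler (F : MvPowerSeries σ R) (m : σ →₀ ℕ) :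
    MvPowerSeries.coeff m (euler F) = (m.degree : R) * MvPowerSeries.coeff m F := rfl

lemma euler_sub (F G : MvPowerSeries σ R) : euler (F - G) = euler F - euler G := by
  ext m; simp [coeff_euler, mul_sub]

lemma euler_one : euler (1 : MvPowerSeries σ R) = 0 := by
  classical
  ext m
  rw [coeff_euler, MvPowerSeries.coeff_one]
  split_ifs with h
  · simp [h]
  · simp

lemma euler_mul (F G : MvPowerSeries σ R) : euler (F * G) = euler F * G + F * euler G := by
  classical
  ext m
  simp only [coeff_euler, map_add, MvPowerSeries.coeff_mul, mul_sum, ← sum_add_distrib]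
  refine sum_congr rfl fun p hp => ?_
  rw [← HasAntidiagonal.mem_antidiagonal.1 hp, map_add]
  push_cast
  ring

lemma euler_pow (F : MvPowerSeries σ R) (n : ℕ) :
    euler (F ^ n) = n • (F ^ (n - 1) * euler F) := by
  induction n with
  | zero => simp [euler_one]
  | succ n ih =>
    rw [pow_succ, euler_mul, ih, Nat.add_sub_cancel]
    rcases n with _ | n
    · simp
    · simp only [Nat.add_sub_cancel, nsmul_eq_mul]
      push_cast
      ring

lemma euler_prod {ι : Type*} (s : Finset ι) (F G : ι → MvPowerSeries σ R)
    (h : ∀ i ∈ s, euler (F i) = F i * G i) :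
    euler (∏ i ∈ s, F i) = (∏ i ∈ s, F i) * ∑ i ∈ s, G i := by
  classical
  induction s using Finset.induction_on with
  | empty => simp [euler_one]
  | insert a s ha ih =>
    rw [prod_insert ha, sum_insert ha, euler_mul, ih fun i hi => h i (mem_insert_of_mem hi),
      h a (mem_insert_self a s)]
    ring

/-- A series without constant term has order at least one, so its `n`-th power has order at least
`n`. This is what makes all truncations of the logarithm harmless. -/
lemma coeff_mul_pow_eq_zero (F G : MvPowerSeries σ R)
    (hF : MvPowerSeries.constantCoeff F = 0) {m : σ →₀ ℕ} {n : ℕ} (h : m.degree < n) :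
    MvPowerSeries.coeff m (F ^ n * G) = 0 := by
  have h1 : (1 : ℕ∞) ≤ F.order := (MvPowerSeries.order_ne_zero_iff_constCoeff_eq_zero.2 hF |>
    Order.one_le_iff_ne_zero.2)
  refine MvPowerSeries.coeff_of_lt_order (lt_of_lt_of_le (Nat.cast_lt.2 h) ?_)
  calc (n : ℕ∞) = n • (1 : ℕ∞) := by simp
    _ ≤ n • F.order := nsmul_le_nsmul_right h1 n
    _ ≤ (F ^ n).order := MvPowerSeries.le_order_pow n
    _ ≤ (F ^ n).order + G.order := le_self_add
    _ ≤ _ := MvPowerSeries.le_order_mul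

/-- `F · E (log F) = E F` for the Euler operator `E`. -/
lemma mul_euler_genLog (F : MvPowerSeries σ R) (hF : MvPowerSeries.constantCoeff F = 1) :
    F * euler (genLog F) = euler F := by
  classical
  have hF0 : MvPowerSeries.constantCoeff (F - 1) = 0 := by simp [hF]
  -- Termwise differentiation turns the logarithm into the geometric series of `1 - F` times `euler
  -- F`. Any truncation bound `N` beyond the degree gives the same coefficient, so one bound can
  -- serve all terms of a product.
  have key : ∀ (m : σ →₀ ℕ) (N : ℕ), m.degree ≤ N → MvPowerSeries.coeff m (euler (genLog F))
      = MvPowerSeries.coeff m ((∑ n ∈ range N, (1 - F) ^ n) * euler F) := by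
    intro m N hN
    rw [coeff_euler, coeff_genLog, sum_mul, map_sum, mul_sum]
    have : ∀ n ∈ Icc 1 m.degree, (m.degree : R) * (algebraMap ℚ R ((-1) ^ (n - 1) / n) *
        MvPowerSeries.coeff m ((F - 1) ^ n))
        = MvPowerSeries.coeff m ((1 - F) ^ (n - 1) * euler F) := by
      intro n hn
      have hn1 := (mem_Icc.1 hn).1
      have h := congrArg (MvPowerSeries.coeff m) (euler_pow (F - 1) n)
      rw [euler_sub, euler_one, sub_zero, map_nsmul, coeff_euler, nsmul_eq_mul] at h
      have h2 : (1 - F) ^ (n - 1) = (-1) ^ (n - 1) * (F - 1) ^ (n - 1) := by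
        rw [← mul_pow]; congr 1; ring
      have h3 : ((-1) ^ (n - 1) * (F - 1) ^ (n - 1) * euler F)
          = ((-1 : R) ^ (n - 1)) • ((F - 1) ^ (n - 1) * euler F) := by
        rw [MvPowerSeries.smul_eq_C_mul]; simp [mul_assoc]
      rw [h2, h3, MvPowerSeries.coeff_smul, mul_left_comm, h, ← mul_assoc,
        ← map_natCast (algebraMap ℚ R) n, ← map_mul, div_mul_cancel₀ _ (by positivity)]
      simp
    rw [sum_congr rfl this]
    -- The case `n = m.degree` also vanishes: `euler F` has no constant term, so the power of `1 -
    -- F` would have to contribute in degree below `n`.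
    have hz : ∀ n ∈ range N, n ∉ range m.degree →
        MvPowerSeries.coeff m ((1 - F) ^ n * euler F) = 0 := by
      intro n _ hn
      by_cases h : m.degree < n
      · exact coeff_mul_pow_eq_zero _ _ (by simp [hF]) h
      · have hn' : n = m.degree := by simp at hn; omega
        rw [MvPowerSeries.coeff_mul]
        refine sum_eq_zero fun p hp => ?_
        rw [HasAntidiagonal.mem_antidiagonal] at hp
        have hd : p.1.degree + p.2.degree = m.degree := by rw [← map_add, hp]
        by_cases hp2 : p.2.degree = 0
        · rw [coeff_euler, hp2]; simp
        · have := coeff_mul_pow_eq_zero (1 - F) 1 (by simp [hF]) (m := p.1) (n := n) (by omega)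
          rw [mul_one] at this
          rw [this, zero_mul]
    rw [← sum_subset (range_mono hN) hz]
    refine (sum_bij' (fun n _ => n + 1) (fun n _ => n - 1) ?_ ?_ ?_ ?_ ?_).symm <;>
      simp <;> intros <;> omega
  ext m
  have h1 : MvPowerSeries.coeff m (F * euler (genLog F))
      = MvPowerSeries.coeff m (F * ((∑ n ∈ range (m.degree + 1), (1 - F) ^ n) * euler F)) := by
    simp only [MvPowerSeries.coeff_mul m F]
    refine sum_congr rfl fun p hp => ?_
    rw [key p.2 (m.degree + 1)]
    rw [← HasAntidiagonal.mem_antidiagonal.1 hp, map_add]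
    omega
  have h2 : F * ∑ n ∈ range (m.degree + 1), (1 - F) ^ n = 1 - (1 - F) ^ (m.degree + 1) := by
    have := mul_neg_geom_sum (1 - F) (m.degree + 1)
    rwa [sub_sub_cancel] at this
  rw [h1, ← mul_assoc, h2, sub_mul, one_mul, map_sub,
    coeff_mul_pow_eq_zero _ _ (by simp [hF]) (Nat.lt_succ_self _), sub_zero]

end GenLog

/-! ## Horizontal strips -/

/-- `la / mu` is a horizontal strip. -/
def HStrip (la mu : YoungDiagram) : Prop :=
  ∀ i, mu.rowLen i ≤ la.rowLen i ∧ la.rowLen (i + 1) ≤ mu.rowLen i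

lemma le_iff_rowLen_le {la mu : YoungDiagram} : mu ≤ la ↔ ∀ i, mu.rowLen i ≤ la.rowLen i := by
  constructor
  · intro h i
    by_contra hlt
    have h1 : (i, la.rowLen i) ∈ mu := YoungDiagram.mem_iff_lt_rowLen.2 (not_le.1 hlt)
    exact lt_irrefl _ (YoungDiagram.mem_iff_lt_rowLen.1 (h h1))
  · rintro h ⟨i, j⟩ hc
    exact YoungDiagram.mem_iff_lt_rowLen.2
      ((YoungDiagram.mem_iff_lt_rowLen.1 hc).trans_le (h i))

lemma diagram_ext {la mu : YoungDiagram} (h : ∀ i, mu.rowLen i = la.rowLen i) : mu = la :=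
  le_antisymm (le_iff_rowLen_le.2 fun i => (h i).le) (le_iff_rowLen_le.2 fun i => (h i).ge)

lemma HStrip.le {la mu : YoungDiagram} (h : HStrip la mu) : mu ≤ la :=
  le_iff_rowLen_le.2 fun i => (h i).1

lemma finite_le (la : YoungDiagram) : {mu : YoungDiagram | mu ≤ la}.Finite := by
  refine Set.Finite.of_finite_image (f := YoungDiagram.cells)
    ((la.cells.powerset.finite_toSet).subset ?_) fun a _ b _ h => YoungDiagram.ext h
  rintro _ ⟨mu, hmu, rfl⟩
  simpa using! YoungDiagram.cells_subset_iff.2 hmu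

/-- The diagrams `mu` for which `la / mu` is a horizontal strip. -/
def strips (la : YoungDiagram) : Finset YoungDiagram :=
  ((finite_le la).subset fun _ (h : HStrip la _) => h.le : {mu | HStrip la mu}.Finite).toFinset

@[simp] lemma mem_strips {la mu : YoungDiagram} : mu ∈ strips la ↔ HStrip la mu := by
  simp [strips]

lemma rowLen_eq_zero_of_le {la : YoungDiagram} {i : ℕ} (h : la.colLen 0 ≤ i) :
    la.rowLen i = 0 := by
  by_contra h0
  have h1 : (i, 0) ∈ la := YoungDiagram.mem_iff_lt_rowLen.2 (Nat.pos_of_ne_zero h0)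
  exact absurd (YoungDiagram.mem_iff_lt_colLen.1 h1) (not_lt.2 h)

lemma card_eq_sum_rowLen (la : YoungDiagram) {N : ℕ} (hN : ∀ i, N ≤ i → la.rowLen i = 0) :
    la.card = ∑ i ∈ range N, la.rowLen i := by
  have : ∀ c ∈ la.cells, c.1 ∈ range N := by
    intro c hc
    by_contra h
    have h1 := YoungDiagram.mem_iff_lt_rowLen.1 (show (c.1, c.2) ∈ la from hc)
    rw [hN c.1 (by simpa using h)] at h1
    exact absurd h1 (Nat.not_lt_zero _)
  change la.cells.card = _
  rw [card_eq_sum_card_fiberwise this]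
  exact sum_congr rfl fun i _ => (YoungDiagram.rowLen_eq_card la).symm

lemma HStrip.colLen_le {la mu : YoungDiagram} (h : HStrip la mu) {N : ℕ}
    (hN : ∀ i, N ≤ i → la.rowLen i = 0) : ∀ i, N ≤ i → mu.rowLen i = 0 := fun i hi =>
  Nat.le_zero.1 ((h i).1.trans (hN i hi).le)

lemma card_le_card {la mu : YoungDiagram} (h : mu ≤ la) : mu.card ≤ la.card :=
  Finset.card_le_card (YoungDiagram.cells_subset_iff.2 h)

/-- The subdiagram of `la` with prescribed row lengths. -/
def subdiagram (la : YoungDiagram) (r : ℕ → ℕ) (hr : Antitone r) : YoungDiagram where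
  cells := {c ∈ la.cells | c.2 < r c.1}
  isLowerSet := by
    rintro ⟨a, b⟩ ⟨c, d⟩ ⟨h1, h2⟩ h
    simp only [coe_filter, Set.mem_ofPred_eq, YoungDiagram.mem_cells] at h ⊢
    exact ⟨la.up_left_mem h1 h2 h.1, (lt_of_le_of_lt h2 h.2).trans_le (hr h1)⟩

lemma rowLen_subdiagram {la : YoungDiagram} {r : ℕ → ℕ} (hr : Antitone r) {i : ℕ}
    (h : r i ≤ la.rowLen i) : (subdiagram la r hr).rowLen i = r i := by
  have : ∀ j, j < (subdiagram la r hr).rowLen i ↔ j < r i := by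
    intro j
    rw [← YoungDiagram.mem_iff_lt_rowLen, ← YoungDiagram.mem_cells]
    simp only [subdiagram, mem_filter, YoungDiagram.mem_cells, YoungDiagram.mem_iff_lt_rowLen]
    exact ⟨fun h => h.2, fun h' => ⟨h'.trans_le h, h'⟩⟩
  exact le_antisymm (not_lt.1 fun h' => lt_irrefl _ ((this _).1 h'))
    (not_lt.1 fun h' => lt_irrefl _ ((this _).2 h'))

/-! ## Tableaux with bounded entries -/

/-- Semistandard tableaux with all entries less than `k`. -/
def BddTableau (k : ℕ) (la : YoungDiagram) : Type :=
  {T : SemistandardYoungTableau la // ∀ c ∈ la.cells, T c.1 c.2 < k}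

/-- The number of entries equal to `i`. -/
def content {la : YoungDiagram} (T : SemistandardYoungTableau la) (i : ℕ) : ℕ :=
  #{c ∈ la.cells | T c.1 c.2 = i}

section Extend

variable {la mu : YoungDiagram} (h : HStrip la mu) {k : ℕ}

/-- Extend a tableau by filling a horizontal strip with the entry `k`. -/
def extendTableau (T : BddTableau k mu) : BddTableau (k + 1) la where
  val :=
    { entry := fun i j => if (i, j) ∈ mu then T.1 i j else if (i, j) ∈ la then k else 0
      row_weak' := by
        intro i j1 j2 hj hc
        have h1 : (i, j1) ∈ la := la.up_left_mem le_rfl hj.le hc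
        by_cases h2 : (i, j2) ∈ mu
        · have h3 : (i, j1) ∈ mu := mu.up_left_mem le_rfl hj.le h2
          simpa [h2, h3] using T.1.row_weak hj h2
        · by_cases h3 : (i, j1) ∈ mu
          · simpa [h2, h3, hc] using (T.2 (i, j1) h3).le
          · simp [h2, h3, hc, h1]
      col_strict' := by
        intro i1 i2 j hi hc
        have h1 : (i1, j) ∈ mu := by
          rw [YoungDiagram.mem_iff_lt_rowLen] at hc ⊢
          exact hc.trans_le ((la.rowLen_anti _ _ hi).trans (h i1).2)
        by_cases h2 : (i2, j) ∈ mu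
        · simpa [h2, h1] using T.1.col_strict hi h2
        · simpa [h2, h1, hc] using T.2 (i1, j) h1
      zeros' := by
        intro i j hc
        have : (i, j) ∉ mu := fun h' => hc (h.le h')
        simp [hc, this] }
  property := by
    intro c hc
    change (if (c.1, c.2) ∈ mu then T.1 c.1 c.2 else if (c.1, c.2) ∈ la then k else 0) < k + 1
    split_ifs with h1
    · exact (T.2 c h1).trans (Nat.lt_succ_self k)
    all_goals omega

lemma extendTableau_apply (T : BddTableau k mu) (i j : ℕ) :
    (extendTableau h T).1 i j =
      if (i, j) ∈ mu then T.1 i j else if (i, j) ∈ la then k else 0 := rfl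

lemma extendTableau_lt_iff (T : BddTableau k mu) {c : ℕ × ℕ} (hc : c ∈ la.cells) :
    (extendTableau h T).1 c.1 c.2 < k ↔ c ∈ mu := by
  rw [extendTableau_apply]
  have hc' : (c.1, c.2) ∈ la := hc
  split_ifs with h1
  · exact ⟨fun _ => h1, fun _ => T.2 c h1⟩
  · exact ⟨fun h' => absurd h' (lt_irrefl k), fun h' => absurd h' h1⟩

lemma content_extendTableau_of_lt (T : BddTableau k mu) {i : ℕ} (hi : i < k) :
    content (extendTableau h T).1 i = content T.1 i := by
  unfold content
  congr 1
  ext c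
  rw [mem_filter, mem_filter, YoungDiagram.mem_cells, YoungDiagram.mem_cells, extendTableau_apply]
  constructor
  · rintro ⟨h1, h2⟩
    have : c ∈ mu := (extendTableau_lt_iff h T h1).1 (by rw [extendTableau_apply, h2]; exact hi)
    exact ⟨this, by rwa [if_pos (show (c.1, c.2) ∈ mu from this)] at h2⟩
  · rintro ⟨h1, h2⟩
    exact ⟨h.le h1, by rwa [if_pos (show (c.1, c.2) ∈ mu from h1)]⟩

lemma content_extendTableau_self (T : BddTableau k mu) :
    mu.card + content (extendTableau h T).1 k = la.card := by
  have : {c ∈ la.cells | (extendTableau h T).1 c.1 c.2 = k} = la.cells \ mu.cells := by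
    ext c
    simp only [mem_filter, mem_sdiff, and_congr_right_iff]
    intro hc
    rw [YoungDiagram.mem_cells, ← extendTableau_lt_iff h T hc]
    have := (extendTableau h T).2 c hc
    omega
  rw [content, this, card_sdiff_of_subset (YoungDiagram.cells_subset_iff.2 h.le)]
  exact Nat.add_sub_cancel' (Finset.card_le_card (YoungDiagram.cells_subset_iff.2 h.le))

end Extend

/-- Tableaux with entries at most `k` are horizontal strips filled with `k`, added to tableaux
with entries less than `k`. -/
def extendMap (k : ℕ) (la : YoungDiagram) :
    (Σ mu : {mu // HStrip la mu}, BddTableau k mu.1) → BddTableau (k + 1) la :=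
  fun x => extendTableau x.1.2 x.2

/-- The inner diagram is recovered as the set of cells with entry less than `k`. Removing the
entries `k` leaves a horizontal strip because columns increase strictly: a cell above another cell
of `la` has an entry less than `k`. -/
lemma extendMap_bijective (k : ℕ) (la : YoungDiagram) : Function.Bijective (extendMap k la) := by
  constructor
  · rintro ⟨⟨mu, h⟩, T⟩ ⟨⟨nu, h'⟩, T'⟩ he
    simp only [extendMap] at he
    have hmn : mu = nu := by
      ext c
      by_cases hc : c ∈ la.cells
      · rw [YoungDiagram.mem_cells, YoungDiagram.mem_cells, ← extendTableau_lt_iff h T hc,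
          ← extendTableau_lt_iff h' T' hc, he]
      · exact ⟨fun h1 => absurd (h.le h1) hc, fun h1 => absurd (h'.le h1) hc⟩
    subst hmn
    congr 1
    refine Subtype.ext (SemistandardYoungTableau.ext fun i j => ?_)
    by_cases hc : (i, j) ∈ mu
    · have := congrArg (fun S : BddTableau (k + 1) la => S.1 i j) he
      simpa [extendTableau_apply, hc] using this
    · rw [T.1.zeros hc, T'.1.zeros hc]
  · intro T
    let mu : YoungDiagram :=
      { cells := {c ∈ la.cells | T.1 c.1 c.2 < k}
        isLowerSet := by
          rintro ⟨a, b⟩ ⟨c, d⟩ ⟨h1, h2⟩ h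
          simp only [coe_filter, Set.mem_ofPred_eq, YoungDiagram.mem_cells] at h ⊢
          have hcb : (c, b) ∈ la := la.up_left_mem h1 le_rfl h.1
          exact ⟨la.up_left_mem h1 h2 h.1,
            lt_of_le_of_lt ((T.1.row_weak_of_le h2 hcb).trans (T.1.col_weak h1 h.1)) h.2⟩ }
    have hmem : ∀ c, c ∈ mu ↔ c ∈ la ∧ T.1 c.1 c.2 < k := fun c => by
      rw [← YoungDiagram.mem_cells]
      simp [mu]
    have hstrip : HStrip la mu := by
      intro i
      refine ⟨le_iff_rowLen_le.1 (fun c hc => ((hmem c).1 hc).1) i, ?_⟩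
      by_contra hlt
      have h1 : (i + 1, mu.rowLen i) ∈ la := YoungDiagram.mem_iff_lt_rowLen.2 (not_le.1 hlt)
      have h2 : (i, mu.rowLen i) ∈ la := la.up_left_mem (Nat.le_succ i) le_rfl h1
      have h3 := T.1.col_strict (Nat.lt_succ_self i) h1
      have h4 := T.2 _ h1
      have h5 : (i, mu.rowLen i) ∈ mu := (hmem _).2 ⟨h2, by simp only [Nat.succ_eq_add_one] at h3 h4 ⊢; omega⟩
      exact lt_irrefl _ (YoungDiagram.mem_iff_lt_rowLen.1 h5)
    refine ⟨⟨⟨mu, hstrip⟩, ⟨⟨fun i j => if (i, j) ∈ mu then T.1 i j else 0, ?_, ?_, ?_⟩, ?_⟩⟩, ?_⟩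
    · intro i j1 j2 hj hc
      simpa [hc, mu.up_left_mem le_rfl hj.le hc] using T.1.row_weak hj ((hmem _).1 hc).1
    · intro i1 i2 j hi hc
      simpa [hc, mu.up_left_mem hi.le le_rfl hc] using T.1.col_strict hi ((hmem _).1 hc).1
    · intro i j hc
      simp [hc]
    · intro c hc
      have hc' : (c.1, c.2) ∈ mu := hc
      change (if (c.1, c.2) ∈ mu then T.1 c.1 c.2 else 0) < k
      rw [if_pos hc']
      exact ((hmem c).1 hc').2
    · refine Subtype.ext (SemistandardYoungTableau.ext fun i j => ?_)
      change (extendTableau hstrip _).1 i j = _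
      rw [extendTableau_apply]
      split_ifs with h1 h2
      · change (if (i, j) ∈ mu then T.1 i j else 0) = _
        rw [if_pos h1]
      · have := T.2 (i, j) h2
        have h3 : ¬ T.1 i j < k := fun h => h1 ((hmem _).2 ⟨h2, h⟩)
        simp only at this
        omega
      · exact (T.1.zeros h2).symm

instance instFiniteStrips (la : YoungDiagram) : Finite {mu // HStrip la mu} :=
  Finite.of_equiv (strips la) (Equiv.subtypeEquivRight fun _ => mem_strips)

lemma bddTableau_zero_eq_bot {la : YoungDiagram} (T : BddTableau 0 la) : la = ⊥ := by
  ext c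
  exact ⟨fun h => absurd (T.2 c h) (Nat.not_lt_zero _), fun h => absurd h (by simp)⟩

instance instFiniteBddTableau (k : ℕ) (la : YoungDiagram) : Finite (BddTableau k la) := by
  induction k generalizing la with
  | zero =>
    refine @Finite.of_subsingleton _ ⟨fun T T' => ?_⟩
    have := bddTableau_zero_eq_bot T
    subst this
    refine Subtype.ext (SemistandardYoungTableau.ext fun i j => ?_)
    rw [T.1.zeros (YoungDiagram.notMem_bot _), T'.1.zeros (YoungDiagram.notMem_bot _)]
  | succ k ih => exact Finite.of_surjective _ (extendMap_bijective k la).2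

/-- The number of semistandard tableaux with content `m 0, …, m (k - 1)`. -/
def tabCount (k : ℕ) (m : ℕ → ℕ) (la : YoungDiagram) : ℕ :=
  Nat.card {T : BddTableau k la // ∀ i < k, content T.1 i = m i}

/-- The number of semistandard tableaux with entries less than `k`. -/
def tabTotal (k : ℕ) (la : YoungDiagram) : ℕ := Nat.card (BddTableau k la)

lemma natCard_bddTableau_zero (la : YoungDiagram) [Decidable (la = ⊥)] :
    Nat.card (BddTableau 0 la) = if la = ⊥ then 1 else 0 := by
  split_ifs with h
  · subst h
    rw [Nat.card_eq_one_iff_unique]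
    refine ⟨⟨fun T T' => Subtype.ext (SemistandardYoungTableau.ext fun i j => ?_)⟩,
      ⟨⟨SemistandardYoungTableau.highestWeight ⊥, fun c hc => absurd hc (by simp)⟩⟩⟩
    rw [T.1.zeros (YoungDiagram.notMem_bot _), T'.1.zeros (YoungDiagram.notMem_bot _)]
  · rw [Nat.card_eq_zero]
    exact Or.inl ⟨fun T => h (bddTableau_zero_eq_bot T)⟩

lemma tabTotal_zero (la : YoungDiagram) [Decidable (la = ⊥)] :
    tabTotal 0 la = if la = ⊥ then 1 else 0 := natCard_bddTableau_zero la

lemma tabCount_zero (m : ℕ → ℕ) (la : YoungDiagram) [Decidable (la = ⊥)] :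
    tabCount 0 m la = if la = ⊥ then 1 else 0 := by
  rw [← natCard_bddTableau_zero]
  exact Nat.card_congr (Equiv.subtypeUnivEquiv fun _ i hi => absurd hi (Nat.not_lt_zero i))

lemma sum_strips_eq {M : Type*} [AddCommMonoid M] (la : YoungDiagram) (f : YoungDiagram → M)
    [Fintype {mu // HStrip la mu}] :
    ∑ mu ∈ strips la, f mu = ∑ mu : {mu // HStrip la mu}, f mu.1 :=
  (sum_subtype (strips la) (fun _ => mem_strips) f)

lemma tabTotal_succ (k : ℕ) (la : YoungDiagram) :
    tabTotal (k + 1) la = ∑ mu ∈ strips la, tabTotal k mu := by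
  classical
  have := Fintype.ofFinite {mu // HStrip la mu}
  rw [sum_strips_eq, tabTotal, ← Nat.card_congr (Equiv.ofBijective _ (extendMap_bijective k la)),
    Nat.card_sigma]
  rfl

/-- The branching rule. Every later statement about Kostka numbers is an induction along it, so
tableaux themselves are hardly used from here on. -/
lemma tabCount_succ (k : ℕ) (m : ℕ → ℕ) (la : YoungDiagram) :
    tabCount (k + 1) m la =
      ∑ mu ∈ strips la, if mu.card + m k = la.card then tabCount k m mu else 0 := by
  classical
  have := Fintype.ofFinite {mu // HStrip la mu}
  rw [sum_strips_eq, tabCount, ← Nat.card_congr ((Equiv.ofBijective _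
    (extendMap_bijective k la)).subtypeEquiv (p := fun x => x.1.1.card + m k = la.card ∧
      ∀ i < k, content x.2.1 i = m i) fun x => ?_)]
  · rw [Nat.card_congr (β := Σ mu : {mu // HStrip la mu}, {T : BddTableau k mu.1 //
      mu.1.card + m k = la.card ∧ ∀ i < k, content T.1 i = m i})
      ⟨fun x => ⟨x.1.1, ⟨x.1.2, x.2⟩⟩, fun x => ⟨⟨x.1, x.2.1⟩, x.2.2⟩, fun _ => rfl, fun _ => rfl⟩,
      Nat.card_sigma]
    refine sum_congr rfl fun mu _ => ?_
    split_ifs with h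
    · exact Nat.card_congr (Equiv.subtypeEquivRight fun _ => by simp [h])
    · rw [Nat.card_eq_zero]
      exact Or.inl ⟨fun T => h T.2.1⟩
  · change _ ↔ ∀ i < k + 1, content (extendTableau x.1.2 x.2).1 i = m i
    have h1 := content_extendTableau_self x.1.2 x.2
    constructor
    · rintro ⟨h2, h3⟩ i hi
      rcases Nat.lt_succ_iff_lt_or_eq.1 hi with hi | rfl
      · rw [content_extendTableau_of_lt _ _ hi, h3 i hi]
      · omega
    · intro h2
      refine ⟨by rw [← h2 k (Nat.lt_succ_self k)]; exact h1, fun i hi => ?_⟩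
      rw [← content_extendTableau_of_lt x.1.2 _ hi, h2 i (hi.trans (Nat.lt_succ_self k))]

lemma tabCount_congr {k : ℕ} {m m' : ℕ → ℕ} (h : ∀ i < k, m i = m' i) (la : YoungDiagram) :
    tabCount k m la = tabCount k m' la :=
  Nat.card_congr (Equiv.subtypeEquivRight fun _ =>
    ⟨fun h1 i hi => (h1 i hi).trans (h i hi), fun h1 i hi => (h1 i hi).trans (h i hi).symm⟩)

/-- Entries outside the support of the weight cannot occur, so any bound `k` beyond the support may
be imposed and the recursion on `k` becomes available. -/
lemma kostkaNumber_eq_tabCount {n : ℕ} (p : n.Partition) (m : ℕ →₀ ℕ) {k : ℕ}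
    (hk : ∀ i, k ≤ i → m i = 0) : kostkaNumber p m = tabCount k m (diagram p) := by
  refine (Nat.card_congr (α := {T : BddTableau k (diagram p) // ∀ i < k, content T.1 i = m i})
    (β := {T : SemistandardYoungTableau (diagram p) // ∀ i, content T i = m i})
    ⟨fun x => ⟨x.1.1, fun i => ?_⟩, fun x => ⟨⟨x.1, fun c hc => ?_⟩,
      fun i _ => x.2 i⟩, fun _ => rfl, fun _ => rfl⟩).symm
  · by_cases hi : i < k
    · exact x.2 i hi
    · rw [hk i (not_lt.1 hi), content, card_eq_zero, filter_eq_empty_iff]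
      intro c hc h
      exact hi (h ▸ x.1.2 c hc)
  · by_contra h
    have h1 := x.2 (x.1 c.1 c.2)
    rw [hk _ (not_lt.1 h), content, card_eq_zero, filter_eq_empty_iff] at h1
    exact h1 hc rfl

lemma sum_content {k : ℕ} {la : YoungDiagram} (T : BddTableau k la) :
    ∑ i ∈ range k, content T.1 i = la.card :=
  (card_eq_sum_card_fiberwise fun c hc => by simpa using! T.2 c hc).symm

lemma sum_tabCount (k : ℕ) (la : YoungDiagram) :
    ∑ m ∈ finsuppAntidiag (range k) la.card, tabCount k m la = tabTotal k la := by
  classical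
  have := Fintype.ofFinite (BddTableau k la)
  let ct : BddTableau k la → (ℕ →₀ ℕ) := fun T =>
    Finsupp.onFinset (range k) (fun i => if i < k then content T.1 i else 0) (by simp +contextual)
  have h : ∀ T ∈ (univ : Finset (BddTableau k la)), ct T ∈ finsuppAntidiag (range k) la.card := by
    intro T _
    rw [mem_finsuppAntidiag]
    refine ⟨?_, Finsupp.support_onFinset_subset⟩
    rw [← sum_content T]
    exact sum_congr rfl fun i hi => by simp [ct, mem_range.1 hi]
  rw [tabTotal, Nat.card_eq_fintype_card, ← card_univ, card_eq_sum_card_fiberwise h]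
  refine sum_congr rfl fun m hm => ?_
  rw [tabCount, Nat.card_eq_fintype_card, Fintype.card_subtype]
  congr 1
  ext T
  simp only [mem_filter, mem_univ, true_and]
  constructor
  · intro h1
    ext i
    by_cases hi : i < k
    · simp [ct, hi, h1 i hi]
    · have h0 : m i = 0 := by
        by_contra h2
        exact hi (mem_range.1 ((mem_finsuppAntidiag.1 hm).2 (Finsupp.mem_support_iff.2 h2)))
      simp [ct, hi, h0]
  · rintro rfl i hi
    simp [ct, hi]

/-! ## Symmetry of the numbers of tableaux -/

/-- The row lengths of the middle diagram reflected in a chain of two horizontal strips. -/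
def reflectRow (la mu nu : YoungDiagram) (i : ℕ) : ℕ :=
  max (mu.rowLen i) (la.rowLen (i + 1)) +
    (match i with
      | 0 => la.rowLen 0
      | i + 1 => min (la.rowLen (i + 1)) (mu.rowLen i)) - nu.rowLen i

section Reflect

variable {la mu nu : YoungDiagram}

/-- For fixed outer and inner diagrams, the rows of the middle one vary independently: row `i` runs
over the interval from `max(mu_i, la_{i+1})` to `min(la_i, mu_{i-1})`, with upper end `la_0` for the
top row. Reflecting each row in its interval is the Bender-Knuth involution. -/
lemma reflectRow_bounds (h1 : HStrip la nu) (h2 : HStrip nu mu) (i : ℕ) :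
    max (mu.rowLen i) (la.rowLen (i + 1)) ≤ reflectRow la mu nu i ∧
      reflectRow la mu nu i ≤ la.rowLen i ∧ reflectRow la mu nu (i + 1) ≤ mu.rowLen i ∧
      nu.rowLen i + reflectRow la mu nu i = max (mu.rowLen i) (la.rowLen (i + 1)) +
        (match i with
          | 0 => la.rowLen 0
          | i + 1 => min (la.rowLen (i + 1)) (mu.rowLen i)) := by
  have a1 := h1 i
  have a2 := h2 i
  have a3 := h1 (i + 1)
  have a4 := h2 (i + 1)
  cases i with
  | zero => simp only [reflectRow]; omega
  | succ i =>
    have a5 := h1 i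
    have a6 := h2 i
    simp only [reflectRow]; omega

lemma antitone_reflectRow (h1 : HStrip la nu) (h2 : HStrip nu mu) :
    Antitone (reflectRow la mu nu) := antitone_nat_of_succ_le fun i => by
  have := reflectRow_bounds h1 h2 i
  omega

open Classical in
/-- Reflection of the middle diagram in a chain of two horizontal strips. -/
def reflect (la mu nu : YoungDiagram) : YoungDiagram :=
  if h : Antitone (reflectRow la mu nu) then subdiagram la _ h else ⊥

lemma rowLen_reflect (h1 : HStrip la nu) (h2 : HStrip nu mu) (i : ℕ) :
    (reflect la mu nu).rowLen i = reflectRow la mu nu i := by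
  rw [reflect, dif_pos (antitone_reflectRow h1 h2)]
  exact rowLen_subdiagram _ (reflectRow_bounds h1 h2 i).2.1

lemma hStrip_reflect (h1 : HStrip la nu) (h2 : HStrip nu mu) :
    HStrip la (reflect la mu nu) ∧ HStrip (reflect la mu nu) mu := by
  refine ⟨fun i => ?_, fun i => ?_⟩ <;> simp only [rowLen_reflect h1 h2] <;>
    have := reflectRow_bounds h1 h2 i <;> omega

lemma reflect_reflect (h1 : HStrip la nu) (h2 : HStrip nu mu) :
    reflect la mu (reflect la mu nu) = nu := by
  refine diagram_ext fun i => ?_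
  obtain ⟨h3, h4⟩ := hStrip_reflect h1 h2
  rw [rowLen_reflect h3 h4]
  have a := (reflectRow_bounds h1 h2 i).2.2.2
  have b := (reflectRow_bounds h3 h4 i).2.2.2
  rw [rowLen_reflect h1 h2] at b
  omega

/-- The endpoints of the intervals add up to `|la| + |mu|`, since `max` and `min` of `mu_i` and
`la_{i+1}` occur at neighbouring rows and together give their sum. Hence the reflection exchanges
the sizes of the two strips. -/
lemma card_reflect (h1 : HStrip la nu) (h2 : HStrip nu mu) :
    nu.card + (reflect la mu nu).card = la.card + mu.card := by
  have hN : ∀ i, la.colLen 0 ≤ i → la.rowLen i = 0 := fun i => rowLen_eq_zero_of_le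
  set N := la.colLen 0
  have hN1 : ∀ i, N + 1 ≤ i → la.rowLen i = 0 := fun i hi => hN i (by omega)
  rw [card_eq_sum_rowLen nu (h1.colLen_le hN1),
    card_eq_sum_rowLen _ ((hStrip_reflect h1 h2).1.colLen_le hN1), ← sum_add_distrib,
    card_eq_sum_rowLen la hN1, card_eq_sum_rowLen mu (h2.colLen_le (h1.colLen_le hN))]
  rw [sum_congr rfl fun i _ => by rw [rowLen_reflect h1 h2, (reflectRow_bounds h1 h2 i).2.2.2],
    sum_add_distrib, sum_range_succ, sum_range_succ' _ N, sum_range_succ' _ N]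
  have e1 : mu.rowLen N = 0 := h2.colLen_le (h1.colLen_le hN) N le_rfl
  have e2 : la.rowLen (N + 1) = 0 := hN _ (by omega)
  have e3 : ∀ i, max (mu.rowLen i) (la.rowLen (i + 1)) + min (la.rowLen (i + 1)) (mu.rowLen i)
      = la.rowLen (i + 1) + mu.rowLen i := fun i => by omega
  simp only [e1, e2, max_self, add_zero]
  rw [← add_assoc, ← sum_add_distrib, sum_congr rfl fun i _ => e3 i, sum_add_distrib]
  ring

end Reflect

/-- Reflecting the diagram between the last two strips exchanges the multiplicities of `k` and `k +
1` and leaves the smaller entries alone. -/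
lemma tabCount_swap_last (k : ℕ) (m : ℕ → ℕ) (la : YoungDiagram) :
    tabCount (k + 2) (m ∘ Equiv.swap k (k + 1)) la = tabCount (k + 2) m la := by
  have hm : ∀ mu, tabCount k (m ∘ Equiv.swap k (k + 1)) mu = tabCount k m mu :=
    tabCount_congr fun i hi => by
      simp [Equiv.swap_apply_of_ne_of_ne (show i ≠ k by omega) (show i ≠ k + 1 by omega)]
  have key : ∀ m : ℕ → ℕ, tabCount (k + 2) m la = ∑ x ∈ (strips la).sigma fun nu => strips nu,
      if x.1.card + m (k + 1) = la.card ∧ x.2.card + m k = x.1.card then tabCount k m x.2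
      else 0 := by
    intro m
    rw [tabCount_succ, sum_sigma]
    refine sum_congr rfl fun nu _ => ?_
    split_ifs with h
    · rw [tabCount_succ]
      simp [h]
    · simp [h]
  rw [key, key]
  simp only [hm, Function.comp, Equiv.swap_apply_left, Equiv.swap_apply_right]
  refine sum_bij' (fun x _ => ⟨reflect la x.2 x.1, x.2⟩) (fun x _ => ⟨reflect la x.2 x.1, x.2⟩)
    ?_ ?_ ?_ ?_ ?_
  all_goals
    rintro ⟨nu, mu⟩ h
    simp only [mem_sigma, mem_strips] at h ⊢
  · exact hStrip_reflect h.1 h.2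
  · exact hStrip_reflect h.1 h.2
  · rw [reflect_reflect h.1 h.2]
  · rw [reflect_reflect h.1 h.2]
  · have h1 := card_reflect h.1 h.2
    have h2 := card_le_card h.2.le
    have h3 := card_le_card (hStrip_reflect h.1 h.2).2.le
    exact if_congr (by omega) rfl rfl

lemma tabCount_swap {k a : ℕ} (ha : a + 1 < k) (m : ℕ → ℕ) (la : YoungDiagram) :
    tabCount k (m ∘ Equiv.swap a (a + 1)) la = tabCount k m la := by
  induction k generalizing la with
  | zero => omega
  | succ k ih =>
    rcases Nat.lt_or_ge (a + 1) k with h | h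
    · rw [tabCount_succ, tabCount_succ]
      refine sum_congr rfl fun mu _ => ?_
      rw [ih h]
      simp [Equiv.swap_apply_of_ne_of_ne (show k ≠ a by omega) (show k ≠ a + 1 by omega)]
    · obtain rfl : k = a + 1 := by omega
      exact tabCount_swap_last a m la

lemma kostkaNumber_swap {n : ℕ} (p : n.Partition) (m m' : ℕ →₀ ℕ) (a : ℕ)
    (h : ∀ i, m' i = m (Equiv.swap a (a + 1) i)) : kostkaNumber p m' = kostkaNumber p m := by
  obtain ⟨k, hk⟩ : ∃ k, ∀ i, k ≤ i → m i = 0 := by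
    refine ⟨m.support.sup id + 1, fun i hi => ?_⟩
    by_contra h0
    have := le_sup (f := id) (Finsupp.mem_support_iff.2 h0)
    simp only [id] at this
    omega
  have hk1 : ∀ i, k + a + 2 ≤ i → m i = 0 := fun i hi => hk i (by omega)
  have hk2 : ∀ i, k + a + 2 ≤ i → m' i = 0 := fun i hi => by
    rw [h, Equiv.swap_apply_of_ne_of_ne (by omega) (by omega), hk1 i hi]
  rw [kostkaNumber_eq_tabCount p m hk1, kostkaNumber_eq_tabCount p m' hk2,
    ← tabCount_swap (show a + 1 < k + a + 2 by omega) m]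
  exact tabCount_congr (fun i _ => h i) _

/-! ## Triangularity -/

lemma rowLen_bot (i : ℕ) : (⊥ : YoungDiagram).rowLen i = 0 := by
  by_contra h
  exact YoungDiagram.notMem_bot _ (YoungDiagram.mem_iff_lt_rowLen.2 (Nat.pos_of_ne_zero h))

lemma eq_bot_of_rowLen_zero {la : YoungDiagram} (h : la.rowLen 0 = 0) : la = ⊥ :=
  diagram_ext fun i => by
    have := la.rowLen_anti 0 i (Nat.zero_le i)
    rw [rowLen_bot]; omega

/-- Along a chain of horizontal strips the number of rows grows by at most one at each step, and the
partial sums of row lengths never decrease. When all entries are used, the partial sum of the weight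
is the whole size of the diagram. -/
lemma dominance_of_tabCount_ne_zero {k : ℕ} {m : ℕ → ℕ} {la : YoungDiagram}
    (h : tabCount k m la ≠ 0) : (∀ i, k ≤ i → la.rowLen i = 0) ∧
      la.card = ∑ i ∈ range k, m i ∧
      ∀ j ≤ k, ∑ i ∈ range j, m i ≤ ∑ i ∈ range j, la.rowLen i := by
  classical
  induction k generalizing la with
  | zero =>
    rw [tabCount_zero] at h
    obtain rfl : la = ⊥ := by by_contra h'; simp [h'] at h
    refine ⟨fun i _ => rowLen_bot i, rfl, fun j hj => ?_⟩
    obtain rfl : j = 0 := by omega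
    simp
  | succ k ih =>
    rw [tabCount_succ] at h
    obtain ⟨mu, hmu, h⟩ := exists_ne_zero_of_sum_ne_zero h
    rw [mem_strips] at hmu
    have hc : mu.card + m k = la.card := by by_contra h'; simp [h'] at h
    rw [if_pos hc] at h
    obtain ⟨h1, h2, h3⟩ := ih h
    have hr : ∀ i, k + 1 ≤ i → la.rowLen i = 0 := by
      intro i hi
      obtain ⟨i, rfl⟩ : ∃ i', i = i' + 1 := ⟨i - 1, by omega⟩
      have := (hmu i).2
      rw [h1 i (by omega)] at this
      omega
    have hcard : la.card = ∑ i ∈ range (k + 1), m i := by rw [sum_range_succ, ← h2, hc]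
    refine ⟨hr, hcard, fun j hj => ?_⟩
    rcases Nat.lt_succ_iff_lt_or_eq.1 (Nat.lt_succ_of_le hj) with hj | rfl
    · exact (h3 j (by omega)).trans (sum_le_sum fun i _ => (hmu i).1)
    · rw [← hcard, card_eq_sum_rowLen la hr]

/-- The largest entry must fill exactly the last row: any other strip of that size would leave an
inner diagram with the same total in the first `k` rows, and row-by-row comparison then forces
equality. -/
lemma tabCount_rowLen_self {k : ℕ} {la : YoungDiagram} (h : ∀ i, k ≤ i → la.rowLen i = 0) :
    tabCount k la.rowLen la = 1 := by
  classical
  induction k generalizing la with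
  | zero => rw [tabCount_zero, if_pos (eq_bot_of_rowLen_zero (h 0 le_rfl))]
  | succ k ih =>
    have hr : Antitone fun i => if i < k then la.rowLen i else 0 := antitone_nat_of_succ_le fun i => by
      have := la.rowLen_anti i (i + 1) (Nat.le_succ i)
      split_ifs <;> omega
    have hrow : ∀ i, (subdiagram la _ hr).rowLen i = if i < k then la.rowLen i else 0 := fun i =>
      rowLen_subdiagram hr (by split_ifs <;> omega)
    set mu := subdiagram la _ hr
    have hmk : ∀ i, k ≤ i → mu.rowLen i = 0 := fun i hi => by rw [hrow, if_neg (by omega)]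
    have hstrip : HStrip la mu := by
      intro i
      rw [hrow]
      have h1 := la.rowLen_anti i (i + 1) (Nat.le_succ i)
      split_ifs with hi
      · exact ⟨le_rfl, h1⟩
      · exact ⟨Nat.zero_le _, (h (i + 1) (by omega)).le⟩
    have hcard : mu.card + la.rowLen k = la.card := by
      rw [card_eq_sum_rowLen la h, card_eq_sum_rowLen mu hmk, sum_range_succ]
      congr 1
      exact sum_congr rfl fun i hi => by rw [hrow, if_pos (mem_range.1 hi)]
    rw [tabCount_succ, sum_eq_single mu]
    · rw [if_pos hcard, ← ih hmk]
      exact tabCount_congr (fun i hi => by rw [hrow, if_pos hi]) _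
    · intro nu hnu hne
      by_contra h0
      have hc : nu.card + la.rowLen k = la.card := by by_contra h'; simp [h'] at h0
      rw [if_pos hc] at h0
      obtain ⟨h1, h2, h3⟩ := dominance_of_tabCount_ne_zero h0
      rw [mem_strips] at hnu
      have hsum : ∑ i ∈ range k, nu.rowLen i = ∑ i ∈ range k, la.rowLen i := by
        rw [← card_eq_sum_rowLen nu h1, h2]
      have heq := (sum_eq_sum_iff_of_le fun i _ => (hnu i).1).1 hsum
      refine hne (diagram_ext fun i => ?_)
      rw [hrow]
      split_ifs with hi
      · exact heq i (mem_range.2 hi)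
      · exact h1 i (by omega)
    · intro hmu
      exact absurd (mem_strips.2 hstrip) hmu

/-! ## Tableaux using all entries, and evaluation at `-1` -/

open Classical in
/-- The number of tableaux whose set of entries is `{0, …, j - 1}`. -/
def packedCount : ℕ → YoungDiagram → ℕ
  | 0, la => if la = ⊥ then 1 else 0
  | j + 1, la => ∑ mu ∈ (strips la).erase la, packedCount j mu

lemma self_mem_strips (la : YoungDiagram) : la ∈ strips la :=
  mem_strips.2 fun i => ⟨le_rfl, la.rowLen_anti i (i + 1) (Nat.le_succ i)⟩

lemma card_lt_of_mem_erase {la mu : YoungDiagram} [DecidableEq YoungDiagram]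
    (h : mu ∈ (strips la).erase la) :
    mu.card < la.card := by
  rw [mem_erase, mem_strips] at h
  exact Finset.card_lt_card (YoungDiagram.cells_ssubset_iff.2 (lt_of_le_of_ne h.2.le h.1))

lemma packedCount_eq_zero {j : ℕ} {la : YoungDiagram} (h : la.card < j) : packedCount j la = 0 := by
  classical
  induction j generalizing la with
  | zero => omega
  | succ j ih =>
    rw [packedCount]
    refine sum_eq_zero fun mu hmu => ih ?_
    have := card_lt_of_mem_erase (by convert hmu)
    omega

/-- Choose which `j` of the `k` entries occur. In the branching rule the term `mu = la` means that
the last entry is not used, the others that it is, and the two match Pascal's rule. This exhibits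
the number of tableaux as a polynomial in `k`. -/
lemma tabTotal_eq_sum_choose (k : ℕ) (la : YoungDiagram) {N : ℕ} (hN : la.card ≤ N) :
    tabTotal k la = ∑ j ∈ range (N + 1), k.choose j * packedCount j la := by
  classical
  induction k generalizing la N with
  | zero =>
    rw [sum_range_succ', sum_eq_zero fun j _ => by simp, tabTotal_zero]
    simp [packedCount]
  | succ k ih =>
    have h1 : ∀ j, ∑ mu ∈ (strips la).erase la, packedCount j mu = packedCount (j + 1) la :=
      fun j => by rw [packedCount]
    rw [tabTotal_succ, ← add_sum_erase _ _ (self_mem_strips la),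
      sum_congr rfl fun mu hmu => ih mu ((card_lt_of_mem_erase hmu).le.trans hN), sum_comm, ih la hN]
    simp only [← mul_sum, h1]
    rw [sum_range_succ (fun j => k.choose j * packedCount (j + 1) la),
      packedCount_eq_zero (show la.card < N + 1 by omega), mul_zero, add_zero,
      sum_range_succ' (fun j => k.choose j * packedCount j la), sum_range_succ' _ N, add_right_comm,
      ← sum_add_distrib]
    simp only [Nat.choose_succ_succ, Nat.choose_zero_right]
    congr 1
    exact sum_congr rfl fun j _ => by ring

/-- The value at `-1` of the polynomial that counts tableaux with bounded entries. -/
def signedCount (la : YoungDiagram) : ℤ :=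
  ∑ j ∈ range (la.card + 1), (-1) ^ j * (packedCount j la : ℤ)

lemma signedCount_eq {la : YoungDiagram} {N : ℕ} (hN : la.card ≤ N) :
    signedCount la = ∑ j ∈ range (N + 1), (-1) ^ j * (packedCount j la : ℤ) := by
  refine sum_subset (range_mono (by omega)) fun j _ hj => ?_
  rw [packedCount_eq_zero (by simp at hj; omega)]
  simp

/-- The branching rule at `k = -1`: summing the values at `-1` over strips gives the value at `0`,
which counts tableaux without entries. Concretely, the alternating sums telescope. -/
lemma sum_strips_signedCount (la : YoungDiagram) [Decidable (la = ⊥)] :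
    ∑ mu ∈ strips la, signedCount mu = if la = ⊥ then 1 else 0 := by
  classical
  rw [← add_sum_erase _ _ (self_mem_strips la),
    sum_congr rfl fun mu hmu => signedCount_eq (card_lt_of_mem_erase hmu).le, sum_comm,
    signedCount_eq (Nat.le_succ _), sum_range_succ', add_right_comm, ← sum_add_distrib,
    sum_eq_zero]
  · simp [packedCount]
  · intro j _
    rw [packedCount, pow_succ, ← mul_sum]
    push_cast
    have : ∀ s : Finset YoungDiagram, (-1 : ℤ) ^ j * -1 * ∑ x ∈ s, (packedCount j x : ℤ)
      + (-1) ^ j * ∑ x ∈ s, (packedCount j x : ℤ) = 0 := fun s => by ring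
    convert this _

/-- The diagram with a single column of height `h`. -/
def columnDiagram (h : ℕ) : YoungDiagram where
  cells := {c ∈ range h ×ˢ range 1 | True}
  isLowerSet := by
    rintro ⟨a, b⟩ ⟨c, d⟩ ⟨h1, h2⟩ h
    simp at h h1 h2 ⊢
    omega

lemma rowLen_columnDiagram (h i : ℕ) : (columnDiagram h).rowLen i = if i < h then 1 else 0 := by
  have : ∀ j, j < (columnDiagram h).rowLen i ↔ i < h ∧ j < 1 := by
    intro j
    rw [← YoungDiagram.mem_iff_lt_rowLen, ← YoungDiagram.mem_cells]
    simp [columnDiagram, eq_comm]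
  split_ifs with hi
  · refine le_antisymm (not_lt.1 fun h' => ?_) ((this 0).2 ⟨hi, one_pos⟩)
    exact absurd ((this _).1 h').2 (lt_irrefl _)
  · exact Nat.le_zero.1 (not_lt.1 fun h' => hi ((this _).1 h').1)

lemma card_columnDiagram (h : ℕ) : (columnDiagram h).card = h := by
  rw [card_eq_sum_rowLen _ (N := h) fun i hi => by rw [rowLen_columnDiagram, if_neg (by omega)],
    sum_congr rfl fun i hi => by rw [rowLen_columnDiagram, if_pos (mem_range.1 hi)]]
  simp

/-- If `la` has `b + 1` rows, a column obtained by removing a horizontal strip has height `b` or `b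
+ 1`, and the two signs cancel. Such columns exist only if the second row of `la` has length at most
one. -/
lemma sum_strips_columns {la : YoungDiagram} (hla : la ≠ ⊥) :
    ∑ mu ∈ strips la, (if mu.rowLen 0 ≤ 1 then (-1 : ℤ) ^ mu.card else 0) = 0 := by
  classical
  have hpos : ∀ i, i < la.colLen 0 → 0 < la.rowLen i := fun i hi =>
    YoungDiagram.mem_iff_lt_rowLen.1 (YoungDiagram.mem_iff_lt_colLen.2 hi)
  have hzero : ∀ i, la.colLen 0 ≤ i → la.rowLen i = 0 := fun i => rowLen_eq_zero_of_le
  obtain ⟨b, hb⟩ : ∃ b, la.colLen 0 = b + 1 := by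
    refine Nat.exists_eq_succ_of_ne_zero fun h0 => hla (eq_bot_of_rowLen_zero (hzero 0 h0.le))
  rw [hb] at hpos hzero
  rw [← sum_filter]
  by_cases h1 : la.rowLen 1 ≤ 1
  · have : {mu ∈ strips la | mu.rowLen 0 ≤ 1} = {columnDiagram (b + 1), columnDiagram b} := by
      ext mu
      simp only [mem_filter, mem_strips, mem_insert, mem_singleton]
      constructor
      · rintro ⟨h, h0⟩
        have hrow : ∀ i, i ≠ b → mu.rowLen i = if i < b then 1 else 0 := by
          intro i hib
          have a1 := mu.rowLen_anti 0 i (Nat.zero_le i)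
          have a2 := h i
          split_ifs with hi
          · have := hpos (i + 1) (by omega)
            omega
          · have := hzero i (by omega)
            omega
        have hbb : mu.rowLen b = 0 ∨ mu.rowLen b = 1 := by
          have a1 := mu.rowLen_anti 0 b (Nat.zero_le b)
          omega
        rcases hbb with hbb | hbb
        · right
          refine diagram_ext fun i => ?_
          rw [rowLen_columnDiagram]
          by_cases hib : i = b
          · subst hib; simp [hbb]
          · exact hrow i hib
        · left
          refine diagram_ext fun i => ?_
          rw [rowLen_columnDiagram]
          by_cases hib : i = b
          · subst hib; simp [hbb]
          · rw [hrow i hib]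
            exact if_congr (by omega) rfl rfl
      · have hle : ∀ i, la.rowLen (i + 1) ≤ 1 := fun i =>
          (la.rowLen_anti 1 (i + 1) (by omega)).trans h1
        rintro (rfl | rfl) <;>
        · refine ⟨fun i => ?_, by rw [rowLen_columnDiagram]; split_ifs <;> omega⟩
          rw [rowLen_columnDiagram]
          have a1 := hle i
          split_ifs with hi
          · have := hpos i (by omega)
            omega
          · have := hzero (i + 1) (by omega)
            omega
    rw [this, sum_pair]
    · rw [card_columnDiagram, card_columnDiagram, pow_succ]
      ring
    · intro h
      have := congrArg YoungDiagram.card h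
      rw [card_columnDiagram, card_columnDiagram] at this
      omega
  · refine sum_eq_zero fun mu hmu => ?_
    rw [mem_filter, mem_strips] at hmu
    have := (hmu.1 0).2
    simp only [zero_add] at this
    omega

/-- Both sides have the same sums over strips, and the strip `mu = la` makes this a recursion on the
size with a unique solution. In terms of symmetric functions, one "negative" variable transposes the
shape up to sign. -/
lemma signedCount_eq_ite (la : YoungDiagram) :
    signedCount la = if la.rowLen 0 ≤ 1 then (-1) ^ la.card else 0 := by
  classical
  induction hn : la.card using Nat.strong_induction_on generalizing la with
  | _ n ih =>
    subst hn
    have h1 := sum_strips_signedCount la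
    rw [← add_sum_erase _ _ (self_mem_strips la), sum_congr rfl fun mu hmu =>
      ih _ (card_lt_of_mem_erase hmu) mu rfl] at h1
    by_cases hla : la = ⊥
    · subst hla
      rw [sum_eq_zero fun mu hmu => absurd (card_lt_of_mem_erase hmu) (Nat.not_lt_zero _)] at h1
      simp only [add_zero, if_true] at h1
      rw [h1, if_pos (by rw [rowLen_bot]; omega)]
      rfl
    · have h2 := sum_strips_columns hla
      rw [← add_sum_erase _ _ (self_mem_strips la)] at h2
      rw [if_neg hla] at h1
      linarith

/-- The polynomial in `X` with value `binom(k, j)` at `k`. -/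
def choosePoly (j : ℕ) : Qq[X] := ∏ i ∈ range j, C ((i + 1 : Qq)⁻¹) * (X - C (i : Qq))

lemma eval_choosePoly (j k : ℕ) : (choosePoly j).eval (k : Qq) = (k.choose j : Qq) := by
  induction j with
  | zero => simp [choosePoly]
  | succ j ih =>
    rw [choosePoly, prod_range_succ, eval_mul, ← choosePoly, ih]
    simp only [eval_mul, eval_C, eval_sub, eval_X]
    have h1 : (j + 1 : Qq) ≠ 0 := by exact_mod_cast Nat.succ_ne_zero j
    field_simp
    have := Nat.choose_succ_right_eq k j
    rcases le_or_gt j k with h | h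
    · rw [← Nat.cast_sub h]
      rw [mul_comm] at this
      exact_mod_cast this.symm
    · rw [Nat.choose_eq_zero_of_lt h, Nat.choose_eq_zero_of_lt (h.trans (Nat.lt_succ_self j))]
      simp

lemma eval_choosePoly_neg_one (j : ℕ) : (choosePoly j).eval (-1) = (-1) ^ j := by
  induction j with
  | zero => simp [choosePoly]
  | succ j ih =>
    rw [choosePoly, prod_range_succ, eval_mul, ← choosePoly, ih]
    simp only [eval_mul, eval_C, eval_sub, eval_X]
    have h1 : (j + 1 : Qq) ≠ 0 := by exact_mod_cast Nat.succ_ne_zero j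
    field_simp
    ring

/-- The polynomial in `X` with value `tabTotal k la` at `k`. -/
def tabPoly (la : YoungDiagram) : Qq[X] :=
  ∑ j ∈ range (la.card + 1), (packedCount j la : Qq[X]) * choosePoly j

lemma eval_tabPoly (la : YoungDiagram) (k : ℕ) : (tabPoly la).eval (k : Qq) = tabTotal k la := by
  rw [tabPoly, eval_finsetSum, tabTotal_eq_sum_choose k la le_rfl]
  push_cast
  exact sum_congr rfl fun j _ => by rw [eval_mul, eval_choosePoly, eval_natCast, mul_comm]

lemma eval_tabPoly_neg_one (la : YoungDiagram) :
    (tabPoly la).eval (-1) = if la.rowLen 0 ≤ 1 then (-1) ^ la.card else 0 := by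
  rw [tabPoly, eval_finsetSum]
  have := congrArg (Int.cast : ℤ → Qq) (signedCount_eq_ite la)
  rw [signedCount] at this
  push_cast at this
  rw [← this]
  exact sum_congr rfl fun j _ => by
    rw [eval_mul, eval_choosePoly_neg_one, eval_natCast, mul_comm]

lemma tabTotal_one (la : YoungDiagram) [Decidable (la.rowLen 1 = 0)] :
    tabTotal 1 la = if la.rowLen 1 = 0 then 1 else 0 := by
  classical
  rw [tabTotal_succ, sum_congr rfl fun mu _ => tabTotal_zero mu, sum_ite_eq']
  refine if_congr ?_ rfl rfl
  rw [mem_strips]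
  constructor
  · intro h
    have := (h 0).2
    rw [rowLen_bot] at this
    simpa using this
  · intro h i
    rw [rowLen_bot]
    have := la.rowLen_anti 1 (i + 1) (by omega)
    omega

/-! ## Partitions and diagrams -/

section Rows

variable {n : ℕ} (p : n.Partition)

lemma rowLen_diagram (i : ℕ) : (diagram p).rowLen i = row p i := by
  have : ∀ j, j < (diagram p).rowLen i ↔ j < row p i := by
    intro j
    rw [← YoungDiagram.mem_iff_lt_rowLen, row]
    change (i, j) ∈ YoungDiagram.ofRowLens (rowList p)
      (Multiset.pairwise_sort p.parts (· ≥ ·)).sortedGE ↔ _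
    refine (YoungDiagram.mem_ofRowLens (w := rowList p)).trans ?_
    constructor
    · rintro ⟨h, h'⟩
      rwa [List.getD_eq_getElem _ _ h]
    · intro h
      by_cases h' : i < (rowList p).length
      · rw [List.getD_eq_getElem _ _ h'] at h
        exact ⟨h', h⟩
      · rw [List.getD_eq_default _ _ (not_lt.1 h')] at h
        exact absurd h (Nat.not_lt_zero _)
  exact le_antisymm (not_lt.1 fun h' => lt_irrefl _ ((this _).1 h'))
    (not_lt.1 fun h' => lt_irrefl _ ((this _).2 h'))

lemma row_antitone : Antitone (row p) := fun i j h => by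
  rw [← rowLen_diagram, ← rowLen_diagram]
  exact (diagram p).rowLen_anti i j h

lemma rowList_pos {x : ℕ} (hx : x ∈ rowList p) : 0 < x :=
  p.parts_pos ((Multiset.mem_sort _).1 hx)

lemma rowList_sum : (rowList p).sum = n := by
  rw [← Multiset.sum_coe, rowList, Multiset.sort_eq, p.parts_sum]

lemma rowLens_diagram : (diagram p).rowLens = rowList p :=
  YoungDiagram.rowLens_ofRowLens_eq_self fun _ hx => rowList_pos p hx

lemma sum_rowLens (la : YoungDiagram) : la.rowLens.sum = la.card := by
  rw [YoungDiagram.rowLens, card_eq_sum_rowLen la (N := la.colLen 0)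
    fun i => rowLen_eq_zero_of_le]
  rfl

lemma card_diagram : (diagram p).card = n := by
  rw [← sum_rowLens, rowLens_diagram, rowList_sum]

lemma parts_eq_rowLens : p.parts = ((diagram p).rowLens : Multiset ℕ) := by
  rw [rowLens_diagram, rowList, Multiset.sort_eq]

lemma diagram_injective : Function.Injective (diagram : n.Partition → YoungDiagram) :=
  fun p r h => Nat.Partition.ext (by rw [parts_eq_rowLens, parts_eq_rowLens, h])

lemma row_injective : Function.Injective (row : n.Partition → ℕ → ℕ) := fun p r h =>
  diagram_injective (diagram_ext fun i => by rw [rowLen_diagram, rowLen_diagram, h])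

lemma exists_diagram_eq (la : YoungDiagram) (h : la.card = n) :
    ∃ p : n.Partition, diagram p = la := by
  refine ⟨⟨la.rowLens, fun hi => la.pos_of_mem_rowLens _ (by simpa using hi), ?_⟩, ?_⟩
  · rw [Multiset.sum_coe, sum_rowLens, h]
  · have : rowList (n := n) ⟨la.rowLens, fun hi => la.pos_of_mem_rowLens _ (by simpa using hi),
        by rw [Multiset.sum_coe, sum_rowLens, h]⟩ = la.rowLens := by
      rw [rowList]
      refine List.Perm.eq_of_pairwise (le := (· ≥ ·)) (fun a b _ _ h1 h2 => le_antisymm h2 h1)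
        (Multiset.pairwise_sort _ _) la.rowLens_sorted.pairwise ?_
      rw [← Multiset.coe_eq_coe, Multiset.sort_eq]
    simp only [diagram, this]
    exact YoungDiagram.ofRowLens_to_rowLens_eq_self

lemma row_eq_zero {i : ℕ} (hi : n ≤ i) : row p i = 0 := by
  by_contra h
  have h1 : ∀ j ∈ range (n + 1), 1 ≤ (diagram p).rowLen j := fun j hj => by
    rw [rowLen_diagram]
    have := row_antitone p (show j ≤ i by simp at hj; omega)
    omega
  have h2 := card_eq_sum_rowLen (diagram p) (N := (diagram p).colLen 0 + (n + 1))
    fun i hi => rowLen_eq_zero_of_le (by omega)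
  have h3 := sum_le_sum h1
  have h4 : ∑ j ∈ range (n + 1), (diagram p).rowLen j ≤ _ :=
    sum_le_sum_of_subset (range_mono (show n + 1 ≤ (diagram p).colLen 0 + (n + 1) by omega))
  rw [← h2, card_diagram] at h4
  simp only [sum_const, card_range, smul_eq_mul, mul_one] at h3
  omega

lemma sum_row : ∑ i ∈ range n, row p i = n := by
  conv_rhs => rw [← card_diagram p, card_eq_sum_rowLen (diagram p) (N := n)
    fun i hi => by rw [rowLen_diagram, row_eq_zero p hi]]
  exact sum_congr rfl fun i _ => (rowLen_diagram p i).symm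

/-- The diagram with given row lengths. -/
lemma exists_row_eq {r : ℕ → ℕ} (hr : Antitone r) (h0 : ∀ i, n ≤ i → r i = 0)
    (hs : ∑ i ∈ range n, r i = n) : ∃ p : n.Partition, row p = r := by
  let la : YoungDiagram :=
    { cells := {c ∈ range n ×ˢ range (r 0) | c.2 < r c.1}
      isLowerSet := by
        rintro ⟨a, b⟩ ⟨c, d⟩ ⟨h1, h2⟩ h
        simp only [coe_filter, Set.mem_ofPred_eq, mem_product, mem_range] at h h1 h2 ⊢
        have := hr h1
        omega }
  have hrow : ∀ i, la.rowLen i = r i := by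
    intro i
    have : ∀ j, j < la.rowLen i ↔ j < r i := by
      intro j
      rw [← YoungDiagram.mem_iff_lt_rowLen, ← YoungDiagram.mem_cells]
      simp only [la, mem_filter, mem_product, mem_range]
      refine ⟨fun h => h.2, fun h => ⟨⟨?_, h.trans_le (hr (Nat.zero_le i))⟩, h⟩⟩
      by_contra h'
      rw [h0 i (not_lt.1 h')] at h
      exact absurd h (Nat.not_lt_zero _)
    exact le_antisymm (not_lt.1 fun h' => lt_irrefl _ ((this _).1 h'))
      (not_lt.1 fun h' => lt_irrefl _ ((this _).2 h'))
  obtain ⟨p, hp⟩ := exists_diagram_eq (n := n) la (by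
    rw [card_eq_sum_rowLen la (N := n) fun i hi => by rw [hrow, h0 i hi],
      sum_congr rfl fun i _ => hrow i, hs])
  exact ⟨p, funext fun i => by rw [← rowLen_diagram, hp, hrow]⟩

end Rows

/-- The exponent vector of the monomial `x^p`. -/
def rowWeight {n : ℕ} (p : n.Partition) : ℕ →₀ ℕ :=
  Finsupp.onFinset (range n) (row p) fun i hi => by
    by_contra h
    exact hi (row_eq_zero p (by simpa using h))

@[simp] lemma rowWeight_apply {n : ℕ} (p : n.Partition) (i : ℕ) : rowWeight p i = row p i := rfl

lemma degree_rowWeight {n : ℕ} (p : n.Partition) : (rowWeight p).degree = n := by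
  conv_rhs => rw [← sum_row p]
  rw [Finsupp.degree_apply]
  exact sum_subset Finsupp.support_onFinset_subset fun i _ hi => Finsupp.notMem_support_iff.1 hi

/-! ## The Kostka matrix -/

/-- The square matrix of Kostka numbers. -/
def kostkaMatrix (n : ℕ) : Matrix n.Partition n.Partition Qq :=
  fun p r => (kostkaNumber p (rowWeight r) : Qq)

lemma kostkaNumber_rowWeight_ne_zero {n : ℕ} {p r : n.Partition}
    (h : kostkaNumber p (rowWeight r) ≠ 0) (j : ℕ) :
    ∑ i ∈ range j, row r i ≤ ∑ i ∈ range j, row p i := by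
  rw [kostkaNumber_eq_tabCount p _ (k := n + j)
    fun i hi => by rw [rowWeight_apply, row_eq_zero r (by omega)]] at h
  simpa only [rowWeight_apply, rowLen_diagram] using
    (dominance_of_tabCount_ne_zero h).2.2 j (by omega)

lemma kostkaNumber_self {n : ℕ} (p : n.Partition) : kostkaNumber p (rowWeight p) = 1 := by
  rw [kostkaNumber_eq_tabCount p _ (k := n)
    fun i hi => by rw [rowWeight_apply, row_eq_zero p hi],
    ← tabCount_rowLen_self (k := n) (la := diagram p)
      fun i hi => by rw [rowLen_diagram, row_eq_zero p hi]]
  exact tabCount_congr (fun i _ => by rw [rowWeight_apply, rowLen_diagram]) _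

/-- A statistic that increases with the dominance order. -/
def domStat {n : ℕ} (p : n.Partition) : ℕ := ∑ j ∈ range (n + 1), ∑ i ∈ range j, row p i

/-- The matrix is unitriangular for the dominance order. Instead of ordering the indices, one looks
at an extremal index in the support of a kernel vector. -/
lemma isUnit_kostkaMatrix (n : ℕ) : IsUnit (kostkaMatrix n) := by
  classical
  rw [← Matrix.mulVec_injective_iff_isUnit, ← Matrix.coe_mulVecLin, injective_iff_map_eq_zero]
  intro c hc
  by_contra h0
  obtain ⟨r0, hr0⟩ : ∃ r, c r ≠ 0 := by
    by_contra h; push Not at h; exact h0 (funext h)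
  -- In the equation for row `p` only partitions dominated by `p` occur. Minimality of `domStat`
  -- forces equality of all partial sums, so only the diagonal term is left.
  obtain ⟨p, hp, hmin⟩ := exists_min_image (univ.filter fun r : n.Partition => c r ≠ 0) domStat
    ⟨r0, by simpa using hr0⟩
  have hp' : c p ≠ 0 := by simpa using hp
  have h1 := congrFun hc p
  rw [Matrix.mulVecLin_apply, Matrix.mulVec, dotProduct, sum_eq_single p] at h1
  · rw [kostkaMatrix, kostkaNumber_self] at h1
    exact hp' (by simpa using h1)
  · intro r _ hrp
    by_contra h2
    obtain ⟨h3, h4⟩ := mul_ne_zero_iff.1 h2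
    have h5 : kostkaNumber p (rowWeight r) ≠ 0 := fun h => h3 (by rw [kostkaMatrix, h, Nat.cast_zero])
    have h6 : ∀ j ∈ range (n + 1), ∑ i ∈ range j, row r i ≤ ∑ i ∈ range j, row p i :=
      fun j _ => kostkaNumber_rowWeight_ne_zero h5 j
    have h7 := (sum_eq_sum_iff_of_le h6).1
      (le_antisymm (sum_le_sum h6) (hmin r (by simpa using h4)))
    refine hrp (row_injective (funext fun i => ?_))
    by_cases hi : i < n
    · have h8 := h7 (i + 1) (by simp; omega)
      rw [sum_range_succ, sum_range_succ, h7 i (by simp; omega)] at h8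
      omega
    · rw [row_eq_zero r (not_lt.1 hi), row_eq_zero p (not_lt.1 hi)]
  · simp

/-! ### Kostka matrices for tuples of partitions. -/

section MultiKostka

variable {I : Type*} [Fintype I] [DecidableEq I]

lemma sum_prod_inv_mul {n : I → ℕ} (M N : ∀ i, Matrix (n i).Partition (n i).Partition Qq)
    (h : ∀ i, N i * M i = 1) (ρ τ : ∀ i, (n i).Partition) :
    ∑ μ : ∀ i, (n i).Partition, (∏ i, N i (ρ i) (μ i)) * ∏ i, M i (μ i) (τ i)
      = if ρ = τ then 1 else 0 := by
  have h1 : ∏ i, ∑ μ, N i (ρ i) μ * M i μ (τ i) = ∏ i, if ρ i = τ i then (1 : Qq) else 0 :=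
    prod_congr rfl fun i _ => by rw [← Matrix.mul_apply, h i, Matrix.one_apply]
  rw [prod_univ_sum, Fintype.piFinset_univ] at h1
  simp only [prod_mul_distrib] at h1
  rw [h1]
  split_ifs with h2
  · subst h2; simp
  · obtain ⟨i, hi⟩ := Function.ne_iff.1 h2
    exact prod_eq_zero (mem_univ i) (if_neg hi)

/-- The matrix is a tensor product of Kostka matrices, inverted by the product of their inverses. -/
lemma existsUnique_multiKostka (v : I → ℕ) (g : ((i : I) → (v i).Partition) → Qq) :
    ∃! c : ((i : I) → (v i).Partition) → Qq, ∀ ρ, g ρ =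
      ∑ μ, c μ * ∏ i, (kostkaNumber (μ i) (rowWeight (ρ i)) : Qq) := by
  have hu := fun i => isUnit_kostkaMatrix (v i)
  choose N hN using fun i => (hu i).exists_left_inv
  have hN' : ∀ i, kostkaMatrix (v i) * N i = 1 := fun i => mul_eq_one_comm.1 (hN i)
  refine ⟨fun μ => ∑ ρ, g ρ * ∏ i, N i (ρ i) (μ i), fun ρ => ?_, fun c hc => funext fun μ => ?_⟩
  · simp only [sum_mul, mul_assoc]
    rw [sum_comm]
    have := sum_prod_inv_mul _ _ hN
    simp only [kostkaMatrix] at this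
    simp only [← mul_sum, this, mul_ite, mul_one, mul_zero, sum_ite_eq', mem_univ, if_true]
  · simp only [hc, sum_mul, mul_assoc]
    rw [sum_comm]
    have := sum_prod_inv_mul N _ hN'
    simp only [kostkaMatrix] at this
    simp only [← mul_sum, this, mul_ite, mul_one, mul_zero, sum_ite_eq', mem_univ, if_true]

end MultiKostka

section Symmetric

variable {I : Type*} [DecidableEq I]

/-! ## Series symmetric in each set of variables -/

/-- The transposition of the variables `x_{i,a}` and `x_{i,a+1}`. -/
def varSwap (i : I) (a : ℕ) : Equiv.Perm (I × ℕ) := Equiv.swap (i, a) (i, a + 1)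

/-- Symmetry in each set of variables, in terms of coefficients. -/
def IsSymm {R : Type*} [Semiring R] (f : MvPowerSeries (I × ℕ) R) : Prop :=
  ∀ (i : I) (a : ℕ) (m m' : I × ℕ →₀ ℕ), (∀ x, m' x = m (varSwap i a x)) →
    MvPowerSeries.coeff m' f = MvPowerSeries.coeff m f

/-- In this form symmetry passes to plethystic logarithms, which commute with renaming of variables.
-/
lemma isSymm_iff_rename {R : Type*} [CommSemiring R] {f : MvPowerSeries (I × ℕ) R} :
    IsSymm f ↔ ∀ i a, MvPowerSeries.rename (varSwap i a) f = f := by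
  have key : ∀ i a m, MvPowerSeries.coeff m (MvPowerSeries.rename (varSwap i a) f)
      = MvPowerSeries.coeff (m.mapDomain (varSwap i a)) f := by
    intro i a m
    have h := MvPowerSeries.coeff_embDomain_rename (varSwap i a).toEmbedding f
      (m.mapDomain (varSwap i a))
    rw [← h]
    simp only [Equiv.coe_toEmbedding, Finsupp.embDomain_eq_mapDomain]
    rw [← Finsupp.mapDomain_comp]
    simp [varSwap, Function.comp_def]
    congr 1
    exact congrArg _ Finsupp.mapDomain_id.symm
  have hm : ∀ i a (m : I × ℕ →₀ ℕ) x, (m.mapDomain (varSwap i a)) x = m (varSwap i a x) := by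
    intro i a m x
    have := Finsupp.mapDomain_apply (varSwap i a).injective m (varSwap i a x)
    rwa [varSwap, Equiv.swap_apply_self] at this
  constructor
  · intro h i a
    ext m
    rw [key]
    exact h i a _ _ (hm i a m)
  · intro h i a m m' hmm
    have : m' = m.mapDomain (varSwap i a) := by
      ext x; rw [hm, hmm]
    rw [this, ← key, h]

/-- Every exponent vector can be sorted by transpositions. -/
lemma sort_induction {P : (I × ℕ →₀ ℕ) → Prop}
    (h0 : ∀ m, (∀ i a, m (i, a + 1) ≤ m (i, a)) → P m)
    (h1 : ∀ i a m m', (∀ x, m' x = m (varSwap i a x)) → P m' → P m) (m : I × ℕ →₀ ℕ) : P m := by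
  -- Exchanging an ascent moves the larger exponent to the smaller index, so the sum of index times
  -- exponent drops.
  induction hs : m.sum (fun x k => x.2 * k) using Nat.strong_induction_on generalizing m with
  | _ n ih =>
    subst hs
    by_cases h : ∀ i a, m (i, a + 1) ≤ m (i, a)
    · exact h0 m h
    · push Not at h
      obtain ⟨i, a, hia⟩ := h
      let m' : I × ℕ →₀ ℕ := m.mapDomain (varSwap i a)
      have hm : ∀ x, m' x = m (varSwap i a x) := fun x => by
        have := Finsupp.mapDomain_apply (varSwap i a).injective m (varSwap i a x)
        rwa [varSwap, Equiv.swap_apply_self] at this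
      refine h1 i a m m' hm (ih _ ?_ m' rfl)
      have e1 : m'.sum (fun x k => x.2 * k) = m.sum (fun x k => (varSwap i a x).2 * k) :=
        Finsupp.sum_mapDomain_index (by simp) (by intros; ring)
      set S := insert (i, a) (insert (i, a + 1) m.support)
      have hsub : m.support ⊆ S := fun x hx => by simp [S, hx]
      rw [e1, Finsupp.sum_of_support_subset m hsub _ (by simp),
        Finsupp.sum_of_support_subset m hsub _ (by simp)]
      have e2 : ∑ x ∈ S, (varSwap i a x).2 * m x + m (i, a + 1) = ∑ x ∈ S, x.2 * m x + m (i, a) := by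
        have f1 : m (i, a + 1) = ∑ x ∈ S, if x = (i, a + 1) then m x else 0 := by
          rw [sum_ite_eq']; simp [S]
        have f2 : m (i, a) = ∑ x ∈ S, if x = (i, a) then m x else 0 := by
          rw [sum_ite_eq']; simp [S]
        rw [f1, f2, ← sum_add_distrib, ← sum_add_distrib]
        refine sum_congr rfl fun x _ => ?_
        by_cases hx1 : x = (i, a)
        · subst hx1
          simp [varSwap]
          ring
        · by_cases hx2 : x = (i, a + 1)
          · subst hx2
            simp [varSwap]
            ring
          · simp [varSwap, Equiv.swap_apply_of_ne_of_ne hx1 hx2, hx1, hx2]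
      omega

variable [Fintype I]

lemma multidegree_varSwap {m m' : I × ℕ →₀ ℕ} {i : I} {a : ℕ}
    (h : ∀ x, m' x = m (varSwap i a x)) : multidegree m' = multidegree m := by
  funext j
  have hd : ∀ m : I × ℕ →₀ ℕ, ∀ N, (∀ x ∈ m.support, x.2 < N) →
      multidegree m j = ∑ b ∈ range N, m (j, b) := by
    intro m N hN
    rw [multidegree, Finsupp.degree_apply]
    refine sum_subset (fun b hb => ?_) fun b _ hb => ?_
    · rw [Finsupp.mem_support_iff, Finsupp.curry_apply] at hb
      exact mem_range.2 (hN _ (Finsupp.mem_support_iff.2 hb))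
    · rwa [Finsupp.notMem_support_iff, Finsupp.curry_apply] at hb
  set N := (m.support.sup Prod.snd) + (m'.support.sup Prod.snd) + a + 2
  rw [hd m N fun x hx => by have := le_sup (f := Prod.snd) hx; omega,
    hd m' N fun x hx => by have := le_sup (f := Prod.snd) hx; omega]
  by_cases hj : j = i
  · subst hj
    refine sum_equiv (Equiv.swap a (a + 1)) (fun b => ?_) fun b _ => ?_
    · simp only [mem_range]
      rw [Equiv.swap_apply_def]
      split_ifs <;> omega
    · rw [h, varSwap, Equiv.swap_apply_def, Equiv.swap_apply_def]
      simp only [Prod.mk.injEq, true_and]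
      split_ifs <;> rfl
  · refine sum_congr rfl fun b _ => ?_
    rw [h, varSwap, Equiv.swap_apply_of_ne_of_ne] <;> simp [hj]

lemma curry_varSwap {m m' : I × ℕ →₀ ℕ} {i : I} {a : ℕ} (h : ∀ x, m' x = m (varSwap i a x))
    {j : I} (hj : j ≠ i) : m'.curry j = m.curry j := by
  ext b
  rw [Finsupp.curry_apply, Finsupp.curry_apply, h, varSwap, Equiv.swap_apply_of_ne_of_ne] <;>
    simp [hj]

lemma curry_varSwap_self {m m' : I × ℕ →₀ ℕ} {i : I} {a : ℕ}
    (h : ∀ x, m' x = m (varSwap i a x)) (b : ℕ) :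
    m'.curry i b = m.curry i (Equiv.swap a (a + 1) b) := by
  rw [Finsupp.curry_apply, Finsupp.curry_apply, h, varSwap, Equiv.swap_apply_def,
    Equiv.swap_apply_def]
  simp only [Prod.mk.injEq, true_and]
  split_ifs <;> rfl

lemma coeff_schur {n : ℕ} (p : n.Partition) (m : ℕ →₀ ℕ) :
    MvPowerSeries.coeff m (schur p) = (kostkaNumber p m : Qq) := rfl

lemma coeff_schur_varSwap {m m' : I × ℕ →₀ ℕ} {i : I} {a : ℕ}
    (h : ∀ x, m' x = m (varSwap i a x)) (j : I) {n : ℕ} (p : n.Partition) :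
    MvPowerSeries.coeff (m'.curry j) (schur p) = MvPowerSeries.coeff (m.curry j) (schur p) := by
  by_cases hj : j = i
  · subst hj
    rw [coeff_schur, coeff_schur, kostkaNumber_swap p _ _ a (curry_varSwap_self h)]
  · rw [curry_varSwap h hj]

/-- The exponent vector of the monomial `∏_i x_i^{ρ^i}`. -/
def multiRowWeight {v : I → ℕ} (ρ : (i : I) → (v i).Partition) : I × ℕ →₀ ℕ :=
  Finsupp.onFinset (univ.biUnion fun i => (range (v i)).map ⟨fun a => (i, a), fun a b h => by
      simpa using h⟩) (fun x => row (ρ x.1) x.2) fun x hx => by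
    simp only [mem_biUnion, mem_univ, true_and, mem_map, mem_range]
    refine ⟨x.1, x.2, ?_, rfl⟩
    by_contra h
    exact hx (row_eq_zero (ρ x.1) (not_lt.1 h))

lemma curry_multiRowWeight {v : I → ℕ} (ρ : (i : I) → (v i).Partition) (i : I) :
    (multiRowWeight ρ).curry i = rowWeight (ρ i) := by
  ext a
  rw [Finsupp.curry_apply]
  rfl

lemma multidegree_multiRowWeight {v : I → ℕ} (ρ : (i : I) → (v i).Partition) :
    multidegree (multiRowWeight ρ) = v := by
  funext i
  rw [multidegree, curry_multiRowWeight, degree_rowWeight]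

lemma exists_multiRowWeight (m : I × ℕ →₀ ℕ) (h : ∀ i a, m (i, a + 1) ≤ m (i, a)) :
    ∃ ρ : (i : I) → (multidegree m i).Partition, m = multiRowWeight ρ := by
  have hex : ∀ i, ∃ p : (multidegree m i).Partition, row p = fun a => m (i, a) := by
    intro i
    have hanti : Antitone fun a => m (i, a) := antitone_nat_of_succ_le (h i)
    have h0 : ∀ a, multidegree m i ≤ a → m (i, a) = 0 := by
      intro a ha
      by_contra hne
      have h1 : ∑ b ∈ range (a + 1), m.curry i b ≤ (m.curry i).degree := by
        rw [Finsupp.degree_apply]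
        refine sum_le_sum_of_ne_zero fun b _ hb => Finsupp.mem_support_iff.2 hb
      have h2 : ∑ b ∈ range (a + 1), 1 ≤ ∑ b ∈ range (a + 1), m.curry i b := by
        refine sum_le_sum fun b hb => ?_
        rw [Finsupp.curry_apply]
        have := hanti (show b ≤ a by simp at hb; omega)
        simp only at this
        omega
      rw [multidegree] at ha
      simp only [sum_const, card_range, smul_eq_mul, mul_one] at h2
      omega
    refine exists_row_eq hanti h0 ?_
    conv_rhs => rw [multidegree, Finsupp.degree_apply]
    symm
    refine sum_subset (fun b hb => ?_) fun b _ hb => ?_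
    · rw [Finsupp.mem_support_iff, Finsupp.curry_apply] at hb
      rw [mem_range]
      by_contra h'
      exact hb (h0 b (not_lt.1 h'))
    · rwa [Finsupp.notMem_support_iff, Finsupp.curry_apply] at hb
  choose ρ hρ using hex
  refine ⟨ρ, ?_⟩
  ext ⟨i, a⟩
  exact (congrFun (hρ i) a).symm

lemma isSchurExpansion_iff {f : MvPowerSeries (I × ℕ) Qq}
    {c : (v : I → ℕ) → ((i : I) → (v i).Partition) → Qq} :
    IsSchurExpansion f c ↔ ∀ v, ∀ m : I × ℕ →₀ ℕ, multidegree m = v →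
      MvPowerSeries.coeff m f =
        ∑ μ : ((i : I) → (v i).Partition), c v μ *
          ∏ i, MvPowerSeries.coeff (m.curry i) (schur (μ i)) := by
  constructor
  · rintro h v m rfl
    exact h m
  · intro h m
    exact h _ m rfl

/-- The coefficients at monomials with weakly decreasing exponents determine the expansion, by
invertibility of the Kostka matrices. Both sides are symmetric, so agreement there extends to all
monomials by sorting. -/
theorem existsUnique_isSchurExpansion {f : MvPowerSeries (I × ℕ) Qq} (hf : IsSymm f) :
    ∃! c, IsSchurExpansion f c := by
  have hex := fun v : I → ℕ => existsUnique_multiKostka v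
    fun ρ => MvPowerSeries.coeff (multiRowWeight ρ) f
  choose c hc hcu using hex
  refine ⟨c, ?_, fun d hd => funext fun v => hcu v _ fun ρ => ?_⟩
  · refine fun m => sort_induction (P := fun m => MvPowerSeries.coeff m f =
      ∑ μ : ((i : I) → (multidegree m i).Partition),
        c (multidegree m) μ * ∏ i, MvPowerSeries.coeff (m.curry i) (schur (μ i))) ?_ ?_ m
    · intro m hm
      obtain ⟨ρ, hρ⟩ := exists_multiRowWeight m hm
      have h1 := hc _ ρ
      rw [← hρ] at h1
      refine h1.trans (sum_congr rfl fun μ _ => ?_)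
      congr 1
      refine prod_congr rfl fun i _ => ?_
      rw [coeff_schur, ← curry_multiRowWeight ρ i, ← hρ]
    · intro i a m m' h hm'
      rw [← hf i a m m' h, hm', multidegree_varSwap h]
      refine sum_congr rfl fun μ _ => ?_
      congr 1
      exact prod_congr rfl fun j _ => coeff_schur_varSwap h j _
  · have := isSchurExpansion_iff.1 hd v (multiRowWeight ρ) (multidegree_multiRowWeight ρ)
    rw [this]
    simp only [curry_multiRowWeight, coeff_schur]

lemma IsSchurExpansion.isSymm {f : MvPowerSeries (I × ℕ) Qq}
    {c : (v : I → ℕ) → ((i : I) → (v i).Partition) → Qq} (h : IsSchurExpansion f c) : IsSymm f := by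
  intro i a m m' hm
  rw [h m', h m, multidegree_varSwap hm]
  refine sum_congr rfl fun μ _ => ?_
  congr 1
  exact prod_congr rfl fun j _ => coeff_schur_varSwap hm j _

/-- Having a Schur expansion already implies symmetry and hence uniqueness, so the arbitrary choice
in `hallSchur` returns the given coefficients. -/
lemma hallSchur_eq {f : MvPowerSeries (I × ℕ) Qq}
    {c : (v : I → ℕ) → ((i : I) → (v i).Partition) → Qq} (h : IsSchurExpansion f c) {v : I → ℕ}
    (μ : (i : I) → (v i).Partition) : hallSchur f μ = c v μ := by
  have h1 : IsSchurExpansion f (Classical.epsilon (IsSchurExpansion f)) :=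
    Classical.epsilon_spec ⟨c, h⟩
  rw [hallSchur, (existsUnique_isSchurExpansion h.isSymm).unique h1 h]

lemma IsSchurExpansion.smul {f : MvPowerSeries (I × ℕ) Qq}
    {c : (v : I → ℕ) → ((i : I) → (v i).Partition) → Qq} (h : IsSchurExpansion f c) (a : Qq) :
    IsSchurExpansion (a • f) fun v μ => a * c v μ := by
  intro m
  rw [MvPowerSeries.coeff_smul, h m, mul_sum]
  exact sum_congr rfl fun μ _ => (mul_assoc _ _ _).symm

end Symmetric

/-! ## Adams operations on `ℚ(q)` -/

/-- Evaluation of rational functions is a ring homomorphism only where no denominator vanishes. The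
substitution of `q ^ d` is `expand` followed by the embedding into `Qq`, and both are injective. -/
lemma eval₂_pow_X_ne_zero {d : ℕ} (hd : d ≠ 0) {f : ℚ[X]} (hf : f ≠ 0) :
    f.eval₂ (algebraMap ℚ Qq) (q ^ d) ≠ 0 := by
  have h : f.eval₂ (algebraMap ℚ Qq) (q ^ d) = algebraMap ℚ[X] Qq (expand ℚ d f) := by
    rw [expand_eq_comp_X_pow, comp, hom_eval₂, map_pow, RatFunc.algebraMap_X]
    exact congrArg (fun φ => f.eval₂ φ (q ^ d)) (Subsingleton.elim _ _)
  rw [h, map_ne_zero_iff _ (RatFunc.algebraMap_injective ℚ)]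
  exact (expand_ne_zero (Nat.pos_of_ne_zero hd)).2 hf

/-- The Adams operation as a ring homomorphism. -/
def adamsHom (d : ℕ) (hd : d ≠ 0) : Qq →+* Qq where
  toFun := adams d
  map_one' := RatFunc.eval_one _ _
  map_zero' := RatFunc.eval_zero _ _
  map_add' f g := RatFunc.eval_add _ _ (eval₂_pow_X_ne_zero hd f.denom_ne_zero)
    (eval₂_pow_X_ne_zero hd g.denom_ne_zero)
  map_mul' f g := RatFunc.eval_mul _ _ (eval₂_pow_X_ne_zero hd f.denom_ne_zero)
    (eval₂_pow_X_ne_zero hd g.denom_ne_zero)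

lemma adamsHom_apply {d : ℕ} (hd : d ≠ 0) (x : Qq) : adamsHom d hd x = adams d x := rfl

/-- The Adams operations as additive homomorphisms, `0` for `d = 0`. -/
def adamsAdd (d : ℕ) : Qq →+ Qq := if hd : d ≠ 0 then (adamsHom d hd).toAddMonoidHom else 0

lemma adamsAdd_apply {d : ℕ} (hd : d ≠ 0) (x : Qq) : adamsAdd d x = adams d x := by
  rw [adamsAdd, dif_pos hd]; rfl

lemma genPlethLog_congr {σ R : Type*} [CommRing R] [Algebra ℚ R] {ψ ψ' : ℕ → R → R}
    (h : ∀ d x, d ≠ 0 → ψ d x = ψ' d x) (F : MvPowerSeries σ R) :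
    genPlethLog ψ F = genPlethLog ψ' F := by
  have := map_genPlethLog (RingHom.id R) ψ ψ' h F
  simpa using this.symm

/-- `rename_genPlethLog` asks for bundled additive operations. The index `d = 0` never enters the
sum, so the value of `adamsAdd` there is irrelevant. -/
lemma plethLog_eq {σ : Type*} (F : MvPowerSeries σ Qq) :
    plethLog F = genPlethLog (fun d => adamsAdd d) F := by
  rw [plethLog_eq_genPlethLog]
  exact genPlethLog_congr (fun d x hd => (adamsAdd_apply hd x).symm) F

lemma rename_plethLog {σ τ : Type*} (f : σ → τ) [Filter.TendstoCofinite f]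
    (F : MvPowerSeries σ Qq) :
    plethLog (MvPowerSeries.rename f F) = MvPowerSeries.rename f (plethLog F) := by
  rw [plethLog_eq, plethLog_eq, rename_genPlethLog]

lemma killCompl_plethLog {σ τ : Type*} (e : τ ↪ σ) (F : MvPowerSeries σ Qq) :
    plethLog (MvPowerSeries.killCompl e F) = MvPowerSeries.killCompl e (plethLog F) := by
  rw [plethLog_eq, plethLog_eq, killCompl_genPlethLog]

section Spec

variable {I : Type*} [Fintype I] [DecidableEq I]

lemma IsSymm.plethLog {F : MvPowerSeries (I × ℕ) Qq} (h : IsSymm F) : IsSymm (plethLog F) := by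
  rw [isSymm_iff_rename] at h ⊢
  intro i a
  rw [← rename_plethLog, h]

/-! ## Specialization of finitely many variables -/

/-- The inclusion of the first `k` variables of each set. -/
def firstVars (I : Type*) (k : ℕ) : I × Fin k ↪ I × ℕ :=
  ⟨fun x => (x.1, x.2), fun x y h => by
    rw [Prod.mk.injEq] at h
    exact Prod.ext h.1 (Fin.ext h.2)⟩

instance instFstTendstoCofinite (k : ℕ) : Filter.TendstoCofinite (Prod.fst : I × Fin k → I) :=
  Filter.tendstoCofinite_of_finite _

/-- The specialization `x_{i,j} ↦ T_i` for `j < k`, and `x_{i,j} ↦ 0` for `j ≥ k`. -/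
def spec (k : ℕ) (f : MvPowerSeries (I × ℕ) Qq) : MvPowerSeries I Qq :=
  MvPowerSeries.rename Prod.fst (MvPowerSeries.killCompl (firstVars I k) f)

lemma spec_plethLog (k : ℕ) (f : MvPowerSeries (I × ℕ) Qq) :
    spec k (plethLog f) = plethLog (spec k f) := by
  rw [spec, spec, ← killCompl_plethLog, rename_plethLog]

lemma embDomain_firstVars_apply {k : ℕ} (x : I × Fin k →₀ ℕ) (i : I) (j : ℕ) :
    x.embDomain (firstVars I k) (i, j) = if h : j < k then x (i, ⟨j, h⟩) else 0 := by
  split_ifs with h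
  · exact Finsupp.embDomain_apply_self (firstVars I k) x (i, ⟨j, h⟩)
  · refine Finsupp.embDomain_of_notMem_range _ _ _ ?_
    rintro ⟨⟨i', j'⟩, h'⟩
    have h2 : (j' : ℕ) = j := congrArg Prod.snd h'
    exact h (h2 ▸ j'.2)

lemma multidegree_embDomain {k : ℕ} (x : I × Fin k →₀ ℕ) :
    multidegree (x.embDomain (firstVars I k)) = fun i => ∑ j, x (i, j) := by
  funext i
  rw [multidegree, Finsupp.degree_apply, sum_subset (s₂ := range k)]
  · rw [← Fin.sum_univ_eq_sum_range (fun j => (x.embDomain (firstVars I k)).curry i j)]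
    refine sum_congr rfl fun j _ => ?_
    rw [Finsupp.curry_apply, embDomain_firstVars_apply, dif_pos j.2]
  · intro j hj
    rw [Finsupp.mem_support_iff, Finsupp.curry_apply, embDomain_firstVars_apply] at hj
    by_contra h
    exact hj (dif_neg (by simpa using h))
  · intro j _ hj
    rwa [Finsupp.notMem_support_iff] at hj

lemma mapDomain_fst_apply {k : ℕ} (x : I × Fin k →₀ ℕ) (i : I) :
    x.mapDomain Prod.fst i = ∑ j, x (i, j) := by
  rw [Finsupp.mapDomain, Finsupp.sum_fintype _ _ (by simp), Finsupp.finsetSum_apply,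
    Fintype.sum_prod_type]
  simp only [Finsupp.single_apply]
  rw [sum_eq_single i]
  · simp
  · intro j _ hj
    simp [hj]
  · simp

/-- The specialization sends `s_μ` to the monomial `T^v` times the product of the numbers of
tableaux with entries less than `k`. The sum over exponents on `I × Fin k` factors over the
vertices. -/
lemma coeff_spec {f : MvPowerSeries (I × ℕ) Qq}
    {c : (v : I → ℕ) → ((i : I) → (v i).Partition) → Qq} (h : IsSchurExpansion f c) (k : ℕ)
    (v : I → ℕ) :
    MvPowerSeries.coeff (Finsupp.equivFunOnFinite.symm v) (spec k f) =
      ∑ μ : ((i : I) → (v i).Partition), c v μ * ∏ i, (tabTotal k (diagram (μ i)) : Qq) := by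
  rw [spec, MvPowerSeries.coeff_rename]
  have hx : ∀ x : I × Fin k →₀ ℕ, x ∈ (Filter.TendstoCofinite.finite_preimage_singleton
      (Finsupp.mapDomain (M := ℕ) (Prod.fst : I × Fin k → I))
        (Finsupp.equivFunOnFinite.symm v)).toFinset ↔ ∀ i, ∑ j, x (i, j) = v i := by
    intro x
    simp only [Set.Finite.mem_toFinset, Set.mem_preimage, Set.mem_singleton_iff]
    rw [Finsupp.ext_iff]
    simp only [mapDomain_fst_apply, Finsupp.equivFunOnFinite_symm_apply_apply]
  have h1 : ∀ x ∈ (Filter.TendstoCofinite.finite_preimage_singleton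
      (Finsupp.mapDomain (M := ℕ) (Prod.fst : I × Fin k → I))
        (Finsupp.equivFunOnFinite.symm v)).toFinset,
      MvPowerSeries.coeff x (MvPowerSeries.killCompl (firstVars I k) f) =
      ∑ μ : ((i : I) → (v i).Partition), c v μ *
          ∏ i, (kostkaNumber (μ i) ((x.embDomain (firstVars I k)).curry i) : Qq) := by
    intro x hxm
    rw [MvPowerSeries.coeff_killCompl]
    refine isSchurExpansion_iff.1 h v _ ?_
    rw [multidegree_embDomain]
    exact funext fun i => (hx x).1 hxm i
  rw [sum_congr rfl h1, sum_comm]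
  refine sum_congr rfl fun μ _ => ?_
  rw [← mul_sum]
  congr 1
  have h2 : ∀ i, (tabTotal k (diagram (μ i)) : Qq) =
      ∑ m ∈ finsuppAntidiag (range k) (v i), (kostkaNumber (μ i) m : Qq) := by
    intro i
    rw [← sum_tabCount, card_diagram]
    push_cast
    refine sum_congr rfl fun m hm => ?_
    rw [kostkaNumber_eq_tabCount (μ i) m (k := k)]
    intro j hj
    by_contra h0
    have := (mem_finsuppAntidiag.1 hm).2 (Finsupp.mem_support_iff.2 h0)
    simp at this
    omega
  simp only [h2]
  rw [prod_univ_sum]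
  refine sum_bij' (fun x _ i => (x.embDomain (firstVars I k)).curry i)
    (fun y _ => Finsupp.equivFunOnFinite.symm fun x => y x.1 x.2) ?_ ?_ ?_ ?_ ?_
  · intro x hxm
    rw [Fintype.mem_piFinset]
    intro i
    have hs : ((x.embDomain (firstVars I k)).curry i).support ⊆ range k := by
      intro j hj
      rw [Finsupp.mem_support_iff, Finsupp.curry_apply, embDomain_firstVars_apply] at hj
      by_contra h
      exact hj (dif_neg (by simpa using h))
    rw [mem_finsuppAntidiag]
    refine ⟨?_, hs⟩
    rw [← (hx x).1 hxm i, ← Fin.sum_univ_eq_sum_range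
      (fun j => (x.embDomain (firstVars I k)).curry i j)]
    refine sum_congr rfl fun j _ => ?_
    rw [Finsupp.curry_apply, embDomain_firstVars_apply, dif_pos j.2]
  · intro y hy
    rw [Fintype.mem_piFinset] at hy
    rw [hx]
    intro i
    rw [← (mem_finsuppAntidiag.1 (hy i)).1, ← Fin.sum_univ_eq_sum_range (fun j => y i j)]
    rfl
  · intro x _
    ext ⟨i, j⟩
    rw [Finsupp.equivFunOnFinite_symm_apply_apply, Finsupp.curry_apply,
      embDomain_firstVars_apply, dif_pos j.2]
  · intro y hy
    rw [Fintype.mem_piFinset] at hy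
    funext i
    ext j
    rw [Finsupp.curry_apply, embDomain_firstVars_apply]
    split_ifs with hj
    · rfl
    · by_contra h0
      exact hj (mem_range.1 ((mem_finsuppAntidiag.1 (hy i)).2
        (Finsupp.mem_support_iff.2 (Ne.symm h0))))
  · intro x _
    rfl

/-- The polynomial in `k` with values the coefficients of `spec k f`, in terms of the Schur
expansion of `f`. -/
def specPoly (c : (v : I → ℕ) → ((i : I) → (v i).Partition) → Qq) : MvPowerSeries I Qq[X] :=
  fun v => ∑ μ : ((i : I) → (v i).Partition), C (c v μ) * ∏ i, tabPoly (diagram (μ i))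

lemma map_eval_specPoly {f : MvPowerSeries (I × ℕ) Qq}
    {c : (v : I → ℕ) → ((i : I) → (v i).Partition) → Qq} (h : IsSchurExpansion f c) (k : ℕ) :
    MvPowerSeries.map (evalRingHom (k : Qq)) (specPoly c) = spec k f := by
  ext v
  obtain ⟨v, rfl⟩ := Finsupp.equivFunOnFinite.symm.surjective v
  rw [coeff_spec h, MvPowerSeries.coeff_map]
  change Polynomial.eval _ (∑ μ : ((i : I) → (v i).Partition),
    C (c v μ) * ∏ i, tabPoly (diagram (μ i))) = _
  rw [eval_finsetSum]
  exact sum_congr rfl fun μ _ => by simp only [eval_mul, eval_C, eval_prod, eval_tabPoly]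

lemma row_oneRow (n i : ℕ) : row (oneRow n) i = if i = 0 then n else 0 := by
  have h : Antitone fun i => if i = 0 then n else 0 :=
    antitone_nat_of_succ_le fun i => by simp
  by_cases hn : n = 0
  · subst hn
    rw [row_eq_zero _ (Nat.zero_le i)]
    simp
  · have : rowList (oneRow n) = [n] := by
      rw [rowList, oneRow, Nat.Partition.indiscrete_parts hn, Multiset.sort_singleton]
    rw [row, this]
    rcases i with _ | i <;> simp

lemma eq_oneRow_iff {n : ℕ} (p : n.Partition) : p = oneRow n ↔ row p 1 = 0 := by
  constructor
  · rintro rfl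
    simp [row_oneRow]
  · intro h
    refine row_injective (funext fun i => ?_)
    have h0 : ∀ i, i ≠ 0 → row p i = 0 := fun i hi => by
      have := row_antitone p (show 1 ≤ i by omega)
      omega
    rw [row_oneRow]
    split_ifs with hi
    · subst hi
      rcases Nat.eq_zero_or_pos n with hn | hn
      · subst hn; exact row_eq_zero p le_rfl
      · have := sum_row p
        rwa [sum_eq_single_of_mem 0 (by simpa using hn) fun i _ hi => h0 i hi] at this
    · exact h0 i hi

lemma parts_oneColumn (n : ℕ) : (oneColumn n).parts = Multiset.replicate n 1 := by
  rw [oneColumn, Nat.Partition.ofSums_parts, Multiset.filter_eq_self]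
  intro a ha
  rw [Multiset.eq_of_mem_replicate ha]
  exact one_ne_zero

lemma row_oneColumn (n i : ℕ) : row (oneColumn n) i = if i < n then 1 else 0 := by
  have : rowList (oneColumn n) = List.replicate n 1 := by
    rw [List.eq_replicate_iff]
    constructor
    · rw [rowList, Multiset.length_sort, parts_oneColumn, Multiset.card_replicate]
    · intro b hb
      rw [rowList, Multiset.mem_sort, parts_oneColumn] at hb
      exact Multiset.eq_of_mem_replicate hb
  rw [row, this]
  split_ifs with h
  · rw [List.getD_eq_getElem _ _ (by simpa using h)]
    simp
  · rw [List.getD_eq_default _ _ (by simpa using h)]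

lemma eq_oneColumn_iff {n : ℕ} (p : n.Partition) : p = oneColumn n ↔ row p 0 ≤ 1 := by
  constructor
  · rintro rfl
    rw [row_oneColumn]
    split_ifs <;> omega
  · intro h
    have h1 : ∀ i ∈ range n, row p i ≤ 1 := fun i _ => (row_antitone p (Nat.zero_le i)).trans h
    have h2 := (sum_eq_sum_iff_of_le h1).1 (by rw [sum_row]; simp)
    refine row_injective (funext fun i => ?_)
    rw [row_oneColumn]
    split_ifs with hi
    · exact h2 i (mem_range.2 hi)
    · exact row_eq_zero p (not_lt.1 hi)

lemma prod_ite_one_zero_eq {v : I → ℕ} (μ ν : (i : I) → (v i).Partition) (a : I → Qq) :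
    ∏ i, (if μ i = ν i then a i else 0) = if μ = ν then ∏ i, a i else 0 := by
  split_ifs with h
  · subst h; simp
  · obtain ⟨i, hi⟩ := Function.ne_iff.1 h
    exact prod_eq_zero (mem_univ i) (if_neg hi)

/-- With a single variable in each set, a Schur function survives only if every shape is a row, and
then its value is one. -/
lemma coeff_spec_one {f : MvPowerSeries (I × ℕ) Qq}
    {c : (v : I → ℕ) → ((i : I) → (v i).Partition) → Qq} (h : IsSchurExpansion f c) (v : I → ℕ) :
    MvPowerSeries.coeff (Finsupp.equivFunOnFinite.symm v) (spec 1 f) =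
      c v fun i => oneRow (v i) := by
  classical
  rw [coeff_spec h]
  have : ∀ μ : (i : I) → (v i).Partition, ∏ i, (tabTotal 1 (diagram (μ i)) : Qq)
      = if μ = fun i => oneRow (v i) then 1 else 0 := by
    intro μ
    have h1 := prod_ite_one_zero_eq μ (fun i => oneRow (v i)) fun _ => 1
    rw [prod_const_one] at h1
    rw [← h1]
    refine prod_congr rfl fun i _ => ?_
    rw [tabTotal_one, rowLen_diagram]
    simp only [eq_oneRow_iff]
    push_cast
    rfl
  simp only [this, mul_ite, mul_one, mul_zero, sum_ite_eq', mem_univ, if_true]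

/-- The specialization "to minus one variable" isolates the columns in the same way as one variable
isolates the rows, with the sign of `signedCount_eq_ite`. -/
lemma coeff_map_eval_neg_one (c : (v : I → ℕ) → ((i : I) → (v i).Partition) → Qq) (v : I → ℕ) :
    MvPowerSeries.coeff (Finsupp.equivFunOnFinite.symm v)
      (MvPowerSeries.map (evalRingHom (-1 : Qq)) (specPoly c)) =
      (-1) ^ (∑ i, v i) * c v fun i => oneColumn (v i) := by
  classical
  rw [MvPowerSeries.coeff_map]
  change Polynomial.eval _ (∑ μ : ((i : I) → (v i).Partition),
    C (c v μ) * ∏ i, tabPoly (diagram (μ i))) = _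
  rw [eval_finsetSum]
  have : ∀ μ : (i : I) → (v i).Partition, (C (c v μ) * ∏ i, tabPoly (diagram (μ i))).eval (-1)
      = c v μ * if μ = fun i => oneColumn (v i) then (-1) ^ (∑ i, v i) else 0 := by
    intro μ
    have h1 := prod_ite_one_zero_eq μ (fun i => oneColumn (v i)) fun i => (-1) ^ v i
    rw [prod_pow_eq_pow_sum] at h1
    rw [eval_mul, eval_C, ← h1, eval_prod]
    congr 1
    refine prod_congr rfl fun i _ => ?_
    rw [eval_tabPoly_neg_one, rowLen_diagram, card_diagram]
    simp only [eq_oneColumn_iff]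
  simp only [this, mul_ite, mul_zero, sum_ite_eq', mem_univ, if_true]
  ring

/-- Adams operations on polynomials in an inert variable `X`. -/
def adamsPoly (d : ℕ) (f : Qq[X]) : Qq[X] := if hd : d ≠ 0 then f.map (adamsHom d hd) else 0

/-- The power series with given coefficients. -/
def seriesOf {R : Type*} (g : (I → ℕ) → R) : MvPowerSeries I R := fun w => g w

lemma coeff_seriesOf {R : Type*} [Semiring R] (g : (I → ℕ) → R) (v : I → ℕ) :
    MvPowerSeries.coeff (Finsupp.equivFunOnFinite.symm v) (seriesOf g) = g v := rfl

/-- One-row Schur coefficients commute with the plethystic logarithm. -/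
theorem plethLog_oneRow {F : MvPowerSeries (I × ℕ) Qq}
    {c c' : (v : I → ℕ) → ((i : I) → (v i).Partition) → Qq} (h : IsSchurExpansion F c)
    (h' : IsSchurExpansion (plethLog F) c') (v : I → ℕ) :
    c' v (fun i => oneRow (v i)) = MvPowerSeries.coeff (Finsupp.equivFunOnFinite.symm v)
      (plethLog (seriesOf fun w => c w fun i => oneRow (w i))) := by
  rw [← coeff_spec_one h', spec_plethLog]
  congr 2
  ext w
  obtain ⟨w, rfl⟩ := Finsupp.equivFunOnFinite.symm.surjective w
  rw [coeff_spec_one h, coeff_seriesOf]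

/-- One-column Schur coefficients commute with the plethystic logarithm, up to signs. -/
theorem plethLog_oneColumn {F : MvPowerSeries (I × ℕ) Qq}
    {c c' : (v : I → ℕ) → ((i : I) → (v i).Partition) → Qq} (h : IsSchurExpansion F c)
    (h' : IsSchurExpansion (plethLog F) c') (v : I → ℕ) :
    (-1) ^ (∑ i, v i) * c' v (fun i => oneColumn (v i)) =
      MvPowerSeries.coeff (Finsupp.equivFunOnFinite.symm v)
        (plethLog (seriesOf fun w => (-1) ^ (∑ i, w i) * c w fun i => oneColumn (w i))) := by
  -- Since `adamsPoly` does not touch the polynomial variable, evaluation at `a` commutes with the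
  -- Adams operations when `a` is fixed by all of them. This applies to natural numbers and to `-1`.
  have hψ : ∀ a : Qq, (∀ d hd, adamsHom d hd a = a) → ∀ d (x : Qq[X]), d ≠ 0 →
      evalRingHom a (adamsPoly d x) = adams d (evalRingHom a x) := by
    intro a ha d x hd
    rw [adamsPoly, dif_pos hd, coe_evalRingHom]
    rw [← adamsHom_apply hd]
    conv_lhs => rw [← ha d hd]
    exact eval_map_apply (adamsHom d hd) a
  -- The coefficients are polynomials in the number of variables and agree at every natural number,
  -- where the identity says that specialization commutes with Log. Infinitely many values suffice.
  have key : specPoly c' = genPlethLog adamsPoly (specPoly c) := by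
    ext1 w
    refine eq_of_infinite_eval_eq _ _ (Set.infinite_of_injective_forall_mem
      (f := fun k : ℕ => (k : Qq)) Nat.cast_injective fun k => ?_)
    have h1 := map_eval_specPoly h' k
    rw [spec_plethLog, ← map_eval_specPoly h k, plethLog_eq_genPlethLog,
      map_genPlethLog _ _ _ (hψ k fun d hd => map_natCast _ k)] at h1
    have h2 := congrArg (MvPowerSeries.coeff w) h1
    rwa [MvPowerSeries.coeff_map, MvPowerSeries.coeff_map] at h2
  rw [← coeff_map_eval_neg_one, key, ← map_genPlethLog _ _ _ (hψ (-1) fun d hd => by rw [map_neg, map_one]),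
    plethLog_eq_genPlethLog]
  congr 2
  ext w
  obtain ⟨w, rfl⟩ := Finsupp.equivFunOnFinite.symm.surjective w
  rw [coeff_map_eval_neg_one, coeff_seriesOf]

end Spec

/-! ## Hall-Littlewood symmetrization -/

section SymSum

variable {ι K : Type*} [DecidableEq ι] [Field K] (x : ι → K) (t : K)

/-- The factor `(x_i - t x_j) / (x_i - x_j)`. -/
def cf (i j : ι) : K := (x i - t * x j) / (x i - x j)

/-- The sum over all orderings `(i_0, …, i_{N-1})` of `A` of
`∏_a x_{i_a}^{α a} ∏_{a < b} (x_{i_a} - t x_{i_b}) / (x_{i_a} - x_{i_b})`. -/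
def symSum : ℕ → (ℕ → ℕ) → Finset ι → K
  | 0, _, A => if A = ∅ then 1 else 0
  | N + 1, α, A => ∑ i ∈ A, x i ^ α 0 * (∏ j ∈ A.erase i, cf x t i j) *
      symSum N (fun k => α (k + 1)) (A.erase i)

variable {x t}

lemma symSum_congr {N : ℕ} {α β : ℕ → ℕ} (h : ∀ i < N, α i = β i) (A : Finset ι) :
    symSum x t N α A = symSum x t N β A := by
  induction N generalizing α β A with
  | zero => rfl
  | succ N ih =>
    rw [symSum, symSum]
    refine sum_congr rfl fun i _ => ?_
    rw [h 0 (Nat.succ_pos N), ih fun k hk => h (k + 1) (by omega)]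

/-- The recursion chooses the first index of an ordering. Unrolled, it is the sum over injective
sequences with image `A`, hence over permutations when `A` is everything. -/
lemma symSum_eq_sum_fun [Fintype ι] (N : ℕ) (α : ℕ → ℕ) (A : Finset ι) :
    symSum x t N α A = ∑ e : Fin N → ι, if Function.Injective e ∧ univ.image e = A then
      (∏ i, x (e i) ^ α i) * ∏ i, ∏ j ∈ Ioi i, cf x t (e i) (e j) else 0 := by
  induction N generalizing α A with
  | zero =>
    rw [Fintype.sum_unique]
    simp only [symSum, univ_eq_empty, image_empty, prod_empty, mul_one, eq_comm (a := A)]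
    refine if_congr ⟨fun h => ⟨Function.injective_of_subsingleton _, h⟩, fun h => h.2⟩ rfl rfl
  | succ N ih =>
    rw [symSum, ← (Fin.consEquiv fun _ : Fin (N + 1) => ι).sum_comp, Fintype.sum_prod_type,
      ← univ_inter A, ← sum_ite_mem]
    refine sum_congr rfl fun i _ => ?_
    have himg : ∀ e : Fin N → ι, univ.image (Fin.cons i e : Fin (N + 1) → ι)
        = insert i (univ.image e) := by
      intro e
      ext j
      simp only [mem_image, mem_univ, true_and, mem_insert, Fin.exists_fin_succ, Fin.cons_zero,
        Fin.cons_succ, eq_comm (a := j)]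
    rw [univ_inter]
    split_ifs with hi
    · rw [ih, mul_sum]
      refine sum_congr rfl fun e _ => ?_
      change _ = if Function.Injective (Fin.cons i e : Fin (N + 1) → ι) ∧
        univ.image (Fin.cons i e : Fin (N + 1) → ι) = A then
          (∏ k, x ((Fin.cons i e : Fin (N + 1) → ι) k) ^ α k) *
          ∏ k, ∏ j ∈ Ioi k, cf x t ((Fin.cons i e : Fin (N + 1) → ι) k)
            ((Fin.cons i e : Fin (N + 1) → ι) j) else 0
      simp only [himg, Fin.cons_injective_iff]
      by_cases h : Function.Injective e ∧ univ.image e = A.erase i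
      · have h' : (i ∉ Set.range e ∧ Function.Injective e) ∧ insert i (univ.image e) = A := by
          refine ⟨⟨fun hr => ?_, h.1⟩, by rw [h.2, insert_erase hi]⟩
          obtain ⟨j, hj⟩ := hr
          have : i ∈ univ.image e := mem_image.2 ⟨j, mem_univ j, hj⟩
          rw [h.2] at this
          exact notMem_erase i A this
        rw [if_pos h, if_pos h', Fin.prod_univ_succ, Fin.prod_univ_succ, Fin.prod_Ioi_zero]
        simp only [Fin.prod_Ioi_succ, Fin.cons_zero, Fin.cons_succ, Fin.val_zero, Fin.val_succ]
        rw [← h.2, prod_image fun a _ b _ hab => h.1 hab]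
        ring
      · have h' : ¬ ((i ∉ Set.range e ∧ Function.Injective e) ∧ insert i (univ.image e) = A) := by
          rintro ⟨⟨h1, h2⟩, h3⟩
          refine h ⟨h2, ?_⟩
          rw [← h3, erase_insert]
          simpa using h1
        rw [if_neg h, if_neg h', mul_zero]
    · symm
      refine sum_eq_zero fun e _ => if_neg ?_
      rintro ⟨-, h⟩
      apply hi
      rw [← h]
      exact (himg e).symm ▸ mem_insert_self i _

/-- The product of the factors over pairs of elements of two sets. -/
def cross (x : ι → K) (t : K) (S T : Finset ι) : K := ∏ i ∈ S, ∏ j ∈ T, cf x t i j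

lemma sum_powersetCard_succ {M : Type*} [AddCommMonoid M] (A : Finset ι) (r : ℕ)
    (f : ι → Finset ι → M) :
    ∑ i ∈ A, ∑ S ∈ powersetCard r (A.erase i), f i S
      = ∑ S ∈ powersetCard (r + 1) A, ∑ i ∈ S, f i (S.erase i) := by
  rw [sum_sigma', sum_sigma']
  refine sum_bij' (fun y _ => ⟨insert y.1 y.2, y.1⟩) (fun y _ => ⟨y.2, y.1.erase y.2⟩) ?_ ?_ ?_ ?_ ?_
  · rintro ⟨i, S⟩ h
    simp only [mem_sigma, mem_powersetCard] at h ⊢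
    have hi : i ∉ S := fun hi => absurd (h.2.1 hi) (notMem_erase i A)
    refine ⟨⟨insert_subset h.1 (h.2.1.trans (erase_subset i A)), ?_⟩, mem_insert_self i S⟩
    rw [card_insert_of_notMem hi, h.2.2]
  · rintro ⟨S, i⟩ h
    simp only [mem_sigma, mem_powersetCard] at h ⊢
    refine ⟨h.1.1 h.2, erase_subset_erase i h.1.1, ?_⟩
    rw [card_erase_of_mem h.2, h.1.2, Nat.add_sub_cancel]
  · rintro ⟨i, S⟩ h
    simp only [mem_sigma, mem_powersetCard] at h ⊢
    have hi : i ∉ S := fun hi => absurd (h.2.1 hi) (notMem_erase i A)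
    rw [erase_insert hi]
  · rintro ⟨S, i⟩ h
    simp only [mem_sigma] at h ⊢
    rw [insert_erase h.2]
  · rintro ⟨i, S⟩ h
    simp only [mem_sigma, mem_powersetCard] at h ⊢
    have hi : i ∉ S := fun hi => absurd (h.2.1 hi) (notMem_erase i A)
    rw [erase_insert hi]

/-- Splitting the orderings of `A` into their first `r` terms and the rest. -/
lemma symSum_add (r s : ℕ) (α : ℕ → ℕ) (A : Finset ι) :
    symSum x t (r + s) α A = ∑ S ∈ powersetCard r A, cross x t S (A \ S) * symSum x t r α S *
      symSum x t s (fun k => α (k + r)) (A \ S) := by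
  induction r generalizing α A with
  | zero => simp [cross, symSum]
  | succ r ih =>
    rw [Nat.add_right_comm, symSum]
    simp only [ih, mul_sum]
    rw [sum_powersetCard_succ]
    refine sum_congr rfl fun S hS => ?_
    rw [mem_powersetCard] at hS
    rw [symSum, mul_sum, sum_mul]
    refine sum_congr rfl fun i hi => ?_
    have h1 : A.erase i \ S.erase i = A \ S := by
      ext j
      simp only [mem_sdiff, mem_erase]
      constructor
      · rintro ⟨⟨h1, h2⟩, h3⟩
        exact ⟨h2, fun h => h3 ⟨h1, h⟩⟩
      · rintro ⟨h1, h2⟩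
        exact ⟨⟨fun h => h2 (h ▸ hi), h1⟩, fun h => h2 h.2⟩
    have h2 : A.erase i = S.erase i ∪ (A \ S) := by
      rw [← h1, union_sdiff_of_subset (erase_subset_erase i hS.1)]
    have h3 : Disjoint (S.erase i) (A \ S) := by
      rw [← h1]; exact disjoint_sdiff
    have h4 : ∏ j ∈ A.erase i, cf x t i j
        = (∏ j ∈ S.erase i, cf x t i j) * ∏ j ∈ A \ S, cf x t i j := by
      rw [← prod_union h3, ← h2]
    have h5 : cross x t S (A \ S) = (∏ j ∈ A \ S, cf x t i j) * cross x t (S.erase i) (A \ S) :=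
      (mul_prod_erase S _ hi).symm
    have h6 : (fun k => α (k + r + 1)) = fun k => α (k + (r + 1)) := rfl
    rw [h1, h4, h5, h6]
    ring

/-! ### The symmetrization of `1` -/

/-- Lagrange interpolation at the points `x_i` of `∏ (X - t x_j) - ∏ (X - x_j)`, whose degree is
less than `#A` because the leading terms cancel, evaluated at `0`. -/
lemma sum_prod_cf (hx : Function.Injective x) (hx0 : ∀ i, x i ≠ 0) (ht : t ≠ 1) (A : Finset ι) :
    ∑ i ∈ A, ∏ j ∈ A.erase i, cf x t i j = (1 - t ^ #A) / (1 - t) := by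
  have ht' : 1 - t ≠ 0 := sub_ne_zero.2 (Ne.symm ht)
  set f : K[X] := ∏ j ∈ A, (X - C (t * x j)) - ∏ j ∈ A, (X - C (x j)) with hf
  have hdeg : f.degree < ((#A : ℕ) : WithBot ℕ) := by
    rcases A.eq_empty_or_nonempty with rfl | hA
    · simp [hf]
    · have h1 : (∏ j ∈ A, (X - C (t * x j))).degree = ((#A : ℕ) : WithBot ℕ) := by
        rw [degree_prod, sum_congr rfl fun j _ => degree_X_sub_C _]; simp
      have h2 : (∏ j ∈ A, (X - C (x j))).degree = ((#A : ℕ) : WithBot ℕ) := by simp [degree_prod]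
      rw [← h1]
      refine degree_sub_lt_left (by rw [h1, h2]) (Monic.ne_zero (monic_prod_of_monic _ _ fun j _ =>
        monic_X_sub_C _)) ?_
      rw [Monic.leadingCoeff (monic_prod_of_monic _ _ fun j _ => monic_X_sub_C _),
        Monic.leadingCoeff (monic_prod_of_monic _ _ fun j _ => monic_X_sub_C _)]
  have h1 := Lagrange.eq_interpolate (s := A) (v := x) hx.injOn hdeg
  have h2 := congrArg (eval 0) h1
  rw [Lagrange.interpolate_apply, eval_finsetSum] at h2
  have h3 : eval 0 f = (t ^ #A - 1) * ∏ j ∈ A, (-x j) := by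
    rw [hf, eval_sub, eval_prod, eval_prod]
    simp only [eval_sub, eval_X, eval_C, zero_sub]
    rw [prod_congr rfl fun j _ => (neg_mul_eq_mul_neg t (x j)), prod_mul_distrib, prod_const]
    ring
  have hP : ∏ j ∈ A, (-x j) ≠ 0 := prod_ne_zero_iff.2 fun j _ => neg_ne_zero.2 (hx0 j)
  have h4 : ∀ i ∈ A, eval 0 (C (eval (x i) f) * Lagrange.basis A x i)
      = (t - 1) * (∏ j ∈ A, (-x j)) * ∏ j ∈ A.erase i, cf x t i j := by
    intro i hi
    have e1 : eval (x i) f = (x i - t * x i) * ∏ j ∈ A.erase i, (x i - t * x j) := by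
      rw [hf, eval_sub, eval_prod, eval_prod, prod_eq_zero (f := fun j => eval (x i) (X - C (x j))) hi
        (by simp), sub_zero,
        ← mul_prod_erase A _ hi]
      simp
    have e2 : eval 0 (Lagrange.basis A x i) = ∏ j ∈ A.erase i, ((x i - x j)⁻¹ * -x j) := by
      rw [Lagrange.basis, eval_prod]
      refine prod_congr rfl fun j _ => ?_
      simp [Lagrange.basisDivisor]
    rw [eval_mul, eval_C, e1, e2, ← mul_prod_erase A (fun j => -x j) hi]
    simp only [cf, div_eq_mul_inv, prod_mul_distrib]
    ring
  rw [h3, sum_congr rfl h4, ← mul_sum] at h2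
  rw [eq_div_iff ht']
  have h5 : (∏ j ∈ A, (-x j)) * (t ^ #A - 1)
      = (∏ j ∈ A, (-x j)) * ((t - 1) * ∑ i ∈ A, ∏ j ∈ A.erase i, cf x t i j) := by
    rw [mul_comm, h2]; ring
  have h6 := mul_left_cancel₀ hP h5
  linear_combination h6

/-- By induction the inner sum does not depend on the first index chosen, so each step contributes
one factor from `sum_prod_cf`. -/
lemma symSum_zero (hx : Function.Injective x) (hx0 : ∀ i, x i ≠ 0) (ht : t ≠ 1) {N : ℕ}
    {A : Finset ι} (hA : #A = N) {α : ℕ → ℕ} (hα : ∀ i < N, α i = 0) :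
    symSum x t N α A = vFactor t N := by
  induction N generalizing A α with
  | zero =>
    rw [card_eq_zero] at hA
    simp [symSum, hA, vFactor]
  | succ N ih =>
    rw [symSum, hα 0 (Nat.succ_pos N)]
    have : ∀ i ∈ A, x i ^ 0 * (∏ j ∈ A.erase i, cf x t i j) *
        symSum x t N (fun k => α (k + 1)) (A.erase i)
        = (∏ j ∈ A.erase i, cf x t i j) * vFactor t N := by
      intro i hi
      rw [ih (by rw [card_erase_of_mem hi, hA, Nat.add_sub_cancel]) fun k hk => hα _ (by omega)]
      ring
    rw [sum_congr rfl this, ← sum_mul, sum_prod_cf hx hx0 ht, hA, vFactor, vFactor,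
      prod_Icc_succ_top (by omega), mul_comm]

/-! ### The identity behind the expansion of complete symmetric functions -/

/-- `∑_{S ⊆ A} t^{binom(|S|, 2)} ∏_{i ∈ S} u x_i ∏_{j ∉ S} (1 - u x_j) cross(S, A ∖ S)`. -/
def subsetPoly (x : ι → K) (t : K) (A : Finset ι) : K[X] :=
  ∑ S ∈ A.powerset, C (t ^ (#S).choose 2 * cross x t S (A \ S) * ∏ i ∈ S, x i) *
    X ^ #S * ∏ j ∈ A \ S, (1 - C (x j) * X)

lemma degree_subsetPoly_le (A : Finset ι) : (subsetPoly x t A).degree ≤ ((#A : ℕ) : WithBot ℕ) := by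
  refine (degree_sum_le _ _).trans (Finset.sup_le fun S hS => ?_)
  have h1 : ∀ j, (1 - C (x j) * X : K[X]).degree ≤ 1 := fun j => by
    compute_degree
  have h2 : (∏ j ∈ A \ S, (1 - C (x j) * X)).degree ≤ ((#(A \ S) : ℕ) : WithBot ℕ) := by
    refine (degree_prod_le _ _).trans ((sum_le_sum fun j _ => h1 j).trans ?_)
    simp
  refine (degree_mul_le _ _).trans ((add_le_add (degree_C_mul_X_pow_le _ _) h2).trans ?_)
  rw [card_sdiff_of_subset (mem_powerset.1 hS)]
  exact_mod_cast (Nat.add_sub_cancel' (Finset.card_le_card (mem_powerset.1 hS))).le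

/-- At `1 / x_k` only the subsets containing `k` survive. For `j` outside the subset, the factor
`cf` of `k` and `j` turns `1 - x_j / x_k` into `1 - t x_j / x_k`, and the increment `t^#S` of the
binomial power is absorbed by the new argument. -/
lemma eval_subsetPoly_inv (hx : Function.Injective x) (hx0 : ∀ i, x i ≠ 0) {A : Finset ι} {k : ι}
    (hk : k ∈ A) : (subsetPoly x t A).eval (x k)⁻¹
      = (subsetPoly x t (A.erase k)).eval (t * (x k)⁻¹) := by
  rw [subsetPoly, subsetPoly, eval_finsetSum, eval_finsetSum]
  conv_lhs => rw [← insert_erase hk, sum_powerset_insert (notMem_erase k A)]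
  rw [sum_eq_zero, zero_add]
  · refine sum_congr rfl fun S hS => ?_
    have hS' := mem_powerset.1 hS
    have hkS : k ∉ S := fun h => notMem_erase k A (hS' h)
    have e1 : insert k (A.erase k) \ insert k S = A.erase k \ S := by
      ext j
      simp only [mem_sdiff, mem_insert, mem_erase]
      tauto
    have e2 : cross x t (insert k S) (A.erase k \ S)
        = (∏ j ∈ A.erase k \ S, cf x t k j) * cross x t S (A.erase k \ S) := prod_insert hkS
    have e3 : (#S + 1).choose 2 = #S + (#S).choose 2 := by
      rw [Nat.choose_succ_succ' _ 1, Nat.choose_one_right]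
    have hc : x k * (x k)⁻¹ = 1 := mul_inv_cancel₀ (hx0 k)
    have e4 : (∏ j ∈ A.erase k \ S, cf x t k j) * ∏ j ∈ A.erase k \ S, (1 - x j * (x k)⁻¹)
        = ∏ j ∈ A.erase k \ S, (1 - x j * (t * (x k)⁻¹)) := by
      rw [← prod_mul_distrib]
      refine prod_congr rfl fun j hj => ?_
      have hkj : x k - x j ≠ 0 := sub_ne_zero.2 fun h =>
        (mem_erase.1 (mem_sdiff.1 hj).1).1 (hx h).symm
      have := hx0 k
      rw [cf]
      field_simp
    simp only [eval_mul, eval_C, eval_pow, eval_X, eval_prod, eval_sub, eval_one]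
    rw [e1, e2, card_insert_of_notMem hkS, prod_insert hkS, e3, ← e4, pow_add, pow_succ, mul_pow]
    linear_combination (t ^ #S * t ^ (#S).choose 2 * (∏ j ∈ A.erase k \ S, cf x t k j) *
      cross x t S (A.erase k \ S) * (∏ i ∈ S, x i) * (x k)⁻¹ ^ #S *
      ∏ j ∈ A.erase k \ S, (1 - x j * (x k)⁻¹)) * hc
  · intro S hS
    have hS' := mem_powerset.1 hS
    have hkS : k ∉ S := fun h => notMem_erase k A (hS' h)
    rw [eval_mul, eval_prod, prod_eq_zero (s := insert k (A.erase k) \ S)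
      (i := k) (by simp [hkS]) (by simp [hx0 k]), mul_zero]

/-- The degree is at most `#A`, and the value is one at the `#A + 1` distinct points `0` and `1 /
x_k`, the latter by induction on `A`. -/
theorem subsetPoly_eq_one (hx : Function.Injective x) (hx0 : ∀ i, x i ≠ 0) (A : Finset ι) :
    subsetPoly x t A = 1 := by
  classical
  induction hn : #A generalizing A with
  | zero =>
    rw [card_eq_zero] at hn
    subst hn
    simp [subsetPoly, cross]
  | succ n ih =>
    have hdeg := degree_subsetPoly_le (x := x) (t := t) A
    set s : Finset K := insert 0 (A.image fun k => (x k)⁻¹)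
    have hs : #s = #A + 1 := by
      rw [card_insert_of_notMem, card_image_of_injective]
      · exact fun a b h => hx (inv_injective h)
      · simp only [mem_image, not_exists, not_and]
        exact fun k _ => inv_ne_zero (hx0 k)
    refine eq_of_degree_sub_lt_of_eval_finset_eq s ?_ fun a ha => ?_
    · rw [hs]
      refine (degree_sub_le _ _).trans_lt (max_lt (hdeg.trans_lt ?_) ?_)
      · exact_mod_cast Nat.lt_succ_self _
      · rw [degree_one]; exact_mod_cast Nat.succ_pos _
    · rcases mem_insert.1 ha with rfl | ha
      · rw [subsetPoly, eval_finsetSum, sum_eq_single ∅]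
        · simp [cross, eval_prod]
        · intro S _ hS
          have : #S ≠ 0 := by rwa [Ne, card_eq_zero]
          simp [this]
        · simp
      · obtain ⟨k, hk, rfl⟩ := mem_image.1 ha
        rw [eval_subsetPoly_inv hx hx0 hk, ih _ (by rw [card_erase_of_mem hk, hn]; rfl)]
        simp

end SymSum

/-! ### Straightening of exponents that are not weakly decreasing. -/

section Straighten

variable {ι K : Type*} [DecidableEq ι] [Field K] {x : ι → K} {t : K}

/-- The exponents `(s, r)`. -/
def pairFun (s r : ℕ) : ℕ → ℕ := fun i => if i = 0 then s else r

lemma symSum_pair (s r : ℕ) {a b : ι} (hab : a ≠ b) :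
    symSum x t 2 (pairFun s r) {a, b}
      = x a ^ s * cf x t a b * x b ^ r + x b ^ s * cf x t b a * x a ^ r := by
  have h1 : ({a, b} : Finset ι).erase a = {b} := by
    rw [erase_insert]; simpa using hab
  have h2 : ({a, b} : Finset ι).erase b = {a} := by
    rw [pair_comm, erase_insert]; simpa using hab.symm
  rw [symSum, sum_pair hab, h1, h2]
  simp [symSum, pairFun]

lemma symSum_pair_succ (hx : Function.Injective x) (s : ℕ) {S : Finset ι} (hS : #S = 2) :
    symSum x t 2 (pairFun s (s + 1)) S = t * symSum x t 2 (pairFun (s + 1) s) S := by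
  obtain ⟨a, b, hab, rfl⟩ := card_eq_two.1 hS
  rw [symSum_pair _ _ hab, symSum_pair _ _ hab, cf, cf]
  have h1 : x a - x b ≠ 0 := sub_ne_zero.2 fun h => hab (hx h)
  have h2 : x b - x a ≠ 0 := sub_ne_zero.2 fun h => hab (hx h).symm
  have h3 : x b - x a = -(x a - x b) := by ring
  rw [h3, div_neg]
  field_simp
  ring

/-- A direct computation in two variables. On the right every second exponent is smaller than `s + 2
+ j`, which makes the straightening terminate. -/
lemma symSum_pair_of_lt (hx : Function.Injective x) (s j : ℕ) {S : Finset ι} (hS : #S = 2) :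
    symSum x t 2 (pairFun s (s + 2 + j)) S = t * symSum x t 2 (pairFun (s + 1) (s + 1 + j)) S
      + t * symSum x t 2 (pairFun (s + 2 + j) s) S
      - symSum x t 2 (pairFun (s + 1 + j) (s + 1)) S := by
  obtain ⟨a, b, hab, rfl⟩ := card_eq_two.1 hS
  simp only [symSum_pair _ _ hab, cf]
  have h1 : x a - x b ≠ 0 := sub_ne_zero.2 fun h => hab (hx h)
  have h3 : x b - x a = -(x a - x b) := by ring
  rw [h3, div_neg]
  field_simp
  ring

/-- Replace two adjacent exponents. -/
def replacePair (α : ℕ → ℕ) (p s r : ℕ) : ℕ → ℕ :=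
  fun i => if i = p then s else if i = p + 1 then r else α i

lemma replacePair_self (α : ℕ → ℕ) (p : ℕ) : replacePair α p (α p) (α (p + 1)) = α := by
  funext i
  rw [replacePair]
  split_ifs with h1 h2
  · rw [h1]
  · rw [h2]
  · rfl

/-- Splitting the orderings before and after two adjacent positions isolates a two-variable sum, so
relations in two variables hold at any adjacent pair of exponents. -/
lemma symSum_replacePair (α : ℕ → ℕ) (p m s r : ℕ) (A : Finset ι) :
    symSum x t (p + (2 + m)) (replacePair α p s r) A
      = ∑ S ∈ powersetCard p A, cross x t S (A \ S) * symSum x t p α S *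
        ∑ S' ∈ powersetCard 2 (A \ S), cross x t S' ((A \ S) \ S') *
          symSum x t 2 (pairFun s r) S' *
          symSum x t m (fun k => α (k + 2 + p)) ((A \ S) \ S') := by
  rw [symSum_add]
  refine sum_congr rfl fun S _ => ?_
  rw [symSum_add]
  congr 1
  · rw [symSum_congr (β := α)]
    intro i hi
    rw [replacePair, if_neg (by omega), if_neg (by omega)]
  · refine sum_congr rfl fun S' _ => ?_
    congr 1
    · rw [symSum_congr (β := pairFun s r)]
      intro i hi
      obtain rfl | rfl : i = 0 ∨ i = 1 := by omega
      · simp [replacePair, pairFun]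
      · simp [replacePair, pairFun, add_comm]
    · refine symSum_congr (fun i _ => ?_) _
      rw [replacePair, if_neg (by omega), if_neg (by omega)]

lemma symSum_replacePair_succ (hx : Function.Injective x) (α : ℕ → ℕ) (p m s : ℕ) (A : Finset ι) :
    symSum x t (p + (2 + m)) (replacePair α p s (s + 1)) A
      = t * symSum x t (p + (2 + m)) (replacePair α p (s + 1) s) A := by
  simp only [symSum_replacePair, mul_sum]
  refine sum_congr rfl fun S _ => sum_congr rfl fun S' hS' => ?_
  rw [symSum_pair_succ hx s (mem_powersetCard.1 hS').2]
  ring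

lemma symSum_replacePair_of_lt (hx : Function.Injective x) (α : ℕ → ℕ) (p m s j : ℕ)
    (A : Finset ι) :
    symSum x t (p + (2 + m)) (replacePair α p s (s + 2 + j)) A
      = t * symSum x t (p + (2 + m)) (replacePair α p (s + 1) (s + 1 + j)) A
        + t * symSum x t (p + (2 + m)) (replacePair α p (s + 2 + j) s) A
        - symSum x t (p + (2 + m)) (replacePair α p (s + 1 + j) (s + 1)) A := by
  simp only [symSum_replacePair, mul_sum]
  rw [← sum_add_distrib, ← sum_sub_distrib]
  refine sum_congr rfl fun S _ => ?_
  rw [← sum_add_distrib, ← sum_sub_distrib]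
  refine sum_congr rfl fun S' hS' => ?_
  rw [symSum_pair_of_lt hx s j (mem_powersetCard.1 hS').2]
  ring

/-- Used with `g = 1` to see that a straightening step keeps the degree and with `g i = i` to see
that it decreases the induction statistic. -/
lemma exists_sum_replacePair (α : ℕ → ℕ) (p m : ℕ) (g : ℕ → ℕ) :
    ∃ c, ∀ s r, ∑ i ∈ range (p + (2 + m)), g i * replacePair α p s r i
      = c + g p * s + g (p + 1) * r := by
  refine ⟨∑ i ∈ range p, g i * α i + ∑ i ∈ range m, g (p + (2 + i)) * α (p + (2 + i)),
    fun s r => ?_⟩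
  rw [sum_range_add, sum_range_add, sum_range_succ, sum_range_one]
  have h1 : ∑ i ∈ range p, g i * replacePair α p s r i = ∑ i ∈ range p, g i * α i :=
    sum_congr rfl fun i hi => by
      rw [mem_range] at hi
      rw [replacePair, if_neg (by omega), if_neg (by omega)]
  have h2 : ∑ i ∈ range m, g (p + (2 + i)) * replacePair α p s r (p + (2 + i))
      = ∑ i ∈ range m, g (p + (2 + i)) * α (p + (2 + i)) :=
    sum_congr rfl fun i hi => by
      rw [replacePair, if_neg (by omega), if_neg (by omega)]
  rw [h1, h2]
  simp [replacePair]
  ring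

variable {k : Type*} [Field k] [Algebra k K]

variable (x) in
/-- The span of the symmetrizations of the monomials with weakly decreasing exponents. -/
def dominantSpan (t : k) (N d : ℕ) (A : Finset ι) : Submodule k K :=
  Submodule.span k {y | ∃ β : ℕ → ℕ, Antitone β ∧ (∀ i, N ≤ i → β i = 0) ∧
    ∑ i ∈ range N, β i = d ∧ y = symSum x (algebraMap k K t) N β A}

/-- Each rewriting of an ascent keeps the sum of the exponents and moves weight to earlier
positions, so `∑ i α_i` decreases. -/
theorem symSum_mem_dominantSpan (hx : Function.Injective x) (t : k) (N : ℕ) (A : Finset ι)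
    (α : ℕ → ℕ) :
    symSum x (algebraMap k K t) N α A ∈ dominantSpan x t N (∑ i ∈ range N, α i) A := by
  induction hn : ∑ i ∈ range N, i * α i using Nat.strong_induction_on generalizing α with
  | _ n ih =>
  subst hn
  by_cases h : ∀ p, p + 1 < N → α (p + 1) ≤ α p
  · refine Submodule.subset_span ⟨fun i => if i < N then α i else 0, antitone_nat_of_succ_le
      fun i => ?_, fun i hi => if_neg (by omega), sum_congr rfl fun i hi => if_pos (mem_range.1 hi),
      symSum_congr (fun i hi => (if_pos hi).symm) A⟩
    split_ifs with h1 h2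
    · exact h i h1
    · omega
    · exact Nat.zero_le _
    · exact le_rfl
  · push Not at h
    obtain ⟨p, hp, hlt⟩ := h
    obtain ⟨m, rfl⟩ : ∃ m, N = p + (2 + m) := ⟨N - p - 2, by omega⟩
    obtain ⟨c, hc⟩ := exists_sum_replacePair α p m fun i => i
    obtain ⟨e, he⟩ := exists_sum_replacePair α p m fun _ => 1
    simp only [one_mul] at he
    have hα := replacePair_self α p
    have key : ∀ s r, s + r = α p + α (p + 1) → p * s + (p + 1) * r < p * α p + (p + 1) * α (p + 1) →
        symSum x (algebraMap k K t) (p + (2 + m)) (replacePair α p s r) A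
          ∈ dominantSpan x t (p + (2 + m)) (∑ i ∈ range (p + (2 + m)), α i) A := by
      intro s r h1 h2
      have := ih _ ?_ (replacePair α p s r) rfl
      · rw [he] at this
        rw [← hα, he]
        simpa only [add_assoc, h1, hα] using this
      · rw [hc]
        conv_rhs => rw [← hα, hc]
        omega
    obtain h1 | ⟨j, h1⟩ : α (p + 1) = α p + 1 ∨ ∃ j, α (p + 1) = α p + 2 + j := by
      rcases Nat.lt_or_ge (α p + 1) (α (p + 1)) with h | h
      · exact Or.inr ⟨α (p + 1) - α p - 2, by omega⟩
      · exact Or.inl (by omega)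
    · have h2 := symSum_replacePair_succ (t := algebraMap k K t) hx α p m (α p) A
      rw [← h1, hα] at h2
      rw [h2, ← Algebra.smul_def]
      refine Submodule.smul_mem _ _ (key _ _ (by omega) ?_)
      nlinarith
    · have h2 := symSum_replacePair_of_lt (t := algebraMap k K t) hx α p m (α p) j A
      rw [← h1, hα] at h2
      rw [h2, ← Algebra.smul_def, ← Algebra.smul_def]
      refine Submodule.sub_mem _ (Submodule.add_mem _ (Submodule.smul_mem _ _ (key _ _ ?_ ?_))
        (Submodule.smul_mem _ _ (key _ _ ?_ ?_))) (key _ _ ?_ ?_)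
      · omega
      · rw [h1]; ring_nf; omega
      · omega
      · rw [h1]; ring_nf; omega
      · omega
      · rw [h1]; ring_nf; omega

end Straighten

/-! ### Complete symmetric polynomials in terms of Hall-Littlewood polynomials. -/

section CompleteSymmetric

variable {ι K : Type*} [DecidableEq ι] [Field K] (x : ι → K) {t : K}

/-- The complete symmetric polynomial of degree `d` in the variables `x_i`, `i ∈ A`. -/
def completeH (A : Finset ι) (d : ℕ) : K :=
  ∑ m ∈ finsuppAntidiag A d, ∏ i ∈ A, x i ^ m i

/-- The generating series of the complete symmetric polynomials. -/
def completeSeries (A : Finset ι) : PowerSeries K :=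
  ∏ i ∈ A, PowerSeries.mk fun n => x i ^ n

lemma coeff_completeSeries (A : Finset ι) (d : ℕ) :
    PowerSeries.coeff d (completeSeries x A) = completeH x A d := by
  simp [completeSeries, completeH, PowerSeries.coeff_prod]

lemma geometric_mul (a : K) :
    (1 - PowerSeries.C a * PowerSeries.X) * PowerSeries.mk (fun n => a ^ n) = 1 := by
  ext n
  rw [sub_mul, one_mul, mul_assoc, map_sub, PowerSeries.coeff_C_mul, PowerSeries.coeff_one]
  rcases n with _ | n
  · simp
  · rw [PowerSeries.coeff_succ_X_mul]
    simp [pow_succ']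

variable {x}

/-- Multiply the identity `subsetPoly_eq_one` by the generating series of `A`: the factors belonging
to elements outside the subset cancel against their geometric series. -/
lemma completeSeries_eq (hx : Function.Injective x) (hx0 : ∀ i, x i ≠ 0) (A : Finset ι) :
    completeSeries x A = ∑ S ∈ A.powerset,
      PowerSeries.C (t ^ (#S).choose 2 * cross x t S (A \ S) * ∏ i ∈ S, x i) *
        (PowerSeries.X ^ #S * completeSeries x S) := by
  have h := congrArg (fun f : K[X] => (f : PowerSeries K) * completeSeries x A)
    (subsetPoly_eq_one (t := t) hx hx0 A)
  simp only [Polynomial.coe_one, one_mul] at h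
  rw [← h, ← Polynomial.coeToPowerSeries.ringHom_apply, subsetPoly, map_sum, sum_mul]
  refine sum_congr rfl fun S hS => ?_
  have h1 : completeSeries x A = completeSeries x (A \ S) * completeSeries x S :=
    (prod_sdiff (mem_powerset.1 hS)).symm
  have h2 : (∏ j ∈ A \ S, (1 - PowerSeries.C (x j) * PowerSeries.X)) * completeSeries x (A \ S)
      = 1 := by
    rw [completeSeries, ← prod_mul_distrib]
    exact prod_eq_one fun j _ => geometric_mul (x j)
  rw [h1]
  simp only [map_mul, map_pow, map_prod, map_sub, map_one,
    Polynomial.coeToPowerSeries.ringHom_apply, Polynomial.coe_C, Polynomial.coe_X] at h2 ⊢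
  linear_combination (PowerSeries.C t ^ (#S).choose 2 * PowerSeries.C (cross x t S (A \ S)) *
    (∏ i ∈ S, PowerSeries.C (x i)) * PowerSeries.X ^ #S * completeSeries x S) * h2

lemma completeH_eq_sum (hx : Function.Injective x) (hx0 : ∀ i, x i ≠ 0) (A : Finset ι) (d : ℕ) :
    completeH x A d = ∑ r ∈ range (#A + 1), if r ≤ d then ∑ S ∈ powersetCard r A,
      t ^ r.choose 2 * cross x t S (A \ S) * (∏ i ∈ S, x i) * completeH x S (d - r) else 0 := by
  rw [← coeff_completeSeries, completeSeries_eq (t := t) hx hx0, map_sum, sum_powerset]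
  refine sum_congr rfl fun r _ => ?_
  split_ifs with h
  · refine sum_congr rfl fun S hS => ?_
    rw [PowerSeries.coeff_C_mul, PowerSeries.coeff_X_pow_mul', (mem_powersetCard.1 hS).2, if_pos h,
      coeff_completeSeries]
  · refine sum_eq_zero fun S hS => ?_
    rw [PowerSeries.coeff_C_mul, PowerSeries.coeff_X_pow_mul', (mem_powersetCard.1 hS).2, if_neg h,
      mul_zero]

lemma completeH_zero (A : Finset ι) : completeH x A 0 = 1 := by
  simp [completeH]

lemma completeH_empty {d : ℕ} (hd : d ≠ 0) : completeH x ∅ d = 0 := by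
  rw [completeH, finsuppAntidiag_empty_of_ne_zero hd, sum_empty]

open Classical in
/-- The partitions of `d` with at most `N` parts, as functions. -/
def dominantWeights (N d : ℕ) : Finset (ℕ →₀ ℕ) :=
  {α ∈ finsuppAntidiag (range N) d | Antitone α}

lemma mem_dominantWeights {N d : ℕ} {α : ℕ →₀ ℕ} : α ∈ dominantWeights N d ↔
    ∑ i ∈ range N, α i = d ∧ (∀ i, N ≤ i → α i = 0) ∧ Antitone α := by
  classical
  rw [dominantWeights, mem_filter, mem_finsuppAntidiag, and_assoc]
  refine and_congr_right fun _ => and_congr_left fun _ => ⟨fun h i hi => ?_, fun h i hi => ?_⟩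
  · by_contra h0
    have := h (Finsupp.mem_support_iff.2 h0)
    rw [mem_range] at this
    omega
  · by_contra h0
    exact (Finsupp.mem_support_iff.1 hi) (h i (by simpa using h0))

/-- Adding a first column of length `r`. -/
def addColumn (r : ℕ) (β : ℕ →₀ ℕ) : ℕ →₀ ℕ :=
  β + Finsupp.indicator (range r) fun _ _ => 1

lemma addColumn_apply (r : ℕ) (β : ℕ →₀ ℕ) (i : ℕ) :
    addColumn r β i = β i + if i < r then 1 else 0 := by
  simp [addColumn, Finsupp.indicator_apply]

lemma support_eq_range {α : ℕ →₀ ℕ} (h : Antitone α) : α.support = range #α.support := by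
  have h1 : ∃ r, ∀ i, i ∈ α.support ↔ i < r := by
    by_cases hα : ∃ i, α i = 0
    · refine ⟨Nat.find hα, fun i => ?_⟩
      rw [Finsupp.mem_support_iff]
      refine ⟨fun hi => ?_, fun hi => Nat.find_min hα hi⟩
      by_contra hlt
      have := h (not_lt.1 hlt)
      have := Nat.find_spec hα
      omega
    · push Not at hα
      exact absurd ((Finsupp.support α).finite_toSet.subset
        fun i (_ : i ∈ Set.univ) => Finsupp.mem_support_iff.2 (hα i)) Set.infinite_univ
  obtain ⟨r, hr⟩ := h1
  have : α.support = range r := by ext i; rw [hr, mem_range]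
  rw [this, card_range]

/-- A partition is its length `r` together with what remains after deleting the first column. Length
zero is excluded because `d` is positive. -/
lemma sum_dominantWeights {M : Type*} [AddCommMonoid M] (N : ℕ) {d : ℕ} (hd : d ≠ 0)
    (f : (ℕ →₀ ℕ) → M) :
    ∑ α ∈ dominantWeights N d, f α = ∑ r ∈ range (N + 1), if r ≤ d ∧ r ≠ 0 then
      ∑ β ∈ dominantWeights r (d - r), f (addColumn r β) else 0 := by
  rw [← sum_filter, sum_sigma']
  refine sum_bij' (fun α _ => ⟨#α.support, α.mapRange (· - 1) rfl⟩)
    (fun y _ => addColumn y.1 y.2) ?_ ?_ ?_ ?_ ?_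
  · intro α h
    rw [mem_dominantWeights] at h
    obtain ⟨h1, h2, h3⟩ := h
    have hs := support_eq_range h3
    have hsub : #α.support ≤ N := by
      have : α.support ⊆ range N := fun i hi => by
        by_contra h0
        exact (Finsupp.mem_support_iff.1 hi) (h2 i (by simpa using h0))
      simpa using Finset.card_le_card this
    have hpos : ∀ i, i < #α.support → 1 ≤ α i := fun i hi => by
      rw [← mem_range, ← hs, Finsupp.mem_support_iff] at hi
      omega
    have hzero : ∀ i, #α.support ≤ i → α i = 0 := fun i hi => by
      by_contra h0
      rw [← Ne, ← Finsupp.mem_support_iff, hs, mem_range] at h0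
      omega
    have hsum : ∑ i ∈ range #α.support, α i = d := by
      rw [← h1]
      exact sum_subset (range_mono hsub) fun i _ hi => hzero i (by simpa using hi)
    have hsum2 : ∑ i ∈ range #α.support, (α i - 1) + #α.support = d := by
      rw [← hsum]
      have : ∑ i ∈ range #α.support, (α i - 1 + 1) = ∑ i ∈ range #α.support, α i :=
        sum_congr rfl fun i hi => Nat.sub_add_cancel (hpos i (mem_range.1 hi))
      rw [← this, sum_add_distrib]
      simp
    rw [mem_sigma, mem_filter, mem_range, mem_dominantWeights]
    refine ⟨⟨Nat.lt_succ_of_le hsub, by change #α.support ≤ d; omega, fun h0 => ?_⟩, ?_,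
      fun i hi => ?_, fun i j hij => ?_⟩
    · change #α.support = 0 at h0
      rw [h0] at hsum2
      simp at hsum2
      omega
    · simp only [Finsupp.mapRange_apply]
      omega
    · rw [Finsupp.mapRange_apply, hzero i hi]
    · rw [Finsupp.mapRange_apply, Finsupp.mapRange_apply]
      exact Nat.sub_le_sub_right (h3 hij) 1
  · rintro ⟨r, β⟩ h
    rw [mem_sigma, mem_filter, mem_range, mem_dominantWeights] at h
    obtain ⟨⟨h1, h2, h3⟩, h4, h5, h6⟩ := h
    rw [mem_dominantWeights]
    simp only [addColumn_apply] at h4 h5 h1 h2 ⊢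
    refine ⟨?_, fun i hi => ?_, fun i j hij => ?_⟩
    · rw [sum_add_distrib, ← sum_subset (range_mono (show r ≤ N by omega))
        fun i _ hi => h5 i (by simpa using hi), h4, ← sum_filter]
      have : {i ∈ range N | i < r} = range r := by
        ext i; simp only [mem_filter, mem_range]; omega
      rw [this]
      simp
      omega
    · rw [h5 i (by omega), if_neg (by omega)]
    · have := h6 hij
      change β j ≤ β i at this
      simp only [addColumn_apply]
      split_ifs <;> omega
  · intro α h
    have h3 := (mem_dominantWeights.1 h).2.2
    have hs := support_eq_range h3
    ext i
    rw [addColumn_apply, Finsupp.mapRange_apply]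
    have : i < #α.support ↔ α i ≠ 0 := by
      rw [← Finsupp.mem_support_iff, ← mem_range, ← hs]
    simp only [this]
    split_ifs <;> omega
  · rintro ⟨r, β⟩ h
    rw [mem_sigma, mem_filter, mem_range, mem_dominantWeights] at h
    obtain ⟨⟨h1, h2, h3⟩, h4, h5, h6⟩ := h
    have h7 : (addColumn r β).support = range r := by
      ext i
      rw [Finsupp.mem_support_iff, addColumn_apply, mem_range]
      split_ifs with hi
      · simp [hi]
      · simp [h5 i (by simpa using hi), hi]
    have h8 : (addColumn r β).mapRange (· - 1) rfl = β := by
      ext i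
      rw [Finsupp.mapRange_apply, addColumn_apply]
      split_ifs with hi
      · rfl
      · rw [h5 i (by simpa using hi)]
    simp only [h7, card_range, h8]
  · intro α h
    have h3 := (mem_dominantWeights.1 h).2.2
    have hs := support_eq_range h3
    congr 1
    ext i
    rw [addColumn_apply, Finsupp.mapRange_apply]
    have : i < #α.support ↔ α i ≠ 0 := by
      rw [← Finsupp.mem_support_iff, ← mem_range, ← hs]
    simp only [this]
    split_ifs <;> omega

/-- `∏_{i < D} v_{m_i}(t)`, where `m_i` is the number of `j < N` with `α j = i`. -/
def vProd {K : Type*} [Field K] (t : K) (N D : ℕ) (α : ℕ → ℕ) : K :=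
  ∏ i ∈ range D, vFactor t #{j ∈ range N | α j = i}

/-- After a column of length `r` is added, the zeros are the positions from `r` to `N - 1`, and
every other multiplicity moves up by one value. -/
lemma vProd_addColumn {N r D : ℕ} (hr : r ≤ N) {β : ℕ →₀ ℕ} (hβ : ∀ i, r ≤ i → β i = 0) :
    vProd t N (D + 1) (addColumn r β) = vFactor t (N - r) * vProd t r D β := by
  rw [vProd, prod_range_succ', mul_comm, vProd]
  have h1 : {j ∈ range N | addColumn r β j = 0} = Ico r N := by
    ext j
    simp only [mem_filter, mem_range, addColumn_apply, mem_Ico]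
    split_ifs with h
    · simp [h]
    · have := hβ j (by omega)
      omega
  have h2 : ∀ i, {j ∈ range N | addColumn r β j = i + 1} = {j ∈ range r | β j = i} := fun i => by
    ext j
    simp only [mem_filter, mem_range, addColumn_apply]
    split_ifs with h
    · omega
    · have := hβ j (by omega)
      omega
  rw [h1, Nat.card_Ico]
  simp only [h2]

lemma vFactor_zero {K : Type*} [Field K] (t : K) : vFactor t 0 = 1 := by simp [vFactor]

lemma symSum_add_one {N : ℕ} {α : ℕ → ℕ} {S : Finset ι} (hS : #S = N) :
    symSum x t N (fun i => α i + 1) S = (∏ i ∈ S, x i) * symSum x t N α S := by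
  induction N generalizing α S with
  | zero =>
    rw [card_eq_zero] at hS
    simp [symSum, hS]
  | succ N ih =>
    rw [symSum, symSum, mul_sum]
    refine sum_congr rfl fun i hi => ?_
    rw [ih (by rw [card_erase_of_mem hi, hS, Nat.add_sub_cancel]), ← mul_prod_erase S x hi]
    ring

/-- Split the orderings after `r` terms. The exponents of the tail are zero, so the tail sums to
`vFactor`; those of the head are positive, so the product of its variables comes out. -/
lemma symSum_addColumn (hx : Function.Injective x) (hx0 : ∀ i, x i ≠ 0) (ht : t ≠ 1) {N r : ℕ}
    {A : Finset ι} (hA : #A = N) (hr : r ≤ N) {β : ℕ →₀ ℕ} (hβ : ∀ i, r ≤ i → β i = 0) :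
    symSum x t N (addColumn r β) A = vFactor t (N - r) *
      ∑ S ∈ powersetCard r A, cross x t S (A \ S) * (∏ i ∈ S, x i) * symSum x t r β S := by
  obtain ⟨s, rfl⟩ := Nat.exists_eq_add_of_le hr
  rw [symSum_add, mul_sum, Nat.add_sub_cancel_left]
  refine sum_congr rfl fun S hS => ?_
  rw [mem_powersetCard] at hS
  rw [symSum_zero (N := s) hx hx0 ht
    (by rw [card_sdiff_of_subset hS.1, hA, hS.2, Nat.add_sub_cancel_left])
    fun i _ => by rw [addColumn_apply, hβ _ (by omega), if_neg (by omega)],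
    symSum_congr (N := r) (β := fun i => β i + 1) fun i hi => by rw [addColumn_apply, if_pos hi],
    symSum_add_one hS.2]
  ring

lemma sum_mul_addColumn {N r : ℕ} (hr : r ≤ N) {β : ℕ →₀ ℕ} (hβ : ∀ i, r ≤ i → β i = 0) :
    ∑ i ∈ range N, i * addColumn r β i = r.choose 2 + ∑ i ∈ range r, i * β i := by
  rw [← sum_subset (range_mono hr) fun i _ hi => by
    rw [addColumn_apply, hβ i (by simpa using hi), if_neg (by simpa using hi), add_zero, mul_zero],
    Nat.choose_two_right, ← sum_range_id, ← sum_add_distrib]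
  refine sum_congr rfl fun i hi => ?_
  rw [addColumn_apply, if_pos (mem_range.1 hi)]
  ring

/-- The expansion of the complete symmetric polynomials in Hall-Littlewood polynomials. -/
theorem completeH_eq_sum_symSum (hx : Function.Injective x) (hx0 : ∀ i, x i ≠ 0)
    (ht : ∀ n, vFactor t n ≠ 0) (ht1 : t ≠ 1) {N d D : ℕ} (hD : d < D) {A : Finset ι}
    (hA : #A = N) :
    completeH x A d = ∑ α ∈ dominantWeights N d,
      t ^ (∑ i ∈ range N, i * α i) * (vProd t N D α)⁻¹ * symSum x t N α A := by
  induction d using Nat.strong_induction_on generalizing N A D with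
  | _ d ih =>
  obtain ⟨D, rfl⟩ : ∃ E, D = E + 1 := ⟨D - 1, by omega⟩
  rcases eq_or_ne d 0 with rfl | hd
  · have : dominantWeights N 0 = {0} := by
      ext α
      rw [mem_dominantWeights, mem_singleton]
      constructor
      · rintro ⟨h1, h2, -⟩
        ext i
        rcases Nat.lt_or_ge i N with hi | hi
        · exact (sum_eq_zero_iff.1 h1) i (mem_range.2 hi)
        · exact h2 i hi
      · rintro rfl
        exact ⟨by simp, fun _ _ => rfl, fun _ _ _ => le_rfl⟩
    rw [this, sum_singleton, completeH_zero, symSum_zero (α := (0 : ℕ →₀ ℕ)) hx hx0 ht1 hA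
      fun i _ => rfl, vProd,
      prod_range_succ', prod_eq_one fun i _ => ?_]
    · simp only [Finsupp.coe_zero, Pi.zero_apply, mul_zero, sum_const_zero, pow_zero, one_mul,
        filter_true, card_range]
      rw [inv_mul_cancel₀ (ht N)]
    · rw [filter_false_of_mem fun j _ => by simp, card_empty, vFactor_zero]
  -- Both sides are now indexed by the length `r` of the first column, and the induction hypothesis
  -- in degree `d - r` matches them. The power with exponent `r.choose 2` is the contribution of
  -- that column to `∑ i α_i`.
  · rw [completeH_eq_sum (t := t) hx hx0, sum_dominantWeights N hd, hA]
    refine sum_congr rfl fun r hr => ?_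
    have hrN : r ≤ N := by rw [mem_range] at hr; omega
    rcases eq_or_ne r 0 with rfl | hr0
    · simp [completeH_empty hd]
    · by_cases hrd : r ≤ d
      · rw [if_pos hrd, if_pos ⟨hrd, hr0⟩]
        have h1 : ∀ S ∈ powersetCard r A,
            t ^ r.choose 2 * cross x t S (A \ S) * (∏ i ∈ S, x i) * completeH x S (d - r)
            = ∑ β ∈ dominantWeights r (d - r), t ^ r.choose 2 * t ^ (∑ i ∈ range r, i * β i) *
              (vProd t r D β)⁻¹ * (cross x t S (A \ S) * (∏ i ∈ S, x i) * symSum x t r β S) := by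
          intro S hS
          rw [ih (d - r) (by omega) (D := D) (by omega) (mem_powersetCard.1 hS).2, mul_sum]
          exact sum_congr rfl fun β _ => by ring
        rw [sum_congr rfl h1, sum_comm]
        refine sum_congr rfl fun β hβ => ?_
        have hβ0 := (mem_dominantWeights.1 hβ).2.1
        rw [← mul_sum, symSum_addColumn hx hx0 ht1 hA hrN hβ0, vProd_addColumn hrN hβ0,
          sum_mul_addColumn hrN hβ0, pow_add, mul_inv]
        have := ht (N - r)
        field_simp
      · rw [if_neg hrd, if_neg fun h => hrd h.1]

end CompleteSymmetric

/-! ### Kostka numbers of rows and columns -/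

lemma tabCount_of_rowLen_one {k : ℕ} {m : ℕ → ℕ} {la : YoungDiagram} (h1 : la.rowLen 1 = 0)
    (hm : ∑ i ∈ range k, m i = la.card) : tabCount k m la = 1 := by
  classical
  have hcard : ∀ mu : YoungDiagram, mu.rowLen 1 = 0 → mu.card = mu.rowLen 0 := fun mu h => by
    rw [card_eq_sum_rowLen mu (N := 1) fun i hi => Nat.le_zero.1 (h ▸ mu.rowLen_anti 1 i hi),
      sum_range_one]
  induction k generalizing la with
  | zero =>
    rw [tabCount_zero, if_pos]
    refine eq_bot_of_rowLen_zero ?_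
    rw [← hcard la h1, ← hm, sum_range_zero]
  | succ k ih =>
    rw [sum_range_succ, hcard la h1] at hm
    have hr : Antitone fun i => if i = 0 then la.rowLen 0 - m k else 0 :=
      antitone_nat_of_succ_le fun i => by simp
    set nu := subdiagram la _ hr with hnu
    have hrow : ∀ i, nu.rowLen i = if i = 0 then la.rowLen 0 - m k else 0 := fun i => by
      refine rowLen_subdiagram hr ?_
      split_ifs with hi
      · subst hi; omega
      · exact Nat.zero_le _
    have hrow0 := hrow 0
    have hrow1 := hrow 1
    simp only [if_true, one_ne_zero, if_false] at hrow0 hrow1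
    rw [tabCount_succ, sum_eq_single nu]
    · rw [if_pos (by rw [hcard nu hrow1, hcard la h1]; omega),
        ih hrow1 (by rw [hcard nu hrow1]; omega)]
    · intro mu hmu hne
      rw [if_neg]
      intro hc
      rw [mem_strips] at hmu
      have h2 : mu.rowLen 1 = 0 := by have := (hmu 1).1; omega
      rw [hcard mu h2, hcard la h1] at hc
      refine hne (diagram_ext fun i => ?_)
      rw [hrow]
      split_ifs with hi
      · subst hi; omega
      · have := mu.rowLen_anti 1 i (by omega); omega
    · intro h
      refine absurd (mem_strips.2 fun i => ?_) h
      rcases i with _ | i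
      · rw [zero_add]; omega
      · rw [hrow, if_neg (by omega)]
        have := la.rowLen_anti 1 (i + 1 + 1) (by omega)
        omega

/-- A horizontal strip has at most `la.rowLen 0` cells, as one sees by telescoping the inequalities
between row `j` of the inner and row `j + 1` of the outer diagram. -/
lemma le_one_of_tabCount_ne_zero {k : ℕ} {m : ℕ → ℕ} {la : YoungDiagram} (h1 : la.rowLen 0 ≤ 1)
    (h : tabCount k m la ≠ 0) : ∀ i < k, m i ≤ 1 := by
  induction k generalizing la with
  | zero => intro i hi; omega
  | succ k ih =>
    rw [tabCount_succ] at h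
    obtain ⟨mu, hmu, hne⟩ := exists_ne_zero_of_sum_ne_zero h
    rw [mem_strips] at hmu
    have hc : mu.card + m k = la.card := by
      by_contra hc
      exact hne (if_neg hc)
    rw [if_pos hc] at hne
    intro i hi
    rcases Nat.lt_succ_iff_lt_or_eq.1 hi with hi | rfl
    · exact ih ((hmu 0).1.trans h1) hne i hi
    · have hN : ∀ j, la.colLen 0 ≤ j → la.rowLen j = 0 := fun j hj => rowLen_eq_zero_of_le hj
      have h2 : ∀ N, ∑ j ∈ range N, la.rowLen j + la.rowLen N
          ≤ ∑ j ∈ range N, mu.rowLen j + la.rowLen 0 := by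
        intro N
        induction N with
        | zero => simp
        | succ N ihN =>
          rw [sum_range_succ, sum_range_succ]
          have := (hmu N).2
          omega
      have h3 := h2 (la.colLen 0)
      rw [← card_eq_sum_rowLen la hN, ← card_eq_sum_rowLen mu (hmu.colLen_le hN)] at h3
      omega

/-! ### The Kostka-Foulkes polynomials -/

section KostkaFoulkes

variable {k : Type*} [Field k] {n : ℕ}

lemma xvar_injective : Function.Injective (xvar k : Fin n → RatVars k n) := fun _ _ h =>
  MvPolynomial.X_injective (IsFractionRing.injective (MvPolynomial (Fin n) k) (RatVars k n) h)

lemma xvar_ne_zero (i : Fin n) : (xvar k i : RatVars k n) ≠ 0 := fun h =>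
  MvPolynomial.X_ne_zero i (IsFractionRing.injective (MvPolynomial (Fin n) k) (RatVars k n)
    (h.trans (map_zero _).symm))

lemma symSum_univ {K : Type*} [Field K] (x : Fin n → K) (t : K) (α : ℕ → ℕ) :
    symSum x t n α univ = ∑ w : Equiv.Perm (Fin n), (∏ i, x (w i) ^ α i) *
      ∏ i, ∏ j ∈ Ioi i, cf x t (w i) (w j) := by
  rw [symSum_eq_sum_fun, ← sum_filter]
  symm
  refine sum_bij (fun w _ => w) ?_ ?_ ?_ ?_
  · intro w _
    rw [mem_filter]
    refine ⟨mem_univ _, w.injective, ?_⟩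
    exact image_univ_of_surjective w.surjective
  · intro w _ w' _ h
    exact DFunLike.coe_injective h
  · intro e he
    rw [mem_filter] at he
    exact ⟨Equiv.ofBijective e (Finite.injective_iff_bijective.1 he.2.1), mem_univ _, rfl⟩
  · intro w _
    rfl

lemma hallLittlewoodP_eq (t : k) (p : n.Partition) : hallLittlewoodP t p =
    (vPart t p)⁻¹ • symSum (xvar k) (algebraMap k (RatVars k n) t) n (row p) univ := by
  rw [hallLittlewoodP, symSum_univ]
  simp only [cf, Algebra.smul_def]

lemma map_vFactor {K : Type*} [Field K] (f : k →+* K) (t : k) (m : ℕ) :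
    f (vFactor t m) = vFactor (f t) m := by
  simp [vFactor, map_prod, map_div₀]

lemma map_vPart {K : Type*} [Field K] (f : k →+* K) (t : k) (p : n.Partition) :
    f (vPart t p) = vProd (f t) n (n + 1) (row p) := by
  simp only [vPart, vProd, map_prod, map_vFactor]

lemma vFactor_ne_zero {t : k} (ht : ∀ j, j ≠ 0 → t ^ j ≠ 1) (m : ℕ) : vFactor t m ≠ 0 := by
  refine prod_ne_zero_iff.2 fun j hj => div_ne_zero (sub_ne_zero.2 (ht j ?_).symm) ?_
  · rw [mem_Icc] at hj; omega
  · have := ht 1 one_ne_zero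
    rw [pow_one] at this
    exact sub_ne_zero.2 this.symm

lemma vPart_ne_zero {t : k} (ht : ∀ j, j ≠ 0 → t ^ j ≠ 1) (p : n.Partition) : vPart t p ≠ 0 :=
  prod_ne_zero_iff.2 fun _ _ => vFactor_ne_zero ht _

lemma embDomain_val_apply (m : Fin n →₀ ℕ) (i : Fin n) :
    m.embDomain Fin.valEmbedding (i : ℕ) = m i :=
  Finsupp.embDomain_apply_self Fin.valEmbedding m i

lemma embDomain_val_eq_zero (m : Fin n →₀ ℕ) {i : ℕ} (hi : n ≤ i) :
    m.embDomain Fin.valEmbedding i = 0 :=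
  Finsupp.embDomain_of_notMem_range _ _ _ fun ⟨j, hj⟩ => by
    have : (j : ℕ) = i := hj
    have := j.2
    omega

/-- Adjacent transpositions generate the symmetric group, so `kostkaNumber_swap` extends to all
permutations. -/
lemma kostkaNumber_embDomain_swap (p : n.Partition) (m m' : Fin n →₀ ℕ) (w : Equiv.Perm (Fin n))
    (h : ∀ i, m' i = m (w i)) : kostkaNumber p (m'.embDomain Fin.valEmbedding)
      = kostkaNumber p (m.embDomain Fin.valEmbedding) := by
  rcases n with _ | n
  · rw [Subsingleton.elim m m']
  have hw : w ∈ (⊤ : Submonoid (Equiv.Perm (Fin (n + 1)))) := trivial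
  rw [← Equiv.Perm.mclosure_swap_castSucc_succ] at hw
  induction hw using Submonoid.closure_induction generalizing m m' with
  | mem w hw =>
    obtain ⟨a, rfl⟩ := hw
    refine kostkaNumber_swap p _ _ a fun i => ?_
    rcases Nat.lt_or_ge i (n + 1) with hi | hi
    · rw [show i = ((⟨i, hi⟩ : Fin (n + 1)) : ℕ) from rfl, embDomain_val_apply, h,
        ← embDomain_val_apply]
      congr 1
      rw [Equiv.swap_apply_def, Equiv.swap_apply_def]
      simp only [Fin.ext_iff, Fin.val_castSucc, Fin.val_succ]
      split_ifs <;> rfl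
    · rw [Equiv.swap_apply_of_ne_of_ne (by omega) (by omega), embDomain_val_eq_zero _ hi,
        embDomain_val_eq_zero _ hi]
  | one => rw [show m' = m from Finsupp.ext h]
  | mul a b _ _ iha ihb =>
    rw [ihb (m.equivMapDomain a.symm) m' fun i => by simp [h, Finsupp.equivMapDomain_apply],
      iha m (m.equivMapDomain a.symm) fun i => by simp [Finsupp.equivMapDomain_apply]]

lemma schurPoly_eq_perm (p : n.Partition) (w : Equiv.Perm (Fin n)) :
    schurPoly k n p = ∑ m ∈ finsuppAntidiag (univ : Finset (Fin n)) n,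
      (kostkaNumber p (m.embDomain Fin.valEmbedding) : RatVars k n) * ∏ i, xvar k (w i) ^ m i := by
  rw [schurPoly]
  refine sum_bij' (fun m _ => m.equivMapDomain w.symm) (fun m _ => m.equivMapDomain w) ?_ ?_ ?_ ?_ ?_
  · intro m hm
    rw [mem_finsuppAntidiag] at hm ⊢
    exact ⟨(Equiv.sum_comp w m).trans hm.1, subset_univ _⟩
  · intro m hm
    rw [mem_finsuppAntidiag] at hm ⊢
    exact ⟨(Equiv.sum_comp w.symm m).trans hm.1, subset_univ _⟩
  · intro m _
    ext i
    simp [Finsupp.equivMapDomain_apply]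
  · intro m _
    ext i
    simp [Finsupp.equivMapDomain_apply]
  · intro m _
    rw [kostkaNumber_embDomain_swap p m (m.equivMapDomain w.symm) w fun i => by
      simp [Finsupp.equivMapDomain_apply]]
    congr 1
    rw [← Equiv.prod_comp w]
    exact prod_congr rfl fun i _ => by simp [Finsupp.equivMapDomain_apply]

/-- The symmetrization of `1` is `vFactor`, and a symmetric factor may be moved inside the sum over
permutations and expanded into monomials there. -/
lemma vFactor_mul_schurPoly {t : k} (ht : t ≠ 1) (p : n.Partition) :
    vFactor (algebraMap k (RatVars k n) t) n * schurPoly k n p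
      = ∑ m ∈ finsuppAntidiag (univ : Finset (Fin n)) n,
        (kostkaNumber p (m.embDomain Fin.valEmbedding) : RatVars k n) *
          symSum (xvar k) (algebraMap k (RatVars k n) t) n (m.embDomain Fin.valEmbedding) univ := by
  have ht' : algebraMap k (RatVars k n) t ≠ 1 := fun h =>
    ht ((algebraMap k (RatVars k n)).injective (h.trans (map_one _).symm))
  rw [← symSum_zero xvar_injective xvar_ne_zero ht' (A := univ) (by simp) (α := fun _ => 0)
    fun _ _ => rfl, symSum_univ, sum_mul]
  have h : ∀ w : Equiv.Perm (Fin n), (∏ i, (xvar k (w i) : RatVars k n) ^ 0) *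
      (∏ i, ∏ j ∈ Ioi i, cf (xvar k) (algebraMap k (RatVars k n) t) (w i) (w j)) * schurPoly k n p
      = ∑ m ∈ finsuppAntidiag (univ : Finset (Fin n)) n,
        (kostkaNumber p (m.embDomain Fin.valEmbedding) : RatVars k n) *
          ((∏ i, xvar k (w i) ^ m i) *
            ∏ i, ∏ j ∈ Ioi i, cf (xvar k) (algebraMap k (RatVars k n) t) (w i) (w j)) := by
    intro w
    rw [schurPoly_eq_perm p w, mul_sum]
    refine sum_congr rfl fun m _ => ?_
    simp only [pow_zero, prod_const_one]
    ring
  rw [sum_congr rfl fun w _ => h w, sum_comm]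
  refine sum_congr rfl fun m _ => ?_
  rw [symSum_univ, mul_sum]
  simp only [embDomain_val_apply]

/-- By `vFactor_mul_schurPoly`, a nonzero multiple of the Schur polynomial is a combination of
symmetrized monomials, which straighten to Hall-Littlewood polynomials. That `t` is no root of unity
keeps the normalizing factors nonzero. -/
lemma schurPoly_mem_span {t : k} (ht : ∀ j, j ≠ 0 → t ^ j ≠ 1) (p : n.Partition) :
    schurPoly k n p ∈ Submodule.span k (Set.range (hallLittlewoodP t : n.Partition → _)) := by
  have hsub : dominantSpan (xvar k : Fin n → RatVars k n) t n n univ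
      ≤ Submodule.span k (Set.range (hallLittlewoodP t : n.Partition → _)) := by
    refine Submodule.span_le.2 ?_
    rintro _ ⟨β, h1, h2, h3, rfl⟩
    obtain ⟨r, hr⟩ := exists_row_eq h1 h2 h3
    have := Submodule.smul_mem _ (vPart t r) (Submodule.subset_span (R := k)
      (Set.mem_range_self (f := (hallLittlewoodP t : n.Partition → _)) r))
    rwa [hallLittlewoodP_eq, smul_smul, mul_inv_cancel₀ (vPart_ne_zero ht r), one_smul, hr] at this
  have ht1 : t ≠ 1 := by simpa using ht 1 one_ne_zero
  have h := vFactor_mul_schurPoly ht1 p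
  rw [← map_vFactor, ← Algebra.smul_def] at h
  have hv := vFactor_ne_zero ht n
  rw [← inv_smul_smul₀ hv (schurPoly k n p), h]
  refine Submodule.smul_mem _ _ (Submodule.sum_mem _ fun m hm => ?_)
  rw [← nsmul_eq_mul]
  refine Submodule.smul_of_tower_mem _ _ (hsub ?_)
  have h1 := symSum_mem_dominantSpan (k := k) (xvar_injective (k := k) (n := n)) t n univ
    (m.embDomain Fin.valEmbedding)
  rw [mem_finsuppAntidiag] at hm
  rwa [← Fin.sum_univ_eq_sum_range, sum_congr rfl fun i _ => embDomain_val_apply m i, hm.1] at h1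

/-- The polynomial underlying a Schur polynomial. -/
def schurMvPoly (n : ℕ) (p : n.Partition) : MvPolynomial (Fin n) Qq :=
  ∑ m ∈ finsuppAntidiag (univ : Finset (Fin n)) n,
    MvPolynomial.monomial m (kostkaNumber p (m.embDomain Fin.valEmbedding) : Qq)

lemma algebraMap_schurMvPoly (p : n.Partition) :
    algebraMap _ (RatVars Qq n) (schurMvPoly n p) = schurPoly Qq n p := by
  rw [schurMvPoly, schurPoly, map_sum]
  refine sum_congr rfl fun m _ => ?_
  rw [MvPolynomial.monomial_eq, Finsupp.prod_fintype _ _ fun i => pow_zero _]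
  simp [xvar, map_prod]

lemma linearIndependent_schurPoly : LinearIndependent Qq (schurPoly Qq n : n.Partition → RatVars Qq n) := by
  rw [Fintype.linearIndependent_iff]
  intro c hc
  have h1 : ∑ p, c p • schurMvPoly n p = 0 := by
    refine IsFractionRing.injective (MvPolynomial (Fin n) Qq) (RatVars Qq n) ?_
    rw [map_zero, ← hc, map_sum]
    refine sum_congr rfl fun p _ => ?_
    rw [← algebraMap_schurMvPoly, MvPolynomial.smul_eq_C_mul, map_mul, Algebra.smul_def]
    rfl
  have h2 : Matrix.vecMul c (kostkaMatrix n) = 0 := by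
    funext r
    have h := congrArg (MvPolynomial.coeff
      (Finsupp.equivFunOnFinite.symm fun i : Fin n => row r i)) h1
    rw [MvPolynomial.coeff_sum, MvPolynomial.coeff_zero] at h
    rw [Pi.zero_apply, ← h]
    change ∑ p, c p * kostkaMatrix n p r = _
    refine sum_congr rfl fun p _ => ?_
    have hmem : Finsupp.equivFunOnFinite.symm (fun i : Fin n => row r i)
        ∈ finsuppAntidiag (univ : Finset (Fin n)) n := by
      rw [mem_finsuppAntidiag]
      refine ⟨?_, subset_univ _⟩
      simp only [Finsupp.coe_equivFunOnFinite_symm]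
      rw [Fin.sum_univ_eq_sum_range, sum_row]
    have hw : (Finsupp.equivFunOnFinite.symm fun i : Fin n => row r i).embDomain Fin.valEmbedding
        = rowWeight r := by
      ext i
      rcases Nat.lt_or_ge i n with hi | hi
      · exact embDomain_val_apply _ ⟨i, hi⟩
      · rw [embDomain_val_eq_zero _ hi, rowWeight_apply, row_eq_zero r hi]
    rw [MvPolynomial.coeff_smul, schurMvPoly, MvPolynomial.coeff_sum, smul_eq_mul]
    simp only [MvPolynomial.coeff_monomial, sum_ite_eq', hmem, if_true, hw, kostkaMatrix]
  have h3 := (Matrix.vecMul_injective_iff_isUnit.2 (isUnit_kostkaMatrix n))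
    (h2.trans (Matrix.zero_vecMul _).symm)
  exact fun p => congrFun h3 p

/-- A dimension count: the span contains the Schur polynomials, which are independent and equally
many. No analysis of leading terms is needed. -/
lemma linearIndependent_hallLittlewoodP {t : Qq} (ht : ∀ j, j ≠ 0 → t ^ j ≠ 1) :
    LinearIndependent Qq (hallLittlewoodP t : n.Partition → _) := by
  rw [linearIndependent_iff_card_le_finrank_span,
    ← finrank_span_eq_card (linearIndependent_schurPoly (n := n))]
  have : FiniteDimensional Qq
      (Submodule.span Qq (Set.range (hallLittlewoodP t : n.Partition → _))) :=
    FiniteDimensional.span_of_finite _ (Set.finite_range _)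
  refine Submodule.finrank_mono (Submodule.span_le.2 ?_)
  rintro _ ⟨p, rfl⟩
  exact schurPoly_mem_span ht p

lemma isKostkaFoulkes {t : Qq} (ht : ∀ j, j ≠ 0 → t ^ j ≠ 1) :
    IsKostkaFoulkes t (kostkaFoulkes t (n := n)) := by
  refine Classical.epsilon_spec (p := IsKostkaFoulkes t (n := n)) ?_
  have := fun p : n.Partition => (Submodule.mem_span_range_iff_exists_fun Qq).1
    (schurPoly_mem_span ht p)
  choose K hK using this
  exact ⟨K, fun p => (hK p).symm⟩

lemma kostkaFoulkes_eq {t : Qq} (ht : ∀ j, j ≠ 0 → t ^ j ≠ 1) {p : n.Partition}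
    {c : n.Partition → Qq} (h : schurPoly Qq n p = ∑ r, c r • hallLittlewoodP t r) :
    kostkaFoulkes t p = c := by
  rw [isKostkaFoulkes ht p, ← sub_eq_zero, ← sum_sub_distrib] at h
  simp only [← sub_smul] at h
  funext r
  exact sub_eq_zero.1 (Fintype.linearIndependent_iff.1 (linearIndependent_hallLittlewoodP ht) _ h r)

lemma kostkaNumber_oneRow {m : Fin n →₀ ℕ} (hm : ∑ i, m i = n) :
    kostkaNumber (oneRow n) (m.embDomain Fin.valEmbedding) = 1 := by
  rw [kostkaNumber_eq_tabCount _ _ fun i hi => embDomain_val_eq_zero m hi]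
  refine tabCount_of_rowLen_one ?_ ?_
  · rw [rowLen_diagram, row_oneRow, if_neg one_ne_zero]
  · rw [card_diagram, ← Fin.sum_univ_eq_sum_range, sum_congr rfl fun i _ => embDomain_val_apply m i,
      hm]

lemma schurPoly_oneRow : schurPoly k n (oneRow n) = completeH (xvar k) univ n := by
  rw [schurPoly, completeH]
  refine sum_congr rfl fun m hm => ?_
  rw [kostkaNumber_oneRow (mem_finsuppAntidiag.1 hm).1, Nat.cast_one, one_mul]

lemma kostkaNumber_oneColumn {m : Fin n →₀ ℕ} (hm : ∑ i, m i = n) :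
    kostkaNumber (oneColumn n) (m.embDomain Fin.valEmbedding)
      = if m = Finsupp.equivFunOnFinite.symm fun _ => 1 then 1 else 0 := by
  split_ifs with h
  · rw [← kostkaNumber_self (oneColumn n)]
    congr 1
    ext i
    rw [rowWeight_apply, row_oneColumn]
    split_ifs with hi
    · rw [show i = ((⟨i, hi⟩ : Fin n) : ℕ) from rfl, embDomain_val_apply, h]
      rfl
    · exact embDomain_val_eq_zero m (not_lt.1 hi)
  · by_contra h0
    rw [kostkaNumber_eq_tabCount _ _ fun i hi => embDomain_val_eq_zero m hi] at h0
    have h1 := le_one_of_tabCount_ne_zero (by rw [rowLen_diagram, row_oneColumn]; split_ifs <;> omega) h0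
    have h2 : ∀ i ∈ (univ : Finset (Fin n)), m i ≤ 1 := fun i _ => by
      rw [← embDomain_val_apply]; exact h1 i i.2
    have h3 := (sum_eq_sum_iff_of_le h2).1 (by rw [hm]; simp)
    exact h (Finsupp.ext fun i => h3 i (mem_univ i))

lemma schurPoly_oneColumn : schurPoly k n (oneColumn n) = ∏ i, xvar k i := by
  rw [schurPoly, sum_eq_single (Finsupp.equivFunOnFinite.symm fun _ => 1)]
  · rw [kostkaNumber_oneColumn (by simp), if_pos rfl]
    simp
  · intro m hm hne
    rw [kostkaNumber_oneColumn (mem_finsuppAntidiag.1 hm).1, if_neg hne, Nat.cast_zero, zero_mul]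
  · intro h
    exact absurd (mem_finsuppAntidiag.2 ⟨by simp, subset_univ _⟩) h

/-- All exponents are one, so the product of the variables factors out of the symmetrization, and
the symmetrization of `1` cancels the normalizing factor. -/
lemma hallLittlewoodP_oneColumn {t : k} (ht : ∀ j, j ≠ 0 → t ^ j ≠ 1) :
    hallLittlewoodP t (oneColumn n) = ∏ i, xvar k i := by
  have ht1 : algebraMap k (RatVars k n) t ≠ 1 := fun h => by
    have h1 := ht 1 one_ne_zero
    rw [pow_one] at h1
    exact h1 ((algebraMap k (RatVars k n)).injective (h.trans (map_one _).symm))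
  have hv : vPart t (oneColumn n) = vFactor t n := by
    have h1 : ∀ i, i ≠ 1 → {j ∈ range n | row (oneColumn n) j = i} = ∅ := fun i hi => by
      refine filter_false_of_mem fun j hj => ?_
      rw [row_oneColumn, if_pos (mem_range.1 hj)]
      exact hi.symm
    rw [vPart, prod_eq_single 1]
    · rw [filter_true_of_mem fun j hj => by rw [row_oneColumn, if_pos (mem_range.1 hj)], card_range]
    · intro i _ hi
      rw [h1 i hi, card_empty, vFactor_zero]
    · intro h
      have : n = 0 := by simpa using h
      subst this
      simp [vFactor_zero]
  have h1 := symSum_add_one (x := (xvar k : Fin n → RatVars k n))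
    (t := algebraMap k (RatVars k n) t) (S := univ) (N := n) (by simp) (α := fun _ => 0)
  rw [symSum_zero xvar_injective xvar_ne_zero ht1 (by simp) fun _ _ => rfl] at h1
  rw [hallLittlewoodP_eq, hv, symSum_congr (β := fun i => 0 + 1) fun i hi => by
    rw [row_oneColumn, if_pos hi], h1, ← map_vFactor, mul_comm, ← Algebra.smul_def,
    inv_smul_smul₀ (vFactor_ne_zero ht n)]

theorem kostkaFoulkes_oneColumn {t : Qq} (ht : ∀ j, j ≠ 0 → t ^ j ≠ 1) (r : n.Partition) :
    kostkaFoulkes t (oneColumn n) r = if r = oneColumn n then 1 else 0 := by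
  rw [kostkaFoulkes_eq ht (c := fun r => if r = oneColumn n then 1 else 0)]
  rw [schurPoly_oneColumn, ← hallLittlewoodP_oneColumn ht]
  simp

/-- The one-row Schur polynomial is complete symmetric, and `completeH_eq_sum_symSum` is its
expansion; the Hall-Littlewood polynomials are independent, so the coefficients can be read off. -/
theorem kostkaFoulkes_oneRow {t : Qq} (ht : ∀ j, j ≠ 0 → t ^ j ≠ 1) (r : n.Partition) :
    kostkaFoulkes t (oneRow n) r = t ^ nStat r := by
  rw [kostkaFoulkes_eq ht (c := fun r => t ^ nStat r)]
  have ht1 : algebraMap Qq (RatVars Qq n) t ≠ 1 := fun h => by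
    have h1 := ht 1 one_ne_zero
    rw [pow_one] at h1
    exact h1 ((algebraMap Qq (RatVars Qq n)).injective (h.trans (map_one _).symm))
  rw [schurPoly_oneRow, completeH_eq_sum_symSum xvar_injective xvar_ne_zero
    (t := algebraMap Qq (RatVars Qq n) t) (fun m => by
      rw [← map_vFactor]
      exact (_root_.map_ne_zero _).2 (vFactor_ne_zero ht m)) ht1 (Nat.lt_succ_self n) (N := n) (A := univ) (by simp)]
  symm
  refine sum_bij (fun r _ => rowWeight r) ?_ ?_ ?_ ?_
  · intro r _
    exact mem_dominantWeights.2 ⟨sum_row r, fun i hi => row_eq_zero r hi, row_antitone r⟩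
  · intro r _ r' _ h
    exact row_injective (congrArg (fun f : ℕ →₀ ℕ => (f : ℕ → ℕ)) h)
  · intro α hα
    obtain ⟨h1, h2, h3⟩ := mem_dominantWeights.1 hα
    obtain ⟨r, hr⟩ := exists_row_eq h3 h2 h1
    exact ⟨r, mem_univ _, DFunLike.coe_injective hr⟩
  · intro r _
    rw [hallLittlewoodP_eq, smul_smul, Algebra.smul_def, map_mul, map_pow, map_inv₀, map_vPart]
    rfl

lemma inv_q_pow_ne_one {j : ℕ} (hj : j ≠ 0) : (q⁻¹ : Qq) ^ j ≠ 1 := by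
  rw [inv_pow, Ne, inv_eq_one]
  intro h
  have h1 : (algebraMap ℚ[X] Qq) (X ^ j) = algebraMap ℚ[X] Qq 1 := by
    rw [map_pow, RatFunc.algebraMap_X, map_one]; exact h
  have h2 := congrArg natDegree (IsFractionRing.injective ℚ[X] Qq h1)
  rw [natDegree_X_pow, natDegree_one] at h2
  exact hj h2

end KostkaFoulkes

/-! ## The Schur expansion of the generating function -/

namespace FinQuiver

variable {I Ω : Type*} [Fintype I] [DecidableEq I] [Fintype Ω] (Γ : FinQuiver I Ω)

/-- The Schur coefficients of `omegaSeries`. -/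
def omegaCoeff (v : I → ℕ) (μ : (i : I) → (v i).Partition) : Qq :=
  ∑ π : ((i : I) → (v i).Partition), Γ.huaTerm π *
    ∏ i, (q ^ nStat (π i) * kostkaFoulkes (q⁻¹ : Qq) (μ i) (π i))

lemma isSchurExpansion_omegaSeries : IsSchurExpansion Γ.omegaSeries Γ.omegaCoeff := by
  intro m
  change ∑ π : ((i : I) → (multidegree m i).Partition),
    Γ.huaTerm π * ∏ i, MvPowerSeries.coeff (m.curry i) (hallLittlewoodH (π i)) = _
  simp only [omegaCoeff, sum_mul]
  rw [sum_comm]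
  refine sum_congr rfl fun π _ => ?_
  simp only [hallLittlewoodH, map_sum, map_smul, smul_eq_mul]
  rw [prod_univ_sum, Fintype.piFinset_univ, mul_sum]
  refine sum_congr rfl fun μ _ => ?_
  rw [prod_mul_distrib, mul_assoc]

lemma existsUnique_genFun : ∃! c, IsSchurExpansion Γ.genFun c := by
  obtain ⟨c, hc⟩ := (existsUnique_isSchurExpansion
    Γ.isSchurExpansion_omegaSeries.isSymm.plethLog).exists
  exact existsUnique_isSchurExpansion (hc.smul (q - 1)).isSymm

/-- The sum of the Hua terms of all multipartitions of given size. -/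
def huaSum (v : I → ℕ) : Qq := ∑ π : ((i : I) → (v i).Partition), Γ.huaTerm π

/-- The factor `q^{n(π)}` of the transformed Hall-Littlewood function cancels the Kostka-Foulkes
polynomial `q^{-n(π)}`. -/
lemma omegaCoeff_oneRow (v : I → ℕ) : Γ.omegaCoeff v (fun i => oneRow (v i)) = Γ.huaSum v := by
  refine sum_congr rfl fun π _ => ?_
  have hq : (q : Qq) ≠ 0 := RatFunc.X_ne_zero
  simp only [kostkaFoulkes_oneRow fun _ => inv_q_pow_ne_one, ← mul_pow, mul_inv_cancel₀ hq,
    one_pow, prod_const_one, mul_one]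

theorem schurCoeff_oneRow (v : I → ℕ) : Γ.schurCoeff (fun i => oneRow (v i))
    = (q - 1) * MvPowerSeries.coeff (Finsupp.equivFunOnFinite.symm v)
        (plethLog (seriesOf Γ.huaSum)) := by
  obtain ⟨c, hc⟩ := (existsUnique_isSchurExpansion
    Γ.isSchurExpansion_omegaSeries.isSymm.plethLog).exists
  rw [schurCoeff, genFun, hallSchur_eq (hc.smul (q - 1)),
    plethLog_oneRow Γ.isSchurExpansion_omegaSeries hc]
  simp only [omegaCoeff_oneRow]

lemma count_oneColumn (n j : ℕ) : (oneColumn n).parts.count j = if j = 1 then n else 0 := by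
  rw [parts_oneColumn, Multiset.count_replicate]
  simp only [eq_comm]

lemma pairing_oneColumn (a b : ℕ) : pairing (oneColumn a) (oneColumn b) = a * b := by
  rw [pairing]
  rcases Nat.eq_zero_or_pos a with rfl | ha
  · simp
  rcases Nat.eq_zero_or_pos b with rfl | hb
  · simp
  rw [sum_eq_single_of_mem 1 (by simp; omega), sum_eq_single_of_mem 1 (by simp; omega)]
  · simp [count_oneColumn]
  · intro j _ hj
    simp [count_oneColumn, hj]
  · intro i _ hi
    simp [count_oneColumn, hi]

lemma nStat_oneColumn (n : ℕ) : nStat (oneColumn n) = ∑ i ∈ range n, i :=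
  sum_congr rfl fun i hi => by rw [row_oneColumn, if_pos (mem_range.1 hi), mul_one]

/-- Only the tuple of columns contributes. Comparing powers of `q` uses that `(γ(v) + δ(v)) / 2` for
the double quiver equals `∑_i (v_i² - binom(v_i, 2)) - ∑_{i → j} v_i v_j`. -/
lemma omegaCoeff_oneColumn (v : I → ℕ) : (-1) ^ (∑ i, v i) * Γ.omegaCoeff v (fun i => oneColumn (v i))
    = MvPowerSeries.coeff (Finsupp.equivFunOnFinite.symm v) Γ.double.dtSeries := by
  have hq : (q : Qq) ≠ 0 := RatFunc.X_ne_zero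
  have h1 : Γ.omegaCoeff v (fun i => oneColumn (v i))
      = Γ.huaTerm (fun i => oneColumn (v i)) * ∏ i, q ^ nStat (oneColumn (v i)) := by
    rw [omegaCoeff, sum_eq_single fun i => oneColumn (v i)]
    · simp [kostkaFoulkes_oneColumn fun _ => inv_q_pow_ne_one]
    · intro π _ hπ
      obtain ⟨i, hi⟩ := Function.ne_iff.1 hπ
      rw [prod_eq_zero (mem_univ i), mul_zero]
      rw [kostkaFoulkes_oneColumn fun _ => inv_q_pow_ne_one, if_neg hi, mul_zero]
    · simp
  change _ = (-1) ^ (∑ i, v i) * q ^ (-((Γ.double.gammaForm v + ∑ i, (v i : ℤ)) / 2)) /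
    ∏ i, ∏ j ∈ Icc 1 (v i), (1 - (q⁻¹) ^ j)
  have h2 : ∀ i, ∏ k ∈ Icc 1 (v i), ∏ j ∈ Icc 1 ((oneColumn (v i)).parts.count k),
      (1 - (q⁻¹ : Qq) ^ j) = ∏ j ∈ Icc 1 (v i), (1 - (q⁻¹ : Qq) ^ j) := by
    intro i
    rcases Nat.eq_zero_or_pos (v i) with hv | hv
    · rw [hv]; simp
    · rw [prod_eq_single_of_mem 1 (by simp; omega)]
      · simp [count_oneColumn]
      · intro j _ hj
        simp [count_oneColumn, hj]
  have h3 : (Γ.double.gammaForm v + ∑ i, (v i : ℤ)) / 2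
      = ∑ i, ((v i : ℤ) * v i - ∑ j ∈ range (v i), (j : ℤ))
        - ∑ a : Ω, (v (Γ.src a) : ℤ) * v (Γ.tgt a) := by
    refine Int.ediv_eq_of_eq_mul_left two_ne_zero ?_
    have e1 : ∀ i, 2 * ∑ j ∈ range (v i), (j : ℤ) = v i * v i - v i := by
      intro i
      induction v i with
      | zero => simp
      | succ n ih => rw [sum_range_succ, mul_add, ih]; push_cast; ring
    have e2 : ∑ a : Ω ⊕ Ω, (v (Γ.double.src a) : ℤ) * v (Γ.double.tgt a)
        = 2 * ∑ a : Ω, (v (Γ.src a) : ℤ) * v (Γ.tgt a) := by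
      rw [Fintype.sum_sum_type, two_mul]
      congr 1
      exact sum_congr rfl fun a _ => mul_comm _ _
    rw [gammaForm, e2, sub_mul, sum_mul]
    have e3 : ∀ i, ((v i : ℤ) * v i - ∑ j ∈ range (v i), (j : ℤ)) * 2 = v i ^ 2 + v i := by
      intro i
      linear_combination -e1 i
    rw [sum_congr rfl fun i _ => e3 i, sum_add_distrib]
    ring
  rw [h1, huaTerm, h3]
  simp only [h2, pairing_oneColumn, nStat_oneColumn, prod_mul_distrib, prod_pow_eq_pow_sum]
  rw [← zpow_natCast, ← zpow_natCast, ← zpow_natCast, neg_sub, sum_sub_distrib, ← sub_add,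
    zpow_add₀ hq, zpow_sub₀ hq]
  push_cast
  have hz : (q : Qq) ^ (∑ i, (v i : ℤ) * v i) ≠ 0 := zpow_ne_zero _ hq
  field_simp
  congr 1
  rw [← zpow_natCast]
  push_cast
  rfl

theorem dtInvariant_eq_schurCoeff (v : I → ℕ) :
    Γ.dtInvariant v = Γ.schurCoeff (fun i => oneColumn (v i)) := by
  obtain ⟨c, hc⟩ := (existsUnique_isSchurExpansion
    Γ.isSchurExpansion_omegaSeries.isSymm.plethLog).exists
  have h := plethLog_oneColumn Γ.isSchurExpansion_omegaSeries hc v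
  simp only [omegaCoeff_oneColumn] at h
  have h2 : seriesOf (fun w => MvPowerSeries.coeff (Finsupp.equivFunOnFinite.symm w)
      Γ.double.dtSeries) = Γ.double.dtSeries := by
    ext m
    change MvPowerSeries.coeff (Finsupp.equivFunOnFinite.symm m) Γ.double.dtSeries = _
    rw [show Finsupp.equivFunOnFinite.symm (m : I → ℕ) = m from Finsupp.ext fun _ => rfl]
  rw [h2] at h
  rw [schurCoeff, genFun, hallSchur_eq (hc.smul (q - 1)), dtInvariant, map_smul, ← h, smul_eq_mul]
  have h3 : ((-1 : Qq) ^ (∑ i, v i)) * (-1) ^ (∑ i, v i) = 1 := by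
    rw [← mul_pow]; simp
  linear_combination (q - 1) * c v (fun i => oneColumn (v i)) * h3

end FinQuiver

/-! ## Direct sum decompositions of modules -/

section KrullSchmidt

variable {A M N X Y : Type*} [Ring A] [AddCommGroup M] [Module A M] [AddCommGroup N] [Module A N]
  [AddCommGroup X] [Module A X] [AddCommGroup Y] [Module A Y]

/-- A module with a retraction onto `M` is the direct sum of `M` and the kernel. -/
def splitEquiv (s : N →ₗ[A] M) (i : M →ₗ[A] N) (h : ∀ m, s (i m) = m) :
    N ≃ₗ[A] M × LinearMap.ker s where
  toFun n := (s n, ⟨n - i (s n), by simp [h]⟩)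
  map_add' a b := by
    ext
    · simp
    · simp; abel
  map_smul' a b := by
    ext
    · simp
    · simp [smul_sub]
  invFun y := i y.1 + y.2
  left_inv n := by simp
  right_inv := by
    rintro ⟨m, k, hk⟩
    rw [LinearMap.mem_ker] at hk
    ext <;> simp [h, hk]

/-- Every endomorphism is invertible or nilpotent. -/
def IsFittingLocal (A M : Type*) [Ring A] [AddCommGroup M] [Module A M] : Prop :=
  ∀ f : Module.End A M, IsUnit f ∨ IsNilpotent f

/-- Fitting's lemma: for large exponents the module is the direct sum of the kernel and the range of
the power. -/
lemma isFittingLocal_of_indecomposable [IsNoetherian A M] [IsArtinian A M]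
    (h : ∀ U W : Submodule A M, IsCompl U W → U = ⊥ ∨ W = ⊥) : IsFittingLocal A M := by
  intro f
  obtain ⟨n, hn⟩ := Filter.eventually_atTop.1 f.eventually_isCompl_ker_pow_range_pow
  -- The exponent is made positive so that injectivity of the power yields injectivity of `f`
  -- itself.
  have h1 := hn (n + 1) (Nat.le_succ n)
  rcases h _ _ h1 with h2 | h2
  · left
    have h3 : Function.Injective (f ^ (n + 1)) := LinearMap.ker_eq_bot.1 h2
    have h4 : Function.Injective f := by
      intro a b hab
      apply h3
      rw [pow_succ, Module.End.mul_apply, Module.End.mul_apply, hab]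
    rw [Module.End.isUnit_iff]
    exact IsArtinian.bijective_of_injective_endomorphism f h4
  · exact Or.inr ⟨n + 1, LinearMap.range_eq_bot.1 h2⟩

lemma isUnit_add_or (hM : IsFittingLocal A M) {f g : Module.End A M} (h : f + g = 1) :
    IsUnit f ∨ IsUnit g := by
  rcases hM f with hf | hf
  · exact Or.inl hf
  · right
    rw [show g = 1 - f by rw [← h]; abel]
    exact hf.isUnit_one_sub

/-- A retract with a map that is invertible on `M` splits off `M`. -/
lemma exists_split_of_isUnit {a : M →ₗ[A] N} {b : N →ₗ[A] M} (h : IsUnit (b ∘ₗ a : Module.End A M)) :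
    ∃ s : N →ₗ[A] M, Nonempty (N ≃ₗ[A] M × LinearMap.ker s) := by
  obtain ⟨u, hu⟩ := h
  refine ⟨(u⁻¹ : (Module.End A M)ˣ).val ∘ₗ b, ⟨splitEquiv _ a fun m => ?_⟩⟩
  change ((u⁻¹ : (Module.End A M)ˣ).val * (b ∘ₗ a : Module.End A M)) m = m
  rw [← hu, Units.inv_mul]
  rfl

/-- A direct summand of a direct sum with local endomorphism ring is a summand of a summand. -/
theorem exists_split_of_prod (hM : IsFittingLocal A M) (e : (M × X) ≃ₗ[A] N × Y) :
    (∃ s : N →ₗ[A] M, Nonempty (N ≃ₗ[A] M × LinearMap.ker s)) ∨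
      ∃ s : Y →ₗ[A] M, Nonempty (Y ≃ₗ[A] M × LinearMap.ker s) := by
  let i : M →ₗ[A] N × Y := e.toLinearMap ∘ₗ LinearMap.inl A M X
  let p : N × Y →ₗ[A] M := LinearMap.fst A M X ∘ₗ e.symm.toLinearMap
  -- The identity of `M` is the sum of its two passages through `N` and through `Y`. By locality one
  -- of them is invertible, and the corresponding module splits.
  have h : ((p ∘ₗ LinearMap.inl A N Y) ∘ₗ (LinearMap.fst A N Y ∘ₗ i) : Module.End A M)
      + ((p ∘ₗ LinearMap.inr A N Y) ∘ₗ (LinearMap.snd A N Y ∘ₗ i)) = 1 := by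
    ext m
    simp only [LinearMap.add_apply, LinearMap.comp_apply, LinearMap.inl_apply, LinearMap.inr_apply,
      LinearMap.fst_apply, LinearMap.snd_apply, Module.End.one_apply]
    rw [← map_add, Prod.mk_add_mk, add_zero, zero_add]
    simp [i, p]
  rcases isUnit_add_or hM h with h | h
  · exact Or.inl (exists_split_of_isUnit h)
  · exact Or.inr (exists_split_of_isUnit h)

/-- The kernel of a map `(m, x) ↦ u m + b x` with `u` invertible. -/
lemma nonempty_equiv_ker {u : Module.End A M} (hu : IsUnit u) (b : X →ₗ[A] M) :
    Nonempty (X ≃ₗ[A] LinearMap.ker (u.coprod b)) := by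
  obtain ⟨u, rfl⟩ := hu
  have h1 : ∀ m, u.val (u⁻¹.val m) = m := fun m => by
    rw [← Module.End.mul_apply, Units.mul_inv]; rfl
  have h2 : ∀ m, u⁻¹.val (u.val m) = m := fun m => by
    rw [← Module.End.mul_apply, Units.inv_mul]; rfl
  refine ⟨LinearEquiv.ofBijective (LinearMap.codRestrict _
    (LinearMap.prod (-(u⁻¹.val ∘ₗ b)) LinearMap.id) fun x => ?_) ⟨fun x y h => ?_, ?_⟩⟩
  · simp [h1]
  · exact congrArg (fun z => z.1.2) h
  · rintro ⟨⟨m, x⟩, h⟩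
    rw [LinearMap.mem_ker, LinearMap.coprod_apply] at h
    refine ⟨x, Subtype.ext (Prod.ext ?_ rfl)⟩
    change -(u⁻¹.val (b x)) = m
    have h' : u.val m = -b x := eq_neg_of_add_eq_zero_left h
    rw [← h2 m, h', map_neg]

/-- Modules with local endomorphism ring cancel from direct sums. -/
theorem cancel_prod [IsNoetherian A M] (hM : IsFittingLocal A M) (e : (M × X) ≃ₗ[A] M × Y) :
    Nonempty (X ≃ₗ[A] Y) := by
  let s : M × X →ₗ[A] M := LinearMap.fst A M Y ∘ₗ e.toLinearMap
  let i : M →ₗ[A] M × X := e.symm.toLinearMap ∘ₗ LinearMap.inl A M Y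
  have hsi : ∀ m, s (i m) = m := fun m => by simp [s, i]
  have hY : Nonempty (Y ≃ₗ[A] LinearMap.ker s) := by
    refine ⟨LinearEquiv.ofBijective (LinearMap.codRestrict _
      (e.symm.toLinearMap ∘ₗ LinearMap.inr A M Y) fun y => by simp [s]) ⟨fun y y' h => ?_, ?_⟩⟩
    · have := congrArg (fun z => (e z.1).2) h
      change (e (e.symm (0, y))).2 = (e (e.symm (0, y'))).2 at this
      simpa using this
    · rintro ⟨z, hz⟩
      refine ⟨(e z).2, Subtype.ext ?_⟩
      have h1 : (e z).1 = 0 := hz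
      change e.symm (0, (e z).2) = z
      rw [← h1]
      exact e.symm_apply_apply z
  let a : Module.End A M := s ∘ₗ LinearMap.inl A M X
  let b : X →ₗ[A] M := s ∘ₗ LinearMap.inr A M X
  have hs : s = a.coprod b := by
    ext <;> simp [a, b]
  -- The shear `(m, x) ↦ (m, x + t m)` carries the kernel of `(a + b t, b)` to the kernel of `s`,
  -- and the former is isomorphic to `X` as soon as `a + b t` is invertible.
  suffices h : ∃ t : M →ₗ[A] X, IsUnit (a + b ∘ₗ t : Module.End A M) by
    obtain ⟨t, ht⟩ := h
    obtain ⟨eX⟩ := nonempty_equiv_ker ht b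
    obtain ⟨eY⟩ := hY
    have hc : ∀ m x, (a + b ∘ₗ t).coprod b (m, x) = s (m, x + t m) := fun m x => by
      rw [hs]; simp; abel
    let f : LinearMap.ker ((a + b ∘ₗ t).coprod b) →ₗ[A] LinearMap.ker s :=
      LinearMap.codRestrict _ ((LinearMap.prod (LinearMap.fst A M X)
        (LinearMap.snd A M X + t ∘ₗ LinearMap.fst A M X)) ∘ₗ Submodule.subtype _) fun z => by
      obtain ⟨⟨m, x⟩, hz⟩ := z
      rw [LinearMap.mem_ker, hc] at hz
      exact hz
    have hf : Function.Bijective f := by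
      constructor
      · rintro ⟨⟨m, x⟩, hz⟩ ⟨⟨m', x'⟩, hz'⟩ h
        have h1 : m = m' := congrArg (fun z => z.1.1) h
        have h2 : x + t m = x' + t m' := congrArg (fun z => z.1.2) h
        subst h1
        rw [add_left_inj] at h2
        subst h2
        rfl
      · rintro ⟨⟨m, x⟩, hz⟩
        rw [LinearMap.mem_ker] at hz
        refine ⟨⟨(m, x - t m), ?_⟩, Subtype.ext (Prod.ext rfl ?_)⟩
        · rw [LinearMap.mem_ker, hc, sub_add_cancel, hz]
        · exact sub_add_cancel x (t m)
    exact ⟨eX.trans ((LinearEquiv.ofBijective f hf).trans eY.symm)⟩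
  by_cases ha : IsUnit a
  · exact ⟨0, by simpa using ha⟩
  -- With `t` the second component of the section, `b t = 1 - a ∘ (fst ∘ i)`. Hence `a + b t` is `1`
  -- minus a left multiple of the non-invertible `a`, which is not invertible and so nilpotent.
  · refine ⟨LinearMap.snd A M X ∘ₗ i, ?_⟩
    have h1 : (b ∘ₗ (LinearMap.snd A M X ∘ₗ i) : Module.End A M)
        = 1 - a * (LinearMap.fst A M X ∘ₗ i : Module.End A M) := by
      rw [eq_sub_iff_add_eq]
      ext m
      have h2 := hsi m
      rw [hs, LinearMap.coprod_apply] at h2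
      rw [LinearMap.add_apply, Module.End.mul_apply, add_comm]
      exact h2
    have h3 : ¬ IsUnit (a * ((LinearMap.fst A M X ∘ₗ i : Module.End A M) - 1)) := by
      intro h
      apply ha
      rw [Module.End.isUnit_iff] at h ⊢
      refine IsNoetherian.bijective_of_surjective_endomorphism a fun m => ?_
      obtain ⟨m', hm'⟩ := h.2 m
      exact ⟨_, hm'⟩
    have h4 := ((hM _).resolve_left h3).isUnit_one_sub
    have h5 : a + (b ∘ₗ (LinearMap.snd A M X ∘ₗ i) : Module.End A M)
        = 1 - a * ((LinearMap.fst A M X ∘ₗ i : Module.End A M) - 1) := by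
      rw [h1, mul_sub, mul_one]
      abel
    rw [h5]
    exact h4

end KrullSchmidt

/-! ## Counting homomorphisms -/

section Lovasz

variable {A : Type*} [Ring A]

instance instFiniteLinearMap {M N : Type*} [AddCommGroup M] [Module A M] [AddCommGroup N]
    [Module A N] [Finite M] [Finite N] : Finite (M →ₗ[A] N) :=
  Finite.of_injective (fun f => (f : M → N)) DFunLike.coe_injective

/-- Homomorphisms with given kernel are injective homomorphisms from the quotient. -/
def kerEquiv {X M : Type*} [AddCommGroup X] [Module A X] [AddCommGroup M] [Module A M]
    (U : Submodule A X) :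
    {f : X →ₗ[A] M // LinearMap.ker f = U} ≃ {f : (X ⧸ U) →ₗ[A] M // Function.Injective f} where
  toFun f := ⟨U.liftQ f.1 f.2.ge, by
    rw [← LinearMap.ker_eq_bot]
    exact Submodule.ker_liftQ_eq_bot _ _ _ f.2.le⟩
  invFun g := ⟨g.1 ∘ₗ U.mkQ, by
    rw [LinearMap.ker_comp, LinearMap.ker_eq_bot.2 g.2, Submodule.comap_bot, Submodule.ker_mkQ]⟩
  left_inv f := by
    ext
    rfl
  right_inv g := by
    apply Subtype.ext
    ext
    rfl

lemma card_hom_eq_sum (X M : Type*) [AddCommGroup X] [Module A X] [AddCommGroup M] [Module A M]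
    [Finite X] [Finite M] [Fintype (Submodule A X)] :
    Nat.card (X →ₗ[A] M)
      = ∑ U : Submodule A X, Nat.card {f : (X ⧸ U) →ₗ[A] M // Function.Injective f} := by
  rw [← Nat.card_congr (Equiv.sigmaFiberEquiv (LinearMap.ker : (X →ₗ[A] M) → Submodule A X)),
    Nat.card_sigma]
  exact sum_congr rfl fun U _ => Nat.card_congr (kerEquiv U)

universe u

variable {M N : Type u} [AddCommGroup M] [Module A M] [AddCommGroup N] [Module A N] [Finite M]
  [Finite N]

/-- Sort the homomorphisms by kernel: their number is a sum over submodules `U` of numbers of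
injections of the quotient by `U`. By induction on the size all terms with `U` nonzero agree, hence
so does the remaining one. -/
lemma card_injective_eq
    (h : ∀ (X : Type u) [AddCommGroup X] [Module A X] [Finite X],
      Nat.card (X →ₗ[A] M) = Nat.card (X →ₗ[A] N))
    (X : Type u) [AddCommGroup X] [Module A X] [Finite X] :
    Nat.card {f : X →ₗ[A] M // Function.Injective f}
      = Nat.card {f : X →ₗ[A] N // Function.Injective f} := by
  classical
  induction hn : Nat.card X using Nat.strong_induction_on generalizing X with
  | _ n ih =>
  subst hn
  have : Finite (Submodule A X) := Finite.of_injective _ (SetLike.coe_injective (B := X))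
  have := Fintype.ofFinite (Submodule A X)
  have h1 := h X
  rw [card_hom_eq_sum, card_hom_eq_sum, ← add_sum_erase _ _ (mem_univ ⊥),
    ← add_sum_erase _ _ (mem_univ ⊥)] at h1
  have h2 : ∀ U ∈ (univ : Finset (Submodule A X)).erase ⊥,
      Nat.card {f : (X ⧸ U) →ₗ[A] M // Function.Injective f}
        = Nat.card {f : (X ⧸ U) →ₗ[A] N // Function.Injective f} := by
    intro U hU
    have : Finite (X ⧸ U) := Finite.of_surjective _ U.mkQ_surjective
    refine ih _ ?_ _ rfl
    have hcard := Submodule.card_eq_card_quotient_mul_card U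
    have hU1 : 1 < Nat.card U := by
      rw [Finite.one_lt_card_iff_nontrivial]
      exact Submodule.nontrivial_iff_ne_bot.2 (mem_erase.1 hU).1
    have h0 : 0 < Nat.card (X ⧸ U) := Nat.card_pos
    rw [hcard]
    nlinarith
  rw [sum_congr rfl h2, add_left_inj] at h1
  have h3 : ∀ (P : Type u) [AddCommGroup P] [Module A P],
      Nat.card {f : (X ⧸ (⊥ : Submodule A X)) →ₗ[A] P // Function.Injective f}
        = Nat.card {f : X →ₗ[A] P // Function.Injective f} := by
    intro P _ _
    let e := Submodule.quotEquivOfEqBot (⊥ : Submodule A X) rfl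
    refine Nat.card_congr ⟨fun f => ⟨f.1 ∘ₗ e.symm.toLinearMap, f.2.comp e.symm.injective⟩,
      fun f => ⟨f.1 ∘ₗ e.toLinearMap, f.2.comp e.injective⟩, fun f => ?_, fun f => ?_⟩
    · apply Subtype.ext
      ext x
      simp
    · apply Subtype.ext
      ext x
      simp
  rwa [h3, h3] at h1

/-- Finite modules are determined by the numbers of homomorphisms into them. -/
theorem nonempty_equiv_of_card_hom_eq
    (h : ∀ (X : Type u) [AddCommGroup X] [Module A X] [Finite X],
      Nat.card (X →ₗ[A] M) = Nat.card (X →ₗ[A] N)) : Nonempty (M ≃ₗ[A] N) := by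
  have h1 : 0 < Nat.card {f : M →ₗ[A] N // Function.Injective f} := by
    rw [← card_injective_eq h M, Nat.card_pos_iff]
    exact ⟨⟨LinearMap.id, fun _ _ h => h⟩, inferInstance⟩
  have h2 : 0 < Nat.card {f : N →ₗ[A] M // Function.Injective f} := by
    rw [card_injective_eq h N, Nat.card_pos_iff]
    exact ⟨⟨LinearMap.id, fun _ _ h => h⟩, inferInstance⟩
  obtain ⟨⟨f, hf⟩⟩ := (Nat.card_pos_iff.1 h1).1
  obtain ⟨⟨g, hg⟩⟩ := (Nat.card_pos_iff.1 h2).1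
  refine ⟨LinearEquiv.ofBijective f ((Nat.bijective_iff_injective_and_card f).2 ⟨hf, ?_⟩)⟩
  exact le_antisymm (Nat.card_le_card_of_injective f hf) (Nat.card_le_card_of_injective g hg)

/-- Finite modules cancel from direct sums. -/
theorem cancel_prod_of_finite (P : Type u) [AddCommGroup P] [Module A P] [Finite P]
    (e : (P × M) ≃ₗ[A] P × N) : Nonempty (M ≃ₗ[A] N) := by
  refine nonempty_equiv_of_card_hom_eq fun X _ _ _ => ?_
  have h : ∀ (Q : Type u) [AddCommGroup Q] [Module A Q], Nat.card (X →ₗ[A] P × Q)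
      = Nat.card (X →ₗ[A] P) * Nat.card (X →ₗ[A] Q) := by
    intro Q _ _
    rw [← Nat.card_prod]
    exact Nat.card_congr (LinearMap.prodEquiv ℕ).toEquiv.symm
  have h1 : Nat.card (X →ₗ[A] P × M) = Nat.card (X →ₗ[A] P × N) :=
    Nat.card_congr ⟨fun f => e.toLinearMap ∘ₗ f, fun f => e.symm.toLinearMap ∘ₗ f,
      fun f => by ext x <;> simp, fun f => by ext x <;> simp⟩
  rw [h, h] at h1
  exact Nat.eq_of_mul_eq_mul_left Nat.card_pos h1

end Lovasz

/-! ## The path algebra -/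

namespace FinQuiver

variable {I Ω : Type*} [Fintype I] [DecidableEq I]

/-- The defining relations of the path algebra. -/
inductive PathRel (Γ : FinQuiver I Ω) (k : Type) [Field k] :
    FreeAlgebra k (I ⊕ Ω) → FreeAlgebra k (I ⊕ Ω) → Prop
  | idem (i : I) : PathRel Γ k (FreeAlgebra.ι k (Sum.inl i) * FreeAlgebra.ι k (Sum.inl i))
      (FreeAlgebra.ι k (Sum.inl i))
  | orth (i j : I) (h : i ≠ j) :
      PathRel Γ k (FreeAlgebra.ι k (Sum.inl i) * FreeAlgebra.ι k (Sum.inl j)) 0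
  | sum : PathRel Γ k (∑ i, FreeAlgebra.ι k (Sum.inl i)) 1
  | arrow (a : Ω) : PathRel Γ k (FreeAlgebra.ι k (Sum.inl (Γ.tgt a)) * FreeAlgebra.ι k (Sum.inr a) *
      FreeAlgebra.ι k (Sum.inl (Γ.src a))) (FreeAlgebra.ι k (Sum.inr a))

/-- The path algebra of a quiver. -/
abbrev PathAlg (Γ : FinQuiver I Ω) (k : Type) [Field k] : Type _ := RingQuot (PathRel Γ k)

variable (Γ : FinQuiver I Ω) (k : Type) [Field k]

/-- The idempotent of a vertex. -/
def vert (i : I) : PathAlg Γ k := RingQuot.mkAlgHom k (PathRel Γ k) (FreeAlgebra.ι k (Sum.inl i))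

/-- The element of an arrow. -/
def arr (a : Ω) : PathAlg Γ k := RingQuot.mkAlgHom k (PathRel Γ k) (FreeAlgebra.ι k (Sum.inr a))

lemma vert_mul_self (i : I) : vert Γ k i * vert Γ k i = vert Γ k i := by
  rw [vert, ← map_mul]
  exact RingQuot.mkAlgHom_rel k (PathRel.idem i)

lemma vert_mul_of_ne {i j : I} (h : i ≠ j) : vert Γ k i * vert Γ k j = 0 := by
  rw [vert, vert, ← map_mul, RingQuot.mkAlgHom_rel k (PathRel.orth i j h), map_zero]

lemma sum_vert : ∑ i, vert Γ k i = 1 := by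
  simp only [vert]
  rw [← map_sum, RingQuot.mkAlgHom_rel k PathRel.sum, map_one]

lemma vert_mul_arr_mul_vert (a : Ω) :
    vert Γ k (Γ.tgt a) * arr Γ k a * vert Γ k (Γ.src a) = arr Γ k a := by
  rw [vert, vert, arr, ← map_mul, ← map_mul]
  exact RingQuot.mkAlgHom_rel k (PathRel.arrow a)

variable {Γ k}

section Modules

variable {M N : Type*} [AddCommGroup M] [Module k M] [Module (PathAlg Γ k) M]
  [IsScalarTower k (PathAlg Γ k) M] [AddCommGroup N] [Module k N] [Module (PathAlg Γ k) N]
  [IsScalarTower k (PathAlg Γ k) N]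

/-- A linear map that commutes with the generators is linear over the path algebra. -/
def linearOfGenerators (f : M →ₗ[k] N) (h1 : ∀ i m, f (vert Γ k i • m) = vert Γ k i • f m)
    (h2 : ∀ a m, f (arr Γ k a • m) = arr Γ k a • f m) : M →ₗ[PathAlg Γ k] N where
  toFun := f
  map_add' := f.map_add
  map_smul' x m := by
    obtain ⟨y, rfl⟩ := RingQuot.mkAlgHom_surjective k (PathRel Γ k) x
    simp only [RingHom.id_apply]
    induction y using FreeAlgebra.induction generalizing m with
    | grade0 c =>
      rw [AlgHom.commutes, algebraMap_smul, algebraMap_smul, map_smul]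
    | grade1 s =>
      rcases s with i | a
      · exact h1 i m
      · exact h2 a m
    | mul a b ha hb => rw [map_mul, mul_smul, mul_smul, ha, hb]
    | add a b ha hb => rw [map_add, add_smul, add_smul, map_add, ha, hb]

end Modules

variable {v w : I → ℕ}

/-- The module of a representation. -/
def RepMod (_φ : Γ.Rep v k) : Type _ := (i : I) → Fin (v i) → k

instance (φ : Γ.Rep v k) : AddCommGroup (RepMod φ) :=
  inferInstanceAs (AddCommGroup ((i : I) → Fin (v i) → k))

instance (φ : Γ.Rep v k) : Module k (RepMod φ) :=
  inferInstanceAs (Module k ((i : I) → Fin (v i) → k))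

instance (φ : Γ.Rep v k) : FiniteDimensional k (RepMod φ) :=
  inferInstanceAs (FiniteDimensional k ((i : I) → Fin (v i) → k))

instance (φ : Γ.Rep v k) [Finite k] : Finite (RepMod φ) :=
  inferInstanceAs (Finite ((i : I) → Fin (v i) → k))

/-- The component of an element at a vertex. -/
def coord (φ : Γ.Rep v k) (i : I) : RepMod φ →ₗ[k] (Fin (v i) → k) :=
  LinearMap.proj (φ := fun i => Fin (v i) → k) i

/-- The element with a single nonzero component. -/
def single (φ : Γ.Rep v k) (i : I) : (Fin (v i) → k) →ₗ[k] RepMod φ :=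
  LinearMap.single k (fun i => Fin (v i) → k) i

/-- The element with given components. -/
def ofCoords (φ : Γ.Rep v k) {M : Type*} [AddCommGroup M] [Module k M]
    (f : (i : I) → M →ₗ[k] (Fin (v i) → k)) : M →ₗ[k] RepMod φ :=
  LinearMap.pi f

@[simp] lemma coord_ofCoords (φ : Γ.Rep v k) {M : Type*} [AddCommGroup M] [Module k M]
    (f : (i : I) → M →ₗ[k] (Fin (v i) → k)) (i : I) (m : M) :
    coord φ i (ofCoords φ f m) = f i m := rfl

@[simp] lemma coord_single (φ : Γ.Rep v k) (i : I) (y : Fin (v i) → k) :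
    coord φ i (single φ i y) = y :=
  Pi.single_eq_same (M := fun i => Fin (v i) → k) i y

lemma coord_single_of_ne (φ : Γ.Rep v k) {i j : I} (h : j ≠ i) (y : Fin (v i) → k) :
    coord φ j (single φ i y) = 0 :=
  Pi.single_eq_of_ne (M := fun i => Fin (v i) → k) h y

lemma repMod_ext {φ : Γ.Rep v k} {x y : RepMod φ} (h : ∀ i, coord φ i x = coord φ i y) : x = y :=
  funext h

lemma sum_single (φ : Γ.Rep v k) (x : RepMod φ) : ∑ i, single φ i (coord φ i x) = x :=
  Finset.univ_sum_single (M := fun i => Fin (v i) → k) x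

/-- The action of the vertex idempotents. -/
def vertEnd (φ : Γ.Rep v k) (i : I) : Module.End k (RepMod φ) := single φ i ∘ₗ coord φ i

/-- The action of the arrows. -/
def arrEnd (φ : Γ.Rep v k) (a : Ω) : Module.End k (RepMod φ) :=
  single φ (Γ.tgt a) ∘ₗ (φ a).mulVecLin ∘ₗ coord φ (Γ.src a)

lemma vertEnd_apply (φ : Γ.Rep v k) (i : I) (x : RepMod φ) :
    vertEnd φ i x = single φ i (coord φ i x) := rfl

lemma arrEnd_apply (φ : Γ.Rep v k) (a : Ω) (x : RepMod φ) :
    arrEnd φ a x = single φ (Γ.tgt a) ((φ a).mulVec (coord φ (Γ.src a) x)) := rfl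

/-- The action of the path algebra on the module of a representation. -/
def repAlgHom (φ : Γ.Rep v k) : PathAlg Γ k →ₐ[k] Module.End k (RepMod φ) :=
  RingQuot.liftAlgHom k ⟨FreeAlgebra.lift k (Sum.elim (vertEnd φ) (arrEnd φ)), by
    intro x y h
    induction h with
    | idem i =>
      rw [map_mul, FreeAlgebra.lift_ι_apply, Sum.elim_inl]
      refine LinearMap.ext fun x => ?_
      rw [Module.End.mul_apply, vertEnd_apply, vertEnd_apply, coord_single]
    | orth i j h =>
      rw [map_mul, FreeAlgebra.lift_ι_apply, FreeAlgebra.lift_ι_apply, Sum.elim_inl, Sum.elim_inl,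
        map_zero]
      refine LinearMap.ext fun x => ?_
      rw [Module.End.mul_apply, vertEnd_apply, vertEnd_apply, coord_single_of_ne φ h, map_zero,
        LinearMap.zero_apply]
    | sum =>
      rw [map_sum, map_one]
      refine LinearMap.ext fun x => ?_
      rw [LinearMap.sum_apply]
      simp only [FreeAlgebra.lift_ι_apply, Sum.elim_inl, vertEnd_apply]
      exact sum_single φ x
    | arrow a =>
      rw [map_mul, map_mul]
      simp only [FreeAlgebra.lift_ι_apply, Sum.elim_inl, Sum.elim_inr]
      refine LinearMap.ext fun x => ?_
      rw [Module.End.mul_apply, Module.End.mul_apply, vertEnd_apply, arrEnd_apply, vertEnd_apply,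
        arrEnd_apply, coord_single, coord_single]⟩

instance (φ : Γ.Rep v k) : Module (PathAlg Γ k) (RepMod φ) :=
  Module.compHom _ (repAlgHom φ).toRingHom

lemma smul_def_repMod (φ : Γ.Rep v k) (y : PathAlg Γ k) (x : RepMod φ) :
    y • x = repAlgHom φ y x := rfl

instance (φ : Γ.Rep v k) : IsScalarTower k (PathAlg Γ k) (RepMod φ) where
  smul_assoc c y x := by
    rw [smul_def_repMod, smul_def_repMod, map_smul, LinearMap.smul_apply]

lemma vert_smul (φ : Γ.Rep v k) (i : I) (x : RepMod φ) :
    vert Γ k i • x = single φ i (coord φ i x) := by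
  rw [smul_def_repMod, vert, repAlgHom, RingQuot.liftAlgHom_mkAlgHom_apply,
    FreeAlgebra.lift_ι_apply]
  rfl

lemma arr_smul (φ : Γ.Rep v k) (a : Ω) (x : RepMod φ) :
    arr Γ k a • x = single φ (Γ.tgt a) ((φ a).mulVec (coord φ (Γ.src a) x)) := by
  rw [smul_def_repMod, arr, repAlgHom, RingQuot.liftAlgHom_mkAlgHom_apply,
    FreeAlgebra.lift_ι_apply]
  rfl

instance (φ : Γ.Rep v k) : IsNoetherian (PathAlg Γ k) (RepMod φ) :=
  isNoetherian_of_tower k inferInstance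

instance (φ : Γ.Rep v k) : IsArtinian (PathAlg Γ k) (RepMod φ) :=
  isArtinian_of_tower k inferInstance

/-! ### Homomorphisms -/

/-- Intertwining families of matrices. -/
def Intertwiner (φ : Γ.Rep v k) (ψ : Γ.Rep w k) : Type _ :=
  {g : (i : I) → Matrix (Fin (w i)) (Fin (v i)) k //
    ∀ a, ψ a * g (Γ.src a) = g (Γ.tgt a) * φ a}

variable {φ : Γ.Rep v k} {ψ : Γ.Rep w k}

/-- The homomorphism of an intertwiner. -/
def Intertwiner.toHom (g : Intertwiner φ ψ) : RepMod φ →ₗ[PathAlg Γ k] RepMod ψ :=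
  linearOfGenerators (ofCoords ψ fun i => (g.1 i).mulVecLin ∘ₗ coord φ i)
    (fun i x => by
      rw [vert_smul, vert_smul]
      refine repMod_ext fun j => ?_
      by_cases h : j = i
      · subst h; simp
      · simp [coord_single_of_ne _ h])
    (fun a x => by
      rw [arr_smul, arr_smul]
      refine repMod_ext fun j => ?_
      by_cases h : j = Γ.tgt a
      · subst h; simp [g.2 a]
      · simp [coord_single_of_ne _ h])

lemma Intertwiner.coord_toHom (g : Intertwiner φ ψ) (x : RepMod φ) (i : I) :
    coord ψ i (g.toHom x) = (g.1 i).mulVec (coord φ i x) := rfl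

/-- The component of a homomorphism at a vertex. -/
def homComponent (f : RepMod φ →ₗ[PathAlg Γ k] RepMod ψ) (i : I) :
    (Fin (v i) → k) →ₗ[k] (Fin (w i) → k) :=
  coord ψ i ∘ₗ (f.restrictScalars k) ∘ₗ single φ i

lemma coord_hom (f : RepMod φ →ₗ[PathAlg Γ k] RepMod ψ) (x : RepMod φ) (i : I) :
    coord ψ i (f x) = homComponent f i (coord φ i x) := by
  have h := congrArg (coord ψ i) (f.map_smul (vert Γ k i) x)
  rw [vert_smul, vert_smul, coord_single] at h
  exact h.symm

/-- The intertwiner of a homomorphism. -/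
def intertwinerOfHom (f : RepMod φ →ₗ[PathAlg Γ k] RepMod ψ) : Intertwiner φ ψ :=
  ⟨fun i => LinearMap.toMatrix' (homComponent f i), fun a => by
    refine (LinearEquiv.injective Matrix.toLin') ?_
    rw [Matrix.toLin'_mul, Matrix.toLin'_mul, Matrix.toLin'_toMatrix', Matrix.toLin'_toMatrix']
    refine LinearMap.ext fun y => ?_
    have h := congrArg (coord ψ (Γ.tgt a)) (f.map_smul (arr Γ k a) (single φ (Γ.src a) y))
    rw [arr_smul, arr_smul] at h
    simp only [coord_hom, coord_single] at h
    exact h.symm⟩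

variable (φ ψ) in
/-- Homomorphisms of modules are intertwiners. -/
def homEquiv : (RepMod φ →ₗ[PathAlg Γ k] RepMod ψ) ≃ Intertwiner φ ψ where
  toFun := intertwinerOfHom
  invFun := Intertwiner.toHom
  left_inv f := by
    refine LinearMap.ext fun x => repMod_ext fun i => ?_
    rw [Intertwiner.coord_toHom, intertwinerOfHom, LinearMap.toMatrix'_mulVec, coord_hom]
  right_inv g := by
    refine Subtype.ext (funext fun i => (LinearEquiv.injective Matrix.toLin') ?_)
    refine (Matrix.toLin'_toMatrix' _).trans (LinearMap.ext fun y => ?_)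
    change coord ψ i (g.toHom (single φ i y)) = _
    rw [Intertwiner.coord_toHom, coord_single]
    rfl

lemma homComponent_comp {u : I → ℕ} {χ : Γ.Rep u k} (f : RepMod φ →ₗ[PathAlg Γ k] RepMod ψ)
    (f' : RepMod ψ →ₗ[PathAlg Γ k] RepMod χ) (i : I) :
    homComponent (f' ∘ₗ f) i = homComponent f' i ∘ₗ homComponent f i := by
  refine LinearMap.ext fun y => ?_
  change coord χ i (f' (f _)) = _
  rw [coord_hom f']
  rfl

lemma homComponent_id (i : I) :
    homComponent (LinearMap.id : RepMod φ →ₗ[PathAlg Γ k] RepMod φ) i = LinearMap.id :=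
  LinearMap.ext fun y => coord_single φ i y

/-- The component of an isomorphism at a vertex. -/
def equivComponent (e : RepMod φ ≃ₗ[PathAlg Γ k] RepMod ψ) (i : I) :
    (Fin (v i) → k) ≃ₗ[k] (Fin (w i) → k) :=
  LinearEquiv.ofLinearMap (homComponent e.toLinearMap i) (homComponent e.symm.toLinearMap i)
    (by rw [← homComponent_comp, LinearEquiv.comp_coe, LinearEquiv.symm_trans_self]
        exact homComponent_id i)
    (by rw [← homComponent_comp, LinearEquiv.comp_coe, LinearEquiv.self_trans_symm]
        exact homComponent_id i)

lemma dim_eq_of_equiv (e : RepMod φ ≃ₗ[PathAlg Γ k] RepMod ψ) : v = w := by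
  funext i
  have := (equivComponent e i).finrank_eq
  simpa using this

lemma repIso_of_equiv {φ ψ : Γ.Rep v k} (e : RepMod φ ≃ₗ[PathAlg Γ k] RepMod ψ) : RepIso φ ψ := by
  have h := (homEquiv φ ψ e.toLinearMap).2
  have h1 : ∀ i, (equivComponent e i).symm.toLinearMap ∘ₗ (equivComponent e i).toLinearMap
      = LinearMap.id := fun i => by ext; simp
  have h2 : ∀ i, (equivComponent e i).toLinearMap ∘ₗ (equivComponent e i).symm.toLinearMap
      = LinearMap.id := fun i => by ext; simp
  let g : (i : I) → GL (Fin (v i)) k := fun i =>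
    ⟨LinearMap.toMatrix' (equivComponent e i).toLinearMap,
      LinearMap.toMatrix' (equivComponent e i).symm.toLinearMap,
      by rw [← LinearMap.toMatrix'_comp, h2, LinearMap.toMatrix'_id],
      by rw [← LinearMap.toMatrix'_comp, h1, LinearMap.toMatrix'_id]⟩
  refine ⟨g, fun a => ?_⟩
  have h3 : ψ a * (g (Γ.src a)).val = (g (Γ.tgt a)).val * φ a := h a
  rw [← h3, Matrix.mul_assoc, Units.mul_inv, Matrix.mul_one]

lemma equiv_of_repIso {φ ψ : Γ.Rep v k} (h : RepIso φ ψ) :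
    Nonempty (RepMod φ ≃ₗ[PathAlg Γ k] RepMod ψ) := by
  obtain ⟨g, hg⟩ := h
  let f : Intertwiner φ ψ := ⟨fun i => (g i).val, fun a => by
    rw [hg a, Matrix.mul_assoc, Units.inv_mul, Matrix.mul_one]⟩
  let f' : Intertwiner ψ φ := ⟨fun i => (g i)⁻¹.val, fun a => by
    rw [hg a, ← Matrix.mul_assoc, ← Matrix.mul_assoc, Units.inv_mul, Matrix.one_mul]⟩
  refine ⟨LinearEquiv.ofLinearMap f.toHom f'.toHom ?_ ?_⟩
  · refine LinearMap.ext fun x => repMod_ext fun i => ?_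
    rw [LinearMap.comp_apply, Intertwiner.coord_toHom, Intertwiner.coord_toHom, Matrix.mulVec_mulVec]
    change ((g i).val * (g i)⁻¹.val).mulVec _ = _
    rw [Units.mul_inv, Matrix.one_mulVec]
    rfl
  · refine LinearMap.ext fun x => repMod_ext fun i => ?_
    rw [LinearMap.comp_apply, Intertwiner.coord_toHom, Intertwiner.coord_toHom, Matrix.mulVec_mulVec]
    change ((g i)⁻¹.val * (g i).val).mulVec _ = _
    rw [Units.inv_mul, Matrix.one_mulVec]
    rfl

end FinQuiver

namespace FinQuiver

variable {I Ω : Type*} [Fintype I] [DecidableEq I] {Γ : FinQuiver I Ω} {k : Type} [Field k]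

/-! ### Modules as representations -/

section Modules

variable (Γ k) in
/-- Every finite-dimensional module over the path algebra is the module of a representation. -/
theorem exists_rep (N : Type*) [AddCommGroup N] [Module k N] [Module (PathAlg Γ k) N]
    [IsScalarTower k (PathAlg Γ k) N] [FiniteDimensional k N] :
    ∃ (v : I → ℕ) (φ : Γ.Rep v k), Nonempty (N ≃ₗ[PathAlg Γ k] RepMod φ) := by
  -- The Peirce decomposition: the orthogonal idempotents of the vertices sum to one, so the module
  -- is the direct sum of their images, and the relation on an arrow makes it act from the source
  -- component to the target component.
  let V : I → Submodule k N := fun i => LinearMap.range (Algebra.lsmul k k N (vert Γ k i))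
  let b : ∀ i, V i ≃ₗ[k] (Fin (Module.finrank k (V i)) → k) := fun i =>
    (Module.finBasis k (V i)).equivFun
  let p : ∀ i, N →ₗ[k] (Fin (Module.finrank k (V i)) → k) := fun i =>
    (b i).toLinearMap ∘ₗ (Algebra.lsmul k k N (vert Γ k i)).rangeRestrict
  let e : ∀ i, (Fin (Module.finrank k (V i)) → k) →ₗ[k] N := fun i =>
    (V i).subtype ∘ₗ (b i).symm.toLinearMap
  have hep : ∀ i n, e i (p i n) = vert Γ k i • n := fun i n => by simp [e, p]
  have hee : ∀ i y, vert Γ k i • e i y = e i y := fun i y => by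
    obtain ⟨n, hn⟩ := ((b i).symm y).2
    change vert Γ k i • ((b i).symm y : N) = _
    change _ = ((b i).symm y : N)
    rw [← hn]
    change vert Γ k i • vert Γ k i • n = vert Γ k i • n
    rw [← mul_smul, vert_mul_self]
  have hinj : ∀ i, Function.Injective (e i) := fun i =>
    Subtype.val_injective.comp (b i).symm.injective
  have hpe : ∀ i y, p i (e i y) = y := fun i y => hinj i (by rw [hep, hee])
  have hpe' : ∀ i j y, j ≠ i → p j (e i y) = 0 := fun i j y h => by
    apply hinj j
    rw [hep, ← hee i, ← mul_smul, vert_mul_of_ne Γ k h, zero_smul, map_zero]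
  have hsum : ∀ n, ∑ i, e i (p i n) = n := fun n => by
    simp only [hep]
    rw [← sum_smul, sum_vert, one_smul]
  let φ : Γ.Rep (fun i => Module.finrank k (V i)) k := fun a =>
    LinearMap.toMatrix' (p (Γ.tgt a) ∘ₗ Algebra.lsmul k k N (arr Γ k a) ∘ₗ e (Γ.src a))
  have hφ : ∀ a y, (φ a).mulVec y = p (Γ.tgt a) (arr Γ k a • e (Γ.src a) y) := fun a y => by
    rw [LinearMap.toMatrix'_mulVec]
    rfl
  have harr : ∀ a n, arr Γ k a • n
      = e (Γ.tgt a) (p (Γ.tgt a) (arr Γ k a • e (Γ.src a) (p (Γ.src a) n))) := fun a n => by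
    rw [hep, hep, ← mul_smul, ← mul_smul, vert_mul_arr_mul_vert]
  refine ⟨_, φ, ⟨LinearEquiv.ofBijective (linearOfGenerators (ofCoords φ p) ?_ ?_) ⟨?_, ?_⟩⟩⟩
  · intro i n
    rw [vert_smul]
    refine repMod_ext fun j => ?_
    rw [coord_ofCoords, coord_ofCoords, ← hep]
    by_cases h : j = i
    · subst h
      rw [hpe, coord_single]
    · rw [hpe' _ _ _ h, coord_single_of_ne _ h]
  · intro a n
    rw [arr_smul, harr]
    refine repMod_ext fun j => ?_
    rw [coord_ofCoords, coord_ofCoords, hφ]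
    by_cases h : j = Γ.tgt a
    · subst h
      rw [hpe, coord_single]
    · rw [hpe' _ _ _ h, coord_single_of_ne _ h]
  · intro n n' h
    have h' : ∀ i, p i n = p i n' := fun i => congrArg (coord φ i) h
    rw [← hsum n, ← hsum n']
    exact sum_congr rfl fun i _ => by rw [h']
  · intro y
    refine ⟨∑ i, e i (coord φ i y), repMod_ext fun j => ?_⟩
    change p j _ = _
    rw [map_sum, sum_eq_single j, hpe]
    · intro i _ hi
      exact hpe' _ _ _ hi.symm
    · simp

end Modules

/-! ### Direct sums -/

variable {v w : I → ℕ}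

/-- The direct sum of two representations. -/
def Rep.add (φ : Γ.Rep v k) (ψ : Γ.Rep w k) : Γ.Rep (fun i => v i + w i) k := fun a =>
  Matrix.reindex finSumFinEquiv finSumFinEquiv (Matrix.fromBlocks (φ a) 0 0 (ψ a))

lemma Rep.add_mulVec_castAdd (φ : Γ.Rep v k) (ψ : Γ.Rep w k) (a : Ω)
    (x : Fin (v (Γ.src a) + w (Γ.src a)) → k) (j : Fin (v (Γ.tgt a))) :
    (φ.add ψ a).mulVec x (Fin.castAdd _ j) = (φ a).mulVec (fun l => x (Fin.castAdd _ l)) j := by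
  simp [Rep.add, Matrix.mulVec, dotProduct, Fin.sum_univ_add]

lemma Rep.add_mulVec_natAdd (φ : Γ.Rep v k) (ψ : Γ.Rep w k) (a : Ω)
    (x : Fin (v (Γ.src a) + w (Γ.src a)) → k) (j : Fin (w (Γ.tgt a))) :
    (φ.add ψ a).mulVec x (Fin.natAdd _ j) = (ψ a).mulVec (fun l => x (Fin.natAdd _ l)) j := by
  simp [Rep.add, Matrix.mulVec, dotProduct, Fin.sum_univ_add]

/-- The module of a direct sum. -/
theorem nonempty_equiv_add (φ : Γ.Rep v k) (ψ : Γ.Rep w k) :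
    Nonempty (RepMod (φ.add ψ) ≃ₗ[PathAlg Γ k] RepMod φ × RepMod ψ) := by
  let f : RepMod (φ.add ψ) →ₗ[k] RepMod φ × RepMod ψ :=
    LinearMap.prod
      (ofCoords φ fun i => LinearMap.funLeft k k (Fin.castAdd (w i)) ∘ₗ coord (φ.add ψ) i)
      (ofCoords ψ fun i => LinearMap.funLeft k k (Fin.natAdd (v i)) ∘ₗ coord (φ.add ψ) i)
  have h1 : ∀ x i j, coord φ i (f x).1 j = coord (φ.add ψ) i x (Fin.castAdd _ j) :=
    fun _ _ _ => rfl
  have h2 : ∀ x i j, coord ψ i (f x).2 j = coord (φ.add ψ) i x (Fin.natAdd _ j) :=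
    fun _ _ _ => rfl
  refine ⟨LinearEquiv.ofBijective (linearOfGenerators f ?_ ?_) ⟨?_, ?_⟩⟩
  · intro i x
    refine Prod.ext (repMod_ext fun j => funext fun l => ?_) (repMod_ext fun j => funext fun l => ?_)
    · rw [Prod.smul_fst, h1, vert_smul, vert_smul]
      by_cases h : j = i
      · subst h
        rw [coord_single, coord_single, h1]
      · rw [coord_single_of_ne _ h, coord_single_of_ne _ h]
        rfl
    · rw [Prod.smul_snd, h2, vert_smul, vert_smul]
      by_cases h : j = i
      · subst h
        rw [coord_single, coord_single, h2]
      · rw [coord_single_of_ne _ h, coord_single_of_ne _ h]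
        rfl
  · intro a x
    refine Prod.ext (repMod_ext fun j => funext fun l => ?_) (repMod_ext fun j => funext fun l => ?_)
    · rw [Prod.smul_fst, h1, arr_smul, arr_smul]
      by_cases h : j = Γ.tgt a
      · subst h
        rw [coord_single, coord_single, Rep.add_mulVec_castAdd]
        rfl
      · rw [coord_single_of_ne _ h, coord_single_of_ne _ h]
        rfl
    · rw [Prod.smul_snd, h2, arr_smul, arr_smul]
      by_cases h : j = Γ.tgt a
      · subst h
        rw [coord_single, coord_single, Rep.add_mulVec_natAdd]
        rfl
      · rw [coord_single_of_ne _ h, coord_single_of_ne _ h]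
        rfl
  · intro x y h
    refine repMod_ext fun i => funext fun l => ?_
    refine Fin.addCases (fun l => ?_) (fun l => ?_) l
    · have := congrFun (congrArg (fun z => coord φ i z.1) h) l
      exact this
    · have := congrFun (congrArg (fun z => coord ψ i z.2) h) l
      exact this
  · rintro ⟨y, z⟩
    refine ⟨(fun i => Fin.addCases (coord φ i y) (coord ψ i z) :
      (i : I) → Fin (v i + w i) → k), Prod.ext (repMod_ext fun i => funext fun l => ?_)
        (repMod_ext fun i => funext fun l => ?_)⟩
    · exact Fin.addCases_left (motive := fun _ => k) l
    · exact Fin.addCases_right (motive := fun _ => k) l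

/-! ### The monoid of isomorphism classes -/

variable (Γ k) in
/-- The isomorphism classes of representations of all dimensions. -/
def Cls : Type _ := Σ v : I → ℕ, Quotient (Γ.repSetoid v k)

/-- The class of a representation. -/
def cls (φ : Γ.Rep v k) : Cls Γ k := ⟨v, Quotient.mk (Γ.repSetoid v k) φ⟩

lemma exists_cls (c : Cls Γ k) : ∃ φ : Γ.Rep c.1 k, c = cls φ := by
  obtain ⟨v, c⟩ := c
  induction c using Quotient.inductionOn with
  | h φ => exact ⟨φ, rfl⟩

lemma cls_eq_iff {φ : Γ.Rep v k} {ψ : Γ.Rep w k} :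
    cls φ = cls ψ ↔ Nonempty (RepMod φ ≃ₗ[PathAlg Γ k] RepMod ψ) := by
  constructor
  · intro h
    have hvw : v = w := congrArg Sigma.fst h
    subst hvw
    exact equiv_of_repIso (Quotient.exact (eq_of_heq (Sigma.mk.inj h).2))
  · rintro ⟨e⟩
    have hvw := dim_eq_of_equiv e
    subst hvw
    exact congrArg (Sigma.mk v) (Quotient.sound (s := Γ.repSetoid v k) (repIso_of_equiv e))

/-- A representative of a class. -/
def Cls.out (c : Cls Γ k) : Γ.Rep c.1 k := (exists_cls c).choose

lemma cls_out (c : Cls Γ k) : cls c.out = c := (exists_cls c).choose_spec.symm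

instance : Add (Cls Γ k) := ⟨fun c d => cls (c.out.add d.out)⟩

lemma cls_add_eq_iff {u : I → ℕ} {φ : Γ.Rep v k} {ψ : Γ.Rep w k} {χ : Γ.Rep u k} :
    cls φ + cls ψ = cls χ ↔ Nonempty ((RepMod φ × RepMod ψ) ≃ₗ[PathAlg Γ k] RepMod χ) := by
  obtain ⟨e1⟩ := cls_eq_iff.1 (cls_out (cls φ))
  obtain ⟨e2⟩ := cls_eq_iff.1 (cls_out (cls ψ))
  obtain ⟨e3⟩ := nonempty_equiv_add (cls φ).out (cls ψ).out
  have e := e3.trans (e1.prodCongr e2)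
  change cls ((cls φ).out.add (cls ψ).out) = _ ↔ _
  rw [cls_eq_iff]
  exact ⟨fun ⟨h⟩ => ⟨e.symm.trans h⟩, fun ⟨h⟩ => ⟨e.trans h⟩⟩

lemma cls_add (φ : Γ.Rep v k) (ψ : Γ.Rep w k) : cls φ + cls ψ = cls (φ.add ψ) := by
  obtain ⟨e⟩ := nonempty_equiv_add φ ψ
  exact cls_add_eq_iff.2 ⟨e.symm⟩

variable (Γ k) in
/-- The zero representation. -/
def zeroRep : Γ.Rep (fun _ => 0) k := fun _ => 0

instance : Zero (Cls Γ k) := ⟨cls (zeroRep Γ k)⟩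

lemma cls_zeroRep : cls (zeroRep Γ k) = 0 := rfl

lemma subsingleton_repMod_zero (φ : Γ.Rep (fun _ => 0) k) : Subsingleton (RepMod φ) :=
  ⟨fun _ _ => repMod_ext fun _ => Subsingleton.elim _ _⟩

instance : AddCommMonoid (Cls Γ k) where
  add_assoc a b c := by
    rw [← cls_out a, ← cls_out b, ← cls_out c, cls_add, cls_add, cls_add, cls_add, cls_eq_iff]
    obtain ⟨e1⟩ := nonempty_equiv_add (a.out.add b.out) c.out
    obtain ⟨e2⟩ := nonempty_equiv_add a.out b.out
    obtain ⟨e3⟩ := nonempty_equiv_add a.out (b.out.add c.out)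
    obtain ⟨e4⟩ := nonempty_equiv_add b.out c.out
    exact ⟨e1.trans ((e2.prodCongr (LinearEquiv.refl _ _)).trans
      ((LinearEquiv.prodAssoc _ _ _ _).trans
        (((LinearEquiv.refl _ _).prodCongr e4.symm).trans e3.symm)))⟩
  add_comm a b := by
    rw [← cls_out a, ← cls_out b, cls_add, cls_add, cls_eq_iff]
    obtain ⟨e1⟩ := nonempty_equiv_add a.out b.out
    obtain ⟨e2⟩ := nonempty_equiv_add b.out a.out
    exact ⟨e1.trans ((LinearEquiv.prodComm _ _ _).trans e2.symm)⟩
  zero_add a := by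
    rw [← cls_out a, ← cls_zeroRep]
    have := subsingleton_repMod_zero (zeroRep Γ k)
    exact cls_add_eq_iff.2 ⟨LinearEquiv.ofBijective (LinearMap.snd _ _ _)
      ⟨fun x y h => Prod.ext (Subsingleton.elim _ _) h, fun y => ⟨(0, y), rfl⟩⟩⟩
  add_zero a := by
    rw [← cls_out a, ← cls_zeroRep]
    have := subsingleton_repMod_zero (zeroRep Γ k)
    exact cls_add_eq_iff.2 ⟨LinearEquiv.ofBijective (LinearMap.fst _ _ _)
      ⟨fun x y h => Prod.ext h (Subsingleton.elim _ _), fun y => ⟨(y, 0), rfl⟩⟩⟩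
  nsmul := nsmulRec

variable (Γ k) in
/-- The dimension of a class. -/
def dim : Cls Γ k →+ (I → ℕ) where
  toFun c := c.1
  map_zero' := rfl
  map_add' _ _ := rfl

lemma dim_cls (φ : Γ.Rep v k) : dim Γ k (cls φ) = v := rfl

lemma eq_zero_of_dim {c : Cls Γ k} (h : dim Γ k c = 0) : c = 0 := by
  obtain ⟨v, c⟩ := c
  change v = 0 at h
  subst h
  induction c using Quotient.inductionOn with
  | h φ =>
    refine cls_eq_iff.2 ⟨LinearEquiv.ofBijective (0 : RepMod φ →ₗ[PathAlg Γ k]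
      RepMod (zeroRep Γ k)) ?_⟩
    have h1 := subsingleton_repMod_zero φ
    have h2 := subsingleton_repMod_zero (zeroRep Γ k)
    exact ⟨fun _ _ _ => h1.elim _ _, fun _ => ⟨0, h2.elim _ _⟩⟩

end FinQuiver

/-! ### Unique decomposition in graded monoids -/

/-- A monoid graded by natural numbers in which the elements that satisfy `P` are the
indecomposable elements, are prime, and can be cancelled. -/
structure IsKrullSchmidt {C : Type*} [AddCommMonoid C] (P : C → Prop) (D : C →+ ℕ) : Prop where
  eq_zero : ∀ {c}, D c = 0 → c = 0
  exists_add : ∀ {c}, c ≠ 0 → ¬ P c → ∃ a b, a ≠ 0 ∧ b ≠ 0 ∧ c = a + b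
  ne_zero : ∀ {c}, P c → c ≠ 0
  indecomposable : ∀ {a b}, P (a + b) → a = 0 ∨ b = 0
  prime : ∀ {p x a b}, P p → p + x = a + b → (∃ z, a = p + z) ∨ ∃ z, b = p + z
  cancel : ∀ {p x y}, P p → p + x = p + y → x = y

namespace IsKrullSchmidt

variable {C : Type*} [AddCommMonoid C] {P : C → Prop} {D : C →+ ℕ} (h : IsKrullSchmidt P D)

/-- The sum of a multiset of indecomposable elements. -/
def sumHom (P : C → Prop) : Multiset {c // P c} →+ C :=
  Multiset.sumAddMonoidHom.comp (Multiset.mapAddMonoidHom Subtype.val)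

lemma sumHom_cons (x : {c // P c}) (m : Multiset {c // P c}) :
    sumHom P (x ::ₘ m) = x.1 + sumHom P m := by simp [sumHom]

lemma sumHom_singleton (x : {c // P c}) : sumHom P {x} = x.1 := by simp [sumHom]

-- A prime indecomposable element that divides a sum of indecomposable elements divides one of them,
-- and an indecomposable element has no proper divisors, so the two coincide.
include h in
lemma mem_of_add_eq (x : {c // P c}) (m : Multiset {c // P c}) :
    ∀ y, x.1 + y = sumHom P m → x ∈ m := by
  induction m using Multiset.induction with
  | empty =>
    intro y hy
    exfalso
    refine h.ne_zero x.2 (h.eq_zero ?_)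
    have := congrArg D hy
    rw [map_add, map_zero, map_zero] at this
    omega
  | cons z m ih =>
    intro y hy
    rw [sumHom_cons] at hy
    rcases h.prime x.2 hy with ⟨t, ht⟩ | ⟨t, ht⟩
    · rcases h.indecomposable (ht ▸ z.2) with h0 | h0
      · exact absurd h0 (h.ne_zero x.2)
      · rw [h0, add_zero] at ht
        rw [Subtype.ext ht]
        exact Multiset.mem_cons_self _ _
    · exact Multiset.mem_cons_of_mem (ih t ht.symm)

include h in
theorem sumHom_injective : Function.Injective (sumHom P) := by
  intro m
  induction m using Multiset.induction with
  | empty =>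
    intro m' hm
    rcases m'.empty_or_exists_mem with h0 | ⟨x, hx⟩
    · exact h0.symm
    · obtain ⟨t, rfl⟩ := Multiset.exists_cons_of_mem hx
      exfalso
      refine h.ne_zero x.2 (h.eq_zero ?_)
      have := congrArg D hm
      rw [map_zero, map_zero, sumHom_cons, map_add] at this
      omega
  | cons x m ih =>
    intro m' hm
    rw [sumHom_cons] at hm
    obtain ⟨t, rfl⟩ := Multiset.exists_cons_of_mem (h.mem_of_add_eq x m' _ hm)
    rw [sumHom_cons] at hm
    rw [ih (h.cancel x.2 hm)]

include h in
theorem sumHom_surjective : Function.Surjective (sumHom P) := by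
  intro c
  induction hn : D c using Nat.strong_induction_on generalizing c with
  | h n ih =>
    by_cases h0 : c = 0
    · exact ⟨0, by rw [map_zero, h0]⟩
    by_cases hP : P c
    · exact ⟨{⟨c, hP⟩}, sumHom_singleton _⟩
    obtain ⟨a, b, ha, hb, rfl⟩ := h.exists_add h0 hP
    rw [map_add] at hn
    have ha' : D a ≠ 0 := fun h' => ha (h.eq_zero h')
    have hb' : D b ≠ 0 := fun h' => hb (h.eq_zero h')
    obtain ⟨m, hm⟩ := ih (D a) (by omega) a rfl
    obtain ⟨m', hm'⟩ := ih (D b) (by omega) b rfl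
    exact ⟨m + m', by rw [map_add, hm, hm']⟩

end IsKrullSchmidt

/-! ### Krull-Schmidt for representations -/

lemma nonempty_equiv_range_prod_ker {A M : Type*} [Ring A] [AddCommGroup M] [Module A M]
    (e : M →ₗ[A] M) (he : ∀ x, e (e x) = e x) :
    Nonempty (M ≃ₗ[A] LinearMap.range e × LinearMap.ker e) := by
  have hst : ∀ m : LinearMap.range e, e.rangeRestrict ((LinearMap.range e).subtype m) = m := by
    rintro ⟨_, x, rfl⟩
    exact Subtype.ext (he x)
  have h := splitEquiv e.rangeRestrict (LinearMap.range e).subtype hst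
  rw [LinearMap.ker_rangeRestrict] at h
  exact ⟨h⟩

namespace FinQuiver

variable {I Ω : Type*} [Fintype I] [DecidableEq I] {Γ : FinQuiver I Ω} {k : Type} [Field k]
  {v w : I → ℕ}

/-- A class is indecomposable. -/
def Cls.IsInd (c : Cls Γ k) : Prop :=
  ∃ (v : I → ℕ) (φ : Γ.Rep v k), IsIndecomposable φ ∧ cls φ = c

variable (Γ k) in
/-- The total dimension of a class. -/
def totalDim : Cls Γ k →+ ℕ where
  toFun c := ∑ i, dim Γ k c i
  map_zero' := by simp
  map_add' c d := by simp [sum_add_distrib]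

lemma cls_eq_zero_iff {φ : Γ.Rep v k} : cls φ = 0 ↔ Subsingleton (RepMod φ) := by
  rw [← cls_zeroRep, cls_eq_iff]
  have h2 := subsingleton_repMod_zero (zeroRep Γ k)
  constructor
  · rintro ⟨e⟩
    exact e.toEquiv.subsingleton
  · intro h1
    exact ⟨LinearEquiv.ofBijective (0 : RepMod φ →ₗ[PathAlg Γ k] RepMod (zeroRep Γ k))
      ⟨fun _ _ _ => Subsingleton.elim _ _, fun _ => ⟨0, Subsingleton.elim _ _⟩⟩⟩

/-- A submodule contains the vertex components of its elements, so it is the same as a stable graded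
subspace, and complements correspond to complements at every vertex. -/
lemma submodule_eq_bot_or {φ : Γ.Rep v k} (hφ : IsIndecomposable φ)
    (U W : Submodule (PathAlg Γ k) (RepMod φ)) (h : IsCompl U W) : U = ⊥ ∨ W = ⊥ := by
  let T : Submodule (PathAlg Γ k) (RepMod φ) → (i : I) → Submodule k (Fin (v i) → k) :=
    fun U i => (U.restrictScalars k).comap (single φ i)
  have hT : ∀ U i x, x ∈ T U i ↔ single φ i x ∈ U := fun _ _ _ => Iff.rfl
  have hTc : ∀ U i x, x ∈ U → coord φ i x ∈ T U i := fun U i x hx => by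
    rw [hT, ← vert_smul]
    exact U.smul_mem _ hx
  have hst : ∀ U, IsStable φ (T U) := fun U a x hx => by
    have := U.smul_mem (arr Γ k a) hx
    rw [arr_smul, coord_single] at this
    exact this
  have hbot : ∀ U, (∀ i, T U i = ⊥) → U = ⊥ := fun U hU => by
    refine (Submodule.eq_bot_iff _).2 fun x hx => repMod_ext fun i => ?_
    have := hTc U i x hx
    rw [hU, Submodule.mem_bot] at this
    rw [this, map_zero]
  refine (hφ.2 (T U) (T W) (hst U) (hst W) fun i => ⟨?_, ?_⟩).imp (hbot U) (hbot W)
  · rw [Submodule.disjoint_def]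
    intro x hx hx'
    have := (Submodule.disjoint_def.1 h.1) _ hx hx'
    rw [← coord_single φ i x, this, map_zero]
  · rw [codisjoint_iff, Submodule.eq_top_iff']
    intro x
    have := (codisjoint_iff.1 h.2).symm ▸ (Submodule.mem_top : single φ i x ∈ ⊤)
    obtain ⟨y, hy, z, hz, hyz⟩ := Submodule.mem_sup.1 this
    rw [← coord_single φ i x, ← hyz, map_add]
    exact Submodule.add_mem_sup (hTc U i y hy) (hTc W i z hz)

lemma isFittingLocal {φ : Γ.Rep v k} (hφ : IsIndecomposable φ) :
    IsFittingLocal (PathAlg Γ k) (RepMod φ) :=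
  isFittingLocal_of_indecomposable (submodule_eq_bot_or hφ)

lemma exists_rep_submodule {φ : Γ.Rep v k} (U : Submodule (PathAlg Γ k) (RepMod φ)) :
    ∃ (w : I → ℕ) (ψ : Γ.Rep w k), Nonempty (U ≃ₗ[PathAlg Γ k] RepMod ψ) := by
  have : FiniteDimensional k U := inferInstanceAs (FiniteDimensional k (U.restrictScalars k))
  exact exists_rep Γ k U

lemma exists_cls_add {u : I → ℕ} {φ : Γ.Rep v k} {ψ : Γ.Rep u k}
    {s : RepMod φ →ₗ[PathAlg Γ k] RepMod ψ}
    (h : Nonempty (RepMod φ ≃ₗ[PathAlg Γ k] RepMod ψ × LinearMap.ker s)) :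
    ∃ z, cls φ = cls ψ + z := by
  obtain ⟨e⟩ := h
  obtain ⟨_, χ, ⟨e'⟩⟩ := exists_rep_submodule (LinearMap.ker s)
  exact ⟨cls χ, (cls_add_eq_iff.2
    ⟨(e.trans ((LinearEquiv.refl _ _).prodCongr e')).symm⟩).symm⟩

/-- The projections along the vertexwise decompositions commute with the arrows because both
families are stable. -/
lemma exists_idempotent {φ : Γ.Rep v k} {U W : (i : I) → Submodule k (Fin (v i) → k)}
    (hU : IsStable φ U) (hW : IsStable φ W) (hUW : ∀ i, IsCompl (U i) (W i)) :
    ∃ e : RepMod φ →ₗ[PathAlg Γ k] RepMod φ, (∀ x, e (e x) = e x) ∧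
      (∀ i, ∀ x ∈ U i, e (single φ i x) = single φ i x) ∧
      ∀ i, ∀ x ∈ W i, e (single φ i x) = 0 := by
  have hd : ∀ i x, ∃ y ∈ U i, ∃ z ∈ W i, y + z = x := fun i x => Submodule.mem_sup.1
    ((codisjoint_iff.1 (hUW i).2).symm ▸ (Submodule.mem_top : x ∈ ⊤))
  have hp : ∀ i, ∃ π : (Fin (v i) → k) →ₗ[k] (Fin (v i) → k), (∀ x ∈ U i, π x = x) ∧
      (∀ x ∈ W i, π x = 0) ∧ ∀ x, π x ∈ U i := fun i =>
    ⟨(U i).subtype ∘ₗ (U i).projectionOnto (W i) (hUW i),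
      fun x hx => congrArg Subtype.val (Submodule.projectionOnto_apply_left (hUW i) ⟨x, hx⟩),
      fun x hx => congrArg Subtype.val (Submodule.projectionOnto_apply_right (hUW i) ⟨x, hx⟩),
      fun x => ((U i).projectionOnto (W i) (hUW i) x).2⟩
  choose π hπ1 hπ2 hπ3 using hp
  let e : Intertwiner φ φ := ⟨fun i => LinearMap.toMatrix' (π i), fun a => by
    refine (LinearEquiv.injective Matrix.toLin') ?_
    rw [Matrix.toLin'_mul, Matrix.toLin'_mul, Matrix.toLin'_toMatrix', Matrix.toLin'_toMatrix']
    refine LinearMap.ext fun x => ?_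
    obtain ⟨y, hy, z, hz, rfl⟩ := hd _ x
    simp only [LinearMap.comp_apply, map_add, Matrix.toLin'_apply]
    rw [hπ1 _ y hy, hπ2 _ z hz, hπ1 _ _ (hU a y hy), hπ2 _ _ (hW a z hz), Matrix.mulVec_zero]⟩
  have he : ∀ x i, coord φ i (e.toHom x) = π i (coord φ i x) := fun x i => by
    rw [Intertwiner.coord_toHom, LinearMap.toMatrix'_mulVec]
  refine ⟨e.toHom, fun x => repMod_ext fun i => ?_, fun i x hx => repMod_ext fun j => ?_,
    fun i x hx => repMod_ext fun j => ?_⟩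
  · rw [he, he, hπ1 _ _ (hπ3 _ _)]
  · rw [he]
    by_cases hj : j = i
    · subst hj
      rw [coord_single, hπ1 _ x hx]
    · rw [coord_single_of_ne _ hj, map_zero]
  · rw [he, map_zero]
    by_cases hj : j = i
    · subst hj
      rw [coord_single, hπ2 _ x hx]
    · rw [coord_single_of_ne _ hj, map_zero]

lemma exists_cls_add_of_idempotent {φ : Γ.Rep v k} (e : RepMod φ →ₗ[PathAlg Γ k] RepMod φ)
    (he : ∀ x, e (e x) = e x) : ∃ a b, cls φ = a + b ∧ (a = 0 → ∀ x, e x = 0) ∧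
      (b = 0 → ∀ x, e x = 0 → x = 0) := by
  obtain ⟨_, ψ, ⟨f⟩⟩ := exists_rep_submodule (LinearMap.range e)
  obtain ⟨_, χ, ⟨g⟩⟩ := exists_rep_submodule (LinearMap.ker e)
  obtain ⟨t⟩ := nonempty_equiv_range_prod_ker e he
  refine ⟨cls ψ, cls χ, (cls_add_eq_iff.2 ⟨(t.trans (f.prodCongr g)).symm⟩).symm,
    fun h x => ?_, fun h x hx => ?_⟩
  · have h1 := cls_eq_zero_iff.1 h
    have h2 := f.toEquiv.subsingleton
    exact congrArg Subtype.val (Subsingleton.elim (⟨e x, x, rfl⟩ : LinearMap.range e) 0)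
  · have h1 := cls_eq_zero_iff.1 h
    have h2 := g.toEquiv.subsingleton
    exact congrArg Subtype.val (Subsingleton.elim (⟨x, hx⟩ : LinearMap.ker e) 0)

lemma single_injective (φ : Γ.Rep v k) (i : I) : Function.Injective (single φ i) :=
  Function.LeftInverse.injective (g := coord φ i) (coord_single φ i)

lemma exists_cls_add_of_not {φ : Γ.Rep v k} (h0 : cls φ ≠ 0) (hφ : ¬ IsIndecomposable φ) :
    ∃ a b, a ≠ 0 ∧ b ≠ 0 ∧ cls φ = a + b := by
  have hv : v ≠ 0 := fun h => h0 (eq_zero_of_dim ((dim_cls φ).trans h))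
  rw [IsIndecomposable, not_and] at hφ
  have hφ := hφ hv
  push Not at hφ
  obtain ⟨U, W, hU, hW, hUW, ⟨i, hi⟩, ⟨j, hj⟩⟩ := hφ
  obtain ⟨e, hee, he1, he2⟩ := exists_idempotent hU hW hUW
  obtain ⟨a, b, hab, ha, hb⟩ := exists_cls_add_of_idempotent e hee
  refine ⟨a, b, fun h => hi ((Submodule.eq_bot_iff _).2 fun x hx => single_injective φ i ?_),
    fun h => hj ((Submodule.eq_bot_iff _).2 fun x hx => single_injective φ j ?_), hab⟩
  · rw [← he1 i x hx, ha h, map_zero]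
  · rw [hb h _ (he2 j x hx), map_zero]

variable (Γ k) in
/-- Representations decompose uniquely. -/
theorem isKrullSchmidt : IsKrullSchmidt (Cls.IsInd (Γ := Γ) (k := k)) (totalDim Γ k) where
  eq_zero {c} h := eq_zero_of_dim (funext fun i => sum_eq_zero_iff.1 h i (mem_univ i))
  exists_add {c} h0 hc := by
    rw [← cls_out c] at h0 ⊢
    exact exists_cls_add_of_not h0 fun h => hc ⟨_, _, h, cls_out c⟩
  ne_zero := by
    rintro _ ⟨v, φ, hφ, rfl⟩ h
    exact hφ.1 (congrArg (dim Γ k) h)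
  indecomposable {a b} := by
    rintro ⟨v, φ, hφ, h⟩
    rw [← cls_out a, ← cls_out b] at h ⊢
    obtain ⟨e⟩ := cls_add_eq_iff.1 h.symm
    have hc := (Submodule.orderIsoMapComap e).isCompl
      (LinearMap.isCompl_range_inl_inr (R := PathAlg Γ k) (M := RepMod a.out) (M₂ := RepMod b.out))
    rcases submodule_eq_bot_or hφ _ _ hc with h1 | h1
    · left
      rw [map_eq_bot_iff, LinearMap.range_eq_bot] at h1
      exact cls_eq_zero_iff.2 ⟨fun x y => LinearMap.inl_injective
        (by rw [h1, LinearMap.zero_apply, LinearMap.zero_apply])⟩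
    · right
      rw [map_eq_bot_iff, LinearMap.range_eq_bot] at h1
      exact cls_eq_zero_iff.2 ⟨fun x y => LinearMap.inr_injective
        (by rw [h1, LinearMap.zero_apply, LinearMap.zero_apply])⟩
  prime {p x a b} := by
    rintro ⟨v, φ, hφ, rfl⟩ h
    rw [← cls_out x, ← cls_out a, ← cls_out b, cls_add a.out] at h
    rw [← cls_out a, ← cls_out b]
    obtain ⟨e⟩ := cls_add_eq_iff.1 h
    obtain ⟨e'⟩ := nonempty_equiv_add a.out b.out
    exact (exists_split_of_prod (isFittingLocal hφ) (e.trans e')).imp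
      (fun ⟨_, hs⟩ => exists_cls_add hs) fun ⟨_, hs⟩ => exists_cls_add hs
  cancel {p x y} := by
    rintro ⟨v, φ, hφ, rfl⟩ h
    rw [← cls_out x, ← cls_out y, cls_add φ y.out] at h
    rw [← cls_out x, ← cls_out y, cls_eq_iff]
    obtain ⟨e⟩ := cls_add_eq_iff.1 h
    obtain ⟨e'⟩ := nonempty_equiv_add φ y.out
    exact cancel_prod (isFittingLocal hφ) (e.trans e')

lemma isInd_cls_iff {φ : Γ.Rep v k} : (cls φ).IsInd ↔ IsIndecomposable φ := by
  refine ⟨fun hc => ?_, fun h => ⟨v, φ, h, rfl⟩⟩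
  by_contra h
  obtain ⟨a, b, ha, hb, hab⟩ := exists_cls_add_of_not ((isKrullSchmidt Γ k).ne_zero hc) h
  rcases (isKrullSchmidt Γ k).indecomposable (hab ▸ hc) with h | h
  exacts [ha h, hb h]

end FinQuiver

/-! ### Fixed vectors of semilinear maps -/

section Semilinear

variable {L : Type*} [Field L] [IsAlgClosed L]

/-- A recursion of additive polynomials has a nontrivial fixed point. -/
lemma exists_recursion_fixed {Q : ℕ} (hQ : 2 ≤ Q) (a : ℕ → L) (h0 : a 0 ≠ 0) (m : ℕ) :
    ∃ b : ℕ → L, b m ≠ 0 ∧ b 0 = a 0 * b m ^ Q ∧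
      ∀ i, b (i + 1) = b i ^ Q + a (i + 1) * b m ^ Q := by
  -- `B i` is the value of `b i` forced by the recursion when `b m` is replaced by an unknown, so a
  -- nonzero fixed point of `B m` is wanted. Every `B i` is divisible by `X ^ 2`, and with `B m = X
  -- ^ 2 * R` any root of `X * R - 1` is such a point.
  let B : ℕ → L[X] := fun i => Nat.rec (C (a 0) * X ^ Q) (fun i P => P ^ Q + C (a (i + 1)) * X ^ Q) i
  have hB0 : B 0 = C (a 0) * X ^ Q := rfl
  have hB1 : ∀ i, B (i + 1) = B i ^ Q + C (a (i + 1)) * X ^ Q := fun _ => rfl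
  have hdeg : ∀ i, (B i).natDegree = Q ^ (i + 1) := by
    intro i
    induction i with
    | zero => rw [hB0, natDegree_C_mul_X_pow _ _ h0, zero_add, pow_one]
    | succ i ih =>
      rw [hB1, natDegree_add_eq_left_of_natDegree_lt, natDegree_pow, ih, mul_comm, ← pow_succ]
      rw [natDegree_pow, ih]
      refine (natDegree_C_mul_X_pow_le _ _).trans_lt ?_
      rw [pow_succ]
      have h1 : 0 < Q ^ i := by positivity
      nlinarith [Nat.le_mul_of_pos_left Q h1]
  have hX : ∀ i, X ^ 2 ∣ B i := by
    intro i
    have h : (X : L[X]) ^ 2 ∣ X ^ Q := pow_dvd_pow _ hQ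
    induction i with
    | zero => exact h.mul_left _
    | succ i ih => exact dvd_add (ih.trans (dvd_pow_self _ (by omega))) (h.mul_left _)
  obtain ⟨R, hR⟩ := hX m
  have hlt : 1 < Q ^ (m + 1) := Nat.one_lt_pow (by omega) (by omega)
  have hR0 : R ≠ 0 := by
    rintro rfl
    have := hdeg m
    rw [hR, mul_zero, natDegree_zero] at this
    omega
  have hd : (X * R - 1 : L[X]).degree ≠ 0 := by
    have hR1 : (X * R).natDegree = R.natDegree + 1 := natDegree_X_mul hR0
    have h1 : (1 : L[X]).degree < (X * R).degree := by
      rw [degree_one, degree_eq_natDegree (mul_ne_zero X_ne_zero hR0), hR1]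
      exact_mod_cast Nat.succ_pos R.natDegree
    rw [degree_sub_eq_left_of_degree_lt h1, degree_eq_natDegree (mul_ne_zero X_ne_zero hR0), hR1]
    exact_mod_cast Nat.succ_ne_zero R.natDegree
  obtain ⟨t, ht⟩ := IsAlgClosed.exists_root _ hd
  have ht1 : t * R.eval t = 1 := by
    have : (X * R - 1 : L[X]).eval t = 0 := ht
    rw [eval_sub, eval_mul, eval_X, eval_one] at this
    exact sub_eq_zero.1 this
  have htm : (B m).eval t = t := by
    rw [hR, eval_mul, eval_pow, eval_X, sq, mul_assoc, ht1, mul_one]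
  refine ⟨fun i => (B i).eval t, ?_, ?_, fun i => ?_⟩
  · change (B m).eval t ≠ 0
    rw [htm]
    rintro rfl
    simp at ht1
  · change (B 0).eval t = a 0 * (B m).eval t ^ Q
    rw [htm, hB0]
    simp
  · simp only [htm, hB1]
    simp

variable {V : Type*} [AddCommGroup V] [Module L V] {Q : ℕ} (F : V →+ V)
  (hF : ∀ (c : L) x, F (c • x) = c ^ Q • F x)

-- For a multiple of a fixed vector take a `Q`-th root of the coefficient.
include hF in
lemma exists_preimage_of_mem_span (hQ : 2 ≤ Q) {w : V} (hw : w ∈ Submodule.span L {x | F x = x}) :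
    ∃ u ∈ Submodule.span L {x | F x = x}, F u = w := by
  induction hw using Submodule.closure_induction with
  | zero => exact ⟨0, Submodule.zero_mem _, map_zero F⟩
  | add x y _ _ hx hy =>
    obtain ⟨u, hu, rfl⟩ := hx
    obtain ⟨u', hu', rfl⟩ := hy
    exact ⟨u + u', Submodule.add_mem _ hu hu', map_add F _ _⟩
  | smul_mem r x hx =>
    obtain ⟨s, rfl⟩ := IsAlgClosed.exists_pow_nat_eq r (show 0 < Q by omega)
    exact ⟨s • x, Submodule.smul_mem _ _ (Submodule.subset_span hx), by rw [hF, hx]⟩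

-- For a multiple of a fixed vector with coefficient `r` solve the Artin-Schreier type equation `s ^
-- Q - s = r`.
include hF in
lemma exists_sub_of_mem_span (hQ : 2 ≤ Q) {w : V} (hw : w ∈ Submodule.span L {x | F x = x}) :
    ∃ u ∈ Submodule.span L {x | F x = x}, F u - u = w := by
  induction hw using Submodule.closure_induction with
  | zero => exact ⟨0, Submodule.zero_mem _, by rw [map_zero, sub_zero]⟩
  | add x y _ _ hx hy =>
    obtain ⟨u, hu, rfl⟩ := hx
    obtain ⟨u', hu', rfl⟩ := hy
    exact ⟨u + u', Submodule.add_mem _ hu hu', by rw [map_add]; abel⟩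
  | smul_mem r x hx =>
    have hd : (X ^ Q - (X + C r) : L[X]).degree ≠ 0 := by
      have h1 : (X + C r : L[X]).degree < (X ^ Q : L[X]).degree := by
        rw [degree_X_add_C, degree_X_pow]
        exact_mod_cast hQ
      rw [degree_sub_eq_left_of_degree_lt h1, degree_X_pow]
      exact_mod_cast (by omega : Q ≠ 0)
    obtain ⟨s, hs⟩ := IsAlgClosed.exists_root _ hd
    have hs' : s ^ Q - (s + r) = 0 := by simpa [IsRoot] using hs
    refine ⟨s • x, Submodule.smul_mem _ _ (Submodule.subset_span hx), ?_⟩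
    rw [hF, hx, ← sub_smul, sub_eq_iff_eq_add.1 (hs' ▸ rfl : s ^ Q - (s + r) = 0), zero_add,
      add_sub_cancel_left]

include hF in
/-- The fixed vectors of an injective semilinear map span. -/
theorem span_fixed_eq_top [FiniteDimensional L V] (hQ : 2 ≤ Q) (hinj : Function.Injective F) :
    Submodule.span L {x | F x = x} = ⊤ := by
  set W := Submodule.span L {x | F x = x} with hW
  have hmem : ∀ y, F y ∈ W → y ∈ W := fun y hy => by
    obtain ⟨u, hu, huy⟩ := exists_preimage_of_mem_span F hF hQ hy
    rwa [← hinj huy]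
  by_contra hne
  obtain ⟨x, -, hx⟩ := SetLike.exists_of_lt (lt_top_iff_ne_top.2 hne)
  let S : ℕ → Submodule L V := fun m => Nat.rec W (fun i T => T ⊔ Submodule.span L {F^[i] x}) m
  have hS1 : ∀ m, S (m + 1) = S m ⊔ Submodule.span L {F^[m] x} := fun _ => rfl
  have hSmem : ∀ m y, y ∈ S m → ∃ w ∈ W, ∃ a : ℕ → L, y = w + ∑ i ∈ range m, a i • F^[i] x := by
    intro m
    induction m with
    | zero => exact fun y hy => ⟨y, hy, 0, by simp⟩
    | succ m ih =>
      intro y hy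
      rw [hS1] at hy
      obtain ⟨z, hz, t, ht, rfl⟩ := Submodule.mem_sup.1 hy
      obtain ⟨c, rfl⟩ := Submodule.mem_span_singleton.1 ht
      obtain ⟨w, hw, a, rfl⟩ := ih z hz
      refine ⟨w, hw, Function.update a m c, ?_⟩
      rw [sum_range_succ, Function.update_self, add_assoc]
      congr 2
      exact sum_congr rfl fun i hi => by
        rw [Function.update_of_ne (mem_range.1 hi).ne]
  have hmono : ∀ m, S m ≤ S (m + 1) := fun m => by rw [hS1]; exact le_sup_left
  have hSW : ∀ m, W ≤ S m := fun m => monotone_nat_of_le_succ hmono (Nat.zero_le m)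
  have hSi : ∀ m i, i < m → F^[i] x ∈ S m := fun m i hi =>
    monotone_nat_of_le_succ hmono (Nat.succ_le_of_lt hi)
      (hS1 i ▸ Submodule.mem_sup_right (Submodule.mem_span_singleton_self _))
  -- The chain of subspaces spanned by `W` and the first iterates of `x` becomes stationary, so some
  -- iterate depends on the earlier ones modulo `W`.
  have hex : ∃ m, F^[m] x ∈ S m := by
    obtain ⟨m, hm⟩ := monotone_stabilizes_iff_noetherian.2 (inferInstance : IsNoetherian L V)
      ⟨S, monotone_nat_of_le_succ hmono⟩
    have h : S m = S (m + 1) := hm (m + 1) (Nat.le_succ m)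
    exact ⟨m, h ▸ hSi (m + 1) m (Nat.lt_succ_self m)⟩
  classical
  obtain ⟨m, hm, hmin⟩ : ∃ m, F^[m] x ∈ S m ∧ ∀ l < m, F^[l] x ∉ S l :=
    ⟨Nat.find hex, Nat.find_spec hex, fun l hl => Nat.find_min hex hl⟩
  obtain ⟨w, hw, a, ha⟩ := hSmem m _ hm
  obtain _ | m := m
  · exact hx hm
  -- Otherwise the relation lies in the image of `F`: taking `Q`-th roots of the coefficients and
  -- cancelling the injective `F` gives a relation for an earlier iterate, against minimality.
  have ha0 : a 0 ≠ 0 := by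
    intro h0
    refine hmin m (Nat.lt_succ_self m) ?_
    choose r hr using fun i => IsAlgClosed.exists_pow_nat_eq (a (i + 1)) (show 0 < Q by omega)
    obtain ⟨u, hu, rfl⟩ := exists_preimage_of_mem_span F hF hQ hw
    have : F (F^[m] x) = F (u + ∑ i ∈ range m, r i • F^[i] x) := by
      rw [← Function.iterate_succ_apply' F, ha, sum_range_succ', h0, zero_smul, add_zero, map_add,
        map_sum]
      congr 1
      exact sum_congr rfl fun i _ => by rw [hF, hr, Function.iterate_succ_apply']
    rw [hinj this]
    exact Submodule.add_mem _ (hSW m hu) (Submodule.sum_mem _ fun i hi =>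
      Submodule.smul_mem _ _ (hSi m i (mem_range.1 hi)))
  -- The coefficients are chosen so that `y = ∑ b_i F^i x` satisfies `F y - y ∈ W`. Correcting `y`
  -- by an element of `W` makes it fixed, so `y ∈ W`; as `b m ≠ 0`, this is a relation for `F^m x`,
  -- contradicting minimality.
  obtain ⟨b, hbm, hb0, hb⟩ := exists_recursion_fixed hQ a ha0 m
  set y := ∑ i ∈ range (m + 1), b i • F^[i] x with hy
  have hFy : F y - y = b m ^ Q • w := by
    have h1 : F y = ∑ i ∈ range m, b i ^ Q • F^[i + 1] x
        + b m ^ Q • (w + ∑ i ∈ range (m + 1), a i • F^[i] x) := by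
      rw [hy, map_sum, sum_range_succ, hF, ← Function.iterate_succ_apply' F, ha]
      congr 1
      exact sum_congr rfl fun i _ => by rw [hF, Function.iterate_succ_apply']
    have h2 : y = ∑ i ∈ range m, b i ^ Q • F^[i + 1] x
        + b m ^ Q • ∑ i ∈ range (m + 1), a i • F^[i] x := by
      rw [hy, sum_range_succ', sum_range_succ' (fun i => a i • F^[i] x), hb0, smul_add,
        smul_sum, ← add_assoc, ← sum_add_distrib, smul_smul, mul_comm]
      congr 1
      exact sum_congr rfl fun i _ => by rw [hb, add_smul, smul_smul, mul_comm (a _)]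
    rw [h1, h2, smul_add]
    abel
  obtain ⟨u, hu, huy⟩ := exists_sub_of_mem_span F hF hQ (Submodule.smul_mem W (b m ^ Q) hw)
  have hfix : F (y - u) = y - u := by
    rw [map_sub, ← sub_eq_zero]
    have : F y - F u - (y - u) = (F y - y) - (F u - u) := by abel
    rw [this, hFy, huy, sub_self]
  have hyW : y ∈ W := by
    have := Submodule.add_mem W (Submodule.subset_span hfix : y - u ∈ W) hu
    rwa [sub_add_cancel] at this
  refine hmin m (Nat.lt_succ_self m) ?_
  have h3 : b m • F^[m] x = y - ∑ i ∈ range m, b i • F^[i] x := by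
    rw [hy, sum_range_succ]
    abel
  rw [← Submodule.smul_mem_iff _ hbm, h3]
  exact Submodule.sub_mem _ (hSW m hyW) (Submodule.sum_mem _ fun i hi =>
    Submodule.smul_mem _ _ (hSi m i (mem_range.1 hi)))

/-- The theorem of Lang for the general linear group. -/
theorem exists_eq_mul_map {n : ℕ} {Q : ℕ} (hQ : 2 ≤ Q) (τ : L ≃+* L) (hτ : ∀ x, τ x = x ^ Q)
    (g : GL (Fin n) L) : ∃ h : GL (Fin n) L, g.val * h.val.map τ = h.val := by
  let F : (Fin n → L) →+ (Fin n → L) :=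
    { toFun := fun x => g.val.mulVec (τ ∘ x)
      map_zero' := by
        have : τ ∘ (0 : Fin n → L) = 0 := funext fun _ => map_zero τ
        rw [this, Matrix.mulVec_zero]
      map_add' := fun x y => by
        have : τ ∘ (x + y) = τ ∘ x + τ ∘ y := funext fun _ => map_add τ _ _
        rw [this, Matrix.mulVec_add] }
  have hFd : ∀ x, F x = g.val.mulVec (τ ∘ x) := fun _ => rfl
  have hF : ∀ (c : L) x, F (c • x) = c ^ Q • F x := fun c x => by
    have : τ ∘ (c • x) = c ^ Q • (τ ∘ x) := funext fun i => by
      simp [hτ, mul_pow]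
    rw [hFd, this, Matrix.mulVec_smul, hFd]
  have hinj : Function.Injective F := fun x y h => by
    have h1 := Matrix.mulVec_injective_of_isUnit g.isUnit h
    exact funext fun i => τ.injective (congrFun h1 i)
  have htop := span_fixed_eq_top F hF hQ hinj
  -- The required matrix has as its columns a basis of vectors `x` with `g · τ(x) = x`.
  obtain ⟨s, hs, b, hb⟩ : ∃ s : Set (Fin n → L), s ⊆ {x | F x = x} ∧
      ∃ b : Module.Basis s L (Fin n → L), ∀ i, b i = i.1 := by
    obtain ⟨s, hs, hspan, hli⟩ := exists_linearIndependent L {x | F x = x}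
    refine ⟨s, hs, Module.Basis.mk hli ?_, fun i => Module.Basis.mk_apply _ _ i⟩
    rw [Subtype.range_coe, hspan, htop]
  let e : s ≃ Fin n := b.indexEquiv (Pi.basisFun L (Fin n))
  let b' := b.reindex e
  let H : Matrix (Fin n) (Fin n) L := (Pi.basisFun L (Fin n)).toMatrix b'
  have hH : ∀ i j, H i j = b' j i := fun i j => rfl
  have hinv : Invertible H := (Pi.basisFun L (Fin n)).invertibleToMatrix b'
  refine ⟨unitOfInvertible H, ?_⟩
  change g.val * H.map τ = H
  ext i j
  have hfix : F (b' j) = b' j := by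
    rw [Module.Basis.reindex_apply, hb]
    exact hs (e.symm j).2
  exact congrFun hfix i

end Semilinear

/-! ### Solutions of linear systems under field extensions -/

section Descent

variable {K L : Type*} [Field K] [Field L] {V W V' W' : Type*}
  [AddCommGroup V] [Module K V] [AddCommGroup W] [Module K W] [AddCommGroup V'] [Module L V']
  [AddCommGroup W'] [Module L W'] [FiniteDimensional K V]
  [FiniteDimensional L V'] [FiniteDimensional L W']

/-- Extension of scalars does not change the dimension of a space of solutions. -/
theorem finrank_ker_eq_of_extension (h : Module.finrank K V = Module.finrank L V')
    (j : V → V') (j' : W → W')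
    (hj : ∀ (n : ℕ) (x : Fin n → V), LinearIndependent K x → LinearIndependent L (j ∘ x))
    (hj' : ∀ (n : ℕ) (x : Fin n → W), LinearIndependent K x → LinearIndependent L (j' ∘ x))
    (f : V →ₗ[K] W) (g : V' →ₗ[L] W') (hfg : ∀ x, g (j x) = j' (f x)) (h0 : j' 0 = 0) :
    Module.finrank K (LinearMap.ker f) = Module.finrank L (LinearMap.ker g) := by
  -- Neither the kernel nor the range can lose dimension, since independence is preserved. The sums
  -- of the two dimensions agree, so both inequalities are equalities.
  have hk : Module.finrank K (LinearMap.ker f) ≤ Module.finrank L (LinearMap.ker g) := by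
    let b := Module.finBasis K (LinearMap.ker f)
    have h1 := hj _ _ (b.linearIndependent.map' (LinearMap.ker f).subtype
      (Submodule.ker_subtype _))
    let y : Fin (Module.finrank K (LinearMap.ker f)) → LinearMap.ker g := fun i =>
      ⟨j (b i), by rw [LinearMap.mem_ker, hfg, (b i).2, h0]⟩
    have h2 : LinearIndependent L y := LinearIndependent.of_comp (LinearMap.ker g).subtype h1
    simpa using h2.fintype_card_le_finrank
  have hr : Module.finrank K (LinearMap.range f) ≤ Module.finrank L (LinearMap.range g) := by
    let b := Module.finBasis K (LinearMap.range f)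
    have h1 := hj' _ _ (b.linearIndependent.map' (LinearMap.range f).subtype
      (Submodule.ker_subtype _))
    let y : Fin (Module.finrank K (LinearMap.range f)) → LinearMap.range g := fun i =>
      ⟨j' (b i), by
        obtain ⟨x, hx⟩ := (b i).2
        exact ⟨j x, by rw [hfg, hx]⟩⟩
    have h2 : LinearIndependent L y := LinearIndependent.of_comp (LinearMap.range g).subtype h1
    simpa using h2.fintype_card_le_finrank
  have h1 := f.finrank_range_add_finrank_ker
  have h2 := g.finrank_range_add_finrank_ker
  omega

/-- Families of matrices as functions. -/
def famEquiv {ι : Type*} (K : Type*) [Field K] (a b : ι → ℕ) :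
    ((i : ι) → Matrix (Fin (a i)) (Fin (b i)) K) ≃ₗ[K] ((Σ i, Fin (a i) × Fin (b i)) → K) where
  toFun x s := x s.1 s.2.1 s.2.2
  invFun y i r c := y ⟨i, r, c⟩
  map_add' _ _ := rfl
  map_smul' _ _ := rfl

lemma finrank_fam {ι : Type*} [Fintype ι] (K : Type*) [Field K] (a b : ι → ℕ) :
    Module.finrank K ((i : ι) → Matrix (Fin (a i)) (Fin (b i)) K)
      = Fintype.card (Σ i, Fin (a i) × Fin (b i)) := by
  rw [(famEquiv K a b).finrank_eq, Module.finrank_fintype_fun_eq_card]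

lemma linearIndependent_fam [Algebra K L] {ι : Type*} [Fintype ι] (a b : ι → ℕ) (n : ℕ)
    (x : Fin n → (i : ι) → Matrix (Fin (a i)) (Fin (b i)) K) (hx : LinearIndependent K x) :
    LinearIndependent L ((fun y i => (y i).map (algebraMap K L)) ∘ x) := by
  have h1 := hx.map' (famEquiv K a b).toLinearMap (LinearEquiv.ker _)
  have h2 := (linearIndependent_algebraMap_comp_iff (S := L)).2 h1
  exact LinearIndependent.of_comp (famEquiv L a b).toLinearMap h2

end Descent

namespace FinQuiver

variable {I Ω : Type*} [Fintype I] [DecidableEq I] {Γ : FinQuiver I Ω}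
  {K L : Type} [Field K] [Field L] {u v w : I → ℕ}

/-! ### Change of fields -/

/-- A representation over a larger field. -/
def Rep.map (f : K →+* L) (φ : Γ.Rep v K) : Γ.Rep v L := fun a => (φ a).map f

lemma RepIso.map (f : K →+* L) {φ ψ : Γ.Rep v K} (h : RepIso φ ψ) : RepIso (φ.map f) (ψ.map f) := by
  obtain ⟨g, hg⟩ := h
  refine ⟨fun i => Matrix.GeneralLinearGroup.map f (g i), fun a => ?_⟩
  rw [← map_inv]
  change (ψ a).map f = (g _).val.map f * (φ a).map f * (g (Γ.src a))⁻¹.val.map f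
  rw [hg, Matrix.map_mul, Matrix.map_mul]

lemma Rep.map_add (f : K →+* L) (φ : Γ.Rep v K) (ψ : Γ.Rep w K) :
    (φ.add ψ).map f = (φ.map f).add (ψ.map f) := by
  funext a
  simp [Rep.map, Rep.add, Matrix.fromBlocks_map, ← Matrix.submatrix_map]

/-- Extension of scalars of classes. -/
def clsMap (f : K →+* L) : Cls Γ K →+ Cls Γ L where
  toFun c := cls (c.out.map f)
  map_zero' := eq_zero_of_dim rfl
  map_add' c d := by
    rw [cls_add, ← Rep.map_add]
    have h : cls (c.out.add d.out) = c + d := by rw [← cls_add, cls_out, cls_out]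
    generalize hφ : c.out.add d.out = φ at *
    have h2 := cls_out (c + d)
    rw [← h] at h2 ⊢
    exact congrArg (Sigma.mk _) (Quotient.sound
      ((repIso_of_equiv (cls_eq_iff.1 h2).some).map f))

lemma clsMap_cls (f : K →+* L) (φ : Γ.Rep v K) : clsMap f (cls φ) = cls (φ.map f) :=
  congrArg (Sigma.mk _) (Quotient.sound
    ((repIso_of_equiv (cls_eq_iff.1 (cls_out (cls φ))).some).map f))

lemma dim_clsMap (f : K →+* L) (c : Cls Γ K) : dim Γ L (clsMap f c) = dim Γ K c := rfl

lemma clsMap_comp {M : Type} [Field M] (f : K →+* L) (g : L →+* M) (c : Cls Γ K) :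
    clsMap g (clsMap f c) = clsMap (g.comp f) c := by
  rw [← cls_out c, clsMap_cls, clsMap_cls, clsMap_cls]
  rfl

lemma clsMap_id (c : Cls Γ K) : clsMap (RingHom.id K) c = c := by
  conv_rhs => rw [← cls_out c]
  rfl

variable (Γ) in
/-- An automorphism of the field acts on the classes. -/
def clsEquiv (τ : L ≃+* L) : Cls Γ L ≃+ Cls Γ L where
  toFun := clsMap τ.toRingHom
  invFun := clsMap τ.symm.toRingHom
  left_inv c := by
    rw [clsMap_comp]
    convert clsMap_id c
    ext x
    exact τ.symm_apply_apply x
  right_inv c := by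
    rw [clsMap_comp]
    convert clsMap_id c
    ext x
    exact τ.apply_symm_apply x
  map_add' := map_add _

/-- The conditions for an intertwiner. -/
def intertwinerMap (φ : Γ.Rep v K) (ψ : Γ.Rep w K) :
    ((i : I) → Matrix (Fin (w i)) (Fin (v i)) K) →ₗ[K]
      ((a : Ω) → Matrix (Fin (w (Γ.tgt a))) (Fin (v (Γ.src a))) K) where
  toFun g a := ψ a * g (Γ.src a) - g (Γ.tgt a) * φ a
  map_add' g h := by
    funext a
    simp only [Pi.add_apply, Matrix.mul_add, Matrix.add_mul]
    abel
  map_smul' c g := by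
    funext a
    simp [smul_sub]

lemma mem_ker_intertwinerMap {φ : Γ.Rep v K} {ψ : Γ.Rep w K}
    {g : (i : I) → Matrix (Fin (w i)) (Fin (v i)) K} :
    g ∈ LinearMap.ker (intertwinerMap φ ψ) ↔ ∀ a, ψ a * g (Γ.src a) = g (Γ.tgt a) * φ a := by
  rw [LinearMap.mem_ker, funext_iff]
  exact forall_congr' fun a => sub_eq_zero

lemma card_hom_eq_pow [Finite K] (φ : Γ.Rep v K) (ψ : Γ.Rep w K) :
    Nat.card (RepMod φ →ₗ[PathAlg Γ K] RepMod ψ)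
      = Nat.card K ^ Module.finrank K (LinearMap.ker (intertwinerMap φ ψ)) := by
  rw [← Module.natCard_eq_pow_finrank, Nat.card_congr (homEquiv φ ψ)]
  exact Nat.card_congr (Equiv.subtypeEquivRight fun g => mem_ker_intertwinerMap.symm)

lemma finrank_intertwiner_map [Fintype Ω] [Algebra K L] (φ : Γ.Rep v K) (ψ : Γ.Rep w K) :
    Module.finrank K (LinearMap.ker (intertwinerMap φ ψ))
      = Module.finrank L (LinearMap.ker (intertwinerMap (φ.map (algebraMap K L))
          (ψ.map (algebraMap K L)))) := by
  have h1 : ∀ x : (i : I) → Matrix (Fin (w i)) (Fin (v i)) K,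
      intertwinerMap (φ.map (algebraMap K L)) (ψ.map (algebraMap K L))
        (fun i => (x i).map (algebraMap K L))
      = fun a => (intertwinerMap φ ψ x a).map (algebraMap K L) := fun x => funext fun a => by
    change (ψ a).map (algebraMap K L) * (x (Γ.src a)).map (algebraMap K L)
      - (x (Γ.tgt a)).map (algebraMap K L) * (φ a).map (algebraMap K L)
      = (ψ a * x (Γ.src a) - x (Γ.tgt a) * φ a).map (algebraMap K L)
    rw [Matrix.map_sub _ (map_sub _), Matrix.map_mul, Matrix.map_mul]
  have h2 : (fun (a : Ω) => ((0 : (a : Ω) → Matrix (Fin (w (Γ.tgt a))) (Fin (v (Γ.src a))) K) a).map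
      (algebraMap K L)) = 0 := funext fun a => Matrix.map_zero _ (map_zero _)
  have h3 : Module.finrank K ((i : I) → Matrix (Fin (w i)) (Fin (v i)) K)
      = Module.finrank L ((i : I) → Matrix (Fin (w i)) (Fin (v i)) L) := by
    rw [finrank_fam, finrank_fam]
  exact finrank_ker_eq_of_extension h3 _ _ (linearIndependent_fam w v)
    (linearIndependent_fam (fun a => w (Γ.tgt a)) fun a => v (Γ.src a)) _ _ h1 h2

lemma finrank_intertwiner_le {χ : Γ.Rep u L} {φ ψ : Γ.Rep v L} (h : RepIso φ ψ) :
    Module.finrank L (LinearMap.ker (intertwinerMap χ φ))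
      ≤ Module.finrank L (LinearMap.ker (intertwinerMap χ ψ)) := by
  obtain ⟨g, hg⟩ := h
  let T : ((i : I) → Matrix (Fin (v i)) (Fin (u i)) L) →ₗ[L]
      ((i : I) → Matrix (Fin (v i)) (Fin (u i)) L) :=
    { toFun := fun x i => (g i).val * x i
      map_add' := fun x y => funext fun i => Matrix.mul_add _ _ _
      map_smul' := fun c x => funext fun i => Matrix.mul_smul (g i).val c (x i) }
  have hT : ∀ x ∈ LinearMap.ker (intertwinerMap χ φ), T x ∈ LinearMap.ker (intertwinerMap χ ψ) := by
    intro x hx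
    rw [mem_ker_intertwinerMap] at hx ⊢
    intro a
    have hxa : φ a * x (Γ.src a) = x (Γ.tgt a) * χ a := hx a
    change ψ a * ((g (Γ.src a)).val * x (Γ.src a)) = (g (Γ.tgt a)).val * x (Γ.tgt a) * χ a
    rw [hg, Matrix.mul_assoc, ← Matrix.mul_assoc (g (Γ.src a))⁻¹.val, Units.inv_mul,
      Matrix.one_mul, Matrix.mul_assoc, hxa, Matrix.mul_assoc]
  refine LinearMap.finrank_le_finrank_of_injective (f := T.restrict hT) fun x y h => ?_
  refine Subtype.ext (funext fun i => ?_)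
  have h1 : (g i).val * x.1 i = (g i).val * y.1 i := congrFun (congrArg Subtype.val h) i
  have h2 := congrArg ((g i)⁻¹.val * ·) h1
  simpa only [← Matrix.mul_assoc, Units.inv_mul, Matrix.one_mul] using h2

/-- Representations over a finite field that become isomorphic over an extension are
isomorphic. -/
theorem clsMap_injective [Fintype Ω] [Finite K] [Algebra K L] :
    Function.Injective (clsMap (Γ := Γ) (algebraMap K L)) := by
  intro c d h
  have hd : c.1 = d.1 := congrArg (dim Γ L) h
  obtain ⟨v, c⟩ := c
  obtain ⟨w, d⟩ := d
  obtain rfl : v = w := hd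
  obtain ⟨φ, rfl⟩ := Quotient.exists_rep c
  obtain ⟨ψ, rfl⟩ := Quotient.exists_rep d
  change clsMap _ (cls φ) = clsMap _ (cls ψ) at h
  rw [clsMap_cls, clsMap_cls, cls_eq_iff] at h
  obtain ⟨e⟩ := h
  refine cls_eq_iff.2 (nonempty_equiv_of_card_hom_eq fun X _ _ _ => ?_)
  let _ : Module K X := Module.compHom X (algebraMap K (PathAlg Γ K))
  have : IsScalarTower K (PathAlg Γ K) X := ⟨fun c y x => by
    rw [Algebra.smul_def, mul_smul]
    rfl⟩
  obtain ⟨_, χ, ⟨f⟩⟩ := exists_rep Γ K X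
  -- The number of homomorphisms from any finite module is `|K|` to the dimension of a space of
  -- intertwiners. That dimension does not change under the extension, after which the two targets
  -- are isomorphic, and finite modules are determined by these numbers.
  rw [Nat.card_congr (f.congrLeft _ ℤ).toEquiv, Nat.card_congr (f.congrLeft _ ℤ).toEquiv,
    card_hom_eq_pow, card_hom_eq_pow,
    finrank_intertwiner_map (L := L) χ φ, finrank_intertwiner_map (L := L) χ ψ]
  congr 1
  exact le_antisymm (finrank_intertwiner_le (repIso_of_equiv e))
    (finrank_intertwiner_le (repIso_of_equiv e.symm))

section Frobenius

variable [Finite K] [Algebra K L] {τ : L ≃+* L} (hτ : ∀ x, τ x = x ^ Nat.card K)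

-- Fixed elements are roots of `X ^ |K| - X`, which has at most `|K|` roots, and the image of `K`
-- already provides that many.
include hτ in
lemma mem_range_of_frobenius {x : L} (hx : τ x = x) : x ∈ Set.range (algebraMap K L) := by
  classical
  have := Fintype.ofFinite K
  have hq : 1 < Fintype.card K := Fintype.one_lt_card
  rw [hτ, Nat.card_eq_fintype_card] at hx
  have hne := FiniteField.X_pow_card_sub_X_ne_zero L hq
  have hsub : univ.image (algebraMap K L) ⊆ (X ^ Fintype.card K - X : L[X]).roots.toFinset := by
    intro y hy
    obtain ⟨z, -, rfl⟩ := mem_image.1 hy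
    rw [Multiset.mem_toFinset, mem_roots hne, IsRoot, eval_sub, eval_pow, eval_X, ← map_pow,
      FiniteField.pow_card, sub_self]
  have heq := Finset.eq_of_subset_of_card_le hsub (by
    rw [card_image_of_injective _ (algebraMap K L).injective, card_univ]
    refine (Multiset.toFinset_card_le _).trans ((card_roots' _).trans ?_)
    rw [FiniteField.X_pow_card_sub_X_natDegree_eq L hq])
  have hxr : x ∈ (X ^ Fintype.card K - X : L[X]).roots.toFinset := by
    rw [Multiset.mem_toFinset, mem_roots hne, IsRoot, eval_sub, eval_pow, eval_X, hx, sub_self]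
  rw [← heq] at hxr
  obtain ⟨z, -, hz⟩ := mem_image.1 hxr
  exact ⟨z, hz⟩

include hτ in
/-- The classes fixed by the Frobenius automorphism are defined over the finite field. -/
theorem exists_of_frobenius_fixed [IsAlgClosed L] {c : Cls Γ L} (hc : clsEquiv Γ τ c = c) :
    ∃ d : Cls Γ K, clsMap (algebraMap K L) d = c := by
  have hq : 2 ≤ Nat.card K := Finite.one_lt_card
  obtain ⟨v, c⟩ := c
  obtain ⟨φ, rfl⟩ := Quotient.exists_rep c
  change clsMap τ.toRingHom (cls φ) = cls φ at hc
  rw [clsMap_cls] at hc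
  obtain ⟨g, hg⟩ := repIso_of_equiv (cls_eq_iff.1 hc.symm).some
  -- Lang's theorem for the inverses gives `τ(h) = g h`. Conjugating by `h` then removes the cocycle
  -- `g`: the representation `ψ` has entries fixed by `τ`, hence in `K`.
  choose h hh using fun i => exists_eq_mul_map hq τ hτ (g i)⁻¹
  let ψ : Γ.Rep v L := fun a => (h (Γ.tgt a))⁻¹.val * φ a * (h (Γ.src a))⁻¹⁻¹.val
  have hψ : RepIso φ ψ := ⟨fun i => (h i)⁻¹, fun a => rfl⟩
  let T : ∀ i, GL (Fin (v i)) L →* GL (Fin (v i)) L := fun i =>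
    Matrix.GeneralLinearGroup.map τ.toRingHom
  have hgh : ∀ i, T i (h i) = g i * h i := fun i => by
    rw [← inv_mul_eq_iff_eq_mul.1 (Units.ext (hh i) : (g i)⁻¹ * T i (h i) = h i)]
  have hfix : ψ.map τ.toRingHom = ψ := by
    funext a
    have h1 : (φ a).map τ.toRingHom = (g (Γ.tgt a)).val * φ a * (g (Γ.src a))⁻¹.val := hg a
    change ((h (Γ.tgt a))⁻¹.val * φ a * (h (Γ.src a))⁻¹⁻¹.val).map τ.toRingHom = _
    rw [Matrix.map_mul, Matrix.map_mul, h1]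
    change (T _ (h _)⁻¹).val * _ * (T _ (h (Γ.src a))⁻¹⁻¹).val = _
    rw [inv_inv, hgh, map_inv, hgh, mul_inv_rev, Units.val_mul, Units.val_mul]
    simp only [ψ, Matrix.mul_assoc, inv_inv]
    rw [← Matrix.mul_assoc (g (Γ.src a))⁻¹.val, Units.inv_mul, Matrix.one_mul,
      ← Matrix.mul_assoc (g (Γ.tgt a))⁻¹.val, Units.inv_mul, Matrix.one_mul]
  choose η hη using fun a r s => mem_range_of_frobenius hτ
    (congrFun (congrFun (congrFun hfix a) r) s : τ (ψ a r s) = ψ a r s)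
  change ∃ d, _ = cls φ
  refine ⟨cls (Γ := Γ) (v := v) fun a => Matrix.of (η a), ?_⟩
  rw [clsMap_cls]
  have : Rep.map (algebraMap K L) (Γ := Γ) (v := v) (fun a => Matrix.of (η a)) = ψ := by
    funext a
    ext r s
    exact hη a r s
  rw [this]
  exact (cls_eq_iff.2 (equiv_of_repIso hψ)).symm

include hτ in
lemma clsMap_frobenius_fixed (d : Cls Γ K) :
    clsEquiv Γ τ (clsMap (algebraMap K L) d) = clsMap (algebraMap K L) d := by
  have := Fintype.ofFinite K
  change clsMap _ _ = _
  rw [clsMap_comp]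
  have h : τ.toRingHom.comp (algebraMap K L) = algebraMap K L := RingHom.ext fun x => by
    change τ (algebraMap K L x) = _
    rw [hτ, ← map_pow, Nat.card_eq_fintype_card, FiniteField.pow_card]
  rw [h]

include hτ in
/-- Classes over a finite field with a given property over the algebraic closure. -/
theorem card_classes [Fintype Ω] [IsAlgClosed L] (v : I → ℕ) (P : Cls Γ L → Prop) :
    Nat.card {C : Quotient (Γ.repSetoid v K) // P (clsMap (algebraMap K L) ⟨v, C⟩)}
      = Nat.card {c : Cls Γ L // dim Γ L c = v ∧ clsEquiv Γ τ c = c ∧ P c} := by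
  refine Nat.card_congr (Equiv.ofBijective (fun C => ⟨clsMap (algebraMap K L) ⟨v, C.1⟩, rfl,
    clsMap_frobenius_fixed hτ _, C.2⟩) ⟨fun C D h => ?_, ?_⟩)
  · have h1 := clsMap_injective (Subtype.ext_iff.1 h)
    exact Subtype.ext (eq_of_heq (Sigma.mk.inj h1).2)
  · rintro ⟨c, rfl, hc, hP⟩
    obtain ⟨⟨v, C⟩, rfl⟩ := exists_of_frobenius_fixed hτ hc
    exact ⟨⟨C, hP⟩, rfl⟩

end Frobenius

end FinQuiver

/-! ### Sums of power series with the variables raised to powers. -/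

section AdamsSum

variable {σ R : Type*} [CommRing R]

open Classical in
/-- The sum of the power series `g d` with all variables raised to the power `d`. -/
def adamsSum (g : ℕ → MvPowerSeries σ R) : MvPowerSeries σ R := fun m =>
  ∑ d ∈ Icc 1 m.degree,
    if ∀ s, d ∣ m s then MvPowerSeries.coeff (m.mapRange (· / d) (Nat.zero_div d)) (g d) else 0

open Classical in
lemma coeff_adamsSum (g : ℕ → MvPowerSeries σ R) (m : σ →₀ ℕ) :
    MvPowerSeries.coeff m (adamsSum g) = ∑ d ∈ Icc 1 m.degree,
      if ∀ s, d ∣ m s then MvPowerSeries.coeff (m.mapRange (· / d) (Nat.zero_div d)) (g d)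
      else 0 := rfl

end AdamsSum

lemma natCard_subtype_eq {α : Type*} {p : α → Prop} {s : Finset α}
    (h : ∀ x, x ∈ s ↔ p x) : Nat.card {x // p x} = #s := by
  rw [← Nat.card_eq_finsetCard]
  exact Nat.card_congr (Equiv.subtypeEquivRight fun x => (h x).symm)

/-! ### Counting multisets fixed by a permutation -/

namespace FixedMultisets

open Classical in
/-- The orbit of `x`, as many times as needed to have `d` elements. -/
def orb {X : Type*} (τ : Equiv.Perm X) (x : X) (d : ℕ) : Multiset X :=
  (Multiset.range d).map fun i => τ^[i] x

variable {X I : Type*} (τ : Equiv.Perm X)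

lemma orb_add (x : X) (c d : ℕ) : orb τ x (c + d) = orb τ x c + orb τ (τ^[c] x) d := by
  rw [orb, Multiset.range_add, Multiset.map_add, Multiset.map_map]
  congr 1
  refine Multiset.map_congr rfl fun i _ => ?_
  rw [Function.comp_apply, add_comm, Function.iterate_add_apply]

lemma map_orb {x : X} {d : ℕ} (h : τ^[d] x = x) : (orb τ x d).map τ = orb τ x d := by
  have h1 : orb τ x d + {x} = {x} + (orb τ x d).map τ := by
    have h2 := orb_add τ x d 1
    rw [add_comm d 1, orb_add τ x 1 d, h] at h2
    have h3 : ∀ y, orb τ y 1 = {y} := fun y => by simp [orb]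
    rw [h3] at h2
    rw [← h2]
    congr 1
    simp only [orb, Multiset.map_map]
    refine Multiset.map_congr rfl fun i _ => ?_
    rw [Function.comp_apply, ← Function.iterate_succ_apply' τ, Function.iterate_one,
      ← Function.iterate_succ_apply]
  rw [add_comm] at h1
  exact (add_left_cancel h1).symm

variable {τ} {m : Multiset X} (hm : m.map τ = m)

include hm in
lemma iterate_mem {x : X} (hx : x ∈ m) (i : ℕ) : τ^[i] x ∈ m := by
  induction i with
  | zero => exact hx
  | succ i ih =>
    rw [Function.iterate_succ_apply', ← hm]
    exact Multiset.mem_map_of_mem _ ih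

-- All iterates of an element of an invariant multiset lie in its finite support.
include hm in
lemma minimalPeriod_pos {x : X} (hx : x ∈ m) : 0 < Function.minimalPeriod τ x := by
  classical
  rw [Function.minimalPeriod_pos_iff_mem_periodicPts]
  obtain ⟨i, j, hij, h⟩ := Finite.exists_ne_map_eq_of_infinite
    fun i : ℕ => (⟨τ^[i] x, Multiset.mem_toFinset.2 (iterate_mem hm hx i)⟩ : m.toFinset)
  have h' : τ^[i] x = τ^[j] x := Subtype.ext_iff.1 h
  wlog hlt : i < j generalizing i j
  · exact this j i hij.symm h.symm h'.symm (by omega)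
  refine Function.mk_mem_periodicPts (Nat.sub_pos_of_lt hlt) ?_
  apply τ.injective.iterate i
  rw [← Function.iterate_add_apply, Nat.add_sub_cancel' hlt.le, h']

open Classical in
include hm in
lemma count_iterate (x : X) (i : ℕ) : m.count (τ^[i] x) = m.count x := by
  induction i with
  | zero => rfl
  | succ i ih =>
    rw [Function.iterate_succ_apply', ← ih]
    conv_lhs => rw [← hm]
    exact Multiset.count_map_eq_count' _ _ τ.injective _

lemma orb_mul_minimalPeriod (x : X) (j : ℕ) :
    orb τ x (j * Function.minimalPeriod τ x) = j • orb τ x (Function.minimalPeriod τ x) := by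
  induction j with
  | zero => rw [zero_mul, zero_smul]; rfl
  | succ j ih =>
    have h : τ^[j * Function.minimalPeriod τ x] x = x :=
      (Function.isPeriodicPt_minimalPeriod τ x).const_mul j
    rw [add_mul, one_mul, orb_add, h, ih, succ_nsmul]

lemma nodup_orb (x : X) : (orb τ x (Function.minimalPeriod τ x)).Nodup := by
  refine (Multiset.nodup_range _).map_on fun i hi j hj h => ?_
  rw [Multiset.mem_range] at hi hj
  exact (Function.iterate_eq_iterate_iff_of_lt_minimalPeriod hi hj).1 h

-- A segment of `j` full periods consists of `j` copies of the orbit, and multiplicities in an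
-- invariant multiset are constant along orbits.
open Classical in
include hm in
lemma orb_le_iff {x : X} (hx : x ∈ m) (j : ℕ) :
    orb τ x (j * Function.minimalPeriod τ x) ≤ m ↔ j ≤ m.count x := by
  rw [orb_mul_minimalPeriod, Multiset.le_iff_count]
  have h1 : ∀ y ∈ orb τ x (Function.minimalPeriod τ x),
      (orb τ x (Function.minimalPeriod τ x)).count y = 1 :=
    fun y hy => Multiset.count_eq_one_of_mem (nodup_orb x) hy
  constructor
  · intro h
    have h2 := h x
    rwa [Multiset.count_nsmul, h1, mul_one] at h2
    exact Multiset.mem_map.2 ⟨0, Multiset.mem_range.2 (minimalPeriod_pos hm hx), rfl⟩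
  · intro h y
    rw [Multiset.count_nsmul]
    by_cases hy : y ∈ orb τ x (Function.minimalPeriod τ x)
    · rw [h1 y hy, mul_one]
      obtain ⟨i, -, rfl⟩ := Multiset.mem_map.1 hy
      rwa [count_iterate hm]
    · rw [Multiset.count_eq_zero_of_notMem hy, mul_zero]
      exact Nat.zero_le _

variable (δ : X → I →₀ ℕ) (hδ0 : ∀ x, δ x ≠ 0) (hδ : ∀ x, δ (τ x) = δ x)

/-- The total weight of a multiset. -/
def weight : Multiset X →+ (I →₀ ℕ) :=
  Multiset.sumAddMonoidHom.comp (Multiset.mapAddMonoidHom δ)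

include hδ in
lemma weight_orb (x : X) (d : ℕ) : weight δ (orb τ x d) = d • δ x := by
  have h : ∀ i, δ (τ^[i] x) = δ x := fun i => by
    induction i with
    | zero => rfl
    | succ i ih => rw [Function.iterate_succ_apply', hδ, ih]
  simp [weight, orb, Multiset.map_map, h, Multiset.map_const']

lemma weight_mono {m m' : Multiset X} (h : m ≤ m') : weight δ m ≤ weight δ m' := by
  obtain ⟨t, rfl⟩ := Multiset.le_iff_exists_add.1 h
  rw [map_add]
  exact le_self_add

include hδ0 in
lemma le_degree_smul (x : X) (d : ℕ) : d ≤ (d • δ x).degree := by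
  rw [map_nsmul, smul_eq_mul]
  exact Nat.le_mul_of_pos_right d
    (Nat.pos_of_ne_zero fun h => hδ0 x ((Finsupp.degree_eq_zero_iff _).1 h))

include hδ0 hδ in
lemma le_degree_of_orb_le {m : Multiset X} {x : X} {d : ℕ} (h : orb τ x d ≤ m) :
    d ≤ (weight δ m).degree :=
  (le_degree_smul δ hδ0 x d).trans (by
    rw [← weight_orb δ hδ]
    exact Finsupp.degree_mono (weight_mono δ h))

lemma degree_weight [DecidableEq X] (m : Multiset X) :
    (weight δ m).degree = ∑ x ∈ m.toFinset, m.count x * (δ x).degree := by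
  have : weight δ m = ∑ x ∈ m.toFinset, m.count x • δ x :=
    Finset.sum_multiset_map_count m δ
  rw [this, map_sum]
  simp only [map_nsmul, smul_eq_mul]

-- The admissible `d` are the multiples `j` times the minimal period with `1 ≤ j ≤ count`. Counting
-- them is the device that replaces a multiplicity by a sum over `d`.
open Classical in
include hδ0 hδ hm in
lemma card_orb_le {x : X} (hx : x ∈ m) :
    #{d ∈ Icc 1 (weight δ m).degree | τ^[d] x = x ∧ orb τ x d ≤ m} = m.count x := by
  have hl := minimalPeriod_pos hm hx
  have h : {d ∈ Icc 1 (weight δ m).degree | τ^[d] x = x ∧ orb τ x d ≤ m}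
      = (Icc 1 (m.count x)).image (· * Function.minimalPeriod τ x) := by
    ext d
    rw [mem_filter, mem_image, mem_Icc]
    constructor
    · rintro ⟨⟨hd, -⟩, hd1, hd2⟩
      obtain ⟨j, rfl⟩ := Function.IsPeriodicPt.minimalPeriod_dvd (f := τ) (x := x) hd1
      rw [mul_comm] at hd2 hd
      refine ⟨j, mem_Icc.2 ⟨Nat.pos_of_ne_zero fun h => by simp [h] at hd, (orb_le_iff hm hx j).1 hd2⟩, mul_comm _ _⟩
    · rintro ⟨j, hj, rfl⟩
      rw [mem_Icc] at hj
      have h1 := (orb_le_iff hm hx j).2 hj.2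
      exact ⟨⟨Nat.mul_pos hj.1 hl, le_degree_of_orb_le δ hδ0 hδ h1⟩,
        (Function.isPeriodicPt_minimalPeriod τ x).const_mul j, h1⟩
  rw [h, card_image_of_injective _ fun a b hab => Nat.eq_of_mul_eq_mul_right hl hab, Nat.card_Icc,
    Nat.add_sub_cancel]

variable (τ) in
/-- The generating function of the invariant multisets. -/
def numFixed : MvPowerSeries I ℚ := fun v =>
  (Nat.card {m : Multiset X // weight δ m = v ∧ m.map τ = m} : ℚ)

variable (τ) in
/-- The generating function of the elements fixed by a power of the permutation. -/
def numPeriodic (d : ℕ) : MvPowerSeries I ℚ := fun v =>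
  (Nat.card {x : X // δ x = v ∧ τ^[d] x = x} : ℚ)

open Classical in
include hδ0 hδ in
/-- The recursion for the number of invariant multisets. -/
theorem euler_numFixed
    (hfin : ∀ v, Finite {m : Multiset X // weight δ m = v ∧ m.map τ = m})
    (hfin' : ∀ d v, 0 < d → Finite {x : X // δ x = v ∧ τ^[d] x = x}) :
    euler (numFixed τ δ) = numFixed τ δ * adamsSum fun d => euler (numPeriodic τ δ d) := by
  ext v
  have hFx : ∀ v, ∃ s : Finset (Multiset X), ∀ m, m ∈ s ↔ weight δ m = v ∧ m.map τ = m := fun v =>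
    Set.Finite.exists_finset (s := {m : Multiset X | weight δ m = v ∧ m.map τ = m}) (hfin v)
  choose Fx hFx using hFx
  have hE : ∀ d v, ∃ s : Finset X, 0 < d → ∀ x, x ∈ s ↔ δ x = v ∧ τ^[d] x = x := fun d v => by
    by_cases hd : 0 < d
    · obtain ⟨s, hs⟩ :=
        Set.Finite.exists_finset (s := {x : X | δ x = v ∧ τ^[d] x = x}) (hfin' d v hd)
      exact ⟨s, fun _ => hs⟩
    · exact ⟨∅, fun h => absurd h hd⟩
  choose E hE using hE
  have hFc : ∀ v, MvPowerSeries.coeff v (numFixed τ δ) = #(Fx v) := fun v => by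
    change (Nat.card _ : ℚ) = _
    rw [natCard_subtype_eq (hFx v)]
  have hEc : ∀ d v, 0 < d → MvPowerSeries.coeff v (numPeriodic τ δ d) = #(E d v) := fun d v hd => by
    change (Nat.card _ : ℚ) = _
    rw [natCard_subtype_eq (hE d v hd)]
  -- The degree of `v` is distributed over the elements of each invariant multiset, and each
  -- multiplicity is expressed as a number of segments `orb τ x d` contained in the multiset.
  have hl : MvPowerSeries.coeff v (euler (numFixed τ δ))
      = ∑ m ∈ Fx v, ∑ x ∈ m.toFinset,
        ∑ d ∈ Icc 1 v.degree with τ^[d] x = x ∧ orb τ x d ≤ m, ((δ x).degree : ℚ) := by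
    rw [coeff_euler, hFc, mul_comm, ← nsmul_eq_mul, ← sum_const]
    refine sum_congr rfl fun m hm => ?_
    obtain ⟨rfl, hm'⟩ := (hFx _ _).1 hm
    conv_lhs => rw [degree_weight, Nat.cast_sum]
    refine sum_congr rfl fun x hx => ?_
    rw [sum_const, card_orb_le hm' δ hδ0 hδ (Multiset.mem_toFinset.1 hx), nsmul_eq_mul,
      Nat.cast_mul]
  have hr : MvPowerSeries.coeff v (numFixed τ δ * adamsSum fun d => euler (numPeriodic τ δ d))
      = ∑ p ∈ antidiagonal v, ∑ d ∈ Icc 1 p.2.degree with ∀ s, d ∣ p.2 s,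
        ∑ x ∈ E d (p.2.mapRange (· / d) (Nat.zero_div d)), ∑ m ∈ Fx p.1, ((δ x).degree : ℚ) := by
    rw [MvPowerSeries.coeff_mul]
    refine sum_congr rfl fun p _ => ?_
    rw [coeff_adamsSum, ← sum_filter, mul_sum]
    refine sum_congr rfl fun d hd => ?_
    have hd0 : 0 < d := (mem_Icc.1 (mem_filter.1 hd).1).1
    rw [coeff_euler, hFc, hEc _ _ hd0]
    simp only [sum_const, nsmul_eq_mul]
    rw [← mul_sum]
    congr 1
    rw [sum_congr rfl fun x hx => by rw [((hE d _ hd0 x).1 hx).1], sum_const, nsmul_eq_mul,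
      mul_comm]
  rw [hl, hr]
  simp only [sum_sigma']
  -- Removing the segment `orb τ x d` from the multiset is the bijection. What remains is again
  -- invariant, and the removed part has weight `d • δ x`.
  refine sum_bij'
    (fun t _ => ⟨(weight δ (t.1 - orb τ t.2.1 t.2.2), t.2.2 • δ t.2.1), t.2.2, t.2.1,
      t.1 - orb τ t.2.1 t.2.2⟩)
    (fun t _ => ⟨t.2.2.2 + orb τ t.2.2.1 t.2.1, t.2.2.1, t.2.1⟩) ?_ ?_ ?_ ?_ ?_
  · rintro ⟨m, x, d⟩ h
    simp only [mem_sigma, mem_filter, mem_Icc] at h ⊢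
    obtain ⟨hm', hx, ⟨hd, -⟩, hd1, hd2⟩ := h
    obtain ⟨rfl, hm⟩ := (hFx _ _).1 hm'
    obtain ⟨t, rfl⟩ := Multiset.le_iff_exists_add.1 hd2
    rw [Multiset.map_add, map_orb τ hd1] at hm
    rw [add_tsub_cancel_left]
    refine ⟨?_, ⟨⟨hd, le_degree_smul δ hδ0 x d⟩, fun s => ⟨δ x s, rfl⟩⟩, ?_, ?_⟩
    · rw [HasAntidiagonal.mem_antidiagonal, map_add, weight_orb δ hδ, add_comm]
    · refine (hE d _ hd x).2 ⟨?_, hd1⟩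
      exact ((mapRange_div_eq_iff (by omega) (fun s => ⟨δ x s, rfl⟩) _).2 rfl).symm
    · exact (hFx _ _).2 ⟨rfl, add_left_cancel hm⟩
  · rintro ⟨p, d, x, m⟩ h
    simp only [mem_sigma, mem_filter, mem_Icc] at h ⊢
    obtain ⟨hp, ⟨⟨hd, -⟩, hd2⟩, hx, hm⟩ := h
    obtain ⟨hx1, hx2⟩ := (hE d _ hd x).1 hx
    have hp2 := (mapRange_div_eq_iff (by omega) hd2 _).1 hx1.symm
    obtain ⟨hm1, hm2⟩ := (hFx _ _).1 hm
    have hw : weight δ (m + orb τ x d) = v := by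
      rw [map_add, weight_orb δ hδ, hm1, ← hp2, HasAntidiagonal.mem_antidiagonal.1 hp]
    refine ⟨(hFx _ _).2 ⟨hw, ?_⟩, ?_, ⟨hd, ?_⟩, hx2, Multiset.le_add_left _ _⟩
    · rw [Multiset.map_add, map_orb τ hx2, hm2]
    · rw [Multiset.mem_toFinset, Multiset.mem_add]
      exact Or.inr (Multiset.mem_map.2 ⟨0, Multiset.mem_range.2 hd, rfl⟩)
    · rw [← hw]
      exact le_degree_of_orb_le δ hδ0 hδ (Multiset.le_add_left _ _)
  · rintro ⟨m, x, d⟩ h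
    simp only [mem_sigma, mem_filter, mem_Icc] at h
    simp only [tsub_add_cancel_of_le h.2.2.2.2]
  · rintro ⟨p, d, x, m⟩ h
    simp only [mem_sigma, mem_filter, mem_Icc] at h
    obtain ⟨hp, ⟨⟨hd, -⟩, hd2⟩, hx, hm⟩ := h
    have hp2 := (mapRange_div_eq_iff (by omega) hd2 _).1 ((hE d _ hd x).1 hx).1.symm
    simp only [add_tsub_cancel_right, ((hFx _ _).1 hm).1, ← hp2]
  · rintro ⟨m, x, d⟩ h
    rfl

end FixedMultisets

/-! ### Finite modules over the polynomials over a finite field -/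

section TorsionCounts

variable {R : Type} [CommRing R] {M N N' : Type} [AddCommGroup M] [Module R M] [AddCommGroup N]
  [Module R N] [AddCommGroup N'] [Module R N']

/-- The number of elements annihilated by `a`. -/
def torCard (N : Type) [AddCommGroup N] [Module R N] (a : R) : ℕ := Nat.card {y : N // a • y = 0}

variable (N) in
/-- Homomorphisms from a cyclic module. -/
def homQuotEquiv (a : R) : ((R ⧸ R ∙ a) →ₗ[R] N) ≃ {y : N // a • y = 0} where
  toFun φ := ⟨φ (Submodule.Quotient.mk 1), by
    rw [← map_smul, ← Submodule.Quotient.mk_smul, smul_eq_mul, mul_one,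
      (Submodule.Quotient.mk_eq_zero _).2 (Submodule.mem_span_singleton_self a), map_zero]⟩
  invFun y := Submodule.liftQSpanSingleton a (LinearMap.toSpanSingleton R N y.1) y.2
  left_inv φ := by
    refine Submodule.linearMap_qext _ (LinearMap.ext_ring ?_)
    exact one_smul R _
  right_inv y := Subtype.ext (one_smul R y.1)

lemma card_hom_quot (a : R) : Nat.card ((R ⧸ R ∙ a) →ₗ[R] N) = torCard N a :=
  Nat.card_congr (homQuotEquiv N a)

lemma torCard_congr (e : N ≃ₗ[R] N') (a : R) : torCard N a = torCard N' a :=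
  Nat.card_congr (e.toEquiv.subtypeEquiv fun y => by
    change _ ↔ a • e y = 0
    rw [← map_smul, LinearEquiv.map_eq_zero_iff])

lemma torCard_prod (a : R) : torCard (N × N') a = torCard N a * torCard N' a := by
  rw [torCard, torCard, torCard, ← Nat.card_prod]
  exact Nat.card_congr
    { toFun := fun y => (⟨y.1.1, congrArg Prod.fst y.2⟩, ⟨y.1.2, congrArg Prod.snd y.2⟩)
      invFun := fun y => ⟨(y.1.1, y.2.1), Prod.ext y.1.2 y.2.2⟩
      left_inv := fun _ => rfl
      right_inv := fun _ => rfl }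

lemma torCard_pi {ι : Type} [Fintype ι] (Q : ι → Type) [∀ i, AddCommGroup (Q i)]
    [∀ i, Module R (Q i)] (a : R) : torCard (∀ i, Q i) a = ∏ i, torCard (Q i) a := by
  unfold torCard
  rw [← Nat.card_pi]
  exact Nat.card_congr
    { toFun := fun y i => ⟨y.1 i, congrFun y.2 i⟩
      invFun := fun y => ⟨fun i => (y i).1, funext fun i => (y i).2⟩
      left_inv := fun _ => rfl
      right_inv := fun _ => rfl }

lemma card_hom_prod_left :
    Nat.card ((M × N) →ₗ[R] N') = Nat.card (M →ₗ[R] N') * Nat.card (N →ₗ[R] N') := by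
  rw [← Nat.card_prod]
  exact Nat.card_congr (LinearMap.coprodEquiv ℕ).symm.toEquiv

lemma card_hom_prod_right :
    Nat.card (M →ₗ[R] N × N') = Nat.card (M →ₗ[R] N) * Nat.card (M →ₗ[R] N') := by
  rw [← Nat.card_prod]
  exact Nat.card_congr (LinearMap.prodEquiv ℕ).symm.toEquiv

lemma card_hom_pi_left {ι : Type} [Fintype ι] [DecidableEq ι] (Q : ι → Type)
    [∀ i, AddCommGroup (Q i)] [∀ i, Module R (Q i)] :
    Nat.card ((∀ i, Q i) →ₗ[R] N) = ∏ i, Nat.card (Q i →ₗ[R] N) := by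
  rw [← Nat.card_pi]
  exact Nat.card_congr (LinearMap.lsum R Q ℕ).symm.toEquiv

lemma card_hom_congr_left (e : M ≃ₗ[R] N) : Nat.card (M →ₗ[R] N') = Nat.card (N →ₗ[R] N') :=
  Nat.card_congr (e.congrLeft N' ℤ).toEquiv

end TorsionCounts

/-! ### Cyclic torsion modules over the polynomials. -/

section Cyclic

variable (K : Type) [Field K]

/-- The monic irreducible polynomials. -/
abbrev Irr : Type := {f : K[X] // f.Monic ∧ Irreducible f}

variable {K}

/-- The indecomposable torsion modules over the polynomials. -/
abbrev Cyc (f : K[X]) (n : ℕ) : Type := K[X] ⧸ K[X] ∙ f ^ n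

lemma mk_eq_zero_iff_dvd {f : K[X]} {n : ℕ} {y : K[X]} :
    (Submodule.Quotient.mk y : Cyc f n) = 0 ↔ f ^ n ∣ y :=
  (Submodule.Quotient.mk_eq_zero _).trans Ideal.mem_span_singleton

lemma irr_pow_ne_zero (f : Irr K) (n : ℕ) : f.1 ^ n ≠ 0 := (f.2.1.pow n).ne_zero

instance (f : Irr K) (n : ℕ) : FiniteDimensional K (Cyc f.1 n) :=
  (AdjoinRoot.powerBasis (irr_pow_ne_zero f n)).finite

instance [Finite K] (f : Irr K) (n : ℕ) : Finite (Cyc f.1 n) :=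
  Module.finite_of_finite K

lemma card_cyc (f : Irr K) (n : ℕ) :
    Nat.card (Cyc f.1 n) = (Nat.card K ^ f.1.natDegree) ^ n := by
  rw [Module.natCard_eq_pow_finrank (K := K), ← pow_mul]
  congr 1
  have h := finrank_quotient_span_eq_natDegree (f := f.1 ^ n)
  rw [natDegree_pow, mul_comm] at h
  exact h

lemma irr_isCoprime {f g : Irr K} (h : f ≠ g) : IsCoprime f.1 g.1 := by
  rw [f.2.2.coprime_iff_not_dvd]
  intro hd
  exact h (Subtype.ext (eq_of_monic_of_associated f.2.1 g.2.1
    ((f.2.2.dvd_irreducible_iff_associated g.2.2).1 hd)))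

lemma torCard_cyc_of_ne {f g : Irr K} (h : f ≠ g) (n e : ℕ) : torCard (Cyc f.1 n) (g.1 ^ e) = 1 := by
  rw [torCard, Nat.card_eq_one_iff_unique]
  refine ⟨⟨fun y z => ?_⟩, ⟨⟨0, smul_zero _⟩⟩⟩
  have h0 : ∀ y : Cyc f.1 n, g.1 ^ e • y = 0 → y = 0 := by
    intro y hy
    obtain ⟨y, rfl⟩ := Submodule.Quotient.mk_surjective _ y
    rw [← Submodule.Quotient.mk_smul, mk_eq_zero_iff_dvd] at hy
    exact mk_eq_zero_iff_dvd.2 ((irr_isCoprime h).pow.dvd_of_dvd_mul_left hy)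
  exact Subtype.ext ((h0 _ y.2).trans (h0 _ z.2).symm)

/-- Multiplication by `f ^ (n - min e n)` identifies the cyclic module of length `min e n` with the
elements annihilated by `f ^ e`. -/
lemma torCard_cyc (f : Irr K) (n e : ℕ) :
    torCard (Cyc f.1 n) (f.1 ^ e) = (Nat.card K ^ f.1.natDegree) ^ min e n := by
  rw [← card_cyc]
  have hk : ∀ y, f.1 ^ n ∣ f.1 ^ (n - min e n) * y ↔ f.1 ^ min e n ∣ y := fun y => by
    conv_lhs => rw [← Nat.sub_add_cancel (min_le_right e n), pow_add, Nat.sub_add_cancel (min_le_right e n)]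
    exact mul_dvd_mul_iff_left (irr_pow_ne_zero f _)
  have hk' : ∀ y, f.1 ^ n ∣ f.1 ^ e * y ↔ f.1 ^ (n - min e n) ∣ y := fun y => by
    rcases le_total e n with h | h
    · rw [min_eq_left h]
      conv_lhs => rw [← Nat.add_sub_cancel' h, pow_add]
      exact mul_dvd_mul_iff_left (irr_pow_ne_zero f e)
    · rw [min_eq_right h, Nat.sub_self, pow_zero]
      exact ⟨fun _ => one_dvd _, fun _ => (pow_dvd_pow _ h).mul_right _⟩
  let φ : Cyc f.1 (min e n) →ₗ[K[X]] Cyc f.1 n := Submodule.mapQ _ _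
    (LinearMap.mulLeft K[X] (f.1 ^ (n - min e n))) (by
      rw [Submodule.span_singleton_le_iff_mem, Submodule.mem_comap]
      exact Ideal.mem_span_singleton.2 ((hk _).2 dvd_rfl))
  have hφ : ∀ y, φ (Submodule.Quotient.mk y) = Submodule.Quotient.mk (f.1 ^ (n - min e n) * y) :=
    fun y => rfl
  refine (Nat.card_congr (Equiv.ofBijective (fun y => (⟨φ y, ?_⟩ :
    {y : Cyc f.1 n // f.1 ^ e • y = 0})) ⟨fun y z h => ?_, ?_⟩)).symm
  · obtain ⟨y, rfl⟩ := Submodule.Quotient.mk_surjective _ y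
    rw [hφ, ← Submodule.Quotient.mk_smul, mk_eq_zero_iff_dvd, smul_eq_mul, hk']
    exact dvd_mul_right _ _
  · have h1 : φ y = φ z := Subtype.ext_iff.1 h
    rw [← sub_eq_zero, ← map_sub] at h1
    rw [← sub_eq_zero]
    obtain ⟨w, hw⟩ := Submodule.Quotient.mk_surjective _ (y - z)
    rw [← hw, hφ, mk_eq_zero_iff_dvd, hk] at h1
    rw [← hw]
    exact mk_eq_zero_iff_dvd.2 h1
  · rintro ⟨y, hy⟩
    obtain ⟨y, rfl⟩ := Submodule.Quotient.mk_surjective _ y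
    rw [← Submodule.Quotient.mk_smul, mk_eq_zero_iff_dvd, smul_eq_mul, hk'] at hy
    obtain ⟨w, rfl⟩ := hy
    exact ⟨Submodule.Quotient.mk w, Subtype.ext (hφ w)⟩

end Cyclic

/-! ### Types of finite modules over the polynomials. -/

section Types

variable {K : Type} [Field K] [Finite K] {N N' P : Type} [AddCommGroup N] [Module K[X] N]
  [AddCommGroup N'] [Module K[X] N'] [AddCommGroup P] [Module K[X] P]

variable (N) in
-- A finite module is torsion because the polynomial ring is infinite, so the structure theorem
-- applies; its primes are normalized to be monic.
lemma exists_equiv_pi [Finite N] : ∃ (ι : Type) (_ : Fintype ι) (f : ι → Irr K) (e : ι → ℕ),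
    Nonempty (N ≃ₗ[K[X]] ∀ i, Cyc (f i).1 (e i)) := by
  classical
  have ht : Module.IsTorsion K[X] N := fun x => by
    obtain ⟨a, b, hab, h⟩ := Finite.exists_ne_map_eq_of_infinite fun a : K[X] => a • x
    exact ⟨⟨a - b, mem_nonZeroDivisors_of_ne_zero (sub_ne_zero.2 hab)⟩, by
      change (a - b) • x = 0
      rw [sub_smul, sub_eq_zero]
      exact h⟩
  obtain ⟨ι, _, p, hp, e, ⟨E⟩⟩ := Module.equiv_directSum_of_isTorsion ht
  have hf : ∀ i, ∃ f : Irr K, Associated f.1 (p i) := fun i =>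
    ⟨⟨normalize (p i), monic_normalize (hp i).ne_zero,
      (normalize_associated (p i)).symm.irreducible (hp i)⟩, normalize_associated (p i)⟩
  choose f hf using hf
  have hs : ∀ i, (K[X] ∙ p i ^ e i) = K[X] ∙ (f i).1 ^ e i := fun i =>
    (Ideal.span_singleton_eq_span_singleton.2 ((hf i).pow_pow)).symm
  exact ⟨ι, inferInstance, f, e, ⟨(E.trans (DirectSum.linearEquivFunOnFintype K[X] ι _)).trans
    (LinearEquiv.piCongrRight fun i => Submodule.quotEquivOfEq _ _ (hs i))⟩⟩

/-- Every finite test module is a sum of cyclic ones, and homomorphisms from a cyclic module are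
elements of a torsion submodule. So torsion counts determine all numbers of homomorphisms and hence
the module. -/
lemma nonempty_equiv_of_torCard [Finite N] [Finite N']
    (h : ∀ (f : Irr K) (e : ℕ), torCard N (f.1 ^ e) = torCard N' (f.1 ^ e)) :
    Nonempty (N ≃ₗ[K[X]] N') := by
  classical
  refine nonempty_equiv_of_card_hom_eq fun X _ _ _ => ?_
  obtain ⟨ι, _, f, e, ⟨E⟩⟩ := exists_equiv_pi (K := K) X
  rw [card_hom_congr_left E, card_hom_congr_left E, card_hom_pi_left, card_hom_pi_left]
  exact prod_congr rfl fun i _ => by rw [card_hom_quot, card_hom_quot, h]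

/-- The type of a module: the multiplicities of the cyclic modules in it. -/
def HasType (N : Type) [AddCommGroup N] [Module K[X] N] (t : Irr K →₀ Multiset ℕ) : Prop :=
  ∀ (f : Irr K) (e : ℕ),
    torCard N (f.1 ^ e) = (Nat.card K ^ f.1.natDegree) ^ ((t f).map (min e)).sum

lemma HasType.prod {t t' : Irr K →₀ Multiset ℕ} (h : HasType N t) (h' : HasType N' t') :
    HasType (N × N') (t + t') := fun f e => by
  rw [torCard_prod, h, h', ← pow_add, Finsupp.add_apply, Multiset.map_add, Multiset.sum_add]

lemma HasType.congr {t : Irr K →₀ Multiset ℕ} (h : HasType N t) (E : N ≃ₗ[K[X]] N') :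
    HasType N' t := fun f e => by rw [← torCard_congr E, h]

lemma HasType.equiv [Finite N] [Finite N'] {t : Irr K →₀ Multiset ℕ} (h : HasType N t)
    (h' : HasType N' t) : Nonempty (N ≃ₗ[K[X]] N') :=
  nonempty_equiv_of_torCard fun f e => by rw [h, h']

lemma hasType_cyc (f : Irr K) (n : ℕ) : HasType (Cyc f.1 n) (Finsupp.single f {n}) := fun g e => by
  classical
  by_cases h : f = g
  · subst h
    rw [torCard_cyc, Finsupp.single_eq_same, Multiset.map_singleton, Multiset.sum_singleton]
  · rw [torCard_cyc_of_ne h, Finsupp.single_eq_of_ne (Ne.symm h), Multiset.map_zero, Multiset.sum_zero,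
      pow_zero]

lemma hasType_punit : HasType (K := K) PUnit 0 := fun f e => by
  rw [torCard, Finsupp.zero_apply, Multiset.map_zero, Multiset.sum_zero, pow_zero,
    Nat.card_eq_one_iff_unique]
  exact ⟨inferInstance, ⟨0, Subsingleton.elim _ _⟩⟩

variable (K N) in
lemma exists_hasType [Finite N] :
    ∃ t : Irr K →₀ Multiset ℕ, HasType N t ∧ ∀ f, 0 ∉ t f := by
  classical
  obtain ⟨ι, _, f, e, ⟨E⟩⟩ := exists_equiv_pi (K := K) N
  -- The structure theorem may return zero modules; they are dropped so that a type has positive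
  -- parts and is unique.
  let s : ι → Multiset ℕ := fun i => if e i = 0 then 0 else {e i}
  have hs : ∀ i m, ((s i).map (min m)).sum = min m (e i) := fun i m => by
    by_cases h : e i = 0 <;> simp [s, h]
  have hs0 : ∀ i, 0 ∉ s i := fun i => by
    by_cases h : e i = 0
    · simp [s, h]
    · simp [s, h, Ne.symm h]
  have hsum : ∀ g, (∑ i, Finsupp.single (f i) (s i)) g = ∑ i, if f i = g then s i else 0 :=
    fun g => by
      rw [Finsupp.finsetSum_apply]
      exact sum_congr rfl fun i _ => by rw [Finsupp.single_apply]
  refine ⟨∑ i, Finsupp.single (f i) (s i), HasType.congr (fun g m => ?_) E.symm, fun g => ?_⟩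
  · rw [torCard_pi, hsum]
    have h1 : ((∑ i, if f i = g then s i else 0).map (min m)).sum
        = ∑ i, if f i = g then min m (e i) else 0 := by
      have := map_sum (Multiset.sumAddMonoidHom.comp (Multiset.mapAddMonoidHom (min m)))
        (fun i => if f i = g then s i else 0) univ
      refine this.trans (sum_congr rfl fun i _ => ?_)
      change (Multiset.map (min m) _).sum = _
      split_ifs
      · exact hs i m
      · rfl
    rw [h1, ← prod_pow_eq_pow_sum]
    refine prod_congr rfl fun i _ => ?_
    split_ifs with h
    · rw [← h, torCard_cyc]
    · rw [torCard_cyc_of_ne h, pow_zero]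
  · rw [hsum, Multiset.mem_sum]
    rintro ⟨i, -, hi⟩
    split_ifs at hi
    · exact hs0 i hi
    · exact Multiset.notMem_zero _ hi

lemma type_induction {P : (Irr K →₀ Multiset ℕ) → Prop} (h0 : P 0)
    (h1 : ∀ f n t, P t → P (Finsupp.single f {n} + t)) (t : Irr K →₀ Multiset ℕ) : P t := by
  classical
  induction t using Finsupp.induction with
  | zero => exact h0
  | single_add f m t _ hm ht =>
    clear hm
    induction m using Multiset.induction with
    | empty => rwa [Finsupp.single_zero, zero_add]
    | cons n m ih =>
      rw [← Multiset.singleton_add, Finsupp.single_add, add_assoc]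
      exact h1 f n _ ih

variable (K) in
lemma exists_module_hasType (t : Irr K →₀ Multiset ℕ) :
    ∃ (N : Type) (_ : AddCommGroup N) (_ : Module K[X] N), Finite N ∧ HasType N t := by
  induction t using type_induction with
  | h0 => exact ⟨PUnit, inferInstance, inferInstance, inferInstance, hasType_punit⟩
  | h1 f n t ih =>
    obtain ⟨N, _, _, _, hN⟩ := ih
    exact ⟨Cyc f.1 n × N, inferInstance, inferInstance, inferInstance, (hasType_cyc f n).prod hN⟩

/-- Modules of a given type split off cyclic modules. -/
lemma HasType.exists_prod [Finite N] {f : Irr K} {n : ℕ} {t : Irr K →₀ Multiset ℕ}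
    (h : HasType N (Finsupp.single f {n} + t)) :
    ∃ (N' : Type) (_ : AddCommGroup N') (_ : Module K[X] N'), Finite N' ∧ HasType N' t ∧
      Nonempty (N ≃ₗ[K[X]] Cyc f.1 n × N') := by
  obtain ⟨N', _, _, _, hN'⟩ := exists_module_hasType K t
  exact ⟨N', inferInstance, inferInstance, inferInstance, hN',
    h.equiv ((hasType_cyc f n).prod hN')⟩

/-- The sum of the minima of the pairs of elements of two multisets. -/
def minSum (m m' : Multiset ℕ) : ℕ := (m.map fun i => (m'.map (min i)).sum).sum

lemma minSum_add_left (m₁ m₂ m' : Multiset ℕ) :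
    minSum (m₁ + m₂) m' = minSum m₁ m' + minSum m₂ m' := by
  rw [minSum, Multiset.map_add, Multiset.sum_add, minSum, minSum]

/-- The type determines the number of homomorphisms. -/
theorem HasType.card_hom [Finite N'] {t t' : Irr K →₀ Multiset ℕ}
    (h' : HasType N' t') {S : Finset (Irr K)} (hS : t'.support ⊆ S) :
    ∀ (N : Type) [AddCommGroup N] [Module K[X] N] [Finite N], HasType N t →
      Nat.card (N →ₗ[K[X]] N')
        = ∏ f ∈ S, (Nat.card K ^ f.1.natDegree) ^ minSum (t f) (t' f) := by
  classical
  induction t using type_induction with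
  | h0 =>
    intro N _ _ _ h
    obtain ⟨E⟩ := h.equiv hasType_punit
    have := E.toEquiv.subsingleton
    have h1 : Nat.card (N →ₗ[K[X]] N') = 1 := Nat.card_eq_one_iff_unique.2
      ⟨⟨fun a b => LinearMap.ext fun x => by rw [Subsingleton.elim x 0, map_zero, map_zero]⟩, ⟨0⟩⟩
    rw [h1]
    exact (prod_eq_one fun f _ => by simp [minSum]).symm
  | h1 f n t ih =>
    intro N _ _ _ h
    obtain ⟨P, _, _, _, hP, ⟨E⟩⟩ := h.exists_prod
    rw [card_hom_congr_left E, card_hom_prod_left, ih P hP, card_hom_quot, h']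
    have h1 : ∀ g, minSum ((Finsupp.single f {n} + t : Irr K →₀ Multiset ℕ) g) (t' g)
        = (if f = g then ((t' g).map (min n)).sum else 0) + minSum (t g) (t' g) := fun g => by
      rw [Finsupp.add_apply, minSum_add_left, Finsupp.single_apply]
      split_ifs <;> simp [minSum]
    simp only [h1, pow_add, prod_mul_distrib]
    congr 1
    by_cases hf : f ∈ S
    · rw [prod_eq_single f (fun g _ hg => by rw [if_neg hg.symm, pow_zero])
        (fun h => absurd hf h), if_pos rfl]
    · have : t' f = 0 := Finsupp.notMem_support_iff.1 fun h => hf (hS h)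
      rw [this, Multiset.map_zero, Multiset.sum_zero, pow_zero]
      exact (prod_eq_one fun g hg => by
        rw [if_neg (fun hfg : f = g => hf (hfg ▸ hg)), pow_zero]).symm

/-! ### Automorphisms -/

/-- Elements of maximal order can be mapped to the generator of a cyclic module. -/
def HasRetractions (f : Irr K) (n : ℕ) (N : Type) [AddCommGroup N] [Module K[X] N] : Prop :=
  ∀ y : N, f.1 ^ (n + 1) • y = 0 → f.1 ^ n • y ≠ 0 →
    ∃ r : N →ₗ[K[X]] Cyc f.1 (n + 1), r y = Submodule.Quotient.mk 1

/-- If the primes agree, an element of exact order `f ^ (n + 1)` forces `e = n + 1` and is prime to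
`f`, so multiplication by an inverse modulo `f ^ (n + 1)` is the retraction. If they differ, no such
element exists. -/
lemma hasRetractions_cyc {f g : Irr K} {n e : ℕ} (h : f = g → e ≤ n + 1) :
    HasRetractions f n (Cyc g.1 e) := by
  intro y hy hy'
  obtain ⟨y, rfl⟩ := Submodule.Quotient.mk_surjective _ y
  rw [← Submodule.Quotient.mk_smul, mk_eq_zero_iff_dvd, smul_eq_mul] at hy
  rw [← Submodule.Quotient.mk_smul, Ne, mk_eq_zero_iff_dvd, smul_eq_mul] at hy'
  by_cases hfg : f = g
  · subst hfg
    obtain rfl : e = n + 1 := by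
      by_contra hne
      exact hy' ((pow_dvd_pow _ (by have := h rfl; omega)).mul_right y)
    have hc : IsCoprime (f.1 ^ (n + 1)) y := by
      refine IsCoprime.pow_left ((f.2.2.coprime_iff_not_dvd).2 fun hd => hy' ?_)
      rw [pow_succ]
      exact mul_dvd_mul_left _ hd
    obtain ⟨a, b, hab⟩ := hc
    refine ⟨b • LinearMap.id, ?_⟩
    rw [LinearMap.smul_apply, LinearMap.id_apply, ← Submodule.Quotient.mk_smul, ← sub_eq_zero,
      ← Submodule.Quotient.mk_sub, mk_eq_zero_iff_dvd]
    exact ⟨-a, by rw [smul_eq_mul, ← hab]; ring⟩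
  · exact absurd ((irr_isCoprime (Ne.symm hfg)).pow.dvd_of_dvd_mul_left hy |>.mul_left _) hy'

lemma HasRetractions.prod {f : Irr K} {n : ℕ} (h : HasRetractions f n N)
    (h' : HasRetractions f n N') : HasRetractions f n (N × N') := by
  rintro ⟨y, z⟩ h0 h1
  have hy : f.1 ^ (n + 1) • y = 0 := congrArg Prod.fst h0
  have hz : f.1 ^ (n + 1) • z = 0 := congrArg Prod.snd h0
  by_cases h2 : f.1 ^ n • y = 0
  · obtain ⟨r, hr⟩ := h' z hz fun h3 => h1 (Prod.ext h2 h3)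
    exact ⟨r ∘ₗ LinearMap.snd _ _ _, hr⟩
  · obtain ⟨r, hr⟩ := h y hy h2
    exact ⟨r ∘ₗ LinearMap.fst _ _ _, hr⟩

lemma HasType.hasRetractions {f : Irr K} {n : ℕ} {t : Irr K →₀ Multiset ℕ} :
    (∀ i ∈ t f, i ≤ n + 1) → ∀ (N : Type) [AddCommGroup N] [Module K[X] N] [Finite N],
      HasType N t → HasRetractions f n N := by
  classical
  induction t using type_induction with
  | h0 =>
    intro _ N _ _ _ h y _ hy
    obtain ⟨E⟩ := h.equiv hasType_punit
    have := E.toEquiv.subsingleton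
    exact absurd (Subsingleton.elim _ _) hy
  | h1 g m t ih =>
    intro ht N _ _ _ h y hy hy'
    obtain ⟨P, _, _, _, hP, ⟨E⟩⟩ := h.exists_prod
    have h1 := (hasRetractions_cyc (f := f) (g := g) (n := n) (e := m) fun hfg => ht m (by
        rw [Finsupp.add_apply, hfg, Finsupp.single_eq_same]
        exact Multiset.mem_add.2 (Or.inl (Multiset.mem_singleton_self _)))).prod
      (ih (fun i hi => ht i (by
        rw [Finsupp.add_apply]
        exact Multiset.mem_add.2 (Or.inr hi))) P hP)
    obtain ⟨r, hr⟩ := h1 (E y) (by rw [← map_smul, hy, map_zero])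
      (by rwa [← map_smul, Ne, LinearEquiv.map_eq_zero_iff])
    exact ⟨r ∘ₗ E.toLinearMap, hr⟩

end Types

/-! ### Automorphisms of finite modules over the polynomials. -/

section Automorphisms

variable {K : Type} [Field K] [Finite K] {N : Type} [AddCommGroup N] [Module K[X] N] [Finite N]

lemma smul_eq_zero_of_dvd {R M : Type} [CommRing R] [AddCommGroup M] [Module R M] {a b : R}
    (h : a ∣ b) {y : M} (hy : a • y = 0) : b • y = 0 := by
  obtain ⟨c, rfl⟩ := h
  rw [mul_comm, mul_smul, hy, smul_zero]

lemma card_hom_congr_right {R M N P : Type} [CommRing R] [AddCommGroup M] [Module R M]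
    [AddCommGroup N] [Module R N] [AddCommGroup P] [Module R P] (e : M ≃ₗ[R] N) :
    Nat.card (P →ₗ[R] M) = Nat.card (P →ₗ[R] N) :=
  Nat.card_congr
    { toFun := fun φ => e.toLinearMap ∘ₗ φ
      invFun := fun φ => e.symm.toLinearMap ∘ₗ φ
      left_inv := fun φ => by ext x; simp
      right_inv := fun φ => by ext x; simp }

/-- Endomorphisms of a sum that fix the first summand. -/
def fixFirstEquiv {R : Type} [CommRing R] (M N : Type) [AddCommGroup M] [Module R M]
    [AddCommGroup N] [Module R N] :
    {α : (M × N) ≃ₗ[R] M × N // ∀ m, α (m, 0) = (m, 0)} ≃ (N →ₗ[R] M) × (N ≃ₗ[R] N) where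
  toFun α := (LinearMap.fst R M N ∘ₗ α.1.toLinearMap ∘ₗ LinearMap.inr R M N,
    LinearEquiv.ofLinearMap
      (LinearMap.snd R M N ∘ₗ α.1.toLinearMap ∘ₗ LinearMap.inr R M N)
      (LinearMap.snd R M N ∘ₗ α.1.symm.toLinearMap ∘ₗ LinearMap.inr R M N)
      (by
        have h : ∀ m, α.1.symm (m, 0) = (m, 0) := fun m => by
          rw [LinearEquiv.symm_apply_eq, α.2]
        refine LinearMap.ext fun n => ?_
        have h1 : (0, (α.1.symm (0, n)).2) = α.1.symm (0, n) - α.1.symm ((α.1.symm (0, n)).1, 0) := by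
          rw [h]
          exact Prod.ext (sub_self _).symm (sub_zero _).symm
        change (α.1 (0, (α.1.symm (0, n)).2)).2 = n
        rw [h1, map_sub, LinearEquiv.apply_symm_apply, LinearEquiv.apply_symm_apply]
        simp)
      (by
        have h : ∀ m, α.1.symm (m, 0) = (m, 0) := fun m => by
          rw [LinearEquiv.symm_apply_eq, α.2]
        refine LinearMap.ext fun n => ?_
        have h1 : (0, (α.1 (0, n)).2) = α.1 (0, n) - α.1 ((α.1 (0, n)).1, 0) := by
          rw [α.2]
          exact Prod.ext (sub_self _).symm (sub_zero _).symm
        change (α.1.symm (0, (α.1 (0, n)).2)).2 = n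
        rw [h1, map_sub, LinearEquiv.symm_apply_apply, LinearEquiv.symm_apply_apply]
        simp))
  invFun p := ⟨LinearEquiv.ofLinearMap
      (LinearMap.prod (LinearMap.coprod LinearMap.id p.1) (p.2.toLinearMap ∘ₗ LinearMap.snd R M N))
      (LinearMap.prod (LinearMap.coprod LinearMap.id (-(p.1 ∘ₗ p.2.symm.toLinearMap)))
        (p.2.symm.toLinearMap ∘ₗ LinearMap.snd R M N))
      (by ext x <;> simp) (by ext x <;> simp), fun m => by simp⟩
  left_inv α := by
    refine Subtype.ext (LinearEquiv.ext fun x => ?_)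
    have h1 : α.1 x = α.1 (x.1, 0) + α.1 (0, x.2) := by rw [← map_add]; simp
    rw [h1, α.2]
    exact Prod.ext rfl (zero_add _).symm
  right_inv p := by
    refine Prod.ext (LinearMap.ext fun n => ?_) (LinearEquiv.ext fun n => rfl)
    change 0 + p.1 n = _
    rw [zero_add]

lemma cyc_map_ext {f : K[X]} {n : ℕ} {M : Type} [AddCommGroup M] [Module K[X] M]
    {φ ψ : Cyc f n →ₗ[K[X]] M}
    (h : φ (Submodule.Quotient.mk 1) = ψ (Submodule.Quotient.mk 1)) : φ = ψ :=
  Submodule.linearMap_qext _ (LinearMap.ext_ring h)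

/-- Automorphisms of the sum of a cyclic module of maximal order and another module. -/
lemma card_aut_prod {f : Irr K} {n : ℕ} (h : HasRetractions f n (Cyc f.1 (n + 1) × N)) :
    Nat.card ((Cyc f.1 (n + 1) × N) ≃ₗ[K[X]] Cyc f.1 (n + 1) × N)
      = Nat.card {y : Cyc f.1 (n + 1) × N // f.1 ^ (n + 1) • y = 0 ∧ f.1 ^ n • y ≠ 0}
        * (Nat.card (N →ₗ[K[X]] Cyc f.1 (n + 1)) * Nat.card (N ≃ₗ[K[X]] N)) := by
  classical
  set M := Cyc f.1 (n + 1) × N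
  let g : M := (Submodule.Quotient.mk 1, 0)
  have hg1 : f.1 ^ (n + 1) • g = 0 := by
    refine Prod.ext ?_ (smul_zero _)
    change f.1 ^ (n + 1) • (Submodule.Quotient.mk 1 : Cyc f.1 (n + 1)) = 0
    rw [← Submodule.Quotient.mk_smul, mk_eq_zero_iff_dvd, smul_eq_mul, mul_one]
  have hg2 : f.1 ^ n • g ≠ 0 := fun h0 => by
    have h1 : f.1 ^ n • (Submodule.Quotient.mk 1 : Cyc f.1 (n + 1)) = 0 := congrArg Prod.fst h0
    rw [← Submodule.Quotient.mk_smul, mk_eq_zero_iff_dvd, smul_eq_mul, mul_one,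
      pow_dvd_pow_iff f.2.1.ne_zero f.2.2.not_isUnit] at h1
    omega
  let Y := {y : M // f.1 ^ (n + 1) • y = 0 ∧ f.1 ^ n • y ≠ 0}
  -- Orbit and stabilizer: automorphisms are sorted by the image of the generator of the cyclic
  -- summand, which can be any element of exact order `f ^ (n + 1)`.
  let ev : (M ≃ₗ[K[X]] M) → Y := fun α => ⟨α g, by rw [← map_smul, hg1, map_zero], by
    rwa [← map_smul, Ne, LinearEquiv.map_eq_zero_iff]⟩
  have hfib : ∀ y : Y, Nonempty ({α // ev α = y} ≃
      {α : M ≃ₗ[K[X]] M // ∀ m, α (m, 0) = (m, 0)}) := by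
    intro y
    obtain ⟨r, hr⟩ := h y.1 y.2.1 y.2.2
    let s : Cyc f.1 (n + 1) →ₗ[K[X]] M :=
      Submodule.liftQSpanSingleton _ (LinearMap.toSpanSingleton K[X] M y.1) y.2.1
    have hs : s (Submodule.Quotient.mk 1) = y.1 := one_smul K[X] y.1
    have hrs : ∀ m, r (s m) = m := fun m => by
      have : r ∘ₗ s = LinearMap.id := cyc_map_ext (by
        rw [LinearMap.comp_apply, hs, hr, LinearMap.id_apply])
      exact LinearMap.congr_fun this m
    have E := splitEquiv r s hrs
    have hE : ∀ m, splitEquiv r s hrs (s m) = (m, 0) := fun m =>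
      Prod.ext (hrs m) (Subtype.ext (by
        change s m - s (r (s m)) = 0
        rw [hrs, sub_self]))
    -- The submodule generated by `y` splits off, and by cancellation its complement is isomorphic
    -- to `N`. This yields an automorphism `β` taking the generator to `y`, and composing with it
    -- identifies the fibres.
    obtain ⟨F⟩ := cancel_prod_of_finite (Cyc f.1 (n + 1)) (splitEquiv r s hrs)
    let β : M ≃ₗ[K[X]] M := ((LinearEquiv.refl _ _).prodCongr F).trans (splitEquiv r s hrs).symm
    have hβ : ∀ m, β (m, 0) = s m := fun m => by
      change (splitEquiv r s hrs).symm (m, F 0) = _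
      rw [LinearEquiv.symm_apply_eq, hE, map_zero]
    have key : ∀ α : M ≃ₗ[K[X]] M, ev α = y ↔ ∀ m, (α.trans β.symm) (m, 0) = (m, 0) := fun α => by
      have h1 : ev α = y ↔ α g = s (Submodule.Quotient.mk 1) := by
        rw [hs]
        exact Subtype.ext_iff
      rw [h1]
      constructor
      · intro h2 m
        have h3 : α.toLinearMap ∘ₗ LinearMap.inl _ _ _ = s := cyc_map_ext h2
        rw [LinearEquiv.trans_apply, LinearEquiv.symm_apply_eq, hβ]
        exact LinearMap.congr_fun h3 m
      · intro h2
        have h3 := h2 (Submodule.Quotient.mk 1)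
        rw [LinearEquiv.trans_apply, LinearEquiv.symm_apply_eq, hβ] at h3
        exact h3
    exact ⟨Equiv.subtypeEquiv
      { toFun := fun α => α.trans β.symm
        invFun := fun α => α.trans β
        left_inv := fun α => by ext1 x; simp
        right_inv := fun α => by ext1 x; simp } key⟩
  have hfib' : ∀ y : Y, Nat.card {α // ev α = y}
      = Nat.card (N →ₗ[K[X]] Cyc f.1 (n + 1)) * Nat.card (N ≃ₗ[K[X]] N) := fun y => by
    obtain ⟨e⟩ := hfib y
    rw [Nat.card_congr e, Nat.card_congr (fixFirstEquiv _ _), Nat.card_prod]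
  have : Finite (M ≃ₗ[K[X]] M) := Finite.of_injective _ LinearEquiv.toLinearMap_injective
  have : Fintype Y := Fintype.ofFinite Y
  rw [← Nat.card_congr (Equiv.sigmaFiberEquiv ev), Nat.card_sigma, sum_congr rfl fun y _ => hfib' y,
    sum_const, card_univ, ← Nat.card_eq_fintype_card, smul_eq_mul]

/-- `∏_k ∏_{j=1}^{m_k} (1 - Q^{-j})`. -/
def unitRatio (Q : ℚ) (m : Multiset ℕ) : ℚ :=
  ∏ k ∈ m.toFinset, ∏ j ∈ Icc 1 (m.count k), (1 - Q⁻¹ ^ j)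

lemma unitRatio_cons (Q : ℚ) (m : Multiset ℕ) (n : ℕ) :
    unitRatio Q (n ::ₘ m) = (1 - Q⁻¹ ^ (m.count n + 1)) * unitRatio Q m := by
  have h : ∀ m' : Multiset ℕ, m' ≤ n ::ₘ m → unitRatio Q m'
      = ∏ k ∈ insert n m.toFinset, ∏ j ∈ Icc 1 (m'.count k), (1 - Q⁻¹ ^ j) := fun m' hm' => by
    refine prod_subset (fun x hx => ?_) fun k _ hk => ?_
    · have := Multiset.mem_of_le hm' (Multiset.mem_toFinset.1 hx)
      simpa using this
    · rw [Multiset.mem_toFinset] at hk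
      rw [Multiset.count_eq_zero_of_notMem hk]
      rfl
  rw [h _ le_rfl, h m (Multiset.le_cons_self m n),
    ← mul_prod_erase _ _ (mem_insert_self n m.toFinset),
    ← mul_prod_erase (insert n m.toFinset) (fun k => ∏ j ∈ Icc 1 (m.count k), (1 - Q⁻¹ ^ j))
      (mem_insert_self n m.toFinset), Multiset.count_cons_self, ← mul_assoc,
    prod_Icc_succ_top (by omega), mul_comm (1 - _)]
  congr 1
  exact prod_congr rfl fun k hk => by
    rw [Multiset.count_cons_of_ne (ne_of_mem_erase hk)]

lemma sum_map_min {m : Multiset ℕ} {n : ℕ} (h : ∀ i ∈ m, i ≤ n + 1) :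
    (m.map (min (n + 1))).sum = (m.map (min n)).sum + m.count (n + 1) := by
  induction m using Multiset.induction with
  | empty => simp
  | cons i m ih =>
    have hi := h i (Multiset.mem_cons_self i m)
    rw [Multiset.map_cons, Multiset.map_cons, Multiset.sum_cons, Multiset.sum_cons,
      ih fun j hj => h j (Multiset.mem_cons_of_mem hj), Multiset.count_cons]
    split_ifs <;> omega

/-- The type determines the number of automorphisms. -/
theorem HasType.card_aut {S : Finset (Irr K)} : ∀ (N : Type) [AddCommGroup N] [Module K[X] N]
    [Finite N] (t : Irr K →₀ Multiset ℕ), HasType N t → (∀ f, 0 ∉ t f) → t.support ⊆ S →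
      (Nat.card (N ≃ₗ[K[X]] N) : ℚ) = Nat.card (N →ₗ[K[X]] N) *
        ∏ f ∈ S, unitRatio ((Nat.card K : ℚ) ^ f.1.natDegree) (t f) := by
  classical
  intro N
  induction hc : Nat.card N using Nat.strong_induction_on generalizing N with
  | h c ih =>
    intro _ _ _ t h h0 hS
    by_cases ht : t = 0
    · subst ht
      obtain ⟨E⟩ := h.equiv hasType_punit
      have := E.toEquiv.subsingleton
      have h1 : Nat.card (N →ₗ[K[X]] N) = 1 := Nat.card_eq_one_iff_unique.2
        ⟨⟨fun a b => LinearMap.ext fun x => Subsingleton.elim _ _⟩, ⟨0⟩⟩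
      have h2 : Nat.card (N ≃ₗ[K[X]] N) = 1 := Nat.card_eq_one_iff_unique.2
        ⟨⟨fun a b => LinearEquiv.ext fun x => Subsingleton.elim _ _⟩, ⟨LinearEquiv.refl _ _⟩⟩
      rw [h1, h2, Nat.cast_one, one_mul]
      exact (prod_eq_one fun f _ => by simp [unitRatio]).symm
    obtain ⟨f, hf⟩ := Finsupp.ne_iff.1 ht
    rw [Finsupp.zero_apply] at hf
    -- A largest part is split off, since retractions onto the cyclic summand exist only when no
    -- other `f`-part is longer.
    obtain ⟨n, hn, hmax⟩ := (t f).toFinset.exists_max_image id (by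
      obtain ⟨x, hx⟩ := Multiset.exists_mem_of_ne_zero hf
      exact ⟨x, Multiset.mem_toFinset.2 hx⟩)
    rw [Multiset.mem_toFinset] at hn
    have hmax : ∀ i ∈ t f, i ≤ n := fun i hi => hmax i (Multiset.mem_toFinset.2 hi)
    obtain _ | n := n
    · exact absurd hn (h0 f)
    obtain ⟨m, hm⟩ := Multiset.exists_cons_of_mem hn
    obtain ⟨t', ht'⟩ : ∃ t' : Irr K →₀ Multiset ℕ, t = Finsupp.single f {n + 1} + t' := by
      refine ⟨t.update f m, Finsupp.ext fun g => ?_⟩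
      rw [Finsupp.add_apply, Finsupp.update_apply, Finsupp.single_apply]
      by_cases hfg : f = g
      · subst hfg
        rw [if_pos rfl, if_pos rfl, hm, Multiset.singleton_add]
      · rw [if_neg hfg, if_neg (Ne.symm hfg), zero_add]
    have hg : ∀ g, t g = if f = g then (n + 1) ::ₘ t' g else t' g := fun g => by
      rw [ht', Finsupp.add_apply, Finsupp.single_apply]
      split_ifs <;> simp
    have hle : ∀ g, t' g ≤ t g := fun g => by
      rw [hg]
      split_ifs
      exacts [Multiset.le_cons_self _ _, le_rfl]
    have h := h
    rw [ht'] at h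
    obtain ⟨P, _, _, _, hP, ⟨E⟩⟩ := h.exists_prod
    rw [← ht'] at h
    have hQ : 1 < Nat.card K ^ f.1.natDegree :=
      Nat.one_lt_pow f.2.2.natDegree_pos.ne' Finite.one_lt_card
    set Q := Nat.card K ^ f.1.natDegree with hQd
    have hPc : Nat.card P < c := by
      rw [← hc, Nat.card_congr E.toEquiv, Nat.card_prod, card_cyc]
      exact lt_mul_of_one_lt_left Nat.card_pos (Nat.one_lt_pow (by omega) hQ)
    have hih := ih _ hPc P rfl t' hP (fun g hg0 => h0 g (Multiset.mem_of_le (hle g) hg0))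
      (fun g hg0 => hS (Finsupp.mem_support_iff.2 fun h1 => Finsupp.mem_support_iff.1 hg0
        (Multiset.le_zero.1 (h1 ▸ hle g))))
    have hret := (h.congr E)
    have hcount : 1 ≤ (t f).count (n + 1) := Multiset.one_le_count_iff_mem.2 hn
    have htor := hret f (n + 1)
    have htor' := hret f n
    rw [sum_map_min hmax] at htor
    -- Since `n + 1` is the largest part, passing from `f ^ n` to `f ^ (n + 1)` enlarges the torsion
    -- by the factor `Q` to the multiplicity of `n + 1`. The elements of exact order are the
    -- difference.
    have hY : (Nat.card {y : Cyc f.1 (n + 1) × P // f.1 ^ (n + 1) • y = 0 ∧ f.1 ^ n • y ≠ 0} : ℚ)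
        = torCard (Cyc f.1 (n + 1) × P) (f.1 ^ (n + 1))
          * (1 - ((Q : ℚ)⁻¹) ^ ((t f).count (n + 1))) := by
      have h1 : Nat.card {y : Cyc f.1 (n + 1) × P // f.1 ^ (n + 1) • y = 0 ∧ f.1 ^ n • y ≠ 0}
          + torCard (Cyc f.1 (n + 1) × P) (f.1 ^ n)
          = torCard (Cyc f.1 (n + 1) × P) (f.1 ^ (n + 1)) := by
        have h2 : ∀ y : Cyc f.1 (n + 1) × P, f.1 ^ n • y = 0 → f.1 ^ (n + 1) • y = 0 :=
          fun y hy => smul_eq_zero_of_dvd (pow_dvd_pow _ (Nat.le_succ n)) hy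
        have := Fintype.ofFinite (Cyc f.1 (n + 1) × P)
        rw [torCard, torCard, Nat.card_eq_fintype_card, Nat.card_eq_fintype_card,
          Nat.card_eq_fintype_card, Fintype.card_subtype, Fintype.card_subtype,
          Fintype.card_subtype, ← filter_filter, add_comm]
        rw [← card_filter_add_card_filter_not (s := univ.filter
          fun y : Cyc f.1 (n + 1) × P => f.1 ^ (n + 1) • y = 0) (fun y => f.1 ^ n • y = 0)]
        congr 2
        ext y
        simp only [mem_filter, mem_univ, true_and]
        exact ⟨fun hy => ⟨h2 y hy, hy⟩, fun hy => hy.2⟩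
      have h3 : (Nat.card {y : Cyc f.1 (n + 1) × P // f.1 ^ (n + 1) • y = 0 ∧ f.1 ^ n • y ≠ 0} : ℚ)
          = torCard (Cyc f.1 (n + 1) × P) (f.1 ^ (n + 1))
            - torCard (Cyc f.1 (n + 1) × P) (f.1 ^ n) := by
        rw [← h1]
        push_cast
        ring
      have hQ0 : (Q : ℚ) ≠ 0 := by positivity
      have hQc : (Nat.card K : ℚ) ^ f.1.natDegree = Q := by rw [hQd, Nat.cast_pow]
      rw [h3, htor, htor', pow_add]
      push_cast
      rw [hQc, mul_sub, mul_one, inv_pow, mul_assoc, mul_inv_cancel₀ (pow_ne_zero _ hQ0), mul_one]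
    have hend : Nat.card (N →ₗ[K[X]] N) = torCard (Cyc f.1 (n + 1) × P) (f.1 ^ (n + 1))
        * (Nat.card (P →ₗ[K[X]] Cyc f.1 (n + 1)) * Nat.card (P →ₗ[K[X]] P)) := by
      rw [card_hom_congr_left E, card_hom_congr_right E,
        card_hom_prod_left, card_hom_quot, card_hom_prod_right]
    have haut : Nat.card (N ≃ₗ[K[X]] N) = Nat.card
        ((Cyc f.1 (n + 1) × P) ≃ₗ[K[X]] Cyc f.1 (n + 1) × P) :=
      Nat.card_congr
        { toFun := fun α => (E.symm.trans α).trans E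
          invFun := fun α => (E.trans α).trans E.symm
          left_inv := fun α => by ext1 x; simp
          right_inv := fun α => by ext1 x; simp }
    have hprod : ∏ g ∈ S, unitRatio ((Nat.card K : ℚ) ^ g.1.natDegree) (t g)
        = (1 - ((Q : ℚ)⁻¹) ^ ((t f).count (n + 1))) *
          ∏ g ∈ S, unitRatio ((Nat.card K : ℚ) ^ g.1.natDegree) (t' g) := by
      have hfS : f ∈ S := hS (Finsupp.mem_support_iff.2 hf)
      rw [← mul_prod_erase S _ hfS,
        ← mul_prod_erase S (fun g => unitRatio ((Nat.card K : ℚ) ^ g.1.natDegree) (t' g)) hfS,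
        ← mul_assoc]
      congr 1
      · rw [hg f, if_pos rfl, unitRatio_cons, Multiset.count_cons_self]
        push_cast [hQd]
        rfl
      · exact prod_congr rfl fun g hgS => by rw [hg g, if_neg (ne_of_mem_erase hgS).symm]
    rw [haut, card_aut_prod (HasType.hasRetractions hmax _ hret), hend, hprod]
    push_cast
    rw [hY, hih]
    ring

end Automorphisms

/-! ### Square matrices as modules over the polynomials. -/

section Matrices

variable {K : Type} [Field K] {m n : ℕ}

/-- The `K[X]`-module of a matrix. -/
abbrev MatMod (A : Matrix (Fin n) (Fin n) K) : Type := Module.AEval' (Matrix.toLin' A)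

instance [Finite K] (A : Matrix (Fin n) (Fin n) K) : Finite (MatMod A) :=
  inferInstanceAs (Finite (Fin n → K))

lemma X_smul_of_matMod (A : Matrix (Fin n) (Fin n) K) (y : Fin n → K) :
    (X : K[X]) • (Module.AEval'.of (Matrix.toLin' A) y) =
      Module.AEval'.of (Matrix.toLin' A) (A.mulVec y) :=
  Module.AEval'.X_smul_of _ y

/-- Homomorphisms between the modules of two matrices are intertwining matrices. -/
def matHomEquiv (A : Matrix (Fin n) (Fin n) K) (B : Matrix (Fin m) (Fin m) K) :
    (MatMod A →ₗ[K[X]] MatMod B) ≃ {g : Matrix (Fin m) (Fin n) K // B * g = g * A} where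
  toFun g := ⟨LinearMap.toMatrix' ((Module.AEval'.of (Matrix.toLin' B)).symm.toLinearMap ∘ₗ
      g.restrictScalars K ∘ₗ (Module.AEval'.of (Matrix.toLin' A)).toLinearMap), by
    apply Matrix.toLin'.injective
    rw [Matrix.toLin'_mul, Matrix.toLin'_mul, Matrix.toLin'_toMatrix']
    refine LinearMap.ext fun y => ?_
    have h := congrArg (Module.AEval'.of (Matrix.toLin' B)).symm
      (g.map_smul X (Module.AEval'.of (Matrix.toLin' A) y))
    rw [X_smul_of_matMod, Module.AEval'.of_symm_X_smul] at h
    exact h.symm⟩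
  invFun g := LinearMap.ofAEval _
    ((Module.AEval'.of (Matrix.toLin' B)).toLinearMap ∘ₗ Matrix.toLin' g.1) fun y => by
      change Module.AEval'.of _ (g.1.mulVec (A.mulVec y)) =
        X • Module.AEval'.of _ (g.1.mulVec y)
      rw [X_smul_of_matMod, Matrix.mulVec_mulVec, Matrix.mulVec_mulVec, g.2]
  left_inv g := by
    refine LinearMap.ext fun y => ?_
    change Module.AEval'.of _ (Matrix.toLin' (LinearMap.toMatrix' _) _) = _
    rw [Matrix.toLin'_toMatrix']
    rfl
  right_inv g := Subtype.ext (LinearMap.toMatrix'_toLin' _)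

/-- Isomorphisms between the modules of two matrices are invertible intertwining matrices. -/
def matEquivEquiv (A B : Matrix (Fin n) (Fin n) K) :
    (MatMod A ≃ₗ[K[X]] MatMod B) ≃ {g : GL (Fin n) K // B * g.1 = g.1 * A} where
  toFun g := ⟨⟨(matHomEquiv A B g).1, (matHomEquiv B A g.symm).1, by
      change LinearMap.toMatrix' _ * LinearMap.toMatrix' _ = 1
      rw [← LinearMap.toMatrix'_comp, ← LinearMap.toMatrix'_id]
      congr 1
      refine LinearMap.ext fun y => ?_
      exact g.apply_symm_apply y, by
      change LinearMap.toMatrix' _ * LinearMap.toMatrix' _ = 1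
      rw [← LinearMap.toMatrix'_comp, ← LinearMap.toMatrix'_id]
      congr 1
      refine LinearMap.ext fun y => ?_
      exact g.symm_apply_apply y⟩, (matHomEquiv A B g).2⟩
  invFun g := LinearEquiv.ofLinearMap ((matHomEquiv A B).symm ⟨g.1.1, g.2⟩)
    ((matHomEquiv B A).symm ⟨g.1⁻¹.1, by
      have h := congrArg (fun M => g.1⁻¹.1 * M * g.1⁻¹.1) g.2
      simp only [Matrix.mul_assoc, Units.mul_inv, Matrix.mul_one] at h
      simp only [← Matrix.mul_assoc, Units.inv_mul, Matrix.one_mul] at h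
      exact h.symm⟩)
    (LinearMap.ext fun y => by
      have h : ∀ z : Fin n → K, g.1.1.mulVec (g.1⁻¹.1.mulVec z) = z := fun z => by
        rw [Matrix.mulVec_mulVec, Units.mul_inv, Matrix.one_mulVec]
      exact h y)
    (LinearMap.ext fun y => by
      have h : ∀ z : Fin n → K, g.1⁻¹.1.mulVec (g.1.1.mulVec z) = z := fun z => by
        rw [Matrix.mulVec_mulVec, Units.inv_mul, Matrix.one_mulVec]
      exact h y)
  left_inv g := LinearEquiv.toLinearMap_injective ((matHomEquiv A B).symm_apply_apply g.toLinearMap)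
  right_inv g := Subtype.ext (Units.ext
    (congrArg Subtype.val ((matHomEquiv A B).apply_symm_apply ⟨g.1.1, g.2⟩)))

/-- Every `K[X]`-module of dimension `n` is the module of a matrix. -/
lemma exists_matMod_equiv [Finite K] {N : Type} [AddCommGroup N] [Module K[X] N] [Finite N]
    (hN : Nat.card N = Nat.card K ^ n) :
    ∃ A : Matrix (Fin n) (Fin n) K, Nonempty (MatMod A ≃ₗ[K[X]] N) := by
  have := Fintype.ofFinite K
  let _ : Module K N := Module.compHom N (algebraMap K K[X])
  have : IsScalarTower K K[X] N := ⟨fun a f y => by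
    rw [Algebra.smul_def, mul_smul]
    rfl⟩
  have : Module.Finite K N := Module.Finite.of_finite
  have hd : Module.finrank K N = n := by
    have h := Module.natCard_eq_pow_finrank (K := K) (V := N)
    rw [hN] at h
    exact (Nat.pow_right_injective Finite.one_lt_card h).symm
  let e : (Fin n → K) ≃ₗ[K] N := LinearEquiv.ofFinrankEq _ _ (by rw [hd]; simp)
  let φ : (Fin n → K) →ₗ[K] (Fin n → K) :=
    e.symm.toLinearMap ∘ₗ (Algebra.lsmul K K N (X : K[X])) ∘ₗ e.toLinearMap
  refine ⟨LinearMap.toMatrix' φ, ⟨LinearEquiv.ofAEval _ e fun y => ?_⟩⟩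
  rw [Matrix.toLin'_toMatrix']
  change e (e.symm ((X : K[X]) • e y)) = _
  rw [e.apply_symm_apply]

/-- A matrix is invertible if `X` acts injectively on its module. -/
lemma isUnit_iff_torCard [Finite K] (A : Matrix (Fin n) (Fin n) K) :
    IsUnit A ↔ torCard (MatMod A) (X : K[X]) = 1 := by
  rw [torCard, Nat.card_eq_one_iff_unique, ← Matrix.mulVec_injective_iff_isUnit]
  constructor
  · refine fun h => ⟨⟨fun y z => Subtype.ext (h ?_)⟩, ⟨0, smul_zero _⟩⟩
    have h1 : A.mulVec y.1 = 0 := (Module.AEval'.X_smul_of (Matrix.toLin' A) y.1).symm.trans y.2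
    have h2 : A.mulVec z.1 = 0 := (Module.AEval'.X_smul_of (Matrix.toLin' A) z.1).symm.trans z.2
    exact h1.trans h2.symm
  · rintro ⟨h, -⟩ y z hyz
    have h1 : A.mulVec (y - z) = 0 := by
      rw [Matrix.mulVec_sub]
      exact sub_eq_zero.2 hyz
    have h2 : (X : K[X]) • Module.AEval'.of (Matrix.toLin' A) (y - z) = 0 := by
      rw [X_smul_of_matMod, h1, map_zero]
    have h3 := congrArg Subtype.val (Subsingleton.elim
      (⟨Module.AEval'.of (Matrix.toLin' A) (y - z), h2⟩ :
        {y : MatMod A // (X : K[X]) • y = 0}) ⟨0, smul_zero _⟩)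
    exact sub_eq_zero.1 h3

end Matrices

/-! ### Uniqueness of types, and the size of a module. -/

section Types

variable {K : Type} [Field K] [Finite K]

/-- The multiplicity of `e + 1` is minus the second difference, at `e`, of the sum of `min e` over
the parts. -/
lemma count_eq_of_sum_min {m m' : Multiset ℕ} (h0 : 0 ∉ m) (h0' : 0 ∉ m')
    (h : ∀ e, (m.map (min e)).sum = (m'.map (min e)).sum) : m = m' := by
  have key : ∀ (s : Multiset ℕ) (e : ℕ), 2 * (s.map (min (e + 1))).sum
      = (s.map (min e)).sum + (s.map (min (e + 2))).sum + s.count (e + 1) := fun s e => by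
    induction s using Multiset.induction with
    | empty => rfl
    | cons a s ih =>
      simp only [Multiset.map_cons, Multiset.sum_cons, Multiset.count_cons]
      split_ifs <;> omega
  refine Multiset.ext.2 fun k => ?_
  cases k with
  | zero => rw [Multiset.count_eq_zero_of_notMem h0, Multiset.count_eq_zero_of_notMem h0']
  | succ e =>
    have h1 := key m e
    have h2 := key m' e
    rw [h, h, h] at h1
    omega

variable {N N' : Type} [AddCommGroup N] [Module K[X] N] [AddCommGroup N'] [Module K[X] N']

lemma HasType.eq {t t' : Irr K →₀ Multiset ℕ} (h : HasType N t) (h' : HasType N t')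
    (h0 : ∀ f, 0 ∉ t f) (h0' : ∀ f, 0 ∉ t' f) : t = t' :=
  Finsupp.ext fun f => count_eq_of_sum_min (h0 f) (h0' f) fun e => by
    have h1 := (h f e).symm.trans (h' f e)
    exact Nat.pow_right_injective (Nat.one_lt_pow f.2.2.natDegree_pos.ne' Finite.one_lt_card) h1

lemma HasType.card {S : Finset (Irr K)} [Finite N] {t : Irr K →₀ Multiset ℕ} (h : HasType N t)
    (hS : t.support ⊆ S) : Nat.card N = Nat.card K ^ ∑ f ∈ S, f.1.natDegree * (t f).sum := by
  classical
  induction t using type_induction generalizing N with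
  | h0 =>
    obtain ⟨E⟩ := h.equiv hasType_punit
    rw [Nat.card_congr E.toEquiv]
    simp
  | h1 f n t ih =>
    obtain ⟨N', _, _, _, hN', ⟨E⟩⟩ := h.exists_prod
    have hsub : ∀ g, (Finsupp.single f {n} + t : Irr K →₀ Multiset ℕ) g = 0 → t g = 0 := fun g hg => by
      rw [Finsupp.add_apply] at hg
      exact (add_eq_zero.1 hg).2
    have hf : f ∈ S := hS (Finsupp.mem_support_iff.2 fun h0 => by
      rw [Finsupp.add_apply, Finsupp.single_eq_same, add_eq_zero] at h0
      exact Multiset.singleton_ne_zero _ h0.1)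
    rw [Nat.card_congr E.toEquiv, Nat.card_prod, card_cyc, ih hN' fun g hg =>
      hS (Finsupp.mem_support_iff.2 fun h0 => Finsupp.mem_support_iff.1 hg (hsub g h0)), ← pow_mul,
      ← pow_add]
    congr 1
    have h1 : f.1.natDegree * n
        = ∑ g ∈ S, g.1.natDegree * ((Finsupp.single f {n} : Irr K →₀ Multiset ℕ) g).sum := by
      rw [Finset.sum_eq_single_of_mem f hf fun g _ hg => by
        rw [Finsupp.single_eq_of_ne hg, Multiset.sum_zero, mul_zero]]
      simp
    rw [h1, ← sum_add_distrib]
    refine sum_congr rfl fun g _ => ?_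
    rw [Finsupp.add_apply, Multiset.sum_add, mul_add]

end Types

/-! ### Types of invertible matrices. -/

section GLTypes

variable {K : Type} [Field K] [Finite K] {n : ℕ}

/-- The type of the module of a matrix. -/
def matType (A : Matrix (Fin n) (Fin n) K) : Irr K →₀ Multiset ℕ :=
  (exists_hasType K (MatMod A)).choose

lemma hasType_matType (A : Matrix (Fin n) (Fin n) K) : HasType (MatMod A) (matType A) :=
  (exists_hasType K (MatMod A)).choose_spec.1

lemma zero_notMem_matType (A : Matrix (Fin n) (Fin n) K) (f : Irr K) : 0 ∉ matType A f :=
  (exists_hasType K (MatMod A)).choose_spec.2 f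

lemma matType_eq {A : Matrix (Fin n) (Fin n) K} {t : Irr K →₀ Multiset ℕ}
    (h : HasType (MatMod A) t) (h0 : ∀ f, 0 ∉ t f) : matType A = t :=
  (hasType_matType A).eq h (zero_notMem_matType A) h0

lemma sum_map_min_one {m : Multiset ℕ} (h0 : 0 ∉ m) : (m.map (min 1)).sum = 0 ↔ m = 0 := by
  refine ⟨fun h => Multiset.eq_zero_of_forall_notMem fun a ha => ?_, fun h => by simp [h]⟩
  have := Multiset.sum_eq_zero_iff.1 h _ (Multiset.mem_map_of_mem _ ha)
  have h1 : a ≠ 0 := fun h => h0 (h ▸ ha)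
  omega

/-- The irreducible polynomial `X`. -/
def irrX (K : Type) [Field K] : Irr K := ⟨X, monic_X, irreducible_X⟩

lemma isUnit_iff_of_hasType {A : Matrix (Fin n) (Fin n) K} {t : Irr K →₀ Multiset ℕ}
    (h : HasType (MatMod A) t) (h0 : ∀ f, 0 ∉ t f) : IsUnit A ↔ t (irrX K) = 0 := by
  rw [isUnit_iff_torCard, ← sum_map_min_one (h0 _)]
  have h1 := h (irrX K) 1
  rw [pow_one] at h1
  change torCard (MatMod A) (X : K[X]) = _ at h1
  rw [h1]
  have h2 : (irrX K).1.natDegree ≠ 0 := (irrX K).2.2.natDegree_pos.ne'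
  exact ⟨fun h => by_contra fun h3 => (Nat.one_lt_pow h3
    (Nat.one_lt_pow h2 Finite.one_lt_card)).ne' h, fun h => by rw [h, pow_zero]⟩

/-- The types of the elements of `GL_n`. -/
def IsGLType (S : Finset (Irr K)) (n : ℕ) (t : Irr K →₀ Multiset ℕ) : Prop :=
  t.support ⊆ S ∧ (∀ f, 0 ∉ t f) ∧ ∑ f ∈ S, f.1.natDegree * (t f).sum = n

/-- Invertibility excludes the polynomial `X`, and the size of the module fixes the weighted sum of
the parts. This bounds the degrees that occur, so one finite set `S` serves for all sizes up to `N`.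
-/
lemma exists_matType_eq_iff {S : Finset (Irr K)} {N : ℕ}
    (hS : ∀ f : Irr K, f ∈ S ↔ f.1 ≠ X ∧ f.1.natDegree ≤ N) (hn : n ≤ N)
    (t : Irr K →₀ Multiset ℕ) :
    (∃ g : GL (Fin n) K, matType g.1 = t) ↔ IsGLType S n t := by
  classical
  have hX : irrX K ∉ S := fun h => ((hS _).1 h).1 rfl
  constructor
  · rintro ⟨g, rfl⟩
    have h0 := zero_notMem_matType g.1
    have hc := (hasType_matType g.1).card subset_rfl
    have hK : Nat.card (Fin n → K) = Nat.card K ^ n := by rw [Nat.card_fun, Nat.card_fin]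
    rw [show Nat.card (MatMod g.1) = _ from hK] at hc
    have hc := Nat.pow_right_injective Finite.one_lt_card hc
    have hs : (matType g.1).support ⊆ S := fun f hf => by
      refine (hS f).2 ⟨fun h => ?_, le_trans ?_ hn⟩
      · refine Finsupp.mem_support_iff.1 hf ?_
        rw [show f = irrX K from Subtype.ext h]
        exact (isUnit_iff_of_hasType (hasType_matType g.1) h0).1 g.isUnit
      · rw [hc]
        refine le_trans ?_ (single_le_sum (f := fun f : Irr K => f.1.natDegree * (matType g.1 f).sum)
          (fun _ _ => Nat.zero_le _) hf)
        refine Nat.le_mul_of_pos_right _ (Nat.pos_of_ne_zero fun h => ?_)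
        refine Finsupp.mem_support_iff.1 hf (Multiset.eq_zero_of_forall_notMem fun a ha => ?_)
        exact h0 f (Multiset.sum_eq_zero_iff.1 h a ha ▸ ha)
    refine ⟨hs, h0, ?_⟩
    refine Eq.trans ?_ hc.symm
    exact (sum_subset hs fun f _ hf => by rw [Finsupp.notMem_support_iff.1 hf]; simp).symm
  · rintro ⟨hs, h0, hc⟩
    obtain ⟨N, _, _, _, hN⟩ := exists_module_hasType K t
    obtain ⟨A, ⟨E⟩⟩ := exists_matMod_equiv (K := K) (n := n) (N := N) (by rw [hN.card hs, hc])
    have hA : HasType (MatMod A) t := hN.congr E.symm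
    have hu : IsUnit A := (isUnit_iff_of_hasType hA h0).2
      (Finsupp.notMem_support_iff.1 fun h => hX (hs h))
    exact ⟨hu.unit, matType_eq hA h0⟩

/-- Matrices of equal type are conjugate, so the elements of a given type form a conjugacy class,
and the centralizer is the automorphism group of the module. -/
lemma card_matType (g : GL (Fin n) K) : Nat.card (GL (Fin n) K)
    = Nat.card {h : GL (Fin n) K // matType h.1 = matType g.1}
      * Nat.card (MatMod g.1 ≃ₗ[K[X]] MatMod g.1) := by
  classical
  have := Fintype.ofFinite K
  have key : ∀ a b : GL (Fin n) K, b.1 * a.1 = a.1 * g.1 ↔ a * g * a⁻¹ = b := fun a b => by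
    rw [mul_inv_eq_iff_eq_mul, Units.ext_iff, Units.val_mul, Units.val_mul, eq_comm]
  let F : GL (Fin n) K → {h : GL (Fin n) K // matType h.1 = matType g.1} := fun a =>
    ⟨a * g * a⁻¹, matType_eq ((hasType_matType g.1).congr
      ((matEquivEquiv g.1 (a * g * a⁻¹).1).symm ⟨a, (key a _).2 rfl⟩)) (zero_notMem_matType _)⟩
  rw [← Nat.card_congr (Equiv.sigmaFiberEquiv F), Nat.card_sigma,
    sum_congr rfl (g := fun _ => Nat.card (MatMod g.1 ≃ₗ[K[X]] MatMod g.1)), sum_const, card_univ,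
    ← Nat.card_eq_fintype_card (α := {h // _}), smul_eq_mul]
  intro b _
  obtain ⟨E⟩ := (hasType_matType g.1).equiv (b.2 ▸ hasType_matType b.1.1)
  have e1 : {a // F a = b} ≃ {a : GL (Fin n) K // b.1.1 * a.1 = a.1 * g.1} :=
    Equiv.subtypeEquivRight fun a => by rw [key, Subtype.ext_iff]
  have e2 : (MatMod g.1 ≃ₗ[K[X]] MatMod g.1) ≃ (MatMod g.1 ≃ₗ[K[X]] MatMod b.1.1) :=
    ⟨fun a => a.trans E, fun a => a.trans E.symm, fun a => LinearEquiv.ext fun y => by simp,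
      fun a => LinearEquiv.ext fun y => by simp⟩
  exact Nat.card_congr (e1.trans ((matEquivEquiv _ _).symm.trans e2.symm))

/-- The number of automorphisms of a module of given type. -/
def autWeight (Q : ℚ) (m : Multiset ℕ) : ℚ := Q ^ minSum m m * unitRatio Q m

lemma card_gl {S : Finset (Irr K)} {g : GL (Fin n) K} (hS : (matType g.1).support ⊆ S) :
    (Nat.card (GL (Fin n) K) : ℚ) = Nat.card {h : GL (Fin n) K // matType h.1 = matType g.1}
      * ∏ f ∈ S, autWeight ((Nat.card K : ℚ) ^ f.1.natDegree) (matType g.1 f) := by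
  have ht := hasType_matType g.1
  rw [card_matType g, Nat.cast_mul,
    HasType.card_aut (MatMod g.1) _ ht (zero_notMem_matType g.1) hS, ht.card_hom hS _ ht]
  simp only [autWeight, prod_mul_distrib]
  push_cast
  rfl

end GLTypes

/-! ### Burnside's lemma -/

namespace FinQuiver

variable {I Ω : Type*} (Γ : FinQuiver I Ω) (v : I → ℕ) (K : Type) [Field K]

/-- The action of the product of the general linear groups on the representations. -/
abbrev repAction : MulAction ((i : I) → GL (Fin (v i)) K) (Γ.Rep v K) where
  smul g φ := fun a => (g (Γ.tgt a)).val * φ a * (g (Γ.src a))⁻¹.val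
  one_smul φ := funext fun a => by
    change (1 : Matrix _ _ K) * φ a * _ = φ a
    simp
  mul_smul g h φ := funext fun a => by
    change (g (Γ.tgt a) * h (Γ.tgt a)).val * φ a * (g (Γ.src a) * h (Γ.src a))⁻¹.val =
      (g (Γ.tgt a)).val * ((h (Γ.tgt a)).val * φ a * (h (Γ.src a))⁻¹.val) * (g (Γ.src a))⁻¹.val
    rw [mul_inv_rev, Units.val_mul, Units.val_mul]
    simp only [Matrix.mul_assoc]

variable {K} [Fintype I] [DecidableEq I] [Fintype Ω] [Finite K]

lemma card_fixed (g : (i : I) → GL (Fin (v i)) K) :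
    Nat.card {φ : Γ.Rep v K // (repAction Γ v K).toSMul.smul g φ = φ}
      = ∏ a, Nat.card (MatMod (g (Γ.src a)).1 →ₗ[K[X]] MatMod (g (Γ.tgt a)).1) := by
  rw [← Nat.card_pi]
  refine Nat.card_congr ((Equiv.subtypeEquivRight fun φ => ?_).trans
    (Equiv.subtypePiEquivPi.trans (Equiv.piCongrRight fun a => (matHomEquiv _ _).symm)))
  rw [funext_iff]
  refine forall_congr' fun a => ?_
  change (g (Γ.tgt a)).val * φ a * (g (Γ.src a))⁻¹.val = φ a ↔ _
  refine ⟨fun h => ?_, fun h => ?_⟩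
  · conv_rhs => rw [← h]
    rw [Matrix.mul_assoc _ _ (g (Γ.src a)).val, Units.inv_mul, Matrix.mul_one]
  · rw [h, Matrix.mul_assoc, Units.mul_inv, Matrix.mul_one]

/-- Burnside's lemma; a representation is fixed by `g` when each of its matrices is a homomorphism
between the `K[X]`-modules of the components of `g`. -/
lemma card_quotient_mul : Nat.card (Quotient (Γ.repSetoid v K)) *
    Nat.card ((i : I) → GL (Fin (v i)) K) = ∑ᶠ g : (i : I) → GL (Fin (v i)) K,
      ∏ a, Nat.card (MatMod (g (Γ.src a)).1 →ₗ[K[X]] MatMod (g (Γ.tgt a)).1) := by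
  classical
  let _ := repAction Γ v K
  have := Fintype.ofFinite ((i : I) → GL (Fin (v i)) K)
  have : Finite (Γ.Rep v K) := inferInstanceAs (Finite (∀ _, _))
  have := fun g : (i : I) → GL (Fin (v i)) K => Fintype.ofFinite (MulAction.fixedBy (Γ.Rep v K) g)
  have := Fintype.ofFinite (Quotient (MulAction.orbitRel ((i : I) → GL (Fin (v i)) K) (Γ.Rep v K)))
  have h := MulAction.sum_card_fixedBy_eq_card_orbits_mul_card_group
    ((i : I) → GL (Fin (v i)) K) (Γ.Rep v K)
  rw [finsum_eq_sum_of_fintype, Nat.card_eq_fintype_card (α := (i : I) → GL (Fin (v i)) K),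
    Nat.card_congr (β := Quotient (MulAction.orbitRel ((i : I) → GL (Fin (v i)) K) (Γ.Rep v K)))
      (Quotient.congr (Equiv.refl _) fun φ ψ => ?_), Nat.card_eq_fintype_card, ← h]
  · refine sum_congr rfl fun g _ => ?_
    rw [← card_fixed, ← Nat.card_eq_fintype_card]
    rfl
  · rw [Setoid.comm']
    change RepIso ψ φ ↔ ∃ g : (i : I) → GL (Fin (v i)) K, g • ψ = φ
    exact exists_congr fun g => by
      rw [funext_iff]
      exact forall_congr' fun a => eq_comm

/-- The contribution of a tuple of partitions to the number of isomorphism classes. -/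
def huaWeight (Q : ℚ) (m : I → Multiset ℕ) : ℚ :=
  (∏ a, Q ^ minSum (m (Γ.src a)) (m (Γ.tgt a))) / ∏ i, autWeight Q (m i)

open Classical in
variable (K) in
/-- The types of the elements of a product of general linear groups. -/
def glTypes : Finset (I → Irr K →₀ Multiset ℕ) :=
  (Set.finite_range fun (g : (i : I) → GL (Fin (v i)) K) i => matType (g i).1).toFinset

variable {v} in
lemma mem_glTypes {S : Finset (Irr K)} {N : ℕ}
    (hS : ∀ f : Irr K, f ∈ S ↔ f.1 ≠ X ∧ f.1.natDegree ≤ N) (hv : ∀ i, v i ≤ N)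
    {t : I → Irr K →₀ Multiset ℕ} : t ∈ glTypes v K ↔ ∀ i, IsGLType S (v i) (t i) := by
  rw [glTypes, Set.Finite.mem_toFinset, Set.mem_range]
  simp only [← exists_matType_eq_iff hS (hv _)]
  exact ⟨fun ⟨g, hg⟩ i => ⟨g i, congrFun hg i⟩, fun h => by
    choose g hg using h
    exact ⟨g, funext hg⟩⟩

/-- The number of isomorphism classes of representations. -/
theorem card_quotient {S : Finset (Irr K)} {N : ℕ}
    (hS : ∀ f : Irr K, f ∈ S ↔ f.1 ≠ X ∧ f.1.natDegree ≤ N) (hv : ∀ i, v i ≤ N) :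
    (Nat.card (Quotient (Γ.repSetoid v K)) : ℚ) = ∑ t ∈ glTypes v K,
      ∏ f ∈ S, Γ.huaWeight ((Nat.card K : ℚ) ^ f.1.natDegree) fun i => t i f := by
  classical
  have := Fintype.ofFinite ((i : I) → GL (Fin (v i)) K)
  have h := congrArg (Nat.cast : ℕ → ℚ) (card_quotient_mul Γ v (K := K))
  rw [finsum_eq_sum_of_fintype, Nat.cast_mul, Nat.cast_sum] at h
  have hG : (Nat.card ((i : I) → GL (Fin (v i)) K) : ℚ) ≠ 0 :=
    Nat.cast_ne_zero.2 Finite.card_pos.ne'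
  -- Group elements are sorted by type. The summand is constant on each fibre, and the size of the
  -- fibre cancels against the same factor in the order of the group, leaving the Hua weights.
  rw [← mul_left_inj' hG, h, sum_mul, ← sum_fiberwise_of_maps_to (t := glTypes v K)
    (g := fun (g : (i : I) → GL (Fin (v i)) K) i => matType (g i).1)
    fun g _ => (Set.Finite.mem_toFinset _).2 ⟨g, rfl⟩]
  refine sum_congr rfl fun t ht => ?_
  obtain ⟨g, hg⟩ := (Set.Finite.mem_toFinset _).1 ht
  have hsub : ∀ i, (t i).support ⊆ S := fun i => ((mem_glTypes hS hv).1 ht i).1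
  have hsum : ∑ h : (i : I) → GL (Fin (v i)) K with (fun i => matType (h i).1) = t,
      ((∏ a, Nat.card (MatMod (h (Γ.src a)).1 →ₗ[K[X]] MatMod (h (Γ.tgt a)).1) : ℕ) : ℚ)
      = (∏ i, (Nat.card {h : GL (Fin (v i)) K // matType h.1 = t i} : ℚ)) *
        ∏ f ∈ S, ∏ a, ((Nat.card K : ℚ) ^ f.1.natDegree) ^ minSum (t (Γ.src a) f) (t (Γ.tgt a) f) := by
    rw [sum_congr rfl (g := fun _ => ∏ f ∈ S, ∏ a,
      ((Nat.card K : ℚ) ^ f.1.natDegree) ^ minSum (t (Γ.src a) f) (t (Γ.tgt a) f)), sum_const,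
      nsmul_eq_mul]
    · congr 1
      rw [← Nat.cast_prod, ← Nat.card_pi, ← natCard_subtype_eq (fun _ => mem_filter_univ _)]
      exact congrArg _ (Nat.card_congr ((Equiv.subtypeEquivRight fun h => funext_iff).trans
        (Equiv.subtypePiEquivPi (p := fun i (h : GL (Fin (v i)) K) => matType h.1 = t i))))
    · intro h hh
      have ht : ∀ i, HasType (MatMod (h i).1) (t i) := fun i =>
        congrFun (mem_filter.1 hh).2 i ▸ hasType_matType (h i).1
      rw [prod_comm, Nat.cast_prod]
      refine prod_congr rfl fun a _ => ?_
      rw [(ht (Γ.tgt a)).card_hom (hsub _) _ (ht (Γ.src a))]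
      push_cast
      rfl
  have hcard : (Nat.card ((i : I) → GL (Fin (v i)) K) : ℚ)
      = (∏ i, (Nat.card {h : GL (Fin (v i)) K // matType h.1 = t i} : ℚ)) *
        ∏ f ∈ S, ∏ i, autWeight ((Nat.card K : ℚ) ^ f.1.natDegree) (t i f) := by
    rw [Nat.card_pi, Nat.cast_prod, prod_comm, ← prod_mul_distrib]
    refine prod_congr rfl fun i _ => ?_
    have hi : matType (g i).1 = t i := congrFun hg i
    rw [card_gl (g := g i) (hi ▸ hsub i), hi]
  rw [hcard] at hG
  rw [hsum, hcard]
  simp only [huaWeight]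
  rw [prod_div_distrib, mul_comm (∏ i, _ : ℚ), mul_comm (∏ i, _ : ℚ), ← mul_assoc,
    div_mul_cancel₀ _ (right_ne_zero_of_mul hG)]

end FinQuiver

/-! ### Rules for Adams sums. -/

section AdamsSum

variable {σ R : Type*} [CommRing R] [Algebra ℚ R]

lemma adamsSum_congr {g g' : ℕ → MvPowerSeries σ R} (h : ∀ d, d ≠ 0 → g d = g' d) :
    adamsSum g = adamsSum g' := by
  classical
  ext m
  simp only [coeff_adamsSum]
  exact sum_congr rfl fun d hd => by rw [h d (Nat.one_le_iff_ne_zero.1 (mem_Icc.1 hd).1)]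

lemma smul_adamsSum (c : R) (g : ℕ → MvPowerSeries σ R) :
    c • adamsSum g = adamsSum fun d => c • g d := by
  classical
  ext m
  simp only [MvPowerSeries.coeff_smul, coeff_adamsSum, mul_sum, mul_ite, mul_zero]

lemma euler_smul (c : R) (F : MvPowerSeries σ R) : euler (c • F) = c • euler F := by
  ext m
  rw [coeff_euler, MvPowerSeries.coeff_smul, MvPowerSeries.coeff_smul, coeff_euler, mul_left_comm]

lemma degree_eq_mul {d : ℕ} (hd : d ≠ 0) {m : σ →₀ ℕ} (h : ∀ s, d ∣ m s) :
    m.degree = d * (m.mapRange (· / d) (Nat.zero_div d)).degree := by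
  conv_lhs => rw [(mapRange_div_eq_iff hd h _).1 rfl]
  rw [map_nsmul, smul_eq_mul]

lemma euler_adamsSum (g : ℕ → MvPowerSeries σ R) :
    euler (adamsSum g) = adamsSum fun d => (d : R) • euler (g d) := by
  classical
  ext m
  simp only [coeff_euler, coeff_adamsSum, mul_sum, MvPowerSeries.coeff_smul]
  refine sum_congr rfl fun d hd => ?_
  have hd0 := Nat.one_le_iff_ne_zero.1 (mem_Icc.1 hd).1
  split_ifs with h
  · rw [degree_eq_mul hd0 h, Nat.cast_mul, mul_assoc]
  · rw [mul_zero]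

lemma adamsSum_adamsSum (g : ℕ → ℕ → MvPowerSeries σ R) :
    adamsSum (fun d => adamsSum (g d))
      = adamsSum fun n => ∑ x ∈ n.divisorsAntidiagonal, g x.1 x.2 := by
  classical
  ext m
  simp only [coeff_adamsSum]
  rw [← sum_filter, ← sum_filter]
  simp only [map_sum]
  rw [sum_congr rfl fun d _ => (sum_filter _ _).symm, sum_sigma', sum_sigma']
  have key : ∀ d e : ℕ, d ≠ 0 → (∀ s, d ∣ m s) → (∀ s, e ∣ m s / d) → ∀ s, d * e ∣ m s :=
    fun d e hd h h' s => by
      obtain ⟨c, hc⟩ := h s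
      have := h' s
      rw [hc, Nat.mul_div_cancel_left _ (Nat.pos_of_ne_zero hd)] at this
      rw [hc]
      exact mul_dvd_mul_left d this
  refine sum_bij' (fun x _ => ⟨x.1 * x.2, x.1, x.2⟩) (fun x _ => ⟨x.2.1, x.2.2⟩) ?_ ?_ ?_ ?_ ?_
  · rintro ⟨d, e⟩ hx
    have hx := And.intro (mem_filter.1 (mem_sigma.1 hx).1) (mem_filter.1 (mem_sigma.1 hx).2)
    simp only [mem_Icc, Finsupp.mapRange_apply] at hx
    simp only [mem_sigma, mem_filter, mem_Icc, Nat.mem_divisorsAntidiagonal]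
    have hd0 : d ≠ 0 := by omega
    refine ⟨⟨⟨Nat.mul_pos (by omega) (by omega), ?_⟩, key d e hd0 hx.1.2 hx.2.2⟩, trivial,
      mul_ne_zero hd0 (by omega)⟩
    rw [degree_eq_mul hd0 hx.1.2]
    exact Nat.mul_le_mul_left d hx.2.1.2
  · rintro ⟨n, d, e⟩ hx
    simp only [mem_sigma, mem_filter, mem_Icc, Nat.mem_divisorsAntidiagonal] at hx
    obtain ⟨⟨⟨h1, h2⟩, h3⟩, rfl, h5⟩ := hx
    have hd0 := (mul_ne_zero_iff.1 h5).1
    have he0 := (mul_ne_zero_iff.1 h5).2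
    have hd : ∀ s, d ∣ m s := fun s => (Dvd.intro e rfl).trans (h3 s)
    refine mem_sigma.2 ⟨mem_filter.2 ⟨mem_Icc.2 ⟨Nat.pos_of_ne_zero hd0,
      le_trans (Nat.le_mul_of_pos_right d (Nat.pos_of_ne_zero he0)) h2⟩, hd⟩,
      mem_filter.2 ⟨mem_Icc.2 ⟨(by omega : 1 ≤ e), ?_⟩, fun s => ?_⟩⟩
    · rw [degree_eq_mul hd0 hd] at h2
      exact Nat.le_of_mul_le_mul_left h2 (by omega)
    · exact Nat.dvd_div_of_mul_dvd (h3 s)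
  · intro x _
    rfl
  · rintro ⟨n, d, e⟩ hx
    simp only [mem_sigma, mem_filter, mem_Icc, Nat.mem_divisorsAntidiagonal] at hx
    obtain ⟨-, rfl, -⟩ := hx
    rfl
  · rintro ⟨d, e⟩ hx
    congr 2
    refine Finsupp.ext fun s => ?_
    simp only [Finsupp.mapRange_apply, Nat.div_div_eq_div_mul]

lemma coeff_expand {d : ℕ} (hd : d ≠ 0) (F : MvPowerSeries σ R) (m : σ →₀ ℕ)
    [Decidable (∀ s, d ∣ m s)] :
    MvPowerSeries.coeff m (MvPowerSeries.expand d hd F) = if ∀ s, d ∣ m s then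
      MvPowerSeries.coeff (m.mapRange (· / d) (Nat.zero_div d)) F else 0 := by
  split_ifs with h
  · conv_lhs => rw [(mapRange_div_eq_iff hd h _).1 rfl]
    rw [MvPowerSeries.coeff_expand_smul]
  · push Not at h
    obtain ⟨s, hs⟩ := h
    exact MvPowerSeries.coeff_expand_of_not_dvd d hd F hs

lemma euler_expand {d : ℕ} (hd : d ≠ 0) (F : MvPowerSeries σ R) :
    euler (MvPowerSeries.expand d hd F) = (d : R) • MvPowerSeries.expand d hd (euler F) := by
  classical
  ext m
  rw [coeff_euler, MvPowerSeries.coeff_smul, coeff_expand, coeff_expand]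
  split_ifs with h
  · rw [coeff_euler, degree_eq_mul hd h, Nat.cast_mul, mul_assoc]
  · rw [mul_zero, mul_zero]

end AdamsSum

/-! ### Counting irreducible polynomials -/

section Irreducible

variable (K : Type) [Field K] [Finite K]

lemma finite_irr (N : ℕ) : {f : Irr K | f.1 ≠ X ∧ f.1.natDegree ≤ N}.Finite := by
  have h : (Set.range fun (c : Fin (N + 1) → K) => ∑ i, C (c i) * X ^ (i : ℕ)).Finite :=
    Set.finite_range _
  refine (h.preimage (Subtype.val_injective (p := fun f : K[X] => f.Monic ∧ Irreducible f)).injOn).subset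
    fun f hf => ⟨fun i => f.1.coeff i, ?_⟩
  refine (Fin.sum_univ_eq_sum_range (fun i => C (f.1.coeff i) * X ^ i) _).trans ?_
  exact (f.1.as_sum_range_C_mul_X_pow' (Nat.lt_succ_of_le hf.2)).symm

/-- The irreducible polynomials of degree at most `N` other than `X`. -/
def irrUpTo (N : ℕ) : Finset (Irr K) := (finite_irr K N).toFinset

variable {K} in
lemma mem_irrUpTo {N : ℕ} {f : Irr K} : f ∈ irrUpTo K N ↔ f.1 ≠ X ∧ f.1.natDegree ≤ N :=
  Set.Finite.mem_toFinset _

/-- The number of irreducible polynomials of degree `d` other than `X`. -/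
def numIrr (d : ℕ) : ℕ := #{f ∈ irrUpTo K d | f.1.natDegree = d}

variable {K} in
lemma card_filter_irrUpTo {d N : ℕ} (h : d ≤ N) :
    #{f ∈ irrUpTo K N | f.1.natDegree = d} = numIrr K d := by
  refine congrArg _ (Finset.ext fun f => ?_)
  simp only [mem_filter, mem_irrUpTo]
  exact ⟨fun hf => ⟨⟨hf.1.1, hf.2.le⟩, hf.2⟩, fun hf => ⟨⟨hf.1.1, hf.2.le.trans h⟩, hf.2⟩⟩

/-- Compare degrees in the factorization of `X ^ (|K| ^ n) - X`, which is squarefree and contains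
exactly the monic irreducible polynomials of degree dividing `n`. The summand `1` is the polynomial
`X`, excluded from `numIrr`. -/
theorem sum_divisors_numIrr {n : ℕ} (hn : n ≠ 0) :
    ∑ d ∈ n.divisors, d * numIrr K d + 1 = Nat.card K ^ n := by
  classical
  obtain ⟨p, hp⟩ := CharP.exists K
  have hp' : p.Prime := (CharP.char_is_prime_or_zero K p).resolve_right fun h => by
    subst h
    exact CharP.char_ne_zero_of_finite K 0 rfl
  have hdvd : p ∣ Nat.card K ^ n := by
    refine dvd_pow ?_ hn
    have := Fintype.ofFinite K
    rw [← CharP.cast_eq_zero_iff K, Nat.card_eq_fintype_card, FiniteField.cast_card_eq_zero]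
  set P : K[X] := X ^ Nat.card K ^ n - X with hP
  have hdeg : P.natDegree = Nat.card K ^ n :=
    FiniteField.X_pow_card_pow_sub_X_natDegree_eq K hn Finite.one_lt_card
  have hP0 : P ≠ 0 := FiniteField.X_pow_card_pow_sub_X_ne_zero K hn Finite.one_lt_card
  have hsq : Squarefree P := (galois_poly_separable p _ hdvd).squarefree
  have hnd := (UniqueFactorizationMonoid.squarefree_iff_nodup_normalizedFactors hP0).1 hsq
  have hass := UniqueFactorizationMonoid.prod_normalizedFactors hP0
  have hmem : ∀ f : K[X], f ∈ UniqueFactorizationMonoid.normalizedFactors P ↔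
      (f.Monic ∧ Irreducible f) ∧ f.natDegree ∣ n := fun f => by
    rw [Polynomial.mem_normalizedFactors_iff hP0]
    constructor
    · rintro ⟨h1, h2, h3⟩
      exact ⟨⟨h2, h1⟩, h1.natDegree_dvd_iff_dvd_X_pow_card_pow_sub_X.2 h3⟩
    · rintro ⟨⟨h2, h1⟩, h3⟩
      exact ⟨h1, h2, h1.natDegree_dvd_iff_dvd_X_pow_card_pow_sub_X.1 h3⟩
  have hsum : Nat.card K ^ n
      = ∑ f ∈ (UniqueFactorizationMonoid.normalizedFactors P).toFinset, f.natDegree := by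
    rw [← hdeg, ← Polynomial.natDegree_eq_of_degree_eq (Polynomial.degree_eq_degree_of_associated hass),
      Polynomial.natDegree_multiset_prod_of_monic _ fun f hf => ((hmem f).1 hf).1.1, sum_multiset_map_count]
    exact sum_congr rfl fun f hf => by
      rw [Multiset.count_eq_one_of_mem hnd (Multiset.mem_toFinset.1 hf), one_smul]
  have hX : (X : K[X]) ∈ (UniqueFactorizationMonoid.normalizedFactors P).toFinset :=
    Multiset.mem_toFinset.2 ((hmem X).2 ⟨⟨monic_X, irreducible_X⟩, by simp⟩)
  rw [hsum, ← sum_erase_add _ _ hX, natDegree_X]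
  congr 1
  have h1 : ∑ f ∈ (UniqueFactorizationMonoid.normalizedFactors P).toFinset.erase X, f.natDegree
      = ∑ f ∈ irrUpTo K n with f.1.natDegree ∣ n, f.1.natDegree := by
    symm
    refine sum_bij (fun f _ => f.1) ?_ (fun f _ g _ h => Subtype.ext h) ?_ fun _ _ => rfl
    · intro f hf
      rw [mem_filter, mem_irrUpTo] at hf
      exact mem_erase.2 ⟨hf.1.1, Multiset.mem_toFinset.2 ((hmem _).2 ⟨f.2, hf.2⟩)⟩
    · intro f hf
      have h := (hmem f).1 (Multiset.mem_toFinset.1 (mem_erase.1 hf).2)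
      refine ⟨⟨f, h.1⟩, ?_, rfl⟩
      rw [mem_filter, mem_irrUpTo]
      exact ⟨⟨(mem_erase.1 hf).1, Nat.le_of_dvd (Nat.pos_of_ne_zero hn) h.2⟩, h.2⟩
  rw [h1, ← sum_fiberwise_of_maps_to (t := n.divisors) (g := fun f : Irr K => f.1.natDegree)
    fun f hf => Nat.mem_divisors.2 ⟨(mem_filter.1 hf).2, hn⟩]
  refine sum_congr rfl fun d hd => ?_
  rw [← card_filter_irrUpTo (Nat.divisor_le hd), filter_filter, mul_comm, ← smul_eq_mul, ← sum_const]
  refine sum_congr (Finset.ext fun f => ?_) fun f hf => (mem_filter.1 hf).2.2.symm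
  simp only [mem_filter]
  exact and_congr_right fun _ => ⟨fun h => ⟨h ▸ Nat.dvd_of_mem_divisors hd, h⟩, fun h => h.2⟩

end Irreducible

namespace FinQuiver

variable {I Ω : Type*} [Fintype I] [DecidableEq I] [Fintype Ω] (Γ : FinQuiver I Ω)

/-- The generating series of the contributions of tuples of partitions. -/
def huaSeries (Q : ℚ) : MvPowerSeries I ℚ := fun u =>
  ∑ π : (i : I) → (u i).Partition, Γ.huaWeight Q fun i => (π i).parts

/-- The tuples of multisets of positive integers whose sums, multiplied by `d`, are `u`. -/
def tuples (d : ℕ) (u : I → ℕ) : Finset (I → Multiset ℕ) :=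
  Fintype.piFinset fun i =>
    if d ∣ u i then univ.image (fun p : (u i / d).Partition => p.parts) else ∅

lemma mem_tuples {d : ℕ} (hd : d ≠ 0) {u : I → ℕ} {m : I → Multiset ℕ} :
    m ∈ tuples d u ↔ ∀ i, 0 ∉ m i ∧ d * (m i).sum = u i := by
  rw [tuples, Fintype.mem_piFinset]
  refine forall_congr' fun i => ?_
  split_ifs with h
  · rw [mem_image]
    constructor
    · rintro ⟨p, -, hp⟩
      rw [← hp]
      exact ⟨fun h => (p.parts_pos h).ne rfl, by rw [p.parts_sum, Nat.mul_div_cancel' h]⟩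
    · rintro ⟨h0, hs⟩
      refine ⟨⟨m i, fun {a} ha => Nat.pos_of_ne_zero fun h => h0 (h ▸ ha), ?_⟩, mem_univ _, rfl⟩
      rw [← hs, Nat.mul_div_cancel_left _ (Nat.pos_of_ne_zero hd)]
  · simp only [notMem_empty, false_iff]
    exact fun h' => h (h'.2 ▸ dvd_mul_right _ _)

lemma coeff_expand_huaSeries {d : ℕ} (hd : d ≠ 0) (Q : ℚ) (u : I →₀ ℕ) :
    MvPowerSeries.coeff u (MvPowerSeries.expand d hd (Γ.huaSeries Q))
      = ∑ m ∈ tuples d u, Γ.huaWeight Q m := by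
  classical
  rw [coeff_expand]
  split_ifs with h
  · refine sum_bij (fun π _ i => (π i).parts) ?_ ?_ ?_ fun _ _ => rfl
    · intro π _
      refine (mem_tuples hd).2 fun i => ⟨fun h => ((π i).parts_pos h).ne rfl, ?_⟩
      rw [(π i).parts_sum]
      exact Nat.mul_div_cancel' (h i)
    · intro π _ π' _ h
      exact funext fun i => Nat.Partition.ext (congrFun h i)
    · intro m hm
      rw [mem_tuples hd] at hm
      refine ⟨fun i => ⟨m i, fun {a} ha => Nat.pos_of_ne_zero fun h => (hm i).1 (h ▸ ha), ?_⟩,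
        mem_univ _, rfl⟩
      rw [Finsupp.mapRange_apply, ← (hm i).2, Nat.mul_div_cancel_left _ (Nat.pos_of_ne_zero hd)]
  · refine (sum_eq_zero fun m hm => absurd (fun i => ?_) h).symm
    exact ((mem_tuples hd).1 hm i).2 ▸ dvd_mul_right _ _

lemma constantCoeff_huaSeries (Q : ℚ) : MvPowerSeries.constantCoeff (Γ.huaSeries Q) = 1 := by
  have h := Γ.coeff_expand_huaSeries one_ne_zero Q 0
  rw [MvPowerSeries.expand_one_apply, MvPowerSeries.coeff_zero_eq_constantCoeff_apply] at h
  rw [h, sum_eq_single_of_mem 0 ((mem_tuples one_ne_zero).2 fun i => by simp)]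
  · simp [huaWeight, autWeight, minSum, unitRatio]
  · intro m hm hm0
    refine absurd (funext fun i => ?_) hm0
    obtain ⟨h0, hs⟩ := (mem_tuples one_ne_zero).1 hm i
    refine Multiset.eq_zero_of_forall_notMem fun a ha => h0 ?_
    rw [one_mul, Finsupp.zero_apply] at hs
    exact Multiset.sum_eq_zero_iff.1 hs a ha ▸ ha

variable (K : Type) [Field K] [Finite K]

/-- The generating series of the numbers of isomorphism classes of representations. -/
def repSeries : MvPowerSeries I ℚ := fun v => Nat.card (Quotient (Γ.repSetoid v K))

lemma coeff_repSeries (v : I →₀ ℕ) : MvPowerSeries.coeff v (Γ.repSeries K)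
    = (Nat.card (Quotient (Γ.repSetoid v K)) : ℚ) := rfl

lemma natDegree_ne_zero (f : Irr K) : f.1.natDegree ≠ 0 := f.2.2.natDegree_pos.ne'

/-- The Euler product. A tuple of types is an independent choice of a tuple of partitions for each
irreducible polynomial `f`, which contributes with variables raised to `deg f` and with `|K| ^ deg
f` in place of `|K|`. -/
lemma coeff_prod_expand {N : ℕ} (v : I →₀ ℕ) (hv : ∀ i, v i ≤ N) :
    MvPowerSeries.coeff v (∏ f ∈ irrUpTo K N, MvPowerSeries.expand f.1.natDegree
      (natDegree_ne_zero K f) (Γ.huaSeries ((Nat.card K : ℚ) ^ f.1.natDegree)))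
      = MvPowerSeries.coeff v (Γ.repSeries K) := by
  classical
  set S := irrUpTo K N with hSdef
  have hS : ∀ f : Irr K, f ∈ S ↔ f.1 ≠ X ∧ f.1.natDegree ≤ N := fun f => mem_irrUpTo
  have hmem := fun t => mem_glTypes (K := K) (t := t) hS hv
  rw [coeff_repSeries, card_quotient Γ v hS hv, MvPowerSeries.coeff_prod]
  simp only [coeff_expand_huaSeries]
  -- The share of each irreducible polynomial in the dimension vector; it indexes the terms of the
  -- coefficient of a product of series.
  let k : (I → Irr K →₀ Multiset ℕ) → (Irr K →₀ (I →₀ ℕ)) := fun t =>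
    Finsupp.onFinset S (fun f => if f ∈ S then
      Finsupp.equivFunOnFinite.symm fun i => f.1.natDegree * (t i f).sum else 0)
      fun f hf => by_contra fun h => hf (if_neg h)
  have hk : ∀ t f i, f ∈ S → k t f i = f.1.natDegree * (t i f).sum := fun t f i hf => by
    change (if f ∈ S then _ else _ : I →₀ ℕ) i = _
    rw [if_pos hf]
    rfl
  rw [← sum_fiberwise_of_maps_to (s := glTypes v K) (t := S.finsuppAntidiag v) (g := k)]
  · refine sum_congr rfl fun l hl => ?_
    rw [mem_finsuppAntidiag] at hl
    rw [prod_sum]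
    symm
    refine sum_bij' (fun t _ f _ i => t i f)
      (fun p _ i => Finsupp.onFinset S (fun f => if h : f ∈ S then p f h i else 0)
        fun f hf => by_contra fun h => hf (dif_neg h)) ?_ ?_ ?_ ?_ ?_
    · intro t ht
      rw [mem_filter, hmem] at ht
      refine mem_pi.2 fun f hf => (mem_tuples (natDegree_ne_zero K f)).2 fun i => ⟨(ht.1 i).2.1 f, ?_⟩
      rw [← ht.2, hk t f i hf]
    · intro p hp
      rw [mem_filter, hmem]
      have hp' := fun f hf => (mem_tuples (natDegree_ne_zero K f)).1 (mem_pi.1 hp f hf)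
      constructor
      · refine fun i => ⟨Finsupp.support_onFinset_subset, fun f => ?_, ?_⟩
        · rw [Finsupp.onFinset_apply]
          split_ifs with h
          · exact (hp' f h i).1
          · exact Multiset.notMem_zero 0
        · rw [← hl.1, Finsupp.finsetSum_apply]
          refine sum_congr rfl fun f hf => ?_
          rw [Finsupp.onFinset_apply, dif_pos hf]
          exact (hp' f hf i).2
      · refine Finsupp.ext fun f => ?_
        by_cases hf : f ∈ S
        · refine Finsupp.ext fun i => ?_
          rw [hk _ f i hf, Finsupp.onFinset_apply, dif_pos hf]
          exact (hp' f hf i).2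
        · rw [Finsupp.notMem_support_iff.1 fun h => hf (hl.2 h)]
          exact if_neg hf
    · intro t ht
      rw [mem_filter, hmem] at ht
      refine funext fun i => Finsupp.ext fun f => ?_
      rw [Finsupp.onFinset_apply]
      split_ifs with h
      · rfl
      · exact (Finsupp.notMem_support_iff.1 fun h' => h ((ht.1 i).1 h')).symm
    · intro p hp
      refine funext fun f => funext fun hf => funext fun i => ?_
      rw [Finsupp.onFinset_apply, dif_pos hf]
    · intro t ht
      exact (prod_attach S fun f => Γ.huaWeight ((Nat.card K : ℚ) ^ f.1.natDegree) fun i => t i f).symm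
  · intro t ht
    rw [hmem] at ht
    refine mem_finsuppAntidiag.2 ⟨Finsupp.ext fun i => ?_, Finsupp.support_onFinset_subset⟩
    rw [Finsupp.finsetSum_apply, ← (ht i).2.2]
    exact sum_congr rfl fun f hf => hk t f i hf

/-- The logarithmic derivative of the generating series. -/
def huaDeriv (Q : ℚ) : MvPowerSeries I ℚ := euler (genLog (Γ.huaSeries Q))

lemma le_of_antidiagonal {v : I →₀ ℕ} {x : (I →₀ ℕ) × (I →₀ ℕ)} (hx : x ∈ antidiagonal v) :
    x.2.degree ≤ v.degree := by
  rw [← HasAntidiagonal.mem_antidiagonal.1 hx, map_add]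
  exact Nat.le_add_left _ _

/-- Logarithmic derivative of the Euler product, with the irreducible polynomials collected by
degree. The product is truncated at the degree of the coefficient under consideration. -/
theorem euler_repSeries_eq : euler (Γ.repSeries K) = Γ.repSeries K *
    adamsSum fun d => ((d * numIrr K d : ℕ) : ℚ) • Γ.huaDeriv ((Nat.card K : ℚ) ^ d) := by
  classical
  ext v
  have hle : ∀ w : I →₀ ℕ, ∀ i, w i ≤ w.degree := fun w i => Finsupp.le_degree i w
  set N := v.degree
  have h1 := euler_prod (irrUpTo K N) (fun f => MvPowerSeries.expand f.1.natDegree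
      (natDegree_ne_zero K f) (Γ.huaSeries ((Nat.card K : ℚ) ^ f.1.natDegree)))
    (fun f => (f.1.natDegree : ℚ) • MvPowerSeries.expand f.1.natDegree
      (natDegree_ne_zero K f) (Γ.huaDeriv ((Nat.card K : ℚ) ^ f.1.natDegree))) fun f _ => by
    rw [euler_expand, ← mul_euler_genLog _ (Γ.constantCoeff_huaSeries _), map_mul, mul_smul_comm]
    rfl
  have h2 := congrArg (MvPowerSeries.coeff v) h1
  rw [coeff_euler, Γ.coeff_prod_expand K v (hle v), ← coeff_euler, MvPowerSeries.coeff_mul] at h2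
  rw [h2, MvPowerSeries.coeff_mul]
  refine sum_congr rfl fun x hx => ?_
  have hx2 := le_of_antidiagonal hx
  have hx1 : ∀ i, x.1 i ≤ N := fun i => le_trans (by
    rw [← HasAntidiagonal.mem_antidiagonal.1 hx, Finsupp.add_apply]
    exact Nat.le_add_right _ _) (hle v i)
  rw [Γ.coeff_prod_expand K x.1 hx1]
  congr 1
  simp only [map_sum, MvPowerSeries.coeff_smul, coeff_expand, coeff_adamsSum]
  have hdeg : ∀ f ∈ irrUpTo K N, f.1.natDegree ∈ Icc 1 N := fun f hf =>
    mem_Icc.2 ⟨Nat.one_le_iff_ne_zero.2 (natDegree_ne_zero K f), (mem_irrUpTo.1 hf).2⟩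
  rw [← sum_fiberwise_of_maps_to hdeg]
  have h3 : ∀ d ∈ Icc 1 N, (∑ f ∈ irrUpTo K N with f.1.natDegree = d, (f.1.natDegree : ℚ) *
      if ∀ s, f.1.natDegree ∣ x.2 s then MvPowerSeries.coeff
        (x.2.mapRange (· / f.1.natDegree) (Nat.zero_div f.1.natDegree))
        (Γ.huaDeriv ((Nat.card K : ℚ) ^ f.1.natDegree)) else 0)
      = if ∀ s, d ∣ x.2 s then ((d * numIrr K d : ℕ) : ℚ) * MvPowerSeries.coeff
          (x.2.mapRange (· / d) (Nat.zero_div d)) (Γ.huaDeriv ((Nat.card K : ℚ) ^ d))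
        else 0 := fun d hd => by
    rw [sum_congr rfl (g := fun _ => (d : ℚ) * if ∀ s, d ∣ x.2 s then MvPowerSeries.coeff
        (x.2.mapRange (· / d) (Nat.zero_div d)) (Γ.huaDeriv ((Nat.card K : ℚ) ^ d)) else 0)
      fun f hf => by
        obtain ⟨-, rfl⟩ := mem_filter.1 hf
        rfl, sum_const, card_filter_irrUpTo (mem_Icc.1 hd).2, nsmul_eq_mul]
    split_ifs
    · push_cast
      ring
    · simp
  refine (sum_congr rfl h3).trans ?_
  -- The indices `d` beyond the degree of `x.2` contribute only when `x.2` is zero, and there the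
  -- coefficient of an Euler derivative vanishes.
  rw [← sum_subset (Icc_subset_Icc_right (a := 1) hx2)]
  · exact sum_congr rfl fun d _ => by congr
  intro d hd hd'
  split_ifs with h
  · have hd0 := Nat.one_le_iff_ne_zero.1 (mem_Icc.1 hd).1
    rw [mem_Icc, not_and, not_le] at hd'
    have h4 := degree_eq_mul hd0 h
    have h5 : (x.2.mapRange (· / d) (Nat.zero_div d)).degree = 0 := by
      by_contra h6
      have := hd' (mem_Icc.1 hd).1
      rw [h4] at this
      exact absurd (Nat.le_mul_of_pos_right d (Nat.pos_of_ne_zero h6)) (by omega)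
    rw [huaDeriv, coeff_euler, h5, Nat.cast_zero, zero_mul, mul_zero]
  · rfl

/-- The generating series for the Kac polynomials. -/
def kacSeries (Q : ℚ) : MvPowerSeries I ℚ :=
  (Q - 1) • adamsSum fun e =>
    ((ArithmeticFunction.moebius e : ℤ) / e : ℚ) • genLog (Γ.huaSeries (Q ^ e))

/-- Möbius inversion of `sum_divisors_numIrr` writes `n * numIrr n` through the numbers `|K| ^ d -
1`. The resulting convolution is the factor `q - 1` and the Möbius sum of the plethystic logarithm.
-/
theorem euler_repSeries : euler (Γ.repSeries K) = Γ.repSeries K *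
    adamsSum fun d => euler (Γ.kacSeries ((Nat.card K : ℚ) ^ d)) := by
  rw [euler_repSeries_eq]
  congr 1
  set Q := (Nat.card K : ℚ)
  have h1 : ∀ d, euler (Γ.kacSeries (Q ^ d)) = adamsSum fun e =>
      ((Q ^ d - 1) * (ArithmeticFunction.moebius e : ℤ)) • Γ.huaDeriv (Q ^ (d * e)) := fun d => by
    rw [kacSeries, euler_smul, euler_adamsSum, smul_adamsSum]
    refine adamsSum_congr fun e he => ?_
    rw [euler_smul, smul_smul, smul_smul, huaDeriv, pow_mul]
    congr 1
    field_simp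
  simp only [h1]
  rw [adamsSum_adamsSum]
  refine adamsSum_congr fun n hn => ?_
  rw [sum_congr rfl (g := fun x : ℕ × ℕ => ((Q ^ x.1 - 1) * (ArithmeticFunction.moebius x.2 : ℤ)) •
      Γ.huaDeriv (Q ^ n)) fun x hx => by rw [(Nat.mem_divisorsAntidiagonal.1 hx).1], ← sum_smul]
  congr 1
  have h2 := ArithmeticFunction.sum_eq_iff_sum_mul_moebius_eq
    (f := fun d => ((d * numIrr K d : ℕ) : ℚ)) (g := fun d => Q ^ d - 1)
  rw [← h2.1 (fun n hn => ?_) n (Nat.pos_of_ne_zero hn), ← Nat.map_swap_divisorsAntidiagonal, sum_map, Nat.map_swap_divisorsAntidiagonal]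
  · exact sum_congr rfl fun x _ => mul_comm _ _
  · have := sum_divisors_numIrr K hn.ne'
    rw [eq_sub_iff_add_eq, ← Nat.cast_sum]
    exact (Nat.cast_succ _).symm.trans ((congrArg Nat.cast this).trans (Nat.cast_pow _ _))

end FinQuiver

lemma IsKrullSchmidt.map_equiv {C : Type*} [AddCommMonoid C] {P : C → Prop} {D : C →+ ℕ}
    (h : IsKrullSchmidt P D) (e : C ≃+ C) {c : C} (hc : P c) : P (e c) := by
  by_contra hP
  obtain ⟨a, b, ha, hb, hab⟩ := h.exists_add (fun h0 => h.ne_zero hc (e.map_eq_zero_iff.1 h0)) hP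
  have h1 : c = e.symm a + e.symm b := by rw [← map_add, ← hab, e.symm_apply_apply]
  rcases h.indecomposable (h1 ▸ hc) with h2 | h2
  · exact ha (e.symm.map_eq_zero_iff.1 h2)
  · exact hb (e.symm.map_eq_zero_iff.1 h2)

namespace FinQuiver

variable {I Ω : Type*} [Fintype I] [DecidableEq I] [Fintype Ω] (Γ : FinQuiver I Ω)

section

variable {K L : Type} [Field K] [Finite K] [Field L] [IsAlgClosed L] [Algebra K L]
  {τ : L ≃+* L}

lemma finite_fixed (hτ : ∀ x, τ x = x ^ Nat.card K) (v : I → ℕ) :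
    {c : Cls Γ L | dim Γ L c = v ∧ clsEquiv Γ τ c = c}.Finite := by
  have : Finite (Γ.Rep v K) := inferInstanceAs (Finite (∀ _, _))
  refine (Set.finite_range fun C : Quotient (Γ.repSetoid v K) =>
    clsMap (algebraMap K L) ⟨v, C⟩).subset fun c hc => ?_
  obtain ⟨⟨w, d⟩, rfl⟩ := exists_of_frobenius_fixed hτ hc.2
  obtain rfl : w = v := hc.1
  exact ⟨d, rfl⟩

variable {Γ}

/-- The permutation of the indecomposable classes that is given by a field automorphism. -/
def indPerm (τ : L ≃+* L) : Equiv.Perm {c : Cls Γ L // c.IsInd} :=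
  (clsEquiv Γ τ).toEquiv.subtypeEquiv fun c =>
    ⟨(isKrullSchmidt Γ L).map_equiv _, fun h => by
      have := (isKrullSchmidt Γ L).map_equiv (clsEquiv Γ τ).symm h
      rwa [show (clsEquiv Γ τ).symm ((clsEquiv Γ τ).toEquiv c) = c from
        (clsEquiv Γ τ).symm_apply_apply c] at this⟩

lemma coe_indPerm (τ : L ≃+* L) (x : {c : Cls Γ L // c.IsInd}) :
    (indPerm τ x).1 = clsEquiv Γ τ x.1 := rfl

/-- The dimension of an indecomposable class. -/
def indDim (x : {c : Cls Γ L // c.IsInd}) : I →₀ ℕ := Finsupp.equivFunOnFinite.symm (dim Γ L x.1)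

lemma dim_clsEquiv (τ : L ≃+* L) (c : Cls Γ L) : dim Γ L (clsEquiv Γ τ c) = dim Γ L c :=
  dim_clsMap _ c

lemma dim_sumHom (m : Multiset {c : Cls Γ L // c.IsInd}) :
    dim Γ L (IsKrullSchmidt.sumHom _ m) = FixedMultisets.weight indDim m := by
  induction m using Multiset.induction with
  | empty => rw [map_zero, map_zero, map_zero]; rfl
  | cons x m ih =>
    rw [IsKrullSchmidt.sumHom_cons, map_add, ih, ← Multiset.singleton_add, map_add, Finsupp.coe_add]
    simp [FixedMultisets.weight, indDim]

lemma sumHom_map (τ : L ≃+* L) (m : Multiset {c : Cls Γ L // c.IsInd}) :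
    IsKrullSchmidt.sumHom _ (m.map (indPerm τ)) = clsEquiv Γ τ (IsKrullSchmidt.sumHom _ m) := by
  induction m using Multiset.induction with
  | empty => rw [Multiset.map_zero, map_zero, map_zero]
  | cons x m ih =>
    rw [Multiset.map_cons, IsKrullSchmidt.sumHom_cons, IsKrullSchmidt.sumHom_cons, map_add, ih,
      coe_indPerm]

/-- Invariant multisets of indecomposable classes correspond to invariant classes. -/
def fixedEquiv (τ : L ≃+* L) (v : I →₀ ℕ) :
    {m : Multiset {c : Cls Γ L // c.IsInd} //
      FixedMultisets.weight indDim m = v ∧ m.map (indPerm τ) = m} ≃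
    {c : Cls Γ L // dim Γ L c = v ∧ clsEquiv Γ τ c = c ∧ True} :=
  (Equiv.ofBijective _ ⟨(isKrullSchmidt Γ L).sumHom_injective,
    (isKrullSchmidt Γ L).sumHom_surjective⟩).subtypeEquiv fun m => by
      change _ ↔ dim Γ L (IsKrullSchmidt.sumHom _ m) = v ∧
        clsEquiv Γ τ (IsKrullSchmidt.sumHom _ m) = IsKrullSchmidt.sumHom _ m ∧ True
      rw [dim_sumHom, ← sumHom_map, (isKrullSchmidt Γ L).sumHom_injective.eq_iff, and_true,
        DFunLike.coe_fn_eq]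

end

variable (L : Type) [Field L] [IsAlgClosed L] (p : ℕ) [Fact p.Prime] [CharP L p]

/-- The generating series of the numbers of indecomposable classes that are defined over the
field with `p ^ m` elements. -/
def indSeries (m : ℕ) : MvPowerSeries I ℚ := fun v => (Nat.card {c : Cls Γ L //
  dim Γ L c = v ∧ clsEquiv Γ (iterateFrobeniusEquiv L p m) c = c ∧ c.IsInd} : ℚ)

variable {Γ} in
lemma iterate_clsEquiv (m d : ℕ) (c : Cls Γ L) :
    (clsEquiv Γ (iterateFrobeniusEquiv L p m))^[d] c
      = clsEquiv Γ (iterateFrobeniusEquiv L p (m * d)) c := by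
  induction d with
  | zero =>
    refine Eq.trans ?_ (congrArg (fun f => clsMap f c) (?_ : RingHom.id L = _))
    · exact (clsMap_id c).symm
    · ext x
      change x = x ^ p ^ (m * 0)
      simp
  | succ d ih =>
    rw [Function.iterate_succ_apply', ih]
    refine (clsMap_comp _ _ c).trans (congrArg (fun f => clsMap f c) ?_)
    ext x
    change (x ^ p ^ (m * d)) ^ p ^ m = x ^ p ^ (m * (d + 1))
    rw [← pow_mul, ← pow_add, mul_add, mul_one]

/-- The recursion for the numbers of isomorphism classes over a finite field. -/
theorem euler_repSeries_ind {m : ℕ} (hm : m ≠ 0) (K : Type) [Field K] [Finite K] [Algebra K L]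
    (hK : Nat.card K = p ^ m) : euler (Γ.repSeries K) = Γ.repSeries K *
      adamsSum fun d => euler (Γ.indSeries L p (m * d)) := by
  have hτ : ∀ x : L, iterateFrobeniusEquiv L p m x = x ^ Nat.card K := fun x => by rw [hK]; rfl
  have h1 : FixedMultisets.numFixed (indPerm (Γ := Γ) (iterateFrobeniusEquiv L p m)) indDim
      = Γ.repSeries K := by
    ext v
    rw [coeff_repSeries]
    refine congrArg (Nat.cast : ℕ → ℚ) ?_
    rw [Nat.card_congr (fixedEquiv _ v), ← card_classes hτ v fun _ => True]
    exact Nat.card_congr (Equiv.subtypeUnivEquiv fun _ => trivial)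
  have hper : ∀ (d : ℕ) (v : I →₀ ℕ) (x : {c : Cls Γ L // c.IsInd}),
      indDim x = v ∧ (indPerm (iterateFrobeniusEquiv L p m))^[d] x = x ↔
      dim Γ L x.1 = v ∧ clsEquiv Γ (iterateFrobeniusEquiv L p (m * d)) x.1 = x.1 := by
    intro d v x
    have h2 : ∀ d, ((indPerm (iterateFrobeniusEquiv L p m))^[d] x).1
        = (clsEquiv Γ (iterateFrobeniusEquiv L p m))^[d] x.1 := fun d => by
      induction d with
      | zero => rfl
      | succ d ih => rw [Function.iterate_succ_apply', Function.iterate_succ_apply', coe_indPerm, ih]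
    rw [Subtype.ext_iff, h2, iterate_clsEquiv, indDim, Equiv.symm_apply_eq]
    rfl
  have h2 : ∀ d, FixedMultisets.numPeriodic (indPerm (Γ := Γ) (iterateFrobeniusEquiv L p m)) indDim d
      = Γ.indSeries L p (m * d) := fun d => by
    ext v
    refine congrArg (Nat.cast : ℕ → ℚ) (Nat.card_congr ?_)
    refine (Equiv.subtypeEquivRight (hper d v)).trans ((Equiv.subtypeSubtypeEquivSubtypeInter
      (fun c : Cls Γ L => c.IsInd) fun c => dim Γ L c = v ∧
        clsEquiv Γ (iterateFrobeniusEquiv L p (m * d)) c = c).trans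
      (Equiv.subtypeEquivRight fun c => ?_))
    tauto
  rw [← h1]
  simp only [← h2]
  refine FixedMultisets.euler_numFixed indDim (fun x h => ?_) (fun x => ?_) (fun v => ?_)
    fun d v hd => ?_
  · refine (isKrullSchmidt Γ L).ne_zero x.2 (eq_zero_of_dim ?_)
    exact congrArg (Finsupp.equivFunOnFinite) h
  · rw [indDim, indDim, coe_indPerm, dim_clsEquiv]
  · have := (Γ.finite_fixed hτ v).to_subtype
    refine Finite.of_injective (β := {c : Cls Γ L | dim Γ L c = v ∧
      clsEquiv Γ (iterateFrobeniusEquiv L p m) c = c}) (fun x => ⟨(fixedEquiv _ v x).1, (fixedEquiv _ v x).2.1, (fixedEquiv _ v x).2.2.1⟩) fun x y h => by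
      have h1 := Subtype.ext_iff.1 h
      exact (fixedEquiv _ v).injective (Subtype.ext h1)
  -- Classes fixed by the `d`-th power of the Frobenius are defined over the field with `p ^ (m *
  -- d)` elements, embedded in `L`; over it there are finitely many of given dimension.
  · have hmd : m * d ≠ 0 := mul_ne_zero hm hd.ne'
    let _ : Algebra (ZMod p) L := ZMod.algebra L p
    let _ : Algebra (GaloisField p (m * d)) L :=
      (IsAlgClosed.lift (R := ZMod p) (S := GaloisField p (m * d)) (M := L)).toAlgebra
    have := (Γ.finite_fixed (K := GaloisField p (m * d)) (L := L)
      (τ := iterateFrobeniusEquiv L p (m * d))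
      (fun x => by rw [GaloisField.card p _ hmd]; rfl) v).to_subtype
    exact Finite.of_injective (β := {c : Cls Γ L | dim Γ L c = v ∧
      clsEquiv Γ (iterateFrobeniusEquiv L p (m * d)) c = c}) (fun x => ⟨x.1.1, (hper d v x.1).1 x.2⟩) fun x y h => by
      have h1 := Subtype.ext_iff.1 h
      exact Subtype.ext (Subtype.ext h1)

/-- Absolutely indecomposable representations of a finite field. -/
lemma numAbsIndecomposable_eq (F : Type) [Field F] [Finite F] [CharP F p] {m : ℕ}
    (hF : Nat.card F = p ^ m) (v : I →₀ ℕ) :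
    (Γ.numAbsIndecomposable v F : ℚ) =
      MvPowerSeries.coeff v (Γ.indSeries (AlgebraicClosure F) p m) := by
  have hτ : ∀ x, iterateFrobeniusEquiv (AlgebraicClosure F) p m x = x ^ Nat.card F := fun x => by
    rw [hF]; rfl
  refine congrArg (Nat.cast : ℕ → ℚ) ?_
  rw [← card_classes hτ, numAbsIndecomposable, ← Nat.card_coe_set_eq]
  refine Nat.card_congr (Equiv.subtypeEquivRight fun C => ?_)
  obtain ⟨φ, rfl⟩ := Quotient.exists_rep C
  change (∃ ψ : Γ.Rep v F, _) ↔ (clsMap (algebraMap F (AlgebraicClosure F)) (cls φ)).IsInd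
  rw [clsMap_cls, isInd_cls_iff]
  constructor
  · rintro ⟨ψ, h, hC⟩
    have h1 : cls (ψ.map (algebraMap F (AlgebraicClosure F)))
        = cls (φ.map (algebraMap F (AlgebraicClosure F))) := by
      rw [← clsMap_cls, ← clsMap_cls]
      exact congrArg (fun C => clsMap _ ⟨_, C⟩) hC
    rw [← isInd_cls_iff, ← h1, isInd_cls_iff]
    exact h
  · exact fun h => ⟨φ, h, rfl⟩

end FinQuiver

/-- The Adams sums of the logarithmic derivatives determine a family of power series. -/
lemma coeff_eq_of_adamsSum_euler {σ : Type*} {f g : ℕ → MvPowerSeries σ ℚ}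
    (h : ∀ m, m ≠ 0 → (adamsSum fun d => euler (f (m * d))) = adamsSum fun d => euler (g (m * d)))
    {m : ℕ} (hm : m ≠ 0) (v : σ →₀ ℕ) (hv : v ≠ 0) :
    MvPowerSeries.coeff v (f m) = MvPowerSeries.coeff v (g m) := by
  classical
  induction hn : v.degree using Nat.strong_induction_on generalizing v m with
  | h n ih =>
    have hv0 : v.degree ≠ 0 := fun h => hv ((Finsupp.degree_eq_zero_iff v).1 h)
    have h1 := congrArg (MvPowerSeries.coeff v) (h m hm)
    rw [coeff_adamsSum, coeff_adamsSum] at h1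
    have hmem : 1 ∈ Icc 1 v.degree := mem_Icc.2 ⟨le_rfl, Nat.one_le_iff_ne_zero.2 hv0⟩
    -- The term `d = 1` is the unknown. The terms with `d > 1` involve members `m * d` of the family
    -- in smaller degree, which is why the induction treats all `m` at once.
    rw [← add_sum_erase _ _ hmem, ← add_sum_erase _ _ hmem, sum_congr rfl fun d hd => ?_,
      add_left_inj, if_pos fun s => one_dvd _, if_pos fun s => one_dvd _, mul_one,
      (mapRange_div_eq_iff one_ne_zero (fun s => one_dvd _) v).2 (one_smul ℕ v).symm, coeff_euler,
      coeff_euler] at h1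
    · exact mul_left_cancel₀ (Nat.cast_ne_zero.2 hv0) h1
    · obtain ⟨hd1, hd⟩ := mem_erase.1 hd
      have hd0 := Nat.one_le_iff_ne_zero.1 (mem_Icc.1 hd).1
      split_ifs with hdv
      · have h2 := degree_eq_mul hd0 hdv
        rw [coeff_euler, coeff_euler, ih _ ?_ (mul_ne_zero hm hd0) _ ?_ rfl]
        · rw [← hn, h2]
          refine lt_mul_of_one_lt_left (Nat.pos_of_ne_zero fun h3 => ?_) (by omega)
          rw [h3, mul_zero] at h2
          exact hv0 h2
        · intro h3
          rw [h3, map_zero, mul_zero] at h2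
          exact hv0 h2
      · rfl

namespace FinQuiver

variable {I Ω : Type*} [Fintype I] [DecidableEq I] [Fintype Ω] (Γ : FinQuiver I Ω)

lemma repSeries_ne_zero (K : Type) [Field K] [Finite K] : Γ.repSeries K ≠ 0 := fun h => by
  have h1 := congrArg (MvPowerSeries.coeff 0) h
  rw [coeff_repSeries, map_zero, Nat.cast_eq_zero] at h1
  have : Finite (Γ.Rep (0 : I →₀ ℕ) K) := inferInstanceAs (Finite (∀ _, _))
  have : Nonempty (Quotient (Γ.repSetoid (0 : I →₀ ℕ) K)) := ⟨Quotient.mk _ fun _ => 0⟩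
  exact Finite.card_pos.ne' h1

lemma coeff_zero_indSeries (L : Type) [Field L] [IsAlgClosed L] (p : ℕ) [Fact p.Prime] [CharP L p]
    (m : ℕ) : MvPowerSeries.coeff 0 (Γ.indSeries L p m) = 0 := by
  refine Nat.cast_eq_zero.2 (Nat.card_eq_zero.2 (Or.inl ⟨fun c => ?_⟩))
  exact (isKrullSchmidt Γ L).ne_zero c.2.2.2 (eq_zero_of_dim c.2.1)

lemma coeff_zero_kacSeries (Q : ℚ) : MvPowerSeries.coeff 0 (Γ.kacSeries Q) = 0 := by
  classical
  rw [kacSeries, MvPowerSeries.coeff_smul, coeff_adamsSum, map_zero, Icc_eq_empty (by omega),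
    sum_empty, mul_zero]

/-- The numbers of absolutely indecomposable representations in terms of the Hua series. -/
theorem numAbsIndecomposable_eq_kacSeries (F : Type) [Field F] [Finite F] (v : I →₀ ℕ) :
    (Γ.numAbsIndecomposable v F : ℚ) = MvPowerSeries.coeff v (Γ.kacSeries (Nat.card F)) := by
  have := Fintype.ofFinite F
  obtain ⟨p, hp⟩ := CharP.exists F
  obtain ⟨n, hpp, hn⟩ := FiniteField.card F p
  have : Fact p.Prime := ⟨hpp⟩
  rw [← Nat.card_eq_fintype_card] at hn
  let L := AlgebraicClosure F
  have : CharP L p := charP_of_injective_algebraMap (algebraMap F L).injective p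
  rw [numAbsIndecomposable_eq Γ p F hn, hn]
  by_cases hv : v = 0
  · rw [hv, coeff_zero_indSeries, coeff_zero_kacSeries]
  rw [Nat.cast_pow]
  -- Only `m = n` is wanted, but the recursions over all fields of characteristic `p` are needed to
  -- determine the numbers. Each is obtained by cancelling the common factor `repSeries`.
  refine coeff_eq_of_adamsSum_euler (f := Γ.indSeries L p) (g := fun m => Γ.kacSeries ((p : ℚ) ^ m))
    (fun m hm => ?_) n.ne_zero v hv
  let _ : Algebra (ZMod p) L := ZMod.algebra L p
  let _ : Algebra (GaloisField p m) L :=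
    (IsAlgClosed.lift (R := ZMod p) (S := GaloisField p m) (M := L)).toAlgebra
  have h1 := Γ.euler_repSeries_ind L p hm (GaloisField p m) (GaloisField.card p m hm)
  rw [euler_repSeries, GaloisField.card p m hm, Nat.cast_pow] at h1
  refine (mul_left_cancel₀ (Γ.repSeries_ne_zero (GaloisField p m)) h1).symm.trans ?_
  simp only [pow_mul]

end FinQuiver

/-! ### Values of rational functions -/

/-- The integers at which rational functions are evaluated. -/
abbrev EvalPt : Type := {N : ℕ // 2 ≤ N}

/-- Rational functions without poles at the integers `N ≥ 2`, together with their values. -/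
def evalAlg : Subalgebra ℚ (Qq × (EvalPt → ℚ)) where
  carrier := {x | ∃ a b : ℚ[X], (∀ N : EvalPt, b.eval (N : ℚ) ≠ 0) ∧
    x.1 * algebraMap ℚ[X] Qq b = algebraMap ℚ[X] Qq a ∧
    ∀ N : EvalPt, x.2 N * b.eval (N : ℚ) = a.eval (N : ℚ)}
  mul_mem' := by
    rintro x y ⟨a, b, h1, h2, h3⟩ ⟨a', b', h1', h2', h3'⟩
    refine ⟨a * a', b * b', fun N => by rw [eval_mul]; exact mul_ne_zero (h1 N) (h1' N), ?_,
      fun N => ?_⟩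
    · rw [map_mul, map_mul, ← h2, ← h2', Prod.fst_mul]
      ring
    · rw [eval_mul, eval_mul, ← h3, ← h3', Prod.snd_mul, Pi.mul_apply]
      ring
  add_mem' := by
    rintro x y ⟨a, b, h1, h2, h3⟩ ⟨a', b', h1', h2', h3'⟩
    refine ⟨a * b' + a' * b, b * b', fun N => by rw [eval_mul]; exact mul_ne_zero (h1 N) (h1' N),
      ?_, fun N => ?_⟩
    · rw [map_mul, map_add, map_mul, map_mul, ← h2, ← h2', Prod.fst_add]
      ring
    · rw [eval_mul, eval_add, eval_mul, eval_mul, ← h3, ← h3', Prod.snd_add, Pi.add_apply]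
      ring
  algebraMap_mem' c := by
    refine ⟨C c, 1, fun N => by simp, ?_, fun N => by simp⟩
    rw [map_one, mul_one, Prod.algebraMap_apply]
    exact (RingHom.congr_fun (Subsingleton.elim (algebraMap ℚ Qq)
      ((algebraMap ℚ[X] Qq).comp C)) c)

lemma algebraMap_qq_ne_zero {b : ℚ[X]} (h : ∀ N : EvalPt, b.eval (N : ℚ) ≠ 0) :
    algebraMap ℚ[X] Qq b ≠ 0 := fun h0 => by
  have h1 : b = 0 := (map_eq_zero_iff _ (IsFractionRing.injective ℚ[X] Qq)).1 h0
  exact h ⟨2, le_rfl⟩ (by rw [h1, eval_zero])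

lemma inv_mem_evalAlg {x : Qq × (EvalPt → ℚ)} (hx : x ∈ evalAlg) (h : ∀ N, x.2 N ≠ 0) :
    (x.1⁻¹, x.2⁻¹) ∈ evalAlg := by
  obtain ⟨a, b, h1, h2, h3⟩ := hx
  have ha : ∀ N : EvalPt, a.eval (N : ℚ) ≠ 0 := fun N => h3 N ▸ mul_ne_zero (h N) (h1 N)
  refine ⟨b, a, ha, ?_, fun N => ?_⟩
  · have hx0 : x.1 ≠ 0 := fun h0 => algebraMap_qq_ne_zero ha (by rw [← h2, h0, zero_mul])
    rw [← h2, inv_mul_cancel_left₀ hx0]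
  · rw [← h3]
    exact inv_mul_cancel_left₀ (h N) _

lemma q_mem_evalAlg : ((q, fun N => (N : ℚ)) : Qq × (EvalPt → ℚ)) ∈ evalAlg :=
  ⟨X, 1, fun N => by simp, by rw [map_one, mul_one]; exact RatFunc.algebraMap_X.symm, fun N => by simp⟩

/-- On values, the operation `q ↦ q ^ d` becomes the substitution `N ↦ N ^ d`, and the integers at
least two are stable under it. -/
lemma adams_mem_evalAlg {d : ℕ} (hd : d ≠ 0) {x : Qq × (EvalPt → ℚ)} (hx : x ∈ evalAlg) :
    ((adams d x.1, fun N : EvalPt => x.2 ⟨N.1 ^ d, N.2.trans (Nat.le_self_pow hd _)⟩) :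
      Qq × (EvalPt → ℚ)) ∈ evalAlg := by
  obtain ⟨a, b, h1, h2, h3⟩ := hx
  have hexp : ∀ c : ℚ[X], adams d (algebraMap ℚ[X] Qq c) = algebraMap ℚ[X] Qq (expand ℚ d c) :=
    fun c => by
      rw [adams, RatFunc.eval_algebraMap, coe_expand, hom_eval₂, map_pow, RatFunc.algebraMap_X]
      congr 1
      exact Subsingleton.elim _ _
  have he : ∀ (c : ℚ[X]) (N : EvalPt), (expand ℚ d c).eval (N : ℚ) = c.eval ((N.1 ^ d : ℕ) : ℚ) :=
    fun c N => by rw [expand_eval, Nat.cast_pow]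
  refine ⟨expand ℚ d a, expand ℚ d b, fun N => ?_, ?_, fun N => ?_⟩
  · rw [he]
    exact h1 ⟨N.1 ^ d, N.2.trans (Nat.le_self_pow hd _)⟩
  · rw [← hexp, ← hexp, ← h2]
    exact (map_mul (adamsHom d hd) _ _).symm
  · rw [he, he]
    exact h3 ⟨N.1 ^ d, N.2.trans (Nat.le_self_pow hd _)⟩

/-- The Adams operations on rational functions together with their values. -/
def evalAdams (d : ℕ) (x : evalAlg) : evalAlg :=
  if hd : d ≠ 0 then ⟨_, adams_mem_evalAlg hd x.2⟩ else x

/-- The Adams operations on the values of rational functions. -/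
def ptAdams (d : ℕ) (g : EvalPt → ℚ) : EvalPt → ℚ :=
  if hd : d ≠ 0 then fun N => g ⟨N.1 ^ d, N.2.trans (Nat.le_self_pow hd _)⟩ else g

/-- The values of plethystic logarithms. -/
lemma plethLog_mem_evalAlg {σ : Type*} {F : MvPowerSeries σ Qq}
    {G : MvPowerSeries σ (EvalPt → ℚ)}
    (h : ∀ v, (MvPowerSeries.coeff v F, MvPowerSeries.coeff v G) ∈ evalAlg) (v : σ →₀ ℕ) :
    (MvPowerSeries.coeff v (plethLog F), MvPowerSeries.coeff v (genPlethLog ptAdams G)) ∈ evalAlg := by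
  -- Taking the logarithm over the algebra of pairs and projecting gives both logarithms at once, so
  -- their coefficients are again a rational function and its values.
  let H : MvPowerSeries σ evalAlg := fun v => ⟨_, h v⟩
  let f : evalAlg →+* Qq := (RingHom.fst _ _).comp evalAlg.val.toRingHom
  let g : evalAlg →+* (EvalPt → ℚ) := (RingHom.snd _ _).comp evalAlg.val.toRingHom
  have hF : MvPowerSeries.map f H = F := MvPowerSeries.ext fun v => rfl
  have hG : MvPowerSeries.map g H = G := MvPowerSeries.ext fun v => rfl
  rw [plethLog_eq_genPlethLog, ← hF, ← hG, map_genPlethLog f evalAdams, map_genPlethLog g evalAdams]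
  · exact (MvPowerSeries.coeff v (genPlethLog evalAdams H)).2
  · intro d x hd
    rw [evalAdams, dif_pos hd, ptAdams, dif_pos hd]
    rfl
  · intro d x hd
    rw [evalAdams, dif_pos hd]
    rfl

/-! ### Integer-valued rational functions -/

lemma exists_denominator (s : ℚ[X]) :
    ∃ D : ℤ, D ≠ 0 ∧ ∀ n : ℕ, ∃ z : ℤ, (D : ℚ) * s.eval (n : ℚ) = z := by
  induction s using Polynomial.induction_on' with
  | add s t hs ht =>
    obtain ⟨D, hD, h⟩ := hs
    obtain ⟨E, hE, h'⟩ := ht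
    refine ⟨D * E, mul_ne_zero hD hE, fun n => ?_⟩
    obtain ⟨x, hx⟩ := h n
    obtain ⟨y, hy⟩ := h' n
    refine ⟨E * x + D * y, ?_⟩
    push_cast
    rw [← hx, ← hy, eval_add]
    ring
  | monomial k a =>
    refine ⟨a.den, by exact_mod_cast a.den_nz, fun n => ⟨a.num * n ^ k, ?_⟩⟩
    rw [eval_monomial, ← mul_assoc]
    push_cast
    rw [Rat.den_mul_eq_num]

/-- A rational function that is integral at all primes is a polynomial. -/
lemma exists_eq_mul_of_integral {a b : ℚ[X]} {c : ℕ → ℤ} (hb : ∀ N : EvalPt, b.eval (N : ℚ) ≠ 0)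
    (h : ∀ p : ℕ, p.Prime → (c p : ℚ) * b.eval (p : ℚ) = a.eval (p : ℚ)) : ∃ s, a = b * s := by
  have hb0 : b ≠ 0 := fun h0 => hb ⟨2, le_rfl⟩ (by rw [h0, eval_zero])
  refine ⟨a / b, ?_⟩
  obtain ⟨D, hD, hs⟩ := exists_denominator (a / b)
  have hdm := EuclideanDomain.div_add_mod a b
  set r := a % b with hr
  have hdeg : r.degree < b.degree := EuclideanDomain.mod_lt a hb0
  -- At a prime `p`, `D * (r / b)` is an integer, where `D` clears the denominators of the quotient
  -- `s`. As `r / b` tends to zero, it vanishes at all large primes, so `r` has infinitely many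
  -- roots.
  suffices hr0 : r = 0 by rw [← hdm, hr0, add_zero]; simp [mul_div_cancel_left₀ _ hb0]
  have ht := (div_tendsto_atTop_zero_of_degree_lt r b hdeg).comp tendsto_natCast_atTop_atTop
  have hD' : (0 : ℚ) < |(D : ℚ)| := abs_pos.2 (Int.cast_ne_zero.2 hD)
  obtain ⟨M, hM⟩ := Filter.eventually_atTop.1
    (ht.abs.eventually_lt_const (u := |(D : ℚ)|⁻¹) (by rw [abs_zero]; exact inv_pos.2 hD'))
  refine Polynomial.eq_zero_of_infinite_isRoot r (Set.Infinite.mono (s := Nat.cast ''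
    {p : ℕ | p.Prime ∧ M ≤ p}) ?_ (Set.Infinite.image Nat.cast_injective.injOn ?_))
  · rintro _ ⟨p, ⟨hp, hMp⟩, rfl⟩
    have hbp := hb ⟨p, hp.two_le⟩
    obtain ⟨z, hz⟩ := hs p
    have h1 : (D : ℚ) * (r.eval (p : ℚ) / b.eval (p : ℚ)) = ((D * c p - z : ℤ) : ℚ) := by
      have h2 := h p hp
      rw [← hdm, eval_add, eval_mul] at h2
      push_cast
      rw [← hz, mul_div_assoc', div_eq_iff hbp]
      linear_combination (-(D : ℚ)) * h2
    have h3 : |(D : ℚ)| * |r.eval (p : ℚ) / b.eval (p : ℚ)| < |(D : ℚ)| * |(D : ℚ)|⁻¹ :=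
      mul_lt_mul_of_pos_left (hM p hMp) hD'
    rw [← abs_mul, h1, mul_inv_cancel₀ hD'.ne', ← Int.cast_abs] at h3
    have h4 : D * c p - z = 0 := Int.abs_lt_one_iff.1 (by exact_mod_cast h3)
    rw [h4, Int.cast_zero, mul_eq_zero, or_iff_right (Int.cast_ne_zero.2 hD), div_eq_zero_iff,
      or_iff_left hbp] at h1
    exact h1
  · refine Set.infinite_of_forall_exists_gt fun n => ?_
    obtain ⟨p, hp, hp'⟩ := Nat.exists_infinite_primes (max M (n + 1))
    exact ⟨p, ⟨hp', (le_max_left _ _).trans hp⟩, (le_max_right M _).trans hp⟩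

lemma pairing_eq_minSum {a b : ℕ} (p : a.Partition) (r : b.Partition) :
    pairing p r = minSum p.parts r.parts := by
  have key : ∀ {n : ℕ} (p : n.Partition) (f : ℕ → ℕ),
      (p.parts.map f).sum = ∑ i ∈ Icc 1 n, p.parts.count i * f i := fun {n} p f => by
    rw [sum_multiset_map_count]
    refine (sum_subset (fun i hi => ?_) fun i _ hi => ?_)
    · rw [Multiset.mem_toFinset] at hi
      refine mem_Icc.2 ⟨p.parts_pos hi, ?_⟩
      rw [← p.parts_sum]
      exact Multiset.le_sum_of_mem hi
    · rw [Multiset.mem_toFinset] at hi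
      rw [Multiset.count_eq_zero_of_notMem hi, zero_smul]
  rw [minSum, key, pairing]
  refine sum_congr rfl fun i _ => ?_
  rw [key, mul_sum]
  exact sum_congr rfl fun j _ => by ring

lemma prod_count_eq {R : Type*} [CommMonoid R] {n : ℕ} (p : n.Partition) (f : ℕ → R) :
    ∏ k ∈ Icc 1 n, ∏ j ∈ Icc 1 (p.parts.count k), f j
      = ∏ k ∈ p.parts.toFinset, ∏ j ∈ Icc 1 (p.parts.count k), f j := by
  symm
  refine prod_subset (fun i hi => ?_) fun i _ hi => ?_
  · rw [Multiset.mem_toFinset] at hi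
    refine mem_Icc.2 ⟨p.parts_pos hi, ?_⟩
    rw [← p.parts_sum]
    exact Multiset.le_sum_of_mem hi
  · rw [Multiset.mem_toFinset] at hi
    rw [Multiset.count_eq_zero_of_notMem hi, Icc_eq_empty (by omega), prod_empty]

namespace FinQuiver

variable {I Ω : Type*} [Fintype I] [DecidableEq I] [Fintype Ω] (Γ : FinQuiver I Ω)

lemma autWeight_ne_zero (N : EvalPt) (m : Multiset ℕ) : autWeight (N : ℚ) m ≠ 0 := by
  have hN : (1 : ℚ) < N := by exact_mod_cast N.2
  refine mul_ne_zero (pow_ne_zero _ (by positivity)) (prod_ne_zero_iff.2 fun k _ =>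
    prod_ne_zero_iff.2 fun j hj => sub_ne_zero.2 (Ne.symm ?_))
  exact (pow_lt_one₀ (by positivity) (inv_lt_one_of_one_lt₀ hN)
    (Nat.one_le_iff_ne_zero.1 (mem_Icc.1 hj).1)).ne

/-- The values of the Hua terms. -/
lemma huaTerm_mem_evalAlg {v : I → ℕ} (π : (i : I) → (v i).Partition) :
    ((Γ.huaTerm π, fun N : EvalPt => Γ.huaWeight N fun i => (π i).parts) :
      Qq × (EvalPt → ℚ)) ∈ evalAlg := by
  let Z : Qq × (EvalPt → ℚ) := (q, fun N => (N : ℚ))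
  let Y : Qq × (EvalPt → ℚ) := (q⁻¹, fun N => (N : ℚ)⁻¹)
  have hZ : Z ∈ evalAlg := q_mem_evalAlg
  have hY : Y ∈ evalAlg := inv_mem_evalAlg hZ fun N => Nat.cast_ne_zero.2 (by have := N.2; omega)
  let D : Qq × (EvalPt → ℚ) := ∏ i, (Z ^ minSum (π i).parts (π i).parts *
    ∏ k ∈ (π i).parts.toFinset, ∏ j ∈ Icc 1 ((π i).parts.count k), (1 - Y ^ j))
  have hD : D ∈ evalAlg := prod_mem fun i _ => mul_mem (pow_mem hZ _) (prod_mem fun k _ =>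
    prod_mem fun j _ => sub_mem (one_mem _) (pow_mem hY _))
  have hD2 : ∀ N, D.2 N = ∏ i, autWeight (N : ℚ) (π i).parts := fun N => by
    simp only [D, Prod.snd_prod, Finset.prod_apply, Prod.snd_mul, Prod.pow_snd, Pi.mul_apply,
      Pi.pow_apply, Prod.snd_sub, Prod.snd_one, Pi.sub_apply, Pi.one_apply, autWeight, unitRatio,
      Z, Y]
  have h := mul_mem (prod_mem (t := univ) fun a (_ : a ∈ univ) =>
    pow_mem hZ (minSum (π (Γ.src a)).parts (π (Γ.tgt a)).parts))
    (inv_mem_evalAlg hD fun N => by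
      rw [hD2]
      exact prod_ne_zero_iff.2 fun i _ => autWeight_ne_zero N _)
  convert h using 1
  refine Prod.ext ?_ (funext fun N => ?_)
  · simp only [huaTerm, pairing_eq_minSum, prod_count_eq, D, Z, Y, Prod.fst_mul, Prod.fst_prod,
      Prod.pow_fst, Prod.fst_sub, Prod.fst_one, div_eq_mul_inv]
  · have hmul : ∀ x y : Qq × (EvalPt → ℚ), (x * (y.1⁻¹, y.2⁻¹)).2 N = x.2 N * (y.2 N)⁻¹ :=
      fun _ _ => rfl
    rw [hmul, hD2]
    refine (div_eq_mul_inv _ _).trans (congrArg (· * _) ?_)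
    simp only [Prod.snd_prod, Prod.pow_snd, Finset.prod_apply, Pi.pow_apply, Z]

/-- The values of the Hua series. -/
def huaValues : MvPowerSeries I (EvalPt → ℚ) := fun v N => MvPowerSeries.coeff v (Γ.huaSeries N)

/-- The series with `q` specialized to `N` is the value at `N` of a plethystic logarithm: the
operation `ptAdams` accounts for the replacement of `N` by `N ^ e` inside the sum. -/
lemma coeff_kacSeries (N : EvalPt) (v : I →₀ ℕ) :
    MvPowerSeries.coeff v (Γ.kacSeries N)
      = (N - 1) * MvPowerSeries.coeff v (genPlethLog ptAdams Γ.huaValues) N := by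
  classical
  rw [kacSeries, MvPowerSeries.coeff_smul, coeff_adamsSum, coeff_genPlethLog, Finset.sum_apply]
  congr 1
  refine sum_congr rfl fun d hd => ?_
  have hd0 := Nat.one_le_iff_ne_zero.1 (mem_Icc.1 hd).1
  split_ifs
  · have h : ∀ M : EvalPt, MvPowerSeries.map (Pi.evalRingHom (fun _ : EvalPt => ℚ) M) Γ.huaValues
        = Γ.huaSeries M := fun M => MvPowerSeries.ext fun v => rfl
    have h2 := h ⟨N.1 ^ d, N.2.trans (Nat.le_self_pow hd0 _)⟩
    rw [MvPowerSeries.coeff_smul, Pi.mul_apply, ptAdams, dif_pos hd0, ← Nat.cast_pow, ← h2,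
      map_genLog]
    rfl
  · rfl

/-- The one-row coefficient is a rational function without poles at integers at least two, whose
values at cardinalities of finite fields count absolutely indecomposable classes. -/
theorem exists_kacPolynomial (v : I → ℕ) : ∃ A : ℚ[X], Γ.IsKacPolynomial v A ∧
    algebraMap ℚ[X] Qq A = Γ.schurCoeff fun i => oneRow (v i) := by
  set u : I →₀ ℕ := Finsupp.equivFunOnFinite.symm v with hu
  obtain ⟨a, b, hb, h1, h2⟩ := plethLog_mem_evalAlg (F := seriesOf Γ.huaSum) (G := Γ.huaValues)
    (fun w => by
      have h := sum_mem (t := univ) fun (π : (i : I) → (w i).Partition) (_ : π ∈ univ) =>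
        Γ.huaTerm_mem_evalAlg π
      convert h using 1
      refine Prod.ext ?_ (funext fun N => ?_)
      · rw [Prod.fst_sum]
        rfl
      · rw [Prod.snd_sum, Finset.sum_apply]
        rfl) u
  have hval : ∀ N : EvalPt, MvPowerSeries.coeff u (Γ.kacSeries N) * b.eval (N : ℚ)
      = ((X - 1) * a).eval (N : ℚ) := fun N => by
    rw [coeff_kacSeries, mul_assoc]
    change _ * ((genPlethLog ptAdams Γ.huaValues).coeff u N * _) = _
    rw [h2 N]
    simp
  have hfield : ∀ (F : Type) [Field F] [Finite F], (Γ.numAbsIndecomposable v F : ℚ)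
      = MvPowerSeries.coeff u (Γ.kacSeries (Nat.card F)) := fun F _ _ =>
    Γ.numAbsIndecomposable_eq_kacSeries F u
  -- Integrality at the primes, witnessed by the counts over `ZMod p`, already makes the function a
  -- polynomial; the remaining prime powers then follow from `hfield`.
  obtain ⟨A, hA⟩ := exists_eq_mul_of_integral (a := (X - 1) * a)
    (c := fun p => if hp : p.Prime then
      have := Fact.mk hp
      (Γ.numAbsIndecomposable v (ZMod p) : ℤ) else 0) hb fun p hp => by
    have := Fact.mk hp
    rw [dif_pos hp, Int.cast_natCast, hfield, Nat.card_zmod]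
    exact hval ⟨p, hp.two_le⟩
  refine ⟨A, fun F _ _ => ?_, ?_⟩
  · have h3 := hval ⟨Nat.card F, Finite.one_lt_card⟩
    rw [hA, eval_mul, mul_comm] at h3
    rw [hfield]
    exact (mul_left_cancel₀ (hb ⟨Nat.card F, Finite.one_lt_card⟩) h3).symm
  · refine mul_left_cancel₀ (algebraMap_qq_ne_zero hb) ?_
    rw [← map_mul, ← hA, map_mul, ← h1, schurCoeff_oneRow, map_sub, map_one, RatFunc.algebraMap_X]
    ring

end FinQuiver

end KacDT

end

theorem proposition1p1 {I Ω : Type*} [Fintype I] [DecidableEq I] [Fintype Ω]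
    (Γ : KacDT.FinQuiver I Ω) :
    -- the Schur expansion of the generating function exists and is unique
    (∃! c, KacDT.IsSchurExpansion Γ.genFun c) ∧
    ∀ v : I → ℕ,
      (∃ A : Polynomial ℚ, Γ.IsKacPolynomial v A ∧
        algebraMap (Polynomial ℚ) (RatFunc ℚ) A
          = Γ.schurCoeff (fun i => KacDT.oneRow (v i))) ∧
      Γ.dtInvariant v = Γ.schurCoeff (fun i => KacDT.oneColumn (v i)) :=
  ⟨Γ.existsUnique_genFun, fun v => ⟨Γ.exists_kacPolynomial v, Γ.dtInvariant_eq_schurCoeff v⟩⟩
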